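/- **Setting.** Let $M$ be a closed (compact, without boundary) connected smooth manifold of dimension $n$. A *simple normal crossing divisor* in $M$ is a finite collection $\mathcal Z$ of closed hypersurfaces such that every point of $M$ is the centre of a chart in which the members of $\mathcal Z$ passing through the point are pairwise distinct coordinate hyperplanes and which meets no other member of $\mathcal Z$. Write $|\mathcal Z|=\bigcup_{Z\in\mathcal Z}Z$. The smooth vector fields on $M$ tangent to all $Z\in\mathcal Z$ are the smooth sections of a vector bundle ${}^bTM$, a Lie algebroid with anchor $\rho\colon {}^bTM\to TM$ the natural map, which is an isomorphism over $M\setminus|\mathcal Z|$. Assume that $TM$ and ${}^bTM$ are oriented. Let $G\rightrightarrows M$ be a Hausdorff Lie groupoid, with source $s$ and range $r$, that integrates ${}^bTM$: the Lie algebroid $A=\ker(Ts)|_M$ of $G$, with anchor $\rho=Tr$, is identified with ${}^bTM$. Assume that $G$ is *even*: for every $g\in G$ with $r(g),s(g)\in M\setminus|\mathcal Z|$, the anchor is either orientation-preserving at both $r(g)$ and $s(g)$, or orientation-reversing at both. Let $\Lambda=|\det A^*|\otimes\mathbb C$ be the bundle of complex densities on $A$, $\Lambda^{1/2}$ the bundle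 of half-densities, and $\Lambda_M$ the bundle of complex densities on $TM$. Let $\Psi^{-\infty}(G)$ be the space of smooth compactly supported sections of $r^*\Lambda^{1/2}\otimes s^*\Lambda^{1/2}$, with the convolution product $(f_1\star f_0)(g)=\int_{g_1g_0=g}f_1(g_1)f_0(g_0)$. For $f\in\Gamma(\Lambda)$ let $(f)_o$ be the density on $M$ with simple poles along $\mathcal Z$ that is given on $M\setminus|\mathcal Z|$ by transporting $f$ along the isomorphism $\rho\colon A\to TM$ and multiplying the result by $+1$ where $\rho$ preserves orientation and by $-1$ where $\rho$ reverses it. For a Riemannian metric on $M$ and $\epsilon>0$ let $M_\epsilon$ be the complement of the neighbourhood of radius $\epsilon$ of $|\mathcal Z|$, and put $$\tau(f)=\mathrm{pv}_{\mathcal Z}\int_M (f)_o:=\lim_{\epsilon\to0^+}\int_{M_\epsilon}(f)_o .$$ **Proposition.** The limit exists for every $f\in\Gamma(\Lambda)$ and does not depend on the Riemannian metric, and $\tau$ is a linear functional on $\Gamma(\Lambda)$ that is continuous for the $C^\infty$ topology. The composition of $\tau$ with the restriction $f\mapsto f|_M\in\Gamma(\Lambda)$ to the unit space is a trace on $\Psi^{-\infty}(G)$: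 the convolution of two elements of $\Psi^{-\infty}(G)$ is again in $\Psi^{-\infty}(G)$, and $$\tau\big((f_1\star f_0)|_M\big)=\tau\big((f_0\star f_1)|_M\big)\qquad\text{for all } f_0,f_1\in\Psi^{-\infty}(G).$$ -/

import Mathlib

set_option linter.unusedSectionVars false

open Set Filter Topology MeasureTheory
open scoped Manifold ContDiff

noncomputable section

namespace PvTrace

/-! ### Integration of densities over embedded submanifolds -/

/-- A smooth local parametrization of a subset `S` of a manifold `X` by an open subset of `ℝᵏ`:
a smooth embedding of an open set `source ⊆ ℝᵏ` onto a relatively open subset of `S`.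
(For `S = univ` and `k = dim X`, these are the inverses of the charts of `X`.) -/
structure LocalParam (d : ℕ) {X : Type*} [TopologicalSpace X]
    [ChartedSpace (EuclideanSpace ℝ (Fin d)) X] (k : ℕ) (S : Set X) where
  source : Set (EuclideanSpace ℝ (Fin k))
  toFun : EuclideanSpace ℝ (Fin k) → X
  isOpen_source : IsOpen source
  isImmersionAt : ∀ y ∈ source, Manifold.IsImmersionAt (𝓡 k) (𝓡 d) ∞ toFun y
  isEmbedding : IsEmbedding (source.domRestrict toFun)
  image_mem : ∀ y ∈ source, toFun y ∈ S
  isOpen_image : ∃ O : Set X, IsOpen O ∧ toFun '' source = S ∩ O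

/-- The `i`-th coordinate vector of `ℝᵏ`. -/
def coordVec {k : ℕ} (i : Fin k) : EuclideanSpace ℝ (Fin k) := EuclideanSpace.single i 1

open Classical in
/-- The integral over `S` of a density along `S`.  The density is given by its local expressions:
`F P y` is its value on the coordinate frame `∂₁P(y), …, ∂ₖP(y)` of a local parametrization `P` of
`S` at `P(y)`.  The set `S` is covered by countably many parametrized patches, made disjoint, and
the local expressions are integrated over the resulting pieces against Lebesgue measure. -/
def integralOver (d : ℕ) {X : Type*} [TopologicalSpace X]
    [ChartedSpace (EuclideanSpace ℝ (Fin d)) X] (k : ℕ) (S : Set X)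
    (F : LocalParam d k S → EuclideanSpace ℝ (Fin k) → ℂ) : ℂ :=
  if h : ∃ P : ℕ → LocalParam d k S, S ⊆ ⋃ i, (P i).toFun '' (P i).source then
    ∑' i, ∫ y in {y | y ∈ (h.choose i).source ∧
        ∀ j < i, (h.choose i).toFun y ∉ (h.choose j).toFun '' (h.choose j).source},
      F (h.choose i) y
  else 0

section Manifold

variable {n : ℕ} {M : Type*} [TopologicalSpace M] [ChartedSpace (EuclideanSpace ℝ (Fin n)) M]
  [IsManifold (𝓡 n) ∞ M]

/-- The integral over `M` of a (complex, not necessarily smooth) density `μ`, i.e. a function of a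
point of `M` and a frame of the tangent space there. -/
def integralDensity (μ : ∀ m : M, (Fin n → TangentSpace (𝓡 n) m) → ℂ) : ℂ :=
  integralOver n n (univ : Set M)
    (fun P y => μ (P.toFun y) (fun i => mfderiv (𝓡 n) (𝓡 n) P.toFun y (coordVec i)))

/-! ### Simple normal crossing divisors and principal value integrals -/

/-- A finite collection `𝒵` of subsets of `M` is a simple normal crossing divisor if every point `m`
is the centre of a smooth chart in which the members of `𝒵` that pass through `m` are pairwise
different coordinate hyperplanes, and which meets no other member of `𝒵`. -/
def IsSimpleNormalCrossing (n : ℕ) {M : Type*} [TopologicalSpace M]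
    [ChartedSpace (EuclideanSpace ℝ (Fin n)) M] (𝒵 : Finset (Set M)) : Prop :=
  ∀ m : M, ∃ e ∈ IsManifold.maximalAtlas (𝓡 n) ∞ M, m ∈ e.source ∧ e m = 0 ∧
    (∃ c : {Z : Set M // Z ∈ 𝒵 ∧ m ∈ Z} → Fin n, Function.Injective c ∧
      ∀ Z, ∀ p ∈ e.source, p ∈ Z.1 ↔ e p (c Z) = 0) ∧
    ∀ Z ∈ 𝒵, m ∉ Z → ∀ p ∈ e.source, p ∉ Z

/-- The union of the hypersurfaces of the divisor. -/
def divisorSupport (𝒵 : Finset (Set M)) : Set M := ⋃ Z ∈ 𝒵, Z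

/-- The smooth vector fields on `M` that are tangent to all hypersurfaces in `𝒵`: those which map
functions vanishing on `Z` to functions vanishing on `Z`, for every `Z ∈ 𝒵`.  These are the smooth
sections of the b-tangent bundle. -/
def IsBVectorField (𝒵 : Finset (Set M)) (V : ∀ m : M, TangentSpace (𝓡 n) m) : Prop :=
  ContMDiff (𝓡 n) (𝓡 n).tangent ∞ (fun m => (⟨m, V m⟩ : TangentBundle (𝓡 n) M)) ∧
  ∀ Z ∈ 𝒵, ∀ h : M → ℝ, ContMDiff (𝓡 n) 𝓘(ℝ, ℝ) ∞ h → (∀ q ∈ Z, h q = 0) →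
    ∀ p ∈ Z, mfderiv (𝓡 n) 𝓘(ℝ, ℝ) h p (V p) = (0 : ℝ)

/-! ### Orientations -/

/-- The linearly independent tuple `v` is a basis that represents the orientation `o`. -/
def IsPositive {n : ℕ} {V : Type*} [AddCommGroup V] [Module ℝ V]
    (o : Orientation ℝ V (Fin n)) (v : Fin n → V) : Prop :=
  ∃ b : Module.Basis (Fin n) ℝ V, ⇑b = v ∧ b.orientation = o

/-- A family of orientations of the tangent spaces is an orientation of `TM`. -/
def IsTangentOrientation
    (o : ∀ m : M, Orientation ℝ (TangentSpace (𝓡 n) m) (Fin n)) :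
    Prop :=
  ∀ (U : Set M) (V : ∀ m : M, Fin n → TangentSpace (𝓡 n) m), IsOpen U →
    (∀ i, ContMDiffOn (𝓡 n) (𝓡 n).tangent ∞
      (fun m => (⟨m, V m i⟩ : TangentBundle (𝓡 n) M)) U) →
    (∀ m ∈ U, LinearIndependent ℝ (V m)) →
    IsOpen {m ∈ U | IsPositive (o m) (V m)} ∧ IsOpen {m ∈ U | ¬ IsPositive (o m) (V m)}

end Manifold

/-- Smooth Riemannian metrics on `M`. -/
abbrev RiemMetric (n : ℕ) (M : Type*) [TopologicalSpace M]
    [ChartedSpace (EuclideanSpace ℝ (Fin n)) M] [IsManifold (𝓡 n) ∞ M] : Type _ :=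
  Bundle.ContMDiffRiemannianMetric (𝓡 n) ∞ (EuclideanSpace ℝ (Fin n))
    (fun m : M => TangentSpace (𝓡 n) m)

section PrincipalValue

variable {n : ℕ} {M : Type*} [TopologicalSpace M] [ChartedSpace (EuclideanSpace ℝ (Fin n)) M]
  [IsManifold (𝓡 n) ∞ M]

/-- The Riemannian distance of a metric `h`. -/
def RiemMetric.dist (h : RiemMetric n M) (p q : M) : ENNReal :=
  letI : ∀ m : M, ENorm (TangentSpace (𝓡 n) m) :=
    fun m => ⟨fun v => ENNReal.ofReal (Real.sqrt (h.inner m v v))⟩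
  Manifold.riemannianEDist (𝓡 n) p q

/-- `M_ε`: the complement of the neighbourhood of radius `ε` of the union of the hypersurfaces. -/
def truncation (𝒵 : Finset (Set M)) (h : RiemMetric n M) (ε : ℝ) : Set M :=
  {m | ENNReal.ofReal ε ≤ ⨅ z ∈ divisorSupport 𝒵, h.dist m z}

open Classical in
/-- The integral of the density `μ` over `M_ε`. -/
def truncatedIntegral (𝒵 : Finset (Set M)) (h : RiemMetric n M)
    (μ : ∀ m : M, (Fin n → TangentSpace (𝓡 n) m) → ℂ) (ε : ℝ) : ℂ :=
  integralDensity (fun m w => if m ∈ truncation 𝒵 h ε then μ m w else 0)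

/-- The principal value integral of `μ`, the limit of the integrals over `M_ε` as `ε → 0⁺`. -/
def pvIntegral (𝒵 : Finset (Set M)) (h : RiemMetric n M)
    (μ : ∀ m : M, (Fin n → TangentSpace (𝓡 n) m) → ℂ) : ℂ :=
  limUnder (𝓝[>] (0 : ℝ)) (truncatedIntegral 𝒵 h μ)

end PrincipalValue

/-! ### Lie groupoids -/

/-- A Lie groupoid `G ⇉ M` with source `s` and range `r`; `mul g h` is the product `gh` when
`s g = r h`, and is not used for any other pair. -/
structure LieGroupoid (n d : ℕ) (M G : Type*) [TopologicalSpace M]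
    [ChartedSpace (EuclideanSpace ℝ (Fin n)) M] [TopologicalSpace G]
    [ChartedSpace (EuclideanSpace ℝ (Fin d)) G] where
  r : G → M
  s : G → M
  one : M → G
  inv : G → G
  mul : G → G → G
  r_one : ∀ m, r (one m) = m
  s_one : ∀ m, s (one m) = m
  r_inv : ∀ g, r (inv g) = s g
  s_inv : ∀ g, s (inv g) = r g
  r_mul : ∀ g h, s g = r h → r (mul g h) = r g
  s_mul : ∀ g h, s g = r h → s (mul g h) = s h
  mul_assoc : ∀ g h k, s g = r h → s h = r k → mul (mul g h) k = mul g (mul h k)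
  one_mul : ∀ g, mul (one (r g)) g = g
  mul_one : ∀ g, mul g (one (s g)) = g
  mul_inv : ∀ g, mul g (inv g) = one (r g)
  inv_mul : ∀ g, mul (inv g) g = one (s g)
  isSubmersion_r : Manifold.IsSubmersion (𝓡 d) (𝓡 n) ∞ r
  isSubmersion_s : Manifold.IsSubmersion (𝓡 d) (𝓡 n) ∞ s
  contMDiff_one : ContMDiff (𝓡 n) (𝓡 d) ∞ one
  contMDiff_inv : ContMDiff (𝓡 d) (𝓡 d) ∞ inv
  contMDiffOn_mul : ContMDiffOn ((𝓡 d).prod (𝓡 d)) (𝓡 d) ∞ (fun p : G × G => mul p.1 p.2)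
    {p | s p.1 = r p.2}

namespace LieGroupoid

variable {n d : ℕ} {M G : Type*}
  [TopologicalSpace M] [ChartedSpace (EuclideanSpace ℝ (Fin n)) M] [IsManifold (𝓡 n) ∞ M]
  [TopologicalSpace G] [ChartedSpace (EuclideanSpace ℝ (Fin d)) G] [IsManifold (𝓡 d) ∞ G]
  (𝒢 : LieGroupoid n d M G)

/-- The fibre at `m` of the Lie algebroid `A = ker(Ts)|_M`. -/
abbrev A (m : M) : Type :=
  ↥(LinearMap.ker (mfderiv (𝓡 d) (𝓡 n) 𝒢.s (𝒢.one m)).toLinearMap)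

/-- The anchor `ρ = Tr : A → TM`. -/
def anchor (m : M) : 𝒢.A m →ₗ[ℝ] TangentSpace (𝓡 n) m :=
  (show TangentSpace (𝓡 d) (𝒢.one m) →ₗ[ℝ] TangentSpace (𝓡 n) m from
    (mfderiv (𝓡 d) (𝓡 n) 𝒢.r (𝒢.one m)).toLinearMap).comp (Submodule.subtype _)

/-- Smooth sections of `A` over a subset `U` of `M`. -/
def IsSmoothSectionOn (U : Set M) (X : ∀ m, 𝒢.A m) : Prop :=
  ContMDiffOn (𝓡 n) (𝓡 d).tangent ∞
    (fun m => (⟨𝒢.one m, (X m).1⟩ : TangentBundle (𝓡 d) G)) U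

/-- Smooth frames of `A` over an open subset `U` of `M`.  The rank of `A` is required to be `n`
here, as is the case for the b-tangent bundle. -/
structure IsFrameOn (U : Set M) (X : ∀ m, Fin n → 𝒢.A m) : Prop where
  isOpen : IsOpen U
  smooth : ∀ i, 𝒢.IsSmoothSectionOn U (fun m => X m i)
  linearIndependent : ∀ m ∈ U, LinearIndependent ℝ (X m)
  span_eq_top : ∀ m ∈ U, Submodule.span ℝ (range (X m)) = ⊤

/-- `G` is an integration of the b-tangent bundle of `𝒵`: the anchor identifies the smooth sections
of `A` with the smooth vector fields tangent to all hypersurfaces in `𝒵`.  (The anchor is linear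
over smooth functions and preserves Lie brackets, so this is an isomorphism of Lie algebroids from
`A` to the b-tangent bundle; it is the only possible one, as it must be compatible with anchors.) -/
def Integrates (𝒵 : Finset (Set M)) : Prop :=
  (∀ X : ∀ m, 𝒢.A m, 𝒢.IsSmoothSectionOn univ X →
    IsBVectorField 𝒵 (fun m => 𝒢.anchor m (X m))) ∧
  (∀ V : ∀ m : M, TangentSpace (𝓡 n) m, IsBVectorField 𝒵 V →
    ∃! X : ∀ m, 𝒢.A m, 𝒢.IsSmoothSectionOn univ X ∧ ∀ m, 𝒢.anchor m (X m) = V m)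

/-! ### Evenness -/

/-- A family of orientations of the fibres of `A` is an orientation of the vector bundle `A`:
the sets where a smooth local frame is positive, respectively not positive, are open. -/
def IsOrientation (o : ∀ m, Orientation ℝ (𝒢.A m) (Fin n)) : Prop :=
  ∀ U X, 𝒢.IsFrameOn U X →
    IsOpen {m ∈ U | IsPositive (o m) (X m)} ∧ IsOpen {m ∈ U | ¬ IsPositive (o m) (X m)}

variable (oA : ∀ m, Orientation ℝ (𝒢.A m) (Fin n))
  (oM : ∀ m : M, Orientation ℝ (TangentSpace (𝓡 n) m) (Fin n))

/-- The anchor is an orientation-preserving isomorphism at `m`. -/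
def PreservesAt (m : M) : Prop :=
  ∃ h : Function.Bijective (𝒢.anchor m),
    Orientation.map (Fin n) (LinearEquiv.ofBijective (𝒢.anchor m) h) (oA m) = oM m

/-- The anchor is an orientation-reversing isomorphism at `m`. -/
def ReversesAt (m : M) : Prop :=
  ∃ h : Function.Bijective (𝒢.anchor m),
    Orientation.map (Fin n) (LinearEquiv.ofBijective (𝒢.anchor m) h) (oA m) = -oM m

/-- The groupoid is even: for every arrow `g` with both ends off the hypersurfaces, the anchor is
either orientation-preserving at both `r g` and `s g` or orientation-reversing at both. -/
def IsEven (𝒵 : Finset (Set M)) : Prop :=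
  ∀ g, 𝒢.r g ∉ divisorSupport 𝒵 → 𝒢.s g ∉ divisorSupport 𝒵 →
    (𝒢.PreservesAt oA oM (𝒢.r g) ∧ 𝒢.PreservesAt oA oM (𝒢.s g)) ∨
    (𝒢.ReversesAt oA oM (𝒢.r g) ∧ 𝒢.ReversesAt oA oM (𝒢.s g))

/-! ### Densities and half-densities -/

/-- The space `Γ(Λ)` of smooth sections of the bundle `Λ = |det A^*| ⊗ ℂ` of complex densities
on `A`: functions `φ` of a point `m` and an `n`-tuple `a` in `A_m` with
`φ(T a) = |det T| φ(a)`, smooth on smooth local frames. -/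
def densities : Submodule ℂ (∀ m, (Fin n → 𝒢.A m) → ℂ) where
  carrier := {φ | (∀ m (T : 𝒢.A m →ₗ[ℝ] 𝒢.A m) a,
      φ m (fun i => T (a i)) = (|LinearMap.det T| : ℝ) * φ m a) ∧
    ∀ U X, 𝒢.IsFrameOn U X → ContMDiffOn (𝓡 n) 𝓘(ℝ, ℂ) ∞ (fun m => φ m (X m)) U}
  add_mem' := by
    rintro φ ψ ⟨h1, h2⟩ ⟨h3, h4⟩
    refine ⟨fun m T a => ?_, fun U X hX => (h2 U X hX).add (h4 U X hX)⟩
    simp only [Pi.add_apply, h1, h3, mul_add]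
  zero_mem' := by
    refine ⟨fun m T a => by simp, fun U X hX => ?_⟩
    exact contMDiffOn_const (c := (0 : ℂ))
  smul_mem' := by
    rintro c φ ⟨h1, h2⟩
    refine ⟨fun m T a => ?_, fun U X hX => ?_⟩
    · simp only [Pi.smul_apply, h1, smul_eq_mul]; ring
    · exact (contDiff_const_smul c).contMDiff.comp_contMDiffOn (h2 U X hX)

/-- The `C^∞` topology on `Γ(Λ)`: uniform convergence on compact sets of all derivatives of the
coefficients with respect to smooth local frames, in the charts of `M`. -/
@[reducible] def densitiesTopology : TopologicalSpace 𝒢.densities :=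
  ⨅ (x : M) (U : Set M) (X : ∀ m, Fin n → 𝒢.A m) (_ : 𝒢.IsFrameOn U X)
    (K : Set (EuclideanSpace ℝ (Fin n))) (_ : IsCompact K)
    (_ : ∀ y ∈ K, y ∈ (chartAt (EuclideanSpace ℝ (Fin n)) x).target ∧
      (chartAt (EuclideanSpace ℝ (Fin n)) x).symm y ∈ U) (j : ℕ),
    TopologicalSpace.induced
      (fun φ : 𝒢.densities => UniformOnFun.ofFun {K} (iteratedFDeriv ℝ j
        (fun y => φ.1 ((chartAt (EuclideanSpace ℝ (Fin n)) x).symm y)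
          (X ((chartAt (EuclideanSpace ℝ (Fin n)) x).symm y)))))
      inferInstance

/-- `Ψ^{-∞}(G)`: the space of smooth compactly supported sections of `r^*Λ^{1/2} ⊗ s^*Λ^{1/2}`.  An
element of the fibre at `g` is a function `f g a b` of `n`-tuples `a` in `A_{r g}` and `b` in
`A_{s g}` with `f g (S a) (T b) = |det S|^{1/2} |det T|^{1/2} f g a b`. -/
def Psi : Submodule ℂ (∀ g, (Fin n → 𝒢.A (𝒢.r g)) → (Fin n → 𝒢.A (𝒢.s g)) → ℂ) where
  carrier := {f | (∀ g (S : 𝒢.A (𝒢.r g) →ₗ[ℝ] 𝒢.A (𝒢.r g)) (T : 𝒢.A (𝒢.s g) →ₗ[ℝ] 𝒢.A (𝒢.s g))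
        a b, f g (fun i => S (a i)) (fun i => T (b i)) =
          (Real.sqrt |LinearMap.det S| : ℝ) * (Real.sqrt |LinearMap.det T| : ℝ) * f g a b) ∧
    (∀ U X V Y, 𝒢.IsFrameOn U X → 𝒢.IsFrameOn V Y →
      ContMDiffOn (𝓡 d) 𝓘(ℝ, ℂ) ∞ (fun g => f g (X (𝒢.r g)) (Y (𝒢.s g)))
        (𝒢.r ⁻¹' U ∩ 𝒢.s ⁻¹' V)) ∧
    ∃ K : Set G, IsCompact K ∧ ∀ g ∉ K, f g = 0}
  add_mem' := by
    rintro φ ψ ⟨h1, h2, K, hK, hφ⟩ ⟨h3, h4, L, hL, hψ⟩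
    refine ⟨fun g S T a b => ?_,
      fun U X V Y hX hY => (h2 U X V Y hX hY).add (h4 U X V Y hX hY), K ∪ L, hK.union hL, ?_⟩
    · simp only [Pi.add_apply, h1, h3, mul_add]
    · intro g hg
      rw [mem_union, not_or] at hg
      simp [hφ g hg.1, hψ g hg.2]
  zero_mem' := by
    refine ⟨fun g S T a b => by simp, fun U X V Y hX hY => ?_, ∅, isCompact_empty, fun g _ => rfl⟩
    exact contMDiffOn_const (c := (0 : ℂ))
  smul_mem' := by
    rintro c φ ⟨h1, h2, K, hK, hφ⟩
    refine ⟨fun g S T a b => ?_, fun U X V Y hX hY => ?_, K, hK, fun g hg => ?_⟩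
    · simp only [Pi.smul_apply, h1, smul_eq_mul]; ring
    · exact (contDiff_const_smul c).contMDiff.comp_contMDiffOn (h2 U X V Y hX hY)
    · simp [hφ g hg]

/-- The identification of `n`-tuples in `A_p` and in `A_q` when `p = q`. -/
def castTuple {p q : M} (h : p = q) (a : Fin n → 𝒢.A p) : Fin n → 𝒢.A q := h ▸ a

/-- Restriction of sections of `r^*Λ^{1/2} ⊗ s^*Λ^{1/2}` to the unit space, where they become
sections of `Λ^{1/2} ⊗ Λ^{1/2} = Λ`. -/
def restrictFun (f : ∀ g, (Fin n → 𝒢.A (𝒢.r g)) → (Fin n → 𝒢.A (𝒢.s g)) → ℂ) :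
    ∀ m, (Fin n → 𝒢.A m) → ℂ :=
  fun m a => f (𝒢.one m) (𝒢.castTuple (𝒢.r_one m).symm a) (𝒢.castTuple (𝒢.s_one m).symm a)

theorem castTuple_section (X : ∀ m, Fin n → 𝒢.A m) {p q : M} (h : p = q) :
    𝒢.castTuple h (X p) = X q := by
  subst h; rfl

theorem restrict_aux {m p q : M} (hp : m = p) (hq : m = q)
    (F : (Fin n → 𝒢.A p) → (Fin n → 𝒢.A q) → ℂ)
    (hF : ∀ (S : 𝒢.A p →ₗ[ℝ] 𝒢.A p) (T : 𝒢.A q →ₗ[ℝ] 𝒢.A q) a b,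
      F (fun i => S (a i)) (fun i => T (b i)) =
        (Real.sqrt |LinearMap.det S| : ℝ) * (Real.sqrt |LinearMap.det T| : ℝ) * F a b)
    (T : 𝒢.A m →ₗ[ℝ] 𝒢.A m) (a : Fin n → 𝒢.A m) :
    F (𝒢.castTuple hp (fun i => T (a i))) (𝒢.castTuple hq (fun i => T (a i))) =
      (|LinearMap.det T| : ℝ) * F (𝒢.castTuple hp a) (𝒢.castTuple hq a) := by
  subst hp; subst hq
  have := hF T T a a
  rw [← Complex.ofReal_mul, Real.mul_self_sqrt (abs_nonneg _)] at this
  exact this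

theorem restrictFun_mem {f} (hf : f ∈ 𝒢.Psi) : 𝒢.restrictFun f ∈ 𝒢.densities := by
  obtain ⟨h1, h2, -⟩ := hf
  refine ⟨fun m T a => 𝒢.restrict_aux _ _ _ (h1 (𝒢.one m)) T a, fun U X hX => ?_⟩
  have h := (h2 U X U X hX hX).comp (𝒢.contMDiff_one.contMDiffOn (s := U))
    (fun m hm => by simpa [𝒢.r_one, 𝒢.s_one] using hm)
  refine h.congr fun m _ => ?_
  simp only [restrictFun, castTuple_section, Function.comp]

/-- Restriction to the unit space, as a linear map `Ψ^{-∞}(G) → Γ(Λ)`. -/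
def restrict : 𝒢.Psi →ₗ[ℂ] 𝒢.densities where
  toFun f := ⟨𝒢.restrictFun f.1, 𝒢.restrictFun_mem f.2⟩
  map_add' _ _ := rfl
  map_smul' _ _ := rfl

/-! ### The convolution product -/

theorem mem_ker_aux {p q : G} (h : p = q) (v : TangentSpace (𝓡 d) p)
    (hv : mfderiv (𝓡 d) (𝓡 n) 𝒢.s p v = 0) :
    (show TangentSpace (𝓡 d) q from v) ∈
      LinearMap.ker (mfderiv (𝓡 d) (𝓡 n) 𝒢.s q).toLinearMap := by
  subst h; exact hv

/-- Let `P` be a local parametrization of the source fibre `s⁻¹(x)`.  The coordinate vectors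
`∂ᵢP(y)`, which belong to `ker(Ts)`, are moved to `A_{r(P y)}` by right translation by `P(y)⁻¹`. -/
theorem rightTranslate_mem {x : M} (P : LocalParam d n (𝒢.s ⁻¹' {x}))
    {y : EuclideanSpace ℝ (Fin n)} (hy : y ∈ P.source) (v : EuclideanSpace ℝ (Fin n)) :
    mfderiv (𝓡 n) (𝓡 d) (fun z => 𝒢.mul (P.toFun z) (𝒢.inv (P.toFun y))) y v ∈
      LinearMap.ker (mfderiv (𝓡 d) (𝓡 n) 𝒢.s (𝒢.one (𝒢.r (P.toFun y)))).toLinearMap := by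
  by_cases hd : MDifferentiableAt (𝓡 n) (𝓡 d)
      (fun z => 𝒢.mul (P.toFun z) (𝒢.inv (P.toFun y))) y
  · have hs : MDifferentiableAt (𝓡 d) (𝓡 n) 𝒢.s
        (𝒢.mul (P.toFun y) (𝒢.inv (P.toFun y))) :=
      (𝒢.isSubmersion_s.contMDiff _).mdifferentiableAt (by simp)
    have hc := mfderiv_comp_apply y hs hd v
    have hev : (𝒢.s ∘ fun z => 𝒢.mul (P.toFun z) (𝒢.inv (P.toFun y))) =ᶠ[𝓝 y]
        fun _ => 𝒢.r (P.toFun y) := by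
      filter_upwards [P.isOpen_source.mem_nhds hy] with z hz
      have h1 : 𝒢.s (P.toFun z) = x := P.image_mem z hz
      have h2 : 𝒢.s (P.toFun y) = x := P.image_mem y hy
      simp only [Function.comp]
      rw [𝒢.s_mul _ _ (by rw [h1, 𝒢.r_inv, h2]), 𝒢.s_inv]
    rw [hev.mfderiv_eq, mfderiv_const] at hc
    exact 𝒢.mem_ker_aux (𝒢.mul_inv _) _ hc.symm
  · rw [mfderiv_zero_of_not_mdifferentiableAt hd]
    exact Submodule.zero_mem _

/-- The tuple in `A_{r(P y)}` that corresponds to the coordinate frame of `P` at `y`. -/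
def rightTranslate {x : M} (P : LocalParam d n (𝒢.s ⁻¹' {x}))
    {y : EuclideanSpace ℝ (Fin n)} (hy : y ∈ P.source) : Fin n → 𝒢.A (𝒢.r (P.toFun y)) :=
  fun i => ⟨mfderiv (𝓡 n) (𝓡 d) (fun z => 𝒢.mul (P.toFun z) (𝒢.inv (P.toFun y))) y (coordVec i),
    𝒢.rightTranslate_mem P hy (coordVec i)⟩

/-- The product `f₁(g g₀⁻¹) f₀(g₀)`, evaluated on `a` in `A_{r g}`, `b` in `A_{s g}`, and on `u` in
`A_{r g₀}`, where it is a density. -/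
def convIntegrand (f₁ f₀ : ∀ g, (Fin n → 𝒢.A (𝒢.r g)) → (Fin n → 𝒢.A (𝒢.s g)) → ℂ) (g g₀ : G)
    (h : 𝒢.s g₀ = 𝒢.s g) (a : Fin n → 𝒢.A (𝒢.r g)) (b : Fin n → 𝒢.A (𝒢.s g))
    (u : Fin n → 𝒢.A (𝒢.r g₀)) : ℂ :=
  have hc : 𝒢.s g = 𝒢.r (𝒢.inv g₀) := h.symm.trans (𝒢.r_inv g₀).symm
  f₁ (𝒢.mul g (𝒢.inv g₀)) (𝒢.castTuple (𝒢.r_mul _ _ hc).symm a)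
      (𝒢.castTuple ((𝒢.s_inv g₀).symm.trans (𝒢.s_mul _ _ hc).symm) u) *
    f₀ g₀ u (𝒢.castTuple h.symm b)

open Classical in
/-- The convolution product `(f₁ ⋆ f₀)(g) = ∫_{g₁ g₀ = g} f₁(g₁) f₀(g₀)`.  The set of factorizations
of `g` is parametrized by `g₀ ∈ s⁻¹(s g)`, with `g₁ = g g₀⁻¹`. -/
def conv (f₁ f₀ : ∀ g, (Fin n → 𝒢.A (𝒢.r g)) → (Fin n → 𝒢.A (𝒢.s g)) → ℂ) :
    ∀ g, (Fin n → 𝒢.A (𝒢.r g)) → (Fin n → 𝒢.A (𝒢.s g)) → ℂ :=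
  fun g a b => integralOver d n (𝒢.s ⁻¹' {𝒢.s g}) (fun P y =>
    if hy : y ∈ P.source then
      𝒢.convIntegrand f₁ f₀ g (P.toFun y) (P.image_mem y hy) a b (𝒢.rightTranslate P hy)
    else 0)

/-- `t` is a trace on `Ψ^{-∞}(G)`: a linear functional that vanishes on commutators for the
convolution product (whose values lie in `Ψ^{-∞}(G)`). -/
def IsTrace (t : 𝒢.Psi →ₗ[ℂ] ℂ) : Prop :=
  ∀ f₁ f₀ : 𝒢.Psi, ∃ (h₁₀ : 𝒢.conv f₁ f₀ ∈ 𝒢.Psi) (h₀₁ : 𝒢.conv f₀ f₁ ∈ 𝒢.Psi),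
    t (⟨𝒢.conv f₁ f₀, h₁₀⟩ - ⟨𝒢.conv f₀ f₁, h₀₁⟩) = 0

/-! ### The isomorphism `o` -/

open Classical in
/-- The density `(φ)_o` on `M` with simple poles along the hypersurfaces, described on their
complement: there the anchor identifies `A` with `TM`, and `φ` is transported along this
identification and multiplied by `1` or `-1` according to whether the anchor is
orientation-preserving or orientation-reversing. -/
def signedDensity (φ : ∀ m, (Fin n → 𝒢.A m) → ℂ) :
    ∀ m : M, (Fin n → TangentSpace (𝓡 n) m) → ℂ :=
  fun m w =>
    if h : Function.Bijective (𝒢.anchor m) then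
      (if 𝒢.PreservesAt oA oM m then 1 else -1) *
        φ m (fun i => (LinearEquiv.ofBijective (𝒢.anchor m) h).symm (w i))
    else 0

end LieGroupoid

end PvTrace

end

noncomputable section

namespace PvTrace

/-! ### Principal values on `ℝⁿ` -/

section Reflection

variable {n : ℕ}

/-- Change of sign of the coordinates in `s`. -/
def reflect (s : Finset (Fin n)) (x : Fin n → ℝ) : Fin n → ℝ := fun i => if i ∈ s then -x i else x i

theorem abs_reflect (s : Finset (Fin n)) (x : Fin n → ℝ) (i : Fin n) : |reflect s x i| = |x i| := by
  unfold reflect; split_ifs <;> simp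

theorem reflect_involutive (s : Finset (Fin n)) : Function.Involutive (reflect s) := by
  intro x; funext i; unfold reflect; split_ifs <;> simp

theorem measurePreserving_reflect (s : Finset (Fin n)) :
    MeasurePreserving (reflect s) (volume : Measure (Fin n → ℝ)) volume := by
  have h : ∀ i, MeasurePreserving (fun t : ℝ => if i ∈ s then -t else t) volume volume := by
    intro i
    by_cases hi : i ∈ s
    · simpa [hi] using Measure.measurePreserving_neg (volume : Measure ℝ)
    · simp only [hi, if_false]; exact MeasurePreserving.id (volume : Measure ℝ)
  exact volume_preserving_pi h

theorem measurableEmbedding_reflect (s : Finset (Fin n)) : MeasurableEmbedding (reflect s) :=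
  (MeasurableEquiv.ofInvolutive _ (reflect_involutive s)
    (measurePreserving_reflect s).measurable).measurableEmbedding

theorem prod_reflect {I s : Finset (Fin n)} (hs : s ⊆ I) (x : Fin n → ℝ) :
    ∏ i ∈ I, reflect s x i = (-1) ^ s.card * ∏ i ∈ I, x i := by
  have h : ∀ i ∈ I, reflect s x i = (if i ∈ s then -1 else 1) * x i := by
    intro i _; unfold reflect; split_ifs <;> simp
  rw [Finset.prod_congr rfl h, Finset.prod_mul_distrib, Finset.prod_ite_mem,
    Finset.inter_eq_right.2 hs, Finset.prod_const]

end Reflection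

section Weight

set_option linter.unusedVariables false

variable {n : ℕ}

/-- An integrable weight on the line that dominates the singularities below. -/
def lineWeight (n : ℕ) (R : ℝ) (t : ℝ) : ℝ :=
  if |t| ≤ R then 1 + |t| ^ ((1 : ℝ) / (n + 1) - 1) else 0

/-- The product of the weights `lineWeight`. -/
def boxWeight (R : ℝ) (x : Fin n → ℝ) : ℝ := ∏ i, lineWeight n R (x i)

theorem lineWeight_nonneg (n : ℕ) (R t : ℝ) : 0 ≤ lineWeight n R t := by
  unfold lineWeight; split_ifs
  · positivity
  · exact le_rfl

theorem boxWeight_nonneg (R : ℝ) (x : Fin n → ℝ) : 0 ≤ boxWeight R x :=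
  Finset.prod_nonneg fun i _ => lineWeight_nonneg n R _

theorem measurable_lineWeight (n : ℕ) (R : ℝ) : Measurable (lineWeight n R) := by
  unfold lineWeight
  refine Measurable.ite (measurableSet_le continuous_abs.measurable measurable_const) ?_
    measurable_const
  exact measurable_const.add (continuous_abs.measurable.pow_const _)

theorem integrable_lineWeight (n : ℕ) (R : ℝ) : Integrable (lineWeight n R) := by
  have h1 : lineWeight n R = indicator (Icc (-R) R)
      (fun t => 1 + |t| ^ ((1 : ℝ) / (n + 1) - 1)) := by
    funext t
    simp [lineWeight, indicator_apply, abs_le]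
  rw [h1, integrable_indicator_iff measurableSet_Icc]
  refine Integrable.add (integrableOn_const (by simp)) ?_
  have hr : (-1 : ℝ) < (1 : ℝ) / (n + 1) - 1 := by
    have : (0 : ℝ) < 1 / (n + 1) := by positivity
    linarith
  rcases le_or_gt R 0 with hR | hR
  · refine IntegrableOn.of_measure_zero ?_
    rw [Real.volume_Icc]; simp; linarith
  have h2 : IntervalIntegrable (fun t : ℝ => |t| ^ ((1 : ℝ) / (n + 1) - 1)) volume 0 R := by
    refine (intervalIntegral.intervalIntegrable_rpow' (a := 0) (b := R) hr).congr ?_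
    intro t ht
    rw [uIoc_of_le hR.le] at ht
    simp [abs_of_pos ht.1]
  have h3 : IntervalIntegrable (fun t : ℝ => |t| ^ ((1 : ℝ) / (n + 1) - 1)) volume (-R) 0 := by
    have := (IntervalIntegrable.iff_comp_neg (by simp)).1 h2
    simpa using this.symm
  have h4 := h3.trans h2
  rw [intervalIntegrable_iff_integrableOn_Icc_of_le (by linarith)] at h4
  exact h4

theorem integrable_boxWeight (R : ℝ) : Integrable (boxWeight R : (Fin n → ℝ) → ℝ) :=
  Integrable.fintype_prod (fun _ => integrable_lineWeight n R)

theorem measurable_boxWeight (R : ℝ) : Measurable (boxWeight R : (Fin n → ℝ) → ℝ) :=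
  Finset.measurable_prod _ fun i _ => (measurable_lineWeight n R).comp (measurable_pi_apply i)

theorem one_le_lineWeight {n : ℕ} {R t : ℝ} (h : |t| ≤ R) : 1 ≤ lineWeight n R t := by
  simp only [lineWeight, h, if_true]
  have : 0 ≤ |t| ^ ((1 : ℝ) / (n + 1) - 1) := by positivity
  linarith

theorem rpow_le_lineWeight {n : ℕ} {R t : ℝ} (h : |t| ≤ R) :
    |t| ^ ((1 : ℝ) / (n + 1) - 1) ≤ lineWeight n R t := by
  simp only [lineWeight, h, if_true]; linarith

theorem inv_le_lineWeight {n : ℕ} {R t a : ℝ} (ha : 0 < a) (hat : a ≤ |t|) (h : |t| ≤ R) :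
    |t|⁻¹ ≤ a ^ (-((1 : ℝ) / (n + 1))) * lineWeight n R t := by
  have ht : 0 < |t| := ha.trans_le hat
  calc |t|⁻¹ = |t| ^ (-((1 : ℝ) / (n + 1))) * |t| ^ ((1 : ℝ) / (n + 1) - 1) := by
        rw [← Real.rpow_add ht, ← Real.rpow_neg_one]; congr 1; ring
    _ ≤ _ := by
        refine mul_le_mul ?_ (rpow_le_lineWeight h) (by positivity) (by positivity)
        exact Real.rpow_le_rpow_of_nonpos ha hat (neg_nonpos.2 (by positivity))

theorem one_le_rpow_neg {a : ℝ} (n : ℕ) (ha : 0 < a) (ha1 : a ≤ 1) :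
    1 ≤ a ^ (-((1 : ℝ) / (n + 1))) :=
  Real.one_le_rpow_of_pos_of_le_one_of_nonpos ha ha1 (neg_nonpos.2 (by positivity))

theorem abs_prod_inv_eq (I : Finset (Fin n)) (x : Fin n → ℝ) :
    |∏ i ∈ I, x i|⁻¹ = ∏ i, if i ∈ I then |x i|⁻¹ else 1 := by
  rw [Finset.prod_ite_mem, Finset.univ_inter, Finset.abs_prod, Finset.prod_inv_distrib]

theorem abs_prod_inv_le {I : Finset (Fin n)} {R a : ℝ} (ha : 0 < a) (ha1 : a ≤ 1) {x : Fin n → ℝ}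
    (hx : ∀ i, |x i| ≤ R) (hI : ∀ i ∈ I, a ≤ |x i|) :
    |∏ i ∈ I, x i|⁻¹ ≤ (a ^ (-((1 : ℝ) / (n + 1)))) ^ n * boxWeight R x := by
  rw [abs_prod_inv_eq]
  calc _ ≤ ∏ i : Fin n, a ^ (-((1 : ℝ) / (n + 1))) * lineWeight n R (x i) := by
        refine Finset.prod_le_prod (fun i _ => by positivity) fun i _ => ?_
        split_ifs with hi
        · exact inv_le_lineWeight ha (hI i hi) (hx i)
        · exact one_le_mul_of_one_le_of_one_le (one_le_rpow_neg n ha ha1) (one_le_lineWeight (hx i))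
    _ = _ := by rw [Finset.prod_mul_distrib]; simp [boxWeight]

theorem abs_prod_inv_le_erase {I : Finset (Fin n)} {R a : ℝ} (ha : 0 < a) (ha1 : a ≤ 1)
    {x : Fin n → ℝ} (hx : ∀ i, |x i| ≤ R) (hI : ∀ i ∈ I, a ≤ |x i|) (j : Fin n) :
    |∏ i ∈ I, x i|⁻¹ ≤ a⁻¹ * (a ^ (-((1 : ℝ) / (n + 1)))) ^ n *
      ∏ i ∈ Finset.univ.erase j, lineWeight n R (x i) := by
  have h1 := one_le_rpow_neg n ha ha1
  have ha' : 1 ≤ a⁻¹ := (one_le_inv₀ ha).2 ha1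
  rw [abs_prod_inv_eq, ← Finset.mul_prod_erase _ _ (Finset.mem_univ j)]
  have h2 : (∏ i ∈ Finset.univ.erase j, if i ∈ I then |x i|⁻¹ else 1) ≤
      ∏ i ∈ Finset.univ.erase j, a ^ (-((1 : ℝ) / (n + 1))) * lineWeight n R (x i) := by
    refine Finset.prod_le_prod (fun i _ => by positivity) fun i _ => ?_
    split_ifs with hi
    · exact inv_le_lineWeight ha (hI i hi) (hx i)
    · exact one_le_mul_of_one_le_of_one_le h1 (one_le_lineWeight (hx i))
  rw [Finset.prod_mul_distrib, Finset.prod_const] at h2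
  have h3 : (a ^ (-((1 : ℝ) / (n + 1)))) ^ (Finset.univ.erase j).card ≤
      (a ^ (-((1 : ℝ) / (n + 1)))) ^ n :=
    pow_le_pow_right₀ h1 (by simp)
  have h4 : (if j ∈ I then |x j|⁻¹ else 1) ≤ a⁻¹ := by
    split_ifs with hj
    · exact inv_anti₀ ha (hI j hj)
    · exact ha'
  have h5 : 0 ≤ ∏ i ∈ Finset.univ.erase j, lineWeight n R (x i) :=
    Finset.prod_nonneg fun i _ => lineWeight_nonneg n R _
  rw [mul_assoc]
  refine mul_le_mul h4 (h2.trans (mul_le_mul_of_nonneg_right h3 h5)) ?_ (by positivity)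
  exact Finset.prod_nonneg fun i _ => by positivity

/-- Comparison of integrals by integrating one coordinate first. -/
theorem lintegral_le_of_update_le {F F' : (Fin n → ℝ) → ENNReal} (hF : Measurable F)
    (hF' : Measurable F') (j : Fin n)
    (h : ∀ x, ∫⁻ t, F (Function.update x j t) ≤ ∫⁻ t, F' (Function.update x j t)) :
    ∫⁻ x, F x ≤ ∫⁻ x, F' x := by
  have key : ∀ (H : (Fin n → ℝ) → ENNReal), Measurable H →
      ∫⁻ x, H x = lmarginal (fun _ => volume) (Finset.univ.erase j)
        (fun x => ∫⁻ t, H (Function.update x j t)) 0 := by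
    intro H hH
    rw [← lmarginal_insert' H hH (Finset.notMem_erase j _), Finset.insert_erase (Finset.mem_univ j)]
    exact lintegral_eq_lmarginal_univ (μ := fun _ => volume) 0
  rw [key F hF, key F' hF']
  exact lmarginal_mono (fun x => h x) 0

end Weight

section Cutoff

variable {n : ℕ}

/-- The points whose coordinates in `I` have absolute value at least `a`. -/
def awayFrom (I : Finset (Fin n)) (a : ℝ) : Set (Fin n → ℝ) := {x | ∀ i ∈ I, a ≤ |x i|}

theorem measurableSet_awayFrom (I : Finset (Fin n)) (a : ℝ) : MeasurableSet (awayFrom I a) := by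
  have : awayFrom I a = ⋂ i ∈ I, {x : Fin n → ℝ | a ≤ |x i|} := by ext; simp [awayFrom]
  rw [this]
  exact Finset.measurableSet_biInter _ fun i _ =>
    measurableSet_le measurable_const (continuous_abs.measurable.comp (measurable_pi_apply i))

/-- Bounded Lipschitz functions supported in a box. -/
structure IsBoxLipschitz (R K : ℝ) (f : (Fin n → ℝ) → ℂ) : Prop where
  bound : ∀ x, ‖f x‖ ≤ K
  lip : ∀ x y, ‖f x - f y‖ ≤ K * ‖x - y‖
  supp : ∀ x, (∃ i, R < |x i|) → f x = 0

theorem IsBoxLipschitz.nonneg {R K : ℝ} {f : (Fin n → ℝ) → ℂ} (hf : IsBoxLipschitz R K f) :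
    0 ≤ K := (norm_nonneg _).trans (hf.bound 0)

theorem IsBoxLipschitz.continuous {R K : ℝ} {f : (Fin n → ℝ) → ℂ} (hf : IsBoxLipschitz R K f) :
    Continuous f := by
  refine (LipschitzWith.of_dist_le_mul (K := ⟨K, hf.nonneg⟩) fun x y => ?_).continuous
  rw [dist_eq_norm, dist_eq_norm]; exact hf.lip x y

/-- A family of sets that are, up to errors of second order, given by `|x j| * c j ≥ ε` for
positive Lipschitz functions `c j`. -/
structure IsCutoff (I : Finset (Fin n)) (R M C : ℝ) (S : ℝ → Set (Fin n → ℝ))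
    (c : Fin n → (Fin n → ℝ) → ℝ) : Prop where
  measurable : ∀ ε, MeasurableSet (S ε)
  lower : ∀ j x, (∀ i, |x i| ≤ R) → M⁻¹ ≤ c j x
  upper : ∀ j x, (∀ i, |x i| ≤ R) → c j x ≤ M
  lip : ∀ j x y, (∀ i, |x i| ≤ R) → (∀ i, |y i| ≤ R) → |c j x - c j y| ≤ C * ‖x - y‖
  of_mem : ∀ ε, 0 < ε → C * ε ≤ 1 / 2 → ∀ x, (∀ i, |x i| ≤ R) → x ∈ S ε →
    ∀ j ∈ I, ε * (1 - C * ε) ≤ |x j| * c j x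
  of_notMem : ∀ ε, 0 < ε → C * ε ≤ 1 / 2 → ∀ x, (∀ i, |x i| ≤ R) → x ∉ S ε →
    ∃ j ∈ I, |x j| * c j x ≤ ε * (1 + C * ε)

theorem integrableOn_div_prod {I : Finset (Fin n)} {R K a : ℝ} (ha : 0 < a) (ha1 : a ≤ 1)
    {f : (Fin n → ℝ) → ℂ} (hf : IsBoxLipschitz R K f) {S : Set (Fin n → ℝ)} (hS : MeasurableSet S)
    (hSI : ∀ x ∈ S, (∀ i, |x i| ≤ R) → ∀ i ∈ I, a ≤ |x i|) :
    IntegrableOn (fun x => f x / ((∏ i ∈ I, x i : ℝ) : ℂ)) S := by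
  have hK := hf.nonneg
  refine Integrable.mono' (((integrable_boxWeight R).const_mul
    (K * (a ^ (-((1 : ℝ) / (n + 1)))) ^ n)).integrableOn) ?_ ?_
  · refine (Measurable.div hf.continuous.measurable ?_).aestronglyMeasurable
    exact Complex.measurable_ofReal.comp (Finset.measurable_prod _ fun i _ => measurable_pi_apply i)
  · refine (ae_restrict_iff' hS).2 (ae_of_all _ fun x hx => ?_)
    by_cases hR : ∃ i, R < |x i|
    · rw [hf.supp x hR]; simp only [zero_div, norm_zero]
      have := boxWeight_nonneg R x; positivity
    push Not at hR
    rw [norm_div, Complex.norm_real, Real.norm_eq_abs, div_eq_mul_inv, mul_assoc]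
    exact mul_le_mul (hf.bound x) (abs_prod_inv_le ha ha1 hR (hSI x hx hR)) (by positivity) hK

/-- The measure of a slab, weighted by the singularities in the other coordinates. -/
theorem setIntegral_slab_le {R M δ ε : ℝ} (hR : 0 < R) (hM : 0 < M) (hδ : 0 ≤ δ) (j : Fin n)
    {c : (Fin n → ℝ) → ℝ} {S : Set (Fin n → ℝ)} (hS : MeasurableSet S)
    (hSR : ∀ x ∈ S, ∀ i, |x i| ≤ R)
    (hc : ∀ x, (∀ i, |x i| ≤ R) → M⁻¹ ≤ c x)
    (hslab : ∀ x ∈ S, |(|x j| * c (Function.update x j 0)) - ε| ≤ δ) :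
    ∫ x in S, ∏ i ∈ Finset.univ.erase j, lineWeight n R (x i) ≤
      2 * M * δ / R * ∫ x, (boxWeight R x : ℝ) ∂(volume : Measure (Fin n → ℝ)) := by
  have hq0 : ∀ x : Fin n → ℝ, 0 ≤ ∏ i ∈ Finset.univ.erase j, lineWeight n R (x i) :=
    fun x => Finset.prod_nonneg fun i _ => lineWeight_nonneg n R _
  have hqm : Measurable fun x : Fin n → ℝ => ∏ i ∈ Finset.univ.erase j, lineWeight n R (x i) :=
    Finset.measurable_prod _ fun i _ => (measurable_lineWeight n R).comp (measurable_pi_apply i)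
  have hqu : ∀ (x : Fin n → ℝ) t, ∏ i ∈ Finset.univ.erase j,
      lineWeight n R (Function.update x j t i) =
        ∏ i ∈ Finset.univ.erase j, lineWeight n R (x i) := by
    intro x t
    refine Finset.prod_congr rfl fun i hi => ?_
    rw [Function.update_of_ne (Finset.ne_of_mem_erase hi)]
  rw [integral_eq_lintegral_of_nonneg_ae (ae_of_all _ hq0) hqm.aestronglyMeasurable]
  rw [← integral_const_mul, integral_eq_lintegral_of_nonneg_ae (ae_of_all _ fun x =>
    mul_nonneg (by positivity) (boxWeight_nonneg R x))
    ((measurable_boxWeight R).const_mul _).aestronglyMeasurable]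
  refine ENNReal.toReal_mono ?_ ?_
  · exact ((integrable_boxWeight (n := n) R).const_mul _).lintegral_lt_top.ne
  rw [← lintegral_indicator hS]
  refine lintegral_le_of_update_le (hqm.ennreal_ofReal.indicator hS)
    ((measurable_boxWeight R).const_mul _).ennreal_ofReal j fun x => ?_
  set q := ∏ i ∈ Finset.univ.erase j, lineWeight n R (x i) with hq
  have hq0' : 0 ≤ q := hq0 x
  have hright : ENNReal.ofReal (4 * M * δ * q) ≤
      ∫⁻ t, ENNReal.ofReal (2 * M * δ / R * boxWeight R (Function.update x j t)) := by
    calc ENNReal.ofReal (4 * M * δ * q)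
        = ∫⁻ t in Icc (-R) R, ENNReal.ofReal (2 * M * δ / R * q) := by
          rw [setLIntegral_const, Real.volume_Icc, ← ENNReal.ofReal_mul (by positivity)]
          congr 1; field_simp; ring
      _ ≤ ∫⁻ t in Icc (-R) R,
            ENNReal.ofReal (2 * M * δ / R * boxWeight R (Function.update x j t)) := by
          refine setLIntegral_mono' measurableSet_Icc fun t ht => ENNReal.ofReal_le_ofReal ?_
          refine mul_le_mul_of_nonneg_left ?_ (by positivity)
          unfold boxWeight
          rw [← Finset.mul_prod_erase _ _ (Finset.mem_univ j), hqu, Function.update_self]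
          exact le_mul_of_one_le_left hq0' (one_le_lineWeight (abs_le.2 ht))
      _ ≤ _ := setLIntegral_le_lintegral _ _
  refine le_trans ?_ hright
  by_cases hne : ∃ t, Function.update x j t ∈ S
  swap
  · push Not at hne
    have : ∀ t, S.indicator (fun x : Fin n → ℝ => ENNReal.ofReal
        (∏ i ∈ Finset.univ.erase j, lineWeight n R (x i))) (Function.update x j t) = 0 :=
      fun t => indicator_of_notMem (hne t) _
    simp [this]
  obtain ⟨t₀, ht₀⟩ := hne
  set b := c (Function.update x j 0) with hb
  have hbM : M⁻¹ ≤ b := by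
    refine hc _ fun i => ?_
    by_cases hi : i = j
    · subst hi; simp [hR.le]
    · have := hSR _ ht₀ i
      rwa [Function.update_of_ne hi] at this ⊢
  have hb0 : 0 < b := (inv_pos.2 hM).trans_le hbM
  set A : Set ℝ := Icc ((ε - δ) / b) ((ε + δ) / b) ∪ Icc (-((ε + δ) / b)) (-((ε - δ) / b))
  have hA : ∀ t, Function.update x j t ∈ S → t ∈ A := by
    intro t ht
    have h := hslab _ ht
    rw [Function.update_idem, Function.update_self, abs_le] at h
    have h1 : (ε - δ) / b ≤ |t| := by rw [div_le_iff₀ hb0]; linarith [h.1]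
    have h2 : |t| ≤ (ε + δ) / b := by rw [le_div_iff₀ hb0]; linarith [h.2]
    rcases abs_cases t with h' | h'
    · left; constructor <;> linarith
    · right; constructor <;> linarith
  calc _ ≤ ∫⁻ t, A.indicator (fun _ => ENNReal.ofReal q) t := by
        refine lintegral_mono fun t => ?_
        by_cases ht : Function.update x j t ∈ S
        · rw [indicator_of_mem ht, indicator_of_mem (hA t ht), hqu]
        · rw [indicator_of_notMem ht]; exact zero_le
    _ = ENNReal.ofReal q * volume A := by
        rw [lintegral_indicator (measurableSet_Icc.union measurableSet_Icc), setLIntegral_const]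
    _ ≤ ENNReal.ofReal q * ENNReal.ofReal (4 * M * δ) := by
        gcongr
        refine (measure_union_le _ _).trans ?_
        have hw : 2 * δ / b ≤ 2 * M * δ := by
          rw [div_le_iff₀ hb0]
          have : 1 ≤ M * b := by
            rw [inv_eq_one_div, div_le_iff₀ hM] at hbM; linarith
          nlinarith
        rw [Real.volume_Icc, Real.volume_Icc, ← ENNReal.ofReal_add]
        · refine ENNReal.ofReal_le_ofReal ?_
          have : (ε + δ) / b - (ε - δ) / b = 2 * δ / b := by ring
          linarith
        · rw [← sub_div]; exact div_nonneg (by linarith) hb0.le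
        · have : -((ε - δ) / b) - -((ε + δ) / b) = 2 * δ / b := by ring
          rw [this]; positivity
    _ = _ := by rw [← ENNReal.ofReal_mul hq0']; congr 1; ring

end Cutoff

section CutoffError

variable {n : ℕ}

theorem norm_reflect_sub_le (m : Fin n) (x : Fin n → ℝ) : ‖x - reflect {m} x‖ ≤ 2 * |x m| := by
  refine (pi_norm_le_iff_of_nonneg (by positivity)).2 fun i => ?_
  simp only [Pi.sub_apply, reflect, Finset.mem_singleton, Real.norm_eq_abs]
  split_ifs with h
  · subst h
    rw [sub_neg_eq_add, ← two_mul, abs_mul]; simp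
  · simp

/-- The part of an integral over a set that is invariant under the reflection in a polar
coordinate. -/
theorem norm_setIntegral_reflect_le {I : Finset (Fin n)} {R K a b : ℝ} (ha : 0 < a) (ha1 : a ≤ 1)
    {f : (Fin n → ℝ) → ℂ} (hf : IsBoxLipschitz R K f) {m : Fin n} (hm : m ∈ I)
    {Q : Set (Fin n → ℝ)} (hQ : MeasurableSet Q) (hQσ : reflect {m} ⁻¹' Q = Q)
    (hQI : ∀ x ∈ Q, (∀ i, |x i| ≤ R) → ∀ i ∈ I, a ≤ |x i|) (hQm : ∀ x ∈ Q, |x m| ≤ b) (hb : 0 ≤ b) :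
    ‖∫ x in Q, f x / ((∏ i ∈ I, x i : ℝ) : ℂ)‖ ≤
      K * b * ((a ^ (-((1 : ℝ) / (n + 1)))) ^ n *
        ∫ x, (boxWeight R x : ℝ) ∂(volume : Measure (Fin n → ℝ))) := by
  have hK := hf.nonneg
  set w := fun x : Fin n → ℝ => f x / ((∏ i ∈ I, x i : ℝ) : ℂ) with hw
  have hint : IntegrableOn w Q := integrableOn_div_prod ha ha1 hf hQ hQI
  have h1 : ∫ x in Q, w x = ∫ x in Q, w (reflect {m} x) := by
    have := (measurePreserving_reflect {m}).setIntegral_preimage_emb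
      (measurableEmbedding_reflect {m}) w Q
    rw [hQσ] at this; exact this.symm
  have hint2 : IntegrableOn (fun x => w (reflect {m} x)) Q := by
    have := ((measurePreserving_reflect {m}).integrableOn_comp_preimage
      (measurableEmbedding_reflect {m}) (f := w) (s := Q)).2 hint
    rw [hQσ] at this; exact this
  have h2 : (2 : ℂ) * ∫ x in Q, w x = ∫ x in Q, (w x + w (reflect {m} x)) := by
    rw [integral_add hint hint2, ← h1]; ring
  have hsum : ∀ x, w x + w (reflect {m} x) =
      (f x - f (reflect {m} x)) / ((∏ i ∈ I, x i : ℝ) : ℂ) := by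
    intro x
    simp only [hw]
    rw [prod_reflect (Finset.singleton_subset_iff.2 hm)]
    simp only [Finset.card_singleton, pow_one, neg_mul, one_mul, Complex.ofReal_neg, div_neg]
    ring
  have h3 : ‖∫ x in Q, (w x + w (reflect {m} x))‖ ≤
      ∫ x in Q, K * (2 * b) * ((a ^ (-((1 : ℝ) / (n + 1)))) ^ n * boxWeight R x) := by
    refine norm_integral_le_of_norm_le
      ((((integrable_boxWeight R).const_mul _).const_mul _).integrableOn) ?_
    refine (ae_restrict_iff' hQ).2 (ae_of_all _ fun x hx => ?_)
    rw [hsum]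
    have hP := boxWeight_nonneg R x
    by_cases hR : ∃ i, R < |x i|
    · rw [hf.supp x hR, hf.supp _ (by simpa only [abs_reflect] using hR)]
      simp only [sub_zero, zero_div, norm_zero]
      positivity
    push Not at hR
    rw [norm_div, Complex.norm_real, Real.norm_eq_abs, div_eq_mul_inv]
    refine mul_le_mul ?_ (abs_prod_inv_le ha ha1 hR (hQI x hx hR)) (by positivity) (by positivity)
    refine (hf.lip _ _).trans (mul_le_mul_of_nonneg_left ?_ hK)
    exact (norm_reflect_sub_le m x).trans (by linarith [hQm x hx])
  have h4 : ∫ x in Q, K * (2 * b) * ((a ^ (-((1 : ℝ) / (n + 1)))) ^ n * boxWeight R x) ≤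
      ∫ x : Fin n → ℝ, K * (2 * b) * ((a ^ (-((1 : ℝ) / (n + 1)))) ^ n * boxWeight R x) := by
    refine setIntegral_le_integral (((integrable_boxWeight R).const_mul _).const_mul _)
      (ae_of_all _ fun x => ?_)
    have := boxWeight_nonneg R x
    simp only [Pi.zero_apply]; positivity
  have h5 := h3.trans h4
  rw [integral_const_mul, integral_const_mul, ← h2, norm_mul, Complex.norm_two] at h5
  linarith

theorem IsCutoff.le_abs {I : Finset (Fin n)} {R M C ε : ℝ} {S : ℝ → Set (Fin n → ℝ)}
    {c : Fin n → (Fin n → ℝ) → ℝ} (h : IsCutoff I R M C S c) (hM : 1 ≤ M) (hε : 0 < ε)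
    (hCε : C * ε ≤ 1 / 2) {x : Fin n → ℝ} (hx : ∀ i, |x i| ≤ R) (hxS : x ∈ S ε) {j : Fin n}
    (hj : j ∈ I) : ε / (2 * M) ≤ |x j| := by
  have h1 := h.of_mem ε hε hCε x hx hxS j hj
  have h2 := h.upper j x hx
  have h3 : |x j| * c j x ≤ |x j| * M := mul_le_mul_of_nonneg_left h2 (abs_nonneg _)
  rw [div_le_iff₀ (by positivity)]
  nlinarith

theorem IsCutoff.exists_abs_le {I : Finset (Fin n)} {R M C ε : ℝ} {S : ℝ → Set (Fin n → ℝ)}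
    {c : Fin n → (Fin n → ℝ) → ℝ} (h : IsCutoff I R M C S c) (hM : 1 ≤ M) (hε : 0 < ε)
    (hCε : C * ε ≤ 1 / 2) {x : Fin n → ℝ} (hx : ∀ i, |x i| ≤ R) (hxS : x ∉ S ε) :
    ∃ j ∈ I, |x j| * c j x ≤ ε * (1 + C * ε) ∧ |x j| < 2 * M * ε := by
  obtain ⟨j, hj, h1⟩ := h.of_notMem ε hε hCε x hx hxS
  refine ⟨j, hj, h1, ?_⟩
  have h2 := h.lower j x hx
  have hM0 : 0 < M := by linarith
  have h3 : |x j| * M⁻¹ ≤ |x j| * c j x := mul_le_mul_of_nonneg_left h2 (abs_nonneg _)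
  have h4 : |x j| * M⁻¹ < 2 * ε := by nlinarith
  rw [mul_inv_lt_iff₀ hM0] at h4
  linarith

/-- Where a cutoff set is not invariant under a reflection, one of the coordinates is in a slab. -/
theorem IsCutoff.mem_slab {I : Finset (Fin n)} {R M C ε : ℝ} {S : ℝ → Set (Fin n → ℝ)}
    {c : Fin n → (Fin n → ℝ) → ℝ} (h : IsCutoff I R M C S c) (hR : 0 ≤ R) (hM : 1 ≤ M) (hC : 0 ≤ C)
    (hε : 0 < ε) (hCε : C * ε ≤ 1 / 2) {x : Fin n → ℝ} (hx : ∀ i, |x i| ≤ R) (hxS : x ∈ S ε)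
    {m : Fin n} (hxm : |x m| ≤ 2 * M * ε) (hxS' : reflect {m} x ∉ S ε) :
    ∃ j ∈ I, |(|x j| * c j (Function.update x j 0)) - ε| ≤ (C + 8 * C * M ^ 2) * ε ^ 2 := by
  set x' := reflect {m} x with hx'
  have hx'R : ∀ i, |x' i| ≤ R := fun i => by rw [hx', abs_reflect]; exact hx i
  obtain ⟨j, hj, h1, h2⟩ := h.exists_abs_le hM hε hCε hx'R hxS'
  refine ⟨j, hj, ?_⟩
  have h3 := h.of_mem ε hε hCε x hx hxS j hj
  rw [hx', abs_reflect] at h2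
  rw [show |x' j| = |x j| by rw [hx', abs_reflect]] at h1
  set z := Function.update x j 0 with hz
  have hzR : ∀ i, |z i| ≤ R := by
    intro i
    by_cases hi : i = j
    · subst hi; simp [hz, hR]
    · simpa [hz, Function.update_of_ne hi] using hx i
  have hd1 : ‖x - z‖ ≤ |x j| := by
    refine (pi_norm_le_iff_of_nonneg (abs_nonneg _)).2 fun i => ?_
    by_cases hi : i = j
    · subst hi; simp [hz]
    · simp [hz, Function.update_of_ne hi]
  have hd2 : ‖x' - z‖ ≤ 4 * M * ε := by
    refine (pi_norm_le_iff_of_nonneg (by positivity)).2 fun i => ?_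
    have hMε : 0 ≤ M * ε := by positivity
    by_cases hi : i = j
    · subst hi
      simp only [hz, Pi.sub_apply, Function.update_self, sub_zero, Real.norm_eq_abs]
      rw [hx', abs_reflect]; linarith
    · simp only [hz, Pi.sub_apply, Function.update_of_ne hi, Real.norm_eq_abs, hx', reflect,
        Finset.mem_singleton]
      split_ifs with him
      · subst him
        rw [show -x i - x i = -(2 * x i) by ring, abs_neg, abs_mul]
        norm_num; linarith
      · simp; linarith
  have l1 := (abs_le.1 ((h.lip j x z hx hzR).trans (mul_le_mul_of_nonneg_left hd1 hC))).2
  have l2 := (abs_le.1 ((h.lip j x' z hx'R hzR).trans (mul_le_mul_of_nonneg_left hd2 hC))).1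
  set t := |x j| with ht
  have ht0 : 0 ≤ t := abs_nonneg _
  have hMε : 0 ≤ M * ε := by positivity
  rw [abs_le]
  constructor
  · have e1 : t * c j x - t * c j z ≤ t * (C * t) := by
      rw [← mul_sub]; exact mul_le_mul_of_nonneg_left l1 ht0
    have e2 : t * (C * t) ≤ 4 * C * (M * ε) ^ 2 := by
      have : t * t ≤ (2 * M * ε) * (2 * M * ε) := mul_self_le_mul_self ht0 h2.le
      nlinarith
    have e3 : 0 ≤ C * (M * ε) ^ 2 := by positivity
    nlinarith
  · have e1 : t * c j z - t * c j x' ≤ t * (C * (4 * M * ε)) := by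
      rw [← mul_sub]; exact mul_le_mul_of_nonneg_left (by linarith) ht0
    have e2 : t * (C * (4 * M * ε)) ≤ (2 * M * ε) * (C * (4 * M * ε)) :=
      mul_le_mul_of_nonneg_right h2.le (by positivity)
    nlinarith

/-- The error of `exists_cutoff_error`. -/
def cutoffError (n : ℕ) (R M C ε : ℝ) : ℝ :=
  n * ((2 * M * ε) * (((ε / (2 * M)) ^ (-((1 : ℝ) / (n + 1)))) ^ n *
      ∫ x, (boxWeight R x : ℝ) ∂(volume : Measure (Fin n → ℝ))) +
    n * ((ε / (2 * M))⁻¹ * ((ε / (2 * M)) ^ (-((1 : ℝ) / (n + 1)))) ^ n *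
      (2 * M * ((C + 8 * C * M ^ 2) * ε ^ 2) / R *
        ∫ x, (boxWeight R x : ℝ) ∂(volume : Measure (Fin n → ℝ)))))

theorem tendsto_cutoffError (n : ℕ) {R M C : ℝ} (hM : 1 ≤ M) :
    Tendsto (cutoffError n R M C) (𝓝[>] 0) (𝓝 0) := by
  set J := ∫ x, (boxWeight R x : ℝ) ∂(volume : Measure (Fin n → ℝ))
  set B := (n : ℝ) * ((2 * M) * J + n * (2 * M * (2 * M * (C + 8 * C * M ^ 2) / R * J)))
  have hη : (0 : ℝ) < 1 / (n + 1) := by positivity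
  have h1 : Tendsto (fun ε : ℝ => B * (2 * M) * (ε / (2 * M)) ^ ((1 : ℝ) / (n + 1))) (𝓝[>] 0)
      (𝓝 0) := by
    have : Continuous fun ε : ℝ => B * (2 * M) * (ε / (2 * M)) ^ ((1 : ℝ) / (n + 1)) :=
      continuous_const.mul ((continuous_id.div_const _).rpow_const fun _ => Or.inr hη.le)
    have h := (this.tendsto 0).mono_left (nhdsWithin_le_nhds (s := Ioi 0))
    rwa [zero_div, Real.zero_rpow hη.ne', mul_zero] at h
  refine h1.congr' ?_
  filter_upwards [self_mem_nhdsWithin] with ε hε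
  rw [mem_Ioi] at hε
  have ha : 0 < ε / (2 * M) := by positivity
  have h2 : (ε / (2 * M)) ^ ((1 : ℝ) / (n + 1)) =
      ε / (2 * M) * ((ε / (2 * M)) ^ (-((1 : ℝ) / (n + 1)))) ^ n := by
    rw [← Real.rpow_natCast, ← Real.rpow_mul ha.le]
    nth_rewrite 2 [← Real.rpow_one (ε / (2 * M))]
    rw [← Real.rpow_add ha]
    congr 1
    field_simp; ring
  rw [h2]
  unfold cutoffError
  simp only [B]
  set A := ((ε / (2 * M)) ^ (-((1 : ℝ) / (n + 1)))) ^ n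
  by_cases hR : R = 0
  · subst hR; simp only [div_zero, zero_mul, mul_zero, add_zero, J]; field_simp
  · simp only [J]; field_simp

theorem IsBoxLipschitz.norm_setIntegral_slab_le {I : Finset (Fin n)} {R K M C a ε : ℝ}
    {S : ℝ → Set (Fin n → ℝ)} {c : Fin n → (Fin n → ℝ) → ℝ} (h : IsCutoff I R M C S c)
    (hR : 0 < R) (hM : 1 ≤ M) (ha : 0 < a) (ha1 : a ≤ 1) {δ : ℝ} (hδ : 0 ≤ δ)
    {f : (Fin n → ℝ) → ℂ} (hf : IsBoxLipschitz R K f)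
    {Q : Set (Fin n → ℝ)} (hQ : MeasurableSet Q)
    (hQI : ∀ x ∈ Q, (∀ i, |x i| ≤ R) → ∀ i ∈ I, a ≤ |x i|)
    (hslab : ∀ x ∈ Q, (∀ i, |x i| ≤ R) →
      ∃ j ∈ I, |(|x j| * c j (Function.update x j 0)) - ε| ≤ δ) :
    ‖∫ x in Q, f x / ((∏ i ∈ I, x i : ℝ) : ℂ)‖ ≤
      K * (n * (a⁻¹ * (a ^ (-((1 : ℝ) / (n + 1)))) ^ n * (2 * M * δ / R *
        ∫ x, (boxWeight R x : ℝ) ∂(volume : Measure (Fin n → ℝ))))) := by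
  have hK := hf.nonneg
  set box : Set (Fin n → ℝ) := {x | ∀ i, |x i| ≤ R} with hbox
  have hboxc : IsClosed box := by
    have : box = ⋂ i, {x : Fin n → ℝ | |x i| ≤ R} := by ext; simp [hbox]
    rw [this]
    exact isClosed_iInter fun i => isClosed_le (continuous_apply i).abs continuous_const
  set B : Fin n → Set (Fin n → ℝ) := fun j =>
    box ∩ {x | |(|x j| * c j (Function.update x j 0)) - ε| ≤ δ} with hB
  have hupd : ∀ (x : Fin n → ℝ) (j : Fin n), x ∈ box → Function.update x j 0 ∈ box := by
    intro x j hx i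
    by_cases hi : i = j
    · subst hi; simp [hR.le]
    · simpa [Function.update_of_ne hi] using hx i
  have hBm : ∀ j, MeasurableSet (B j) := by
    intro j
    have hcont : ContinuousOn (c j) box := by
      refine (LipschitzOnWith.of_dist_le_mul (K := ⟨max C 0, le_max_right _ _⟩)
        fun x hx y hy => ?_).continuousOn
      rw [Real.dist_eq, dist_eq_norm]
      exact (h.lip j x y hx hy).trans
        (mul_le_mul_of_nonneg_right (le_max_left _ _) (norm_nonneg _))
    have hc2 : ContinuousOn (fun x : Fin n → ℝ =>
        |(|x j| * c j (Function.update x j 0)) - ε|) box := by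
      refine ((((continuous_apply j).abs.continuousOn).mul (hcont.comp ?_ fun x hx =>
        hupd x j hx)).sub continuousOn_const).abs
      exact (continuous_id.update j continuous_const).continuousOn
    exact (hc2.preimage_isClosed_of_isClosed hboxc isClosed_Iic).measurableSet
  set A := (a ^ (-((1 : ℝ) / (n + 1)))) ^ n with hA
  set J := ∫ x, (boxWeight R x : ℝ) ∂(volume : Measure (Fin n → ℝ)) with hJ
  set q : Fin n → (Fin n → ℝ) → ℝ := fun j x =>
    ∏ i ∈ Finset.univ.erase j, lineWeight n R (x i) with hq
  have hq0 : ∀ j x, 0 ≤ q j x := fun j x => Finset.prod_nonneg fun i _ => lineWeight_nonneg n R _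
  have hqint : ∀ j, IntegrableOn (q j) (B j) := by
    intro j
    refine Integrable.mono' (integrable_boxWeight (n := n) R).integrableOn ?_ ?_
    · exact (Finset.measurable_prod _ fun i _ =>
        (measurable_lineWeight n R).comp (measurable_pi_apply i)).aestronglyMeasurable
    · refine (ae_restrict_iff' (hBm j)).2 (ae_of_all _ fun x hx => ?_)
      rw [Real.norm_of_nonneg (hq0 j x)]
      unfold boxWeight
      rw [← Finset.mul_prod_erase _ _ (Finset.mem_univ j)]
      exact le_mul_of_one_le_left (hq0 j x) (one_le_lineWeight (hx.1 j))
  have hgint : Integrable (fun x => ∑ j, K * (a⁻¹ * A) * (B j).indicator (q j) x) :=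
    integrable_finsetSum _ fun j _ => ((integrable_indicator_iff (hBm j)).2 (hqint j)).const_mul _
  have hg0 : ∀ x j, 0 ≤ K * (a⁻¹ * A) * (B j).indicator (q j) x := fun x j =>
    mul_nonneg (by positivity) (indicator_nonneg (fun x _ => hq0 j x) x)
  calc ‖∫ x in Q, f x / ((∏ i ∈ I, x i : ℝ) : ℂ)‖
      ≤ ∫ x in Q, ∑ j, K * (a⁻¹ * A) * (B j).indicator (q j) x := by
        refine norm_integral_le_of_norm_le hgint.integrableOn ?_
        refine (ae_restrict_iff' hQ).2 (ae_of_all _ fun x hx => ?_)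
        by_cases hxR : ∃ i, R < |x i|
        · rw [hf.supp x hxR]; simp only [zero_div, norm_zero]
          exact Finset.sum_nonneg fun j _ => hg0 x j
        push Not at hxR
        obtain ⟨j, hj, hs⟩ := hslab x hx hxR
        refine le_trans ?_ (Finset.single_le_sum (fun j _ => hg0 x j) (Finset.mem_univ j))
        rw [indicator_of_mem (show x ∈ B j from ⟨hxR, hs⟩), norm_div, Complex.norm_real,
          Real.norm_eq_abs, div_eq_mul_inv, mul_assoc]
        exact mul_le_mul (hf.bound x) (abs_prod_inv_le_erase ha ha1 hxR (hQI x hx hxR) j)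
          (by positivity) hK
    _ ≤ ∫ x, ∑ j, K * (a⁻¹ * A) * (B j).indicator (q j) x :=
        setIntegral_le_integral hgint (ae_of_all _ fun x => Finset.sum_nonneg fun j _ => hg0 x j)
    _ = ∑ j, K * (a⁻¹ * A) * ∫ x in B j, q j x := by
        rw [integral_finsetSum _ fun j _ =>
          ((integrable_indicator_iff (hBm j)).2 (hqint j)).const_mul _]
        refine Finset.sum_congr rfl fun j _ => ?_
        rw [integral_const_mul, integral_indicator (hBm j)]
    _ ≤ ∑ j : Fin n, K * (a⁻¹ * A) * (2 * M * δ / R * J) := by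
        refine Finset.sum_le_sum fun j _ => mul_le_mul_of_nonneg_left ?_ (by positivity)
        exact setIntegral_slab_le hR (by linarith) hδ j (hBm j) (fun x hx => hx.1) (h.lower j)
          (fun x hx => hx.2)
    _ = _ := by simp; ring

/-- Principal value integrals over the complements of two families of neighbourhoods of the
coordinate hyperplanes differ by a uniformly small error. -/
theorem IsCutoff.norm_sub_le {I : Finset (Fin n)} {R K M C ε : ℝ}
    {S : ℝ → Set (Fin n → ℝ)} {c : Fin n → (Fin n → ℝ) → ℝ} (h : IsCutoff I R M C S c)
    (hR : 0 < R) (hM : 1 ≤ M) (hC : 0 ≤ C) (hε : 0 < ε) (hε1 : ε ≤ 1) (hCε : C * ε ≤ 1 / 2)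
    {f : (Fin n → ℝ) → ℂ} (hf : IsBoxLipschitz R K f) :
    ‖(∫ x in S ε, f x / ((∏ i ∈ I, x i : ℝ) : ℂ)) -
      ∫ x in awayFrom I (2 * M * ε), f x / ((∏ i ∈ I, x i : ℝ) : ℂ)‖ ≤
      K * cutoffError n R M C ε := by
  have hK := hf.nonneg
  set a := ε / (2 * M) with ha_def
  have ha : 0 < a := by positivity
  have ha1 : a ≤ 1 := by
    rw [ha_def, div_le_iff₀ (by positivity)]; linarith
  have hSI : ∀ x ∈ S ε, (∀ i, |x i| ≤ R) → ∀ i ∈ I, a ≤ |x i| :=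
    fun x hx hxR i hi => h.le_abs hM hε hCε hxR hx hi
  set w := fun x : Fin n → ℝ => f x / ((∏ i ∈ I, x i : ℝ) : ℂ) with hw
  set T := awayFrom I (2 * M * ε) with hT
  have hTm : MeasurableSet T := measurableSet_awayFrom _ _
  have hSm := h.measurable ε
  have hwS : IntegrableOn w (S ε) := integrableOn_div_prod ha ha1 hf hSm hSI
  have h1 : ∫ x in T, w x = ∫ x in S ε ∩ T, w x := by
    refine setIntegral_eq_of_subset_of_forall_sdiff_eq_zero hTm inter_subset_right fun x hx => ?_
    by_cases hxR : ∃ i, R < |x i|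
    · simp [hw, hf.supp x hxR]
    push Not at hxR
    exfalso
    have hxS : x ∉ S ε := fun hh => hx.2 ⟨hh, hx.1⟩
    obtain ⟨j, hj, -, h2⟩ := h.exists_abs_le hM hε hCε hxR hxS
    exact absurd (hx.1 j hj) (not_le.2 h2)
  rw [h1, ← integral_inter_add_sdiff hTm hwS, add_sub_cancel_left]
  set Rg : Fin n → Set (Fin n → ℝ) := fun m =>
    {x | x ∈ S ε ∧ m ∈ I ∧ |x m| < 2 * M * ε ∧ ∀ l < m, l ∈ I → 2 * M * ε ≤ |x l|} with hRg
  have habs : ∀ i, Measurable fun x : Fin n → ℝ => |x i| :=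
    fun i => continuous_abs.measurable.comp (measurable_pi_apply i)
  have hRgm : ∀ m, MeasurableSet (Rg m) := by
    intro m
    refine hSm.inter ((MeasurableSet.const _).inter
      ((measurableSet_lt (habs m) measurable_const).inter ?_))
    have : {x : Fin n → ℝ | ∀ l < m, l ∈ I → 2 * M * ε ≤ |x l|} =
        ⋂ l : Fin n, ⋂ _ : l < m, ⋂ _ : l ∈ I, {x | 2 * M * ε ≤ |x l|} := by ext; simp
    change MeasurableSet {x : Fin n → ℝ | ∀ l < m, l ∈ I → 2 * M * ε ≤ |x l|}
    rw [this]
    exact MeasurableSet.iInter fun l => MeasurableSet.iInter fun _ => MeasurableSet.iInter fun _ =>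
      measurableSet_le measurable_const (habs l)
  have hunion : S ε \ T = ⋃ m ∈ (Finset.univ : Finset (Fin n)), Rg m := by
    ext x
    simp only [Set.mem_sdiff, mem_iUnion, Finset.mem_univ, exists_prop, true_and]
    constructor
    · rintro ⟨hxS, hxT⟩
      simp only [hT, awayFrom, mem_ofPred_eq, not_forall, not_le] at hxT
      have hne : (I.filter fun i => |x i| < 2 * M * ε).Nonempty := by
        obtain ⟨i, hi, h2⟩ := hxT; exact ⟨i, Finset.mem_filter.2 ⟨hi, h2⟩⟩
      obtain ⟨hm1, hm2⟩ := Finset.mem_filter.1 (Finset.min'_mem _ hne)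
      refine ⟨_, hxS, hm1, hm2, fun l hl hlI => ?_⟩
      by_contra hcon
      push Not at hcon
      exact absurd hl (not_lt.2 (Finset.min'_le _ l (Finset.mem_filter.2 ⟨hlI, hcon⟩)))
    · rintro ⟨m, hxS, hm, h2, -⟩
      exact ⟨hxS, fun hh => absurd (hh m hm) (not_le.2 h2)⟩
  have hdisj : ((Finset.univ : Finset (Fin n)) : Set (Fin n)).Pairwise
      (Function.onFun Disjoint Rg) := by
    intro m _ m' _ hne
    rw [Function.onFun, Set.disjoint_left]
    rintro x ⟨-, hm, h2, h3⟩ ⟨-, hm', h2', h3'⟩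
    rcases lt_or_gt_of_ne hne with hlt | hlt
    · exact absurd (h3' m hlt hm) (not_le.2 h2)
    · exact absurd (h3 m' hlt hm') (not_le.2 h2')
  have hRgS : ∀ m, Rg m ⊆ S ε := fun m x hx => hx.1
  rw [hunion, integral_biUnion_finset _ (fun m _ => hRgm m) hdisj
    (fun m _ => hwS.mono_set (hRgS m))]
  refine (norm_sum_le _ _).trans ?_
  set A := (a ^ (-((1 : ℝ) / (n + 1)))) ^ n with hA
  set J := ∫ x, (boxWeight R x : ℝ) ∂(volume : Measure (Fin n → ℝ)) with hJ
  have hJ0 : 0 ≤ J := integral_nonneg fun x => boxWeight_nonneg R x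
  have hmain : ∀ m, ‖∫ x in Rg m, w x‖ ≤ K * (2 * M * ε) * (A * J) +
      K * (n * (a⁻¹ * A * (2 * M * ((C + 8 * C * M ^ 2) * ε ^ 2) / R * J))) := by
    intro m
    by_cases hm : m ∈ I
    swap
    · have : Rg m = ∅ := by ext x; simp [hRg, hm]
      rw [this]; simp; positivity
    set σ := reflect ({m} : Finset (Fin n)) with hσ
    have hσm : Measurable σ := (measurePreserving_reflect {m}).measurable
    have hpre : MeasurableSet (σ ⁻¹' Rg m) := hσm (hRgm m)
    rw [← integral_inter_add_sdiff hpre (hwS.mono_set (hRgS m))]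
    refine (norm_add_le _ _).trans (add_le_add ?_ ?_)
    · refine norm_setIntegral_reflect_le ha ha1 hf hm ((hRgm m).inter hpre) ?_
        (fun x hx => hSI x (hRgS m hx.1)) (fun x hx => hx.1.2.2.1.le) (by positivity)
      rw [preimage_inter, ← preimage_comp, (reflect_involutive {m}).comp_self, preimage_id,
        inter_comm]
    · refine hf.norm_setIntegral_slab_le h hR hM ha ha1 (by positivity) ((hRgm m).diff hpre)
        (fun x hx => hSI x (hRgS m hx.1)) (ε := ε) fun x hx hxR => ?_
      refine h.mem_slab hR.le hM hC hε hCε hxR (hRgS m hx.1) hx.1.2.2.1.le fun hcon => hx.2 ?_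
      refine ⟨hcon, hm, ?_, fun l hl hlI => ?_⟩
      · rw [abs_reflect]; exact hx.1.2.2.1
      · rw [abs_reflect]; exact hx.1.2.2.2 l hl hlI
  refine (Finset.sum_le_sum fun m _ => hmain m).trans (le_of_eq ?_)
  simp only [Finset.sum_const, Finset.card_univ, Fintype.card_fin, nsmul_eq_mul, cutoffError]
  ring

end CutoffError

section PrincipalValue

variable {n : ℕ}

/-- The sum of the values of `f` at all reflections in coordinates in `I`, with signs. -/
def antisymm (I : Finset (Fin n)) (f : (Fin n → ℝ) → ℂ) (x : Fin n → ℝ) : ℂ :=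
  (2 ^ I.card)⁻¹ * ∑ s ∈ I.powerset, (-1) ^ s.card * f (reflect s x)

/-- The principal value of `∫ f / ∏ x i`. -/
def pvBox (I : Finset (Fin n)) (f : (Fin n → ℝ) → ℂ) : ℂ :=
  ∫ x, antisymm I f x / ((∏ i ∈ I, x i : ℝ) : ℂ)

theorem IsBoxLipschitz.norm_antisymm_le {I : Finset (Fin n)} {R K : ℝ} {f : (Fin n → ℝ) → ℂ}
    (hf : IsBoxLipschitz R K f) (x : Fin n → ℝ) : ‖antisymm I f x‖ ≤ K := by
  unfold antisymm
  rw [norm_mul, norm_inv, norm_pow, Complex.norm_two, inv_mul_le_iff₀ (by positivity)]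
  refine (norm_sum_le _ _).trans ?_
  refine (Finset.sum_le_sum (g := fun _ => K) fun s _ => ?_).trans ?_
  · rw [norm_mul, norm_pow, norm_neg, norm_one, one_pow, one_mul]; exact hf.bound _
  · rw [Finset.sum_const, Finset.card_powerset, nsmul_eq_mul]; push_cast; exact le_rfl

theorem IsBoxLipschitz.norm_antisymm_le_abs {I : Finset (Fin n)} {R K : ℝ} {f : (Fin n → ℝ) → ℂ}
    (hf : IsBoxLipschitz R K f) (x : Fin n → ℝ) {j : Fin n} (hj : j ∈ I) :
    ‖antisymm I f x‖ ≤ K * |x j| := by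
  have hK := hf.nonneg
  unfold antisymm
  rw [norm_mul, norm_inv, norm_pow, Complex.norm_two, inv_mul_le_iff₀ (by positivity)]
  have hI : I = insert j (I.erase j) := (Finset.insert_erase hj).symm
  have hcard : I.card = (I.erase j).card + 1 := by
    rw [Finset.card_erase_of_mem hj]
    have := Finset.card_pos.2 ⟨j, hj⟩; omega
  rw [hcard]
  conv_lhs => rw [hI]
  rw [Finset.sum_powerset_insert (Finset.notMem_erase j I), ← Finset.sum_add_distrib]
  refine (norm_sum_le _ _).trans ?_
  refine (Finset.sum_le_sum (g := fun _ => K * (2 * |x j|)) fun s hs => ?_).trans ?_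
  · have hjs : j ∉ s := fun h => Finset.notMem_erase j I (Finset.mem_powerset.1 hs h)
    rw [Finset.card_insert_of_notMem hjs, pow_succ]
    have : (-1 : ℂ) ^ s.card * f (reflect s x) + (-1) ^ s.card * -1 * f (reflect (insert j s) x) =
        (-1) ^ s.card * (f (reflect s x) - f (reflect (insert j s) x)) := by ring
    rw [this, norm_mul, norm_pow, norm_neg, norm_one, one_pow, one_mul]
    refine (hf.lip _ _).trans (mul_le_mul_of_nonneg_left ?_ hK)
    refine (pi_norm_le_iff_of_nonneg (by positivity)).2 fun i => ?_
    simp only [Pi.sub_apply, reflect, Finset.mem_insert, Real.norm_eq_abs]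
    by_cases hij : i = j
    · subst hij
      simp only [hjs, if_false, true_or, if_true]
      rw [sub_neg_eq_add, ← two_mul, abs_mul]; simp
    · simp [hij]
  · rw [Finset.sum_const, Finset.card_powerset, nsmul_eq_mul]; push_cast
    rw [pow_succ]; apply le_of_eq; ring

theorem IsBoxLipschitz.norm_antisymm_div_le {I : Finset (Fin n)} {R K : ℝ} {f : (Fin n → ℝ) → ℂ}
    (hf : IsBoxLipschitz R K f) (x : Fin n → ℝ) :
    ‖antisymm I f x / ((∏ i ∈ I, x i : ℝ) : ℂ)‖ ≤ K * boxWeight R x := by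
  have hK := hf.nonneg
  have hP := boxWeight_nonneg R x
  by_cases hxR : ∃ i, R < |x i|
  · have : antisymm I f x = 0 := by
      unfold antisymm
      rw [Finset.sum_eq_zero, mul_zero]
      intro s _
      rw [hf.supp _ (by simpa only [abs_reflect] using hxR), mul_zero]
    rw [this]; simp only [zero_div, norm_zero]; positivity
  push Not at hxR
  by_cases hx0 : ∃ i ∈ I, x i = 0
  · obtain ⟨i, hi, h0⟩ := hx0
    rw [Finset.prod_eq_zero hi h0]; simp only [Complex.ofReal_zero, div_zero, norm_zero]; positivity
  push Not at hx0
  rcases hK.eq_or_lt with hK0 | hK0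
  · have := hf.norm_antisymm_le (I := I) x
    rw [← hK0, norm_le_zero_iff] at this
    rw [this]; simp only [zero_div, norm_zero]; positivity
  set u := ‖antisymm I f x‖ / K with hu
  have hu0 : 0 ≤ u := by positivity
  have hu1 : u ≤ 1 := (div_le_one hK0).2 (hf.norm_antisymm_le x)
  have hui : ∀ i ∈ I, u ≤ |x i| := fun i hi => by
    rw [hu, div_le_iff₀ hK0, mul_comm]; exact hf.norm_antisymm_le_abs x hi
  have hη : (0 : ℝ) < 1 / (n + 1) := by positivity
  have hkey : u ≤ ∏ i ∈ I, |x i| ^ ((1 : ℝ) / (n + 1)) := by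
    calc u = u ^ (1 : ℝ) := (Real.rpow_one u).symm
      _ ≤ u ^ ((1 : ℝ) / (n + 1) * I.card) := by
          refine Real.rpow_le_rpow_of_exponent_ge_of_imp hu0 hu1 ?_ (by simp)
          rw [one_div_mul_eq_div, div_le_one (by positivity)]
          have : I.card ≤ n := by simpa using I.card_le_univ
          exact_mod_cast this.trans (Nat.le_succ n)
      _ = ∏ i ∈ I, u ^ ((1 : ℝ) / (n + 1)) := by
          rw [Finset.prod_const, Real.rpow_mul_natCast hu0]
      _ ≤ _ := Finset.prod_le_prod (fun i _ => by positivity) fun i hi =>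
          Real.rpow_le_rpow hu0 (hui i hi) hη.le
  have hnorm : ‖antisymm I f x‖ = K * u := by rw [hu]; field_simp
  rw [norm_div, Complex.norm_real, Real.norm_eq_abs, hnorm, mul_div_assoc]
  refine mul_le_mul_of_nonneg_left ?_ hK
  calc u / |∏ i ∈ I, x i| ≤ (∏ i ∈ I, |x i| ^ ((1 : ℝ) / (n + 1))) / |∏ i ∈ I, x i| := by gcongr
    _ = ∏ i ∈ I, |x i| ^ ((1 : ℝ) / (n + 1) - 1) := by
        rw [Finset.abs_prod, ← Finset.prod_div_distrib]
        refine Finset.prod_congr rfl fun i hi => ?_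
        rw [Real.rpow_sub_one (abs_ne_zero.2 (hx0 i hi))]
    _ ≤ ∏ i ∈ I, lineWeight n R (x i) :=
        Finset.prod_le_prod (fun i _ => by positivity) fun i _ => rpow_le_lineWeight (hxR i)
    _ ≤ boxWeight R x := by
        unfold boxWeight
        exact Finset.prod_le_prod_of_subset_of_one_le (Finset.subset_univ I)
          (fun i _ => lineWeight_nonneg n R _) fun i _ _ => one_le_lineWeight (hxR i)

theorem IsBoxLipschitz.norm_pvBox_le {I : Finset (Fin n)} {R K : ℝ} {f : (Fin n → ℝ) → ℂ}
    (hf : IsBoxLipschitz R K f) :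
    ‖pvBox I f‖ ≤ K * ∫ x, (boxWeight R x : ℝ) ∂(volume : Measure (Fin n → ℝ)) := by
  rw [← integral_const_mul]
  exact norm_integral_le_of_norm_le ((integrable_boxWeight R).const_mul _)
    (ae_of_all _ fun x => hf.norm_antisymm_div_le x)

theorem measurable_prod_coord (I : Finset (Fin n)) :
    Measurable fun x : Fin n → ℝ => ((∏ i ∈ I, x i : ℝ) : ℂ) :=
  Complex.measurable_ofReal.comp (Finset.measurable_prod _ fun i _ => measurable_pi_apply i)

theorem IsBoxLipschitz.measurable_antisymm {I : Finset (Fin n)} {R K : ℝ} {f : (Fin n → ℝ) → ℂ}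
    (hf : IsBoxLipschitz R K f) : Measurable (antisymm I f) := by
  refine (Finset.measurable_sum _ fun s _ => ?_).const_mul _
  exact (hf.continuous.measurable.comp (measurePreserving_reflect s).measurable).const_mul _

theorem IsBoxLipschitz.tendsto_pvBox {I : Finset (Fin n)} {R K : ℝ} {f : (Fin n → ℝ) → ℂ}
    (hf : IsBoxLipschitz R K f) :
    Tendsto (fun a => ∫ x in awayFrom I a, f x / ((∏ i ∈ I, x i : ℝ) : ℂ)) (𝓝[>] 0)
      (𝓝 (pvBox I f)) := by
  set w := fun x : Fin n → ℝ => f x / ((∏ i ∈ I, x i : ℝ) : ℂ) with hw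
  have h1 : Tendsto (fun a => ∫ x, (awayFrom I a).indicator
      (fun x => antisymm I f x / ((∏ i ∈ I, x i : ℝ) : ℂ)) x) (𝓝[>] 0) (𝓝 (pvBox I f)) := by
    refine tendsto_integral_filter_of_dominated_convergence (fun x => K * boxWeight R x) ?_ ?_
      ((integrable_boxWeight R).const_mul _) ?_
    · exact Eventually.of_forall fun a => ((hf.measurable_antisymm.div
        (measurable_prod_coord I)).indicator (measurableSet_awayFrom I a)).aestronglyMeasurable
    · refine Eventually.of_forall fun a => ae_of_all _ fun x => ?_
      exact (norm_indicator_le_norm_self _ _).trans (hf.norm_antisymm_div_le x)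
    · refine ae_of_all _ fun x => ?_
      by_cases hx0 : ∃ i ∈ I, x i = 0
      · obtain ⟨i, hi, h0⟩ := hx0
        have : ∀ a, (awayFrom I a).indicator
            (fun x => antisymm I f x / ((∏ i ∈ I, x i : ℝ) : ℂ)) x = 0 := by
          intro a
          refine indicator_apply_eq_zero.2 fun _ => ?_
          rw [Finset.prod_eq_zero hi h0]; simp
        simp only [this]
        rw [Finset.prod_eq_zero hi h0]; simp
      · push Not at hx0
        refine tendsto_const_nhds.congr' ?_
        have : ∀ᶠ a in 𝓝[>] (0 : ℝ), ∀ i ∈ I, a ≤ |x i| := by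
          rw [Filter.eventually_all_finset]
          intro i hi
          exact nhdsWithin_le_nhds (eventually_le_nhds (abs_pos.2 (hx0 i hi)))
        filter_upwards [this] with a ha
        rw [indicator_of_mem (show x ∈ awayFrom I a from ha)]
  refine h1.congr' ?_
  filter_upwards [self_mem_nhdsWithin, nhdsWithin_le_nhds (eventually_le_nhds one_pos)]
    with a ha ha1
  rw [mem_Ioi] at ha
  rw [integral_indicator (measurableSet_awayFrom I a)]
  have hwint : IntegrableOn w (awayFrom I a) :=
    integrableOn_div_prod ha ha1 hf (measurableSet_awayFrom I a) fun x hx _ => hx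
  have hpre : ∀ s, reflect s ⁻¹' awayFrom I a = awayFrom I a := by
    intro s; ext x; simp [awayFrom, abs_reflect]
  have hint : ∀ s, IntegrableOn (fun x => w (reflect s x)) (awayFrom I a) := by
    intro s
    have := ((measurePreserving_reflect s).integrableOn_comp_preimage
      (measurableEmbedding_reflect s) (f := w) (s := awayFrom I a)).2 hwint
    rwa [hpre] at this
  have heq : ∀ s, ∫ x in awayFrom I a, w (reflect s x) = ∫ x in awayFrom I a, w x := by
    intro s
    have := (measurePreserving_reflect s).setIntegral_preimage_emb
      (measurableEmbedding_reflect s) w (awayFrom I a)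
    rwa [hpre] at this
  have hpt : ∀ x, antisymm I f x / ((∏ i ∈ I, x i : ℝ) : ℂ) =
      (2 ^ I.card)⁻¹ * ∑ s ∈ I.powerset, w (reflect s x) := by
    intro x
    unfold antisymm
    rw [mul_div_assoc, Finset.sum_div]
    congr 1
    refine Finset.sum_congr rfl fun s hs => ?_
    simp only [hw]
    rw [prod_reflect (Finset.mem_powerset.1 hs)]
    rcases neg_one_pow_eq_or ℝ s.card with h | h
    · rcases neg_one_pow_eq_or ℂ s.card with h' | h'
      · rw [h, h']; simp
      · exfalso
        have := congrArg (Complex.ofReal) h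
        push_cast at this
        rw [h'] at this; norm_num at this
    · rcases neg_one_pow_eq_or ℂ s.card with h' | h'
      · exfalso
        have := congrArg (Complex.ofReal) h
        push_cast at this
        rw [h'] at this; norm_num at this
      · rw [h, h']
        simp only [neg_mul, one_mul, Complex.ofReal_neg, div_neg, neg_div]
  simp_rw [hpt]
  rw [integral_const_mul, integral_finsetSum _ fun s _ => hint s]
  simp_rw [heq]
  rw [Finset.sum_const, Finset.card_powerset, nsmul_eq_mul]
  push_cast
  rw [← mul_assoc, inv_mul_cancel₀ (pow_ne_zero _ two_ne_zero), one_mul]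

end PrincipalValue

section IntegralOver

variable {d k : ℕ} {X : Type*} [TopologicalSpace X] [ChartedSpace (EuclideanSpace ℝ (Fin d)) X]
  [IsManifold (𝓡 d) ∞ X] {S : Set X}

namespace LocalParam

theorem continuousAt (P : LocalParam d k S) {y : EuclideanSpace ℝ (Fin k)} (hy : y ∈ P.source) :
    ContinuousAt P.toFun y := (P.isImmersionAt y hy).continuousAt

theorem injOn (P : LocalParam d k S) : InjOn P.toFun P.source := by
  intro y hy z hz h
  have := P.isEmbedding.injective (a₁ := ⟨y, hy⟩) (a₂ := ⟨z, hz⟩) h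
  exact congrArg Subtype.val this

/-- The part of the source of `P` that is mapped into the image of `Q`. -/
def overlap (P Q : LocalParam d k S) : Set (EuclideanSpace ℝ (Fin k)) :=
  {y | y ∈ P.source ∧ P.toFun y ∈ Q.toFun '' Q.source}

theorem isOpen_overlap (P Q : LocalParam d k S) : IsOpen (P.overlap Q) := by
  obtain ⟨O, hO, hQ⟩ := Q.isOpen_image
  have h : P.overlap Q = P.source ∩ P.toFun ⁻¹' O := by
    ext y
    simp only [overlap, mem_ofPred_eq, mem_inter_iff, mem_preimage, hQ]
    exact ⟨fun h => ⟨h.1, h.2.2⟩, fun h => ⟨h.1, P.image_mem y h.1, h.2⟩⟩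
  rw [h]
  have hc : ContinuousOn P.toFun P.source := fun y hy => (P.continuousAt hy).continuousWithinAt
  exact hc.isOpen_inter_preimage P.isOpen_source hO

/-- The coordinate change from `P` to `Q`. -/
def transition (P Q : LocalParam d k S) (y : EuclideanSpace ℝ (Fin k)) :
    EuclideanSpace ℝ (Fin k) := Function.invFunOn Q.toFun Q.source (P.toFun y)

variable {P Q : LocalParam d k S} {y : EuclideanSpace ℝ (Fin k)}

theorem transition_mem (hy : y ∈ P.overlap Q) : P.transition Q y ∈ Q.source :=
  Function.invFunOn_mem hy.2

theorem apply_transition (hy : y ∈ P.overlap Q) : Q.toFun (P.transition Q y) = P.toFun y :=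
  Function.invFunOn_eq hy.2

theorem transition_eq (hy : y ∈ P.overlap Q) {z : EuclideanSpace ℝ (Fin k)} (hz : z ∈ Q.source)
    (h : Q.toFun z = P.toFun y) : P.transition Q y = z :=
  Q.injOn (transition_mem hy) hz ((apply_transition hy).trans h.symm)

theorem injOn_transition : InjOn (P.transition Q) (P.overlap Q) := by
  intro y hy z hz h
  refine P.injOn hy.1 hz.1 ?_
  rw [← apply_transition hy, ← apply_transition hz, h]

theorem continuousAt_transition (hy : y ∈ P.overlap Q) : ContinuousAt (P.transition Q) y := by
  intro N hN
  obtain ⟨N', hN'N, hN'o, hN'm⟩ := mem_nhds_iff.1 hN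
  obtain ⟨O, hO, hON⟩ := Q.isEmbedding.isOpen_iff.1 (hN'o.preimage continuous_subtype_val)
  have hQ : ∀ z (hz : z ∈ Q.source), Q.toFun z ∈ O ↔ z ∈ N' := by
    intro z hz
    have := congrArg (fun s => (⟨z, hz⟩ : Q.source) ∈ s) hON
    simpa using this
  have h1 : ∀ᶠ y' in 𝓝 y, P.toFun y' ∈ O := by
    refine (P.continuousAt hy.1).eventually (hO.mem_nhds ?_)
    rw [← apply_transition hy]
    exact (hQ _ (transition_mem hy)).2 hN'm
  change ∀ᶠ y' in 𝓝 y, P.transition Q y' ∈ N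
  filter_upwards [h1, (P.isOpen_overlap Q).mem_nhds hy] with y' h2 h3
  refine hN'N ((hQ _ (transition_mem h3)).1 ?_)
  rwa [apply_transition h3]

theorem contMDiffAt_transition (hy : y ∈ P.overlap Q) :
    ContMDiffAt (𝓡 k) (𝓡 k) ∞ (P.transition Q) y := by
  rw [ContMDiffAt.iff_comp_isImmersionAt (Q.isImmersionAt _ (transition_mem hy))]
  refine ⟨continuousAt_transition hy, ?_⟩
  refine ((P.isImmersionAt y hy.1).contMDiffAt).congr_of_eventuallyEq ?_
  filter_upwards [(P.isOpen_overlap Q).mem_nhds hy] with y' h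
  exact apply_transition h

theorem hasFDerivAt_transition (hy : y ∈ P.overlap Q) :
    HasFDerivAt (P.transition Q) (fderiv ℝ (P.transition Q) y) y :=
  ((contMDiffAt_transition hy).contDiffAt.differentiableAt (by simp)).hasFDerivAt

end LocalParam

/-- A family of functions, one for each local parametrization, consists of the local expressions of
a density. -/
def IsCompatible (F : LocalParam d k S → EuclideanSpace ℝ (Fin k) → ℂ) : Prop :=
  ∀ (P Q : LocalParam d k S) (φ : EuclideanSpace ℝ (Fin k) → EuclideanSpace ℝ (Fin k))
    (L : EuclideanSpace ℝ (Fin k) →L[ℝ] EuclideanSpace ℝ (Fin k)) (y : EuclideanSpace ℝ (Fin k)),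
    y ∈ P.source → φ y ∈ Q.source → (∀ᶠ y' in 𝓝 y, Q.toFun (φ y') = P.toFun y') →
    HasFDerivAt φ L y → F P y = (|L.det| : ℝ) * F Q (φ y)

theorem IsCompatible.mul {F : LocalParam d k S → EuclideanSpace ℝ (Fin k) → ℂ}
    (hF : IsCompatible F) (w : X → ℂ) : IsCompatible fun P y => w (P.toFun y) * F P y := by
  intro P Q φ L y hy hφ hev hL
  simp only
  rw [hF P Q φ L y hy hφ hev hL, hev.self_of_nhds]
  ring

theorem setIntegral_pieces {F : LocalParam d k S → EuclideanSpace ℝ (Fin k) → ℂ}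
    (hF : IsCompatible F) (P Q : LocalParam d k S) {A : Set (EuclideanSpace ℝ (Fin k))}
    (hA : MeasurableSet A) (hAP : A ⊆ P.source)
    (hsupp : ∀ y ∈ A, F P y ≠ 0 → P.toFun y ∈ Q.toFun '' Q.source) :
    MeasurableSet {z | z ∈ Q.source ∧ ∃ y ∈ A, P.toFun y = Q.toFun z} ∧
    (IntegrableOn (F Q) {z | z ∈ Q.source ∧ ∃ y ∈ A, P.toFun y = Q.toFun z} ↔
      IntegrableOn (F P) A) ∧
    ∫ z in {z | z ∈ Q.source ∧ ∃ y ∈ A, P.toFun y = Q.toFun z}, F Q z = ∫ y in A, F P y := by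
  set D := A ∩ P.overlap Q with hD
  have hDm : MeasurableSet D := hA.inter (P.isOpen_overlap Q).measurableSet
  have hder : ∀ y ∈ D, HasFDerivWithinAt (P.transition Q) (fderiv ℝ (P.transition Q) y) D y :=
    fun y hy => (LocalParam.hasFDerivAt_transition hy.2).hasFDerivWithinAt
  have hinj : InjOn (P.transition Q) D := LocalParam.injOn_transition.mono inter_subset_right
  have himg : {z | z ∈ Q.source ∧ ∃ y ∈ A, P.toFun y = Q.toFun z} = P.transition Q '' D := by
    ext z
    constructor
    · rintro ⟨hz, y, hy, h⟩
      have hy' : y ∈ P.overlap Q := ⟨hAP hy, z, hz, h.symm⟩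
      exact ⟨y, ⟨hy, hy'⟩, LocalParam.transition_eq hy' hz h.symm⟩
    · rintro ⟨y, hy, rfl⟩
      exact ⟨LocalParam.transition_mem hy.2, y, hy.1, (LocalParam.apply_transition hy.2).symm⟩
  have heq : ∀ y ∈ D, |(fderiv ℝ (P.transition Q) y).det| • F Q (P.transition Q y) = F P y := by
    intro y hy
    rw [hF P Q (P.transition Q) _ y hy.2.1 (LocalParam.transition_mem hy.2) ?_
      (LocalParam.hasFDerivAt_transition hy.2)]
    · exact Complex.real_smul
    · filter_upwards [(P.isOpen_overlap Q).mem_nhds hy.2] with y' h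
      exact LocalParam.apply_transition h
  have hzero : ∀ y ∈ A \ D, F P y = 0 := by
    intro y hy
    by_contra hne
    exact hy.2 ⟨hy.1, hAP hy.1, hsupp y hy.1 hne⟩
  rw [himg]
  refine ⟨measurable_image_of_fderivWithin hDm hder hinj, ?_, ?_⟩
  · rw [integrableOn_image_iff_integrableOn_abs_det_fderiv_smul volume hDm hder hinj,
      integrableOn_congr_fun heq hDm]
    refine ⟨fun h => ?_, fun h => h.mono_set inter_subset_left⟩
    exact h.of_forall_sdiff_eq_zero hA hzero
  · rw [integral_image_eq_integral_abs_det_fderiv_smul volume hDm hder hinj,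
      setIntegral_congr_fun hDm heq]
    exact (setIntegral_eq_of_subset_of_forall_sdiff_eq_zero hA inter_subset_left hzero).symm

/-- Computation of the integral of a density along `S` with finitely many parametrizations and a
partition of unity. -/
theorem integralOver_eq_sum {F : LocalParam d k S → EuclideanSpace ℝ (Fin k) → ℂ}
    (hF : IsCompatible F) (hcov : ∃ P : ℕ → LocalParam d k S, S ⊆ ⋃ i, (P i).toFun '' (P i).source)
    {α : Type*} [Fintype α] (Q : α → LocalParam d k S) (w : α → X → ℂ)
    (hsum : ∀ (P : LocalParam d k S), ∀ y ∈ P.source, F P y ≠ 0 → ∑ a, w a (P.toFun y) = 1)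
    (hsupp : ∀ a, ∀ (P : LocalParam d k S), ∀ y ∈ P.source, F P y ≠ 0 → w a (P.toFun y) ≠ 0 →
      P.toFun y ∈ (Q a).toFun '' (Q a).source)
    (hint : ∀ a, IntegrableOn (fun y => w a ((Q a).toFun y) * F (Q a) y) (Q a).source) :
    integralOver d k S F = ∑ a, ∫ y in (Q a).source, w a ((Q a).toFun y) * F (Q a) y := by
  classical
  rw [integralOver, dif_pos hcov]
  generalize hPdef : hcov.choose = P
  have hP : S ⊆ ⋃ i, (P i).toFun '' (P i).source := hPdef ▸ hcov.choose_spec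
  set A : ℕ → Set (EuclideanSpace ℝ (Fin k)) := fun i => {y | y ∈ (P i).source ∧
    ∀ j < i, (P i).toFun y ∉ (P j).toFun '' (P j).source} with hA
  have hAm : ∀ i, MeasurableSet (A i) := by
    intro i
    have : A i = (P i).source \ ⋃ j, ⋃ _ : j < i, (P i).overlap (P j) := by
      ext y
      simp only [hA, mem_ofPred_eq, Set.mem_sdiff, mem_iUnion, LocalParam.overlap, not_exists]
      constructor
      · rintro ⟨h1, h2⟩; exact ⟨h1, fun j hj h => h2 j hj h.2⟩
      · rintro ⟨h1, h2⟩; exact ⟨h1, fun j hj h => h2 j hj ⟨h1, h⟩⟩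
    rw [this]
    exact (P i).isOpen_source.measurableSet.diff (MeasurableSet.iUnion fun j =>
      MeasurableSet.iUnion fun _ => ((P i).isOpen_overlap (P j)).measurableSet)
  set g : α → LocalParam d k S → EuclideanSpace ℝ (Fin k) → ℂ :=
    fun a P y => w a (P.toFun y) * F P y with hg
  have hpiece : ∀ a i, _ := fun a i =>
    setIntegral_pieces (hF.mul (w a)) (P i) (Q a) (hAm i) (fun y hy => hy.1)
      (fun y hy hne => hsupp a (P i) y hy.1 (right_ne_zero_of_mul hne) (left_ne_zero_of_mul hne))
  set B : α → ℕ → Set (EuclideanSpace ℝ (Fin k)) := fun a i =>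
    {z | z ∈ (Q a).source ∧ ∃ y ∈ A i, (P i).toFun y = (Q a).toFun z} with hB
  have hBU : ∀ a, ⋃ i, B a i = (Q a).source := by
    intro a
    ext z
    simp only [mem_iUnion]
    refine ⟨fun ⟨i, h⟩ => h.1, fun hz => ?_⟩
    have hex : ∃ i, (Q a).toFun z ∈ (P i).toFun '' (P i).source :=
      mem_iUnion.1 (hP ((Q a).image_mem z hz))
    obtain ⟨y, hy, hyz⟩ := Nat.find_spec hex
    refine ⟨Nat.find hex, hz, y, ⟨hy, fun j hj => ?_⟩, hyz⟩
    rw [hyz]; exact Nat.find_min hex hj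
  have hBd : ∀ a, Pairwise (Function.onFun Disjoint (B a)) := by
    intro a i j hij
    rw [Function.onFun, Set.disjoint_left]
    rintro z ⟨-, y, hy, hyz⟩ ⟨-, y', hy', hyz'⟩
    rcases lt_or_gt_of_ne hij with h | h
    · exact hy'.2 i h ⟨y, hy.1, hyz.trans hyz'.symm⟩
    · exact hy.2 j h ⟨y', hy'.1, hyz'.trans hyz.symm⟩
  have hhas : ∀ a, HasSum (fun i => ∫ y in A i, g a (P i) y)
      (∫ y in (Q a).source, g a (Q a) y) := by
    intro a
    have h1 : HasSum (fun i => ∫ z in B a i, g a (Q a) z) (∫ z in ⋃ i, B a i, g a (Q a) z) :=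
      hasSum_integral_iUnion (fun i => (hpiece a i).1) (hBd a) (by rw [hBU]; exact hint a)
    rw [hBU] at h1
    refine h1.congr_fun fun i => ?_
    exact (hpiece a i).2.2.symm
  have htot := hasSum_sum (s := Finset.univ) fun a _ => hhas a
  refine (htot.congr_fun fun i => ?_).tsum_eq
  rw [← integral_finsetSum]
  · refine setIntegral_congr_fun (hAm i) fun y hy => ?_
    simp only [hg]
    rw [← Finset.sum_mul]
    by_cases h0 : F (P i) y = 0
    · simp [h0]
    · rw [hsum _ y hy.1 h0, one_mul]
  · intro a _
    refine (hpiece a i).2.1.1 ((hint a).mono_set fun z hz => hz.1)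

theorem integralOver_const_mul (F : LocalParam d k S → EuclideanSpace ℝ (Fin k) → ℂ) (c : ℂ) :
    integralOver d k S (fun P y => c * F P y) = c * integralOver d k S F := by
  unfold integralOver
  split_ifs with h
  · rw [← tsum_mul_left]
    refine tsum_congr fun i => ?_
    rw [integral_const_mul]
  · rw [mul_zero]

end IntegralOver

section Calculus

/-- Smoothness of integrals that depend on a parameter. -/
theorem contDiffOn_integral_param {P V F : Type*} [NormedAddCommGroup P] [NormedSpace ℝ P]
    [NormedAddCommGroup V] [NormedSpace ℝ V] [MeasurableSpace V] [BorelSpace V] {μ : Measure V}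
    [NormedAddCommGroup F] [NormedSpace ℝ F] {s : Set P} (hs : IsOpen s)
    {K : Set V} (hK : IsCompact K) {g : P → V → F} (hg0 : ∀ p ∈ s, ∀ x ∉ K, g p x = 0)
    (hg : ContDiffOn ℝ ∞ (Function.uncurry g) (s ×ˢ univ)) {h : V → ℝ}
    (hh : LocallyIntegrable h μ) :
    ContDiffOn ℝ ∞ (fun p => ∫ x, h x • g p x ∂μ) s := by
  have h1 := contDiffOn_convolution_right_with_param (n := ⊤) (μ := μ) (f := h)
    (ContinuousLinearMap.lsmul ℝ ℝ (E := F)) (g := fun p x => g p (-x)) (k := -K) hs hK.neg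
    (fun p x hp hx => hg0 p hp (-x) fun hh => hx (by simpa using hh)) hh
    (hg.comp (f := fun q : P × V => (q.1, -q.2))
      (contDiff_fst.prodMk contDiff_snd.neg).contDiffOn (fun q hq => ⟨hq.1, mem_univ _⟩))
  have h2 := h1.comp (f := fun p : P => (p, (0 : V)))
    (contDiff_id.prodMk contDiff_const).contDiffOn (fun p hp => ⟨hp, mem_univ _⟩)
  refine h2.congr fun p _ => ?_
  simp [convolution, Function.comp]

/-- Division of a smooth function that vanishes on a hyperplane. -/
theorem exists_contDiff_eq_mul {E : Type*} [NormedAddCommGroup E] [NormedSpace ℝ E]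
    {f : E → ℝ} (hf : ContDiff ℝ ∞ f) (l : E →L[ℝ] ℝ) {v : E} (hv : l v = 1)
    (h0 : ∀ x, l x = 0 → f x = 0) :
    ∃ g : E → ℝ, ContDiff ℝ ∞ g ∧ ∀ x, f x = l x * g x := by
  obtain ⟨b, hb1, hbK⟩ : ∃ b : ℝ → ℝ, (∀ t ∈ Icc (0 : ℝ) 1, b t = 1) ∧
      ContDiff ℝ ∞ b ∧ ∀ t ∉ Icc (-1 : ℝ) 2, b t = 0 := by
    let c : ContDiffBump (1 / 2 : ℝ) := ⟨1 / 2, 3 / 2, by norm_num, by norm_num⟩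
    refine ⟨c, fun t ht => c.one_of_mem_closedBall ?_, c.contDiff, fun t ht => c.zero_of_le_dist ?_⟩
    · simp only [c, Metric.mem_closedBall, Real.dist_eq, abs_le]
      constructor <;> linarith [ht.1, ht.2]
    · simp only [c, Real.dist_eq]
      rw [mem_Icc, not_and_or, not_le, not_le] at ht
      rcases ht with ht | ht
      · rw [abs_of_neg] <;> linarith
      · rw [abs_of_pos] <;> linarith
  set γ : E → ℝ → E := fun x t => x - ((1 - t) * l x) • v with hγ
  set G : E → ℝ → ℝ := fun x t => b t * fderiv ℝ f (γ x t) v with hG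
  have hGs : ContDiff ℝ ∞ (Function.uncurry G) := by
    have hγs : ContDiff ℝ ∞ fun q : E × ℝ => γ q.1 q.2 := by
      simp only [hγ]
      have := l.contDiff (n := ∞)
      fun_prop
    refine (hbK.1.comp contDiff_snd).mul ?_
    have h1 : ContDiff ℝ ∞ (fderiv ℝ f) := hf.fderiv_right (by simp)
    exact (h1.comp hγs).clm_apply contDiff_const
  have hint : LocallyIntegrable (indicator (Icc (0 : ℝ) 1) fun _ => (1 : ℝ)) :=
    ((integrable_indicator_iff measurableSet_Icc).2
      (integrableOn_const (by simp))).locallyIntegrable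
  refine ⟨fun x => ∫ t, indicator (Icc (0 : ℝ) 1) (fun _ => (1 : ℝ)) t • G x t, ?_, fun x => ?_⟩
  · rw [← contDiffOn_univ]
    exact contDiffOn_integral_param isOpen_univ (isCompact_Icc (a := (-1 : ℝ)) (b := 2))
      (fun p _ t ht => by simp [hG, hbK.2 t ht]) hGs.contDiffOn hint
  · have h1 : ∀ t, HasDerivAt (fun t => f (γ x t)) (l x * fderiv ℝ f (γ x t) v) t := by
      intro t
      have h2 : HasDerivAt (γ x) (l x • v) t := by
        have := (((((hasDerivAt_id t).const_sub 1).mul_const (l x)).smul_const v).const_sub x)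
        simpa [hγ] using this
      have h3 : HasFDerivAt f (fderiv ℝ f (γ x t)) (γ x t) :=
        (hf.differentiable (by simp) _).hasFDerivAt
      have := h3.comp_hasDerivAt t h2
      rw [map_smul, smul_eq_mul] at this
      exact this
    have hcont : Continuous fun t => l x * fderiv ℝ f (γ x t) v := by
      have h1 : Continuous (fderiv ℝ f) := (hf.continuous_fderiv (by simp))
      have h2 : Continuous (γ x) := by simp only [hγ]; fun_prop
      exact continuous_const.mul ((h1.comp h2).clm_apply continuous_const)
    have h4 := intervalIntegral.integral_eq_sub_of_hasDerivAt (a := 0) (b := 1)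
      (fun t _ => h1 t) (hcont.intervalIntegrable _ _)
    have h5 : f (γ x 0) = 0 := h0 _ (by simp [hγ, hv])
    have h6 : γ x 1 = x := by simp [hγ]
    rw [h5, h6, sub_zero, intervalIntegral.integral_const_mul] at h4
    rw [← h4, intervalIntegral.integral_of_le zero_le_one, ← integral_Icc_eq_integral_Ioc,
      ← integral_indicator measurableSet_Icc]
    congr 1
    refine integral_congr_ae (ae_of_all _ fun t => ?_)
    by_cases ht : t ∈ Icc (0 : ℝ) 1
    · simp [indicator_of_mem ht, hG, hb1 t ht]
    · simp [indicator_of_notMem ht]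

end Calculus

section Charts

variable {d : ℕ} {E' H' N X : Type*} [NormedAddCommGroup E'] [NormedSpace ℝ E']
  [TopologicalSpace H'] {I' : ModelWithCorners ℝ E' H'}
  [TopologicalSpace N] [ChartedSpace H' N]
  [TopologicalSpace X] [ChartedSpace (EuclideanSpace ℝ (Fin d)) X] [IsManifold (𝓡 d) ∞ X]

variable {V : Type*} [NormedAddCommGroup V] [NormedSpace ℝ V]

/-- A diffeomorphism of an open subset of `X` onto an open subset of the vector space `V`. -/
structure IsSmoothChart (d : ℕ) {X V : Type*} [TopologicalSpace X]
    [ChartedSpace (EuclideanSpace ℝ (Fin d)) X] [NormedAddCommGroup V] [NormedSpace ℝ V]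
    (e : OpenPartialHomeomorph X V) : Prop where
  contMDiffOn : ContMDiffOn (𝓡 d) 𝓘(ℝ, V) ∞ e e.source
  contMDiffOn_symm : ContMDiffOn 𝓘(ℝ, V) (𝓡 d) ∞ e.symm e.target

theorem isSmoothChart_of_mem_maximalAtlas {e : OpenPartialHomeomorph X (EuclideanSpace ℝ (Fin d))}
    (he : e ∈ IsManifold.maximalAtlas (𝓡 d) ∞ X) : IsSmoothChart d e :=
  ⟨contMDiffOn_of_mem_maximalAtlas he, contMDiffOn_symm_of_mem_maximalAtlas he⟩

namespace IsSmoothChart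

variable {e : OpenPartialHomeomorph X V}

theorem contMDiffAt (he : IsSmoothChart d e) {x : X} (hx : x ∈ e.source) :
    ContMDiffAt (𝓡 d) 𝓘(ℝ, V) ∞ e x :=
  (he.contMDiffOn x hx).contMDiffAt (e.open_source.mem_nhds hx)

theorem contMDiffAt_symm (he : IsSmoothChart d e) {y : V} (hy : y ∈ e.target) :
    ContMDiffAt 𝓘(ℝ, V) (𝓡 d) ∞ e.symm y :=
  (he.contMDiffOn_symm y hy).contMDiffAt (e.open_target.mem_nhds hy)

theorem mdifferentiable (he : IsSmoothChart d e) : e.MDifferentiable (𝓡 d) 𝓘(ℝ, V) :=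
  ⟨he.contMDiffOn.mdifferentiableOn (by simp), he.contMDiffOn_symm.mdifferentiableOn (by simp)⟩

theorem mfderiv_symm_mfderiv (he : IsSmoothChart d e) {x : X} (hx : x ∈ e.source)
    (v : TangentSpace (𝓡 d) x) :
    mfderiv 𝓘(ℝ, V) (𝓡 d) e.symm (e x) (mfderiv (𝓡 d) 𝓘(ℝ, V) e x v) = v :=
  congrArg (fun L : TangentSpace (𝓡 d) x →L[ℝ] TangentSpace (𝓡 d) x => L v)
    (he.mdifferentiable.symm_comp_deriv hx)

theorem mfderiv_mfderiv_symm (he : IsSmoothChart d e) {x : X} (hx : x ∈ e.source) (v : V) :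
    mfderiv (𝓡 d) 𝓘(ℝ, V) e x (mfderiv 𝓘(ℝ, V) (𝓡 d) e.symm (e x) v) = v := by
  have h := he.mdifferentiable.comp_symm_deriv (e.map_source hx)
  rw [e.left_inv hx] at h
  exact congrArg (fun L : V →L[ℝ] V => L v) h

/-- Smoothness of a vector field along a map, in terms of a chart. -/
theorem contMDiffAt_tangent_iff (he : IsSmoothChart d e) {b : N → X}
    {v : ∀ m, TangentSpace (𝓡 d) (b m)} {m₀ : N} (hm : b m₀ ∈ e.source) :
    ContMDiffAt I' (𝓡 d).tangent ∞ (fun m => (⟨b m, v m⟩ : TangentBundle (𝓡 d) X)) m₀ ↔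
      ContMDiffAt I' (𝓡 d) ∞ b m₀ ∧
      ContMDiffAt I' 𝓘(ℝ, V) ∞
        (fun m => (show V from mfderiv (𝓡 d) 𝓘(ℝ, V) e (b m) (v m))) m₀ := by
  constructor
  · intro h
    have hb : ContMDiffAt I' (𝓡 d) ∞ b m₀ :=
      (Bundle.contMDiffAt_totalSpace.1 h).1
    refine ⟨hb, ?_⟩
    have h1 := (he.contMDiffOn.contMDiffOn_tangentMapWithin (m := ∞)
      (by simp) e.open_source.uniqueMDiffOn)
    have h2 : ContMDiffAt (𝓡 d).tangent 𝓘(ℝ, V).tangent ∞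
        (tangentMapWithin (𝓡 d) 𝓘(ℝ, V) e e.source)
        (⟨b m₀, v m₀⟩ : TangentBundle (𝓡 d) X) := by
      refine (h1 _ hm).contMDiffAt ?_
      exact (e.open_source.preimage
        (FiberBundle.continuous_proj (EuclideanSpace ℝ (Fin d)) _)).mem_nhds hm
    have h3 := h2.comp m₀ h
    have h4 := (contMDiff_snd_tangentBundle_modelSpace (n := ∞) V
      𝓘(ℝ, V)).contMDiffAt.comp m₀ h3
    refine h4.congr_of_eventuallyEq ?_
    filter_upwards [hb.continuousAt.eventually (e.open_source.mem_nhds hm)] with m hm'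
    simp only [Function.comp, tangentMapWithin]
    rw [mfderivWithin_of_isOpen e.open_source hm']
  · rintro ⟨hb, hv⟩
    have h1 := (he.contMDiffOn_symm.contMDiffOn_tangentMapWithin (m := ∞)
      (by simp) e.open_target.uniqueMDiffOn)
    have hz : e (b m₀) ∈ e.target := e.map_source hm
    set u : N → V := fun m => mfderiv (𝓡 d) 𝓘(ℝ, V) e (b m) (v m) with hu
    have h2 : ContMDiffAt 𝓘(ℝ, V).tangent (𝓡 d).tangent ∞
        (tangentMapWithin 𝓘(ℝ, V) (𝓡 d) e.symm e.target)
        (⟨e (b m₀), u m₀⟩ : TangentBundle 𝓘(ℝ, V) V) := by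
      refine (h1 _ hz).contMDiffAt ?_
      exact (e.open_target.preimage (FiberBundle.continuous_proj V _)).mem_nhds hz
    have h3 : ContMDiffAt I' 𝓘(ℝ, V).tangent ∞
        (fun m => (⟨e (b m), u m⟩ : TangentBundle 𝓘(ℝ, V) V)) m₀ := by
      rw [Bundle.contMDiffAt_totalSpace]
      refine ⟨(he.contMDiffAt hm).comp m₀ hb, ?_⟩
      simpa using hv
    refine (h2.comp m₀ h3).congr_of_eventuallyEq ?_
    filter_upwards [hb.continuousAt.eventually (e.open_source.mem_nhds hm)] with m hm'
    simp only [Function.comp, tangentMapWithin]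
    rw [mfderivWithin_of_isOpen e.open_target (e.map_source hm')]
    refine Bundle.TotalSpace.ext (e.left_inv hm').symm ?_
    simp only
    have := he.mfderiv_symm_mfderiv hm' (v m)
    exact heq_of_eq this.symm

end IsSmoothChart

/-- A smooth chart in which the map `s` is the first projection, read in the chart `e`. -/
structure IsProductChart (d : ℕ) {X : Type*} [TopologicalSpace X]
    [ChartedSpace (EuclideanSpace ℝ (Fin d)) X] {n : ℕ} {M F : Type*} [TopologicalSpace M]
    [NormedAddCommGroup F] [NormedSpace ℝ F] (s : X → M)
    (e : OpenPartialHomeomorph M (EuclideanSpace ℝ (Fin n)))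
    (Ψ : OpenPartialHomeomorph X (EuclideanSpace ℝ (Fin n) × F)) : Prop
    extends IsSmoothChart d Ψ where
  mem_source : ∀ g ∈ Ψ.source, s g ∈ e.source
  fst_eq : ∀ g ∈ Ψ.source, (Ψ g).1 = e (s g)

theorem exists_isProductChart {n : ℕ} {M : Type*} [TopologicalSpace M]
    [ChartedSpace (EuclideanSpace ℝ (Fin n)) M] [IsManifold (𝓡 n) ∞ M] {s : X → M} {g₀ : X}
    (hs : Manifold.IsSubmersionAt (𝓡 d) (𝓡 n) ∞ s g₀)
    {e : OpenPartialHomeomorph M (EuclideanSpace ℝ (Fin n))}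
    (he : e ∈ IsManifold.maximalAtlas (𝓡 n) ∞ M) (hg : s g₀ ∈ e.source) :
    ∃ Ψ : OpenPartialHomeomorph X (EuclideanSpace ℝ (Fin n) × hs.complement),
      g₀ ∈ Ψ.source ∧ IsProductChart d s e Ψ := by
  have hφ := isSmoothChart_of_mem_maximalAtlas hs.domChart_mem_maximalAtlas
  have hψ := isSmoothChart_of_mem_maximalAtlas hs.codChart_mem_maximalAtlas
  have he' := isSmoothChart_of_mem_maximalAtlas he
  set φ := hs.domChart
  set ψ := hs.codChart
  set q := hs.equiv
  have hmem : ∀ g ∈ φ.source, s g ∈ ψ.source := fun g hg => hs.source_subset_preimage_source hg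
  have hw : ∀ g ∈ φ.source, (q (φ g)).1 = ψ (s g) := by
    intro g hg
    have := hs.writtenInCharts (show φ g ∈ (φ.extend (𝓡 d)).target by
      simpa using φ.map_source hg)
    simp only [Function.comp_apply] at this
    rw [← this]
    simp [φ.left_inv hg, φ, ψ]
  let T := (ψ.symm.trans e).prod (OpenPartialHomeomorph.refl hs.complement)
  let Ψ := (φ.trans q.toHomeomorph.toOpenPartialHomeomorph).trans T
  have hsrc : ∀ g, g ∈ Ψ.source ↔ g ∈ φ.source ∧ s g ∈ e.source := by
    intro g
    simp only [Ψ, T, OpenPartialHomeomorph.trans_source, mem_inter_iff, mem_preimage,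
      OpenPartialHomeomorph.prod_source, mem_prod, OpenPartialHomeomorph.coe_trans,
      Function.comp_apply]
    constructor
    · rintro ⟨⟨h1, -⟩, ⟨h2, h3⟩, -⟩
      refine ⟨h1, ?_⟩
      have := hw g h1
      simp only [Homeomorph.toOpenPartialHomeomorph_apply,
        ContinuousLinearEquiv.coe_toHomeomorph] at h3
      rw [this, ψ.left_inv (hmem g h1)] at h3
      exact h3
    · rintro ⟨h1, h2⟩
      have := hw g h1
      refine ⟨⟨h1, by simp⟩, ⟨?_, ?_⟩, by simp⟩
      · simp only [Homeomorph.toOpenPartialHomeomorph_apply,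
          ContinuousLinearEquiv.coe_toHomeomorph, OpenPartialHomeomorph.symm_source]
        rw [this]; exact ψ.map_source (hmem g h1)
      · simp only [Homeomorph.toOpenPartialHomeomorph_apply,
          ContinuousLinearEquiv.coe_toHomeomorph]
        rw [this, ψ.left_inv (hmem g h1)]; exact h2
  have hT1 : ContDiffOn ℝ ∞ T T.source := by
    have h1 : ContDiffOn ℝ ∞ (ψ.symm.trans e) (ψ.symm.trans e).source := by
      rw [← contMDiffOn_iff_contDiffOn]
      exact he'.contMDiffOn.comp' hψ.contMDiffOn_symm
    exact h1.prodMap (contDiffOn_id (s := univ))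
  have hT2 : ContDiffOn ℝ ∞ T.symm T.target := by
    have h1 : ContDiffOn ℝ ∞ (ψ.symm.trans e).symm (ψ.symm.trans e).target := by
      rw [← contMDiffOn_iff_contDiffOn]
      exact hψ.contMDiffOn.comp' he'.contMDiffOn_symm
    exact h1.prodMap (contDiffOn_id (s := univ))
  refine ⟨Ψ, (hsrc _).2 ⟨hs.mem_domChart_source, hg⟩, ⟨⟨?_, ?_⟩, fun g hg => ((hsrc g).1 hg).2,
    fun g hg => ?_⟩⟩
  · have h1 : ContMDiffOn (𝓡 d) 𝓘(ℝ, EuclideanSpace ℝ (Fin n) × hs.complement) ∞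
        (fun g => q (φ g)) φ.source :=
      (q.contDiff.contMDiff).comp_contMDiffOn hφ.contMDiffOn
    exact (contMDiffOn_iff_contDiffOn.2 hT1).comp (h1.mono fun g hg => ((hsrc g).1 hg).1)
      fun g hg => hg.2
  · have h1 : ContMDiffOn 𝓘(ℝ, EuclideanSpace ℝ (Fin n) × hs.complement) (𝓡 d) ∞
        (fun y => φ.symm (q.symm y)) (q.symm ⁻¹' φ.target) :=
      hφ.contMDiffOn_symm.comp (q.symm.contDiff.contMDiff.contMDiffOn) fun y hy => hy
    exact h1.comp ((contMDiffOn_iff_contDiffOn.2 hT2).mono fun y hy => hy.1) fun y hy => hy.2.2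
  · have h1 := ((hsrc g).1 hg).1
    change e (ψ.symm (q (φ g)).1) = _
    rw [hw g h1, ψ.left_inv (hmem g h1)]

end Charts

section TangentAlong

variable {d : ℕ} {E' H' N X : Type*} [NormedAddCommGroup E'] [NormedSpace ℝ E']
  [TopologicalSpace H'] {I' : ModelWithCorners ℝ E' H'}
  [TopologicalSpace N] [ChartedSpace H' N]
  [TopologicalSpace X] [ChartedSpace (EuclideanSpace ℝ (Fin d)) X] [IsManifold (𝓡 d) ∞ X]

theorem isSmoothChart_chartAt (x : X) :
    IsSmoothChart d (chartAt (EuclideanSpace ℝ (Fin d)) x) :=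
  isSmoothChart_of_mem_maximalAtlas (IsManifold.chart_mem_maximalAtlas x)

variable {b : N → X}

theorem contMDiffAt_tangent_zero {m : N} (hb : ContMDiffAt I' (𝓡 d) ∞ b m) :
    ContMDiffAt I' (𝓡 d).tangent ∞ (fun m => (⟨b m, 0⟩ : TangentBundle (𝓡 d) X)) m := by
  rw [(isSmoothChart_chartAt (b m)).contMDiffAt_tangent_iff (mem_chart_source _ _)]
  refine ⟨hb, ?_⟩
  simp only [map_zero]
  exact contMDiffAt_const

theorem contMDiffAt_tangent_smul {v : ∀ m, TangentSpace (𝓡 d) (b m)} {f : N → ℝ} {m : N}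
    (hf : ContMDiffAt I' 𝓘(ℝ, ℝ) ∞ f m)
    (hv : ContMDiffAt I' (𝓡 d).tangent ∞ (fun m => (⟨b m, v m⟩ : TangentBundle (𝓡 d) X)) m) :
    ContMDiffAt I' (𝓡 d).tangent ∞
      (fun m => (⟨b m, f m • v m⟩ : TangentBundle (𝓡 d) X)) m := by
  have hc := isSmoothChart_chartAt (d := d) (b m)
  rw [hc.contMDiffAt_tangent_iff (mem_chart_source _ _)] at hv ⊢
  refine ⟨hv.1, ?_⟩
  simp only [map_smul]
  exact hf.smul hv.2

theorem contMDiffAt_tangent_sum {ι : Type*} {t : Finset ι}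
    {v : ι → ∀ m, TangentSpace (𝓡 d) (b m)} {m : N} (hb : ContMDiffAt I' (𝓡 d) ∞ b m)
    (hv : ∀ i ∈ t, ContMDiffAt I' (𝓡 d).tangent ∞
      (fun m => (⟨b m, v i m⟩ : TangentBundle (𝓡 d) X)) m) :
    ContMDiffAt I' (𝓡 d).tangent ∞
      (fun m => (⟨b m, ∑ i ∈ t, v i m⟩ : TangentBundle (𝓡 d) X)) m := by
  have hc := isSmoothChart_chartAt (d := d) (b m)
  rw [hc.contMDiffAt_tangent_iff (mem_chart_source _ _)]
  refine ⟨hb, ?_⟩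
  simp only [map_sum]
  refine contMDiffAt_finsetSum fun i hi => ?_
  exact ((hc.contMDiffAt_tangent_iff (mem_chart_source _ _)).1 (hv i hi)).2

/-- Extension by zero of a vector field along a map. -/
theorem contMDiff_tangent_smul_of_tsupport {v : ∀ m, TangentSpace (𝓡 d) (b m)} {f : N → ℝ}
    (hb : ContMDiff I' (𝓡 d) ∞ b) (hf : ContMDiff I' 𝓘(ℝ, ℝ) ∞ f) {U : Set N}
    (hsupp : tsupport f ⊆ U)
    (hv : ∀ m ∈ U, ContMDiffAt I' (𝓡 d).tangent ∞
      (fun m => (⟨b m, v m⟩ : TangentBundle (𝓡 d) X)) m) :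
    ContMDiff I' (𝓡 d).tangent ∞ (fun m => (⟨b m, f m • v m⟩ : TangentBundle (𝓡 d) X)) := by
  intro m
  by_cases hm : m ∈ tsupport f
  · exact contMDiffAt_tangent_smul (hf m) (hv m (hsupp hm))
  · refine (contMDiffAt_tangent_zero (hb m)).congr_of_eventuallyEq ?_
    filter_upwards [(isClosed_tsupport f).isOpen_compl.mem_nhds hm] with m' hm'
    rw [image_eq_zero_of_notMem_tsupport hm', zero_smul]

theorem contMDiff_smul_of_tsupport {F : Type*} [NormedAddCommGroup F] [NormedSpace ℝ F]
    {v : N → F} {f : N → ℝ} (hf : ContMDiff I' 𝓘(ℝ, ℝ) ∞ f) {U : Set N}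
    (hsupp : tsupport f ⊆ U) (hv : ∀ m ∈ U, ContMDiffAt I' 𝓘(ℝ, F) ∞ v m) :
    ContMDiff I' 𝓘(ℝ, F) ∞ (fun m => f m • v m) := by
  intro m
  by_cases hm : m ∈ tsupport f
  · exact (hf m).smul (hv m (hsupp hm))
  · refine (contMDiffAt_const (c := (0 : F))).congr_of_eventuallyEq ?_
    filter_upwards [(isClosed_tsupport f).isOpen_compl.mem_nhds hm] with m' hm'
    rw [image_eq_zero_of_notMem_tsupport hm', zero_smul]

theorem exists_cutoff [T2Space X] {x : X} {U : Set X} (hU : U ∈ 𝓝 x) :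
    ∃ χ : X → ℝ, ContMDiff (𝓡 d) 𝓘(ℝ, ℝ) ∞ χ ∧ HasCompactSupport χ ∧ tsupport χ ⊆ U ∧
      ∀ᶠ y in 𝓝 x, χ y = 1 := by
  obtain ⟨f, -, hf⟩ := (SmoothBumpFunction.nhds_basis_tsupport (I := 𝓡 d) x).mem_iff.1 hU
  exact ⟨f, f.contMDiff, f.hasCompactSupport, hf, f.eventuallyEq_one⟩

end TangentAlong

section ChartFields

variable {n : ℕ} {M : Type*} [TopologicalSpace M] [ChartedSpace (EuclideanSpace ℝ (Fin n)) M]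
  [IsManifold (𝓡 n) ∞ M]

/-- The vector field `∂ᵢ` of a chart. -/
def chartVec (e : OpenPartialHomeomorph M (EuclideanSpace ℝ (Fin n))) (i : Fin n) (m : M) :
    TangentSpace (𝓡 n) m :=
  show EuclideanSpace ℝ (Fin n) from mfderiv (𝓡 n) (𝓡 n) e.symm (e m) (coordVec i)

/-- The coefficient of `∂ᵢ` in the local frame of the b-tangent bundle. -/
def bWeight (I : Finset (Fin n)) (i : Fin n) (x : EuclideanSpace ℝ (Fin n)) : ℝ :=
  if i ∈ I then x i else 1

theorem prod_bWeight (I : Finset (Fin n)) (x : EuclideanSpace ℝ (Fin n)) :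
    ∏ i, bWeight I i x = ∏ i ∈ I, x i := by
  simp [bWeight, Finset.prod_ite_mem]

theorem contDiff_bWeight (I : Finset (Fin n)) (i : Fin n) : ContDiff ℝ ∞ (bWeight I i) := by
  unfold bWeight
  split_ifs
  · exact contDiff_piLp_apply (p := 2)
  · exact contDiff_const

variable {e : OpenPartialHomeomorph M (EuclideanSpace ℝ (Fin n))}

theorem mfderiv_chartVec (he : IsSmoothChart n e) {m : M} (hm : m ∈ e.source) (i : Fin n) :
    mfderiv (𝓡 n) 𝓘(ℝ, EuclideanSpace ℝ (Fin n)) e m (chartVec e i m) = coordVec i :=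
  he.mfderiv_mfderiv_symm hm _

theorem contMDiffAt_chartVec (he : IsSmoothChart n e) {m : M} (hm : m ∈ e.source) (i : Fin n) :
    ContMDiffAt (𝓡 n) (𝓡 n).tangent ∞
      (fun m => (⟨m, chartVec e i m⟩ : TangentBundle (𝓡 n) M)) m := by
  refine (he.contMDiffAt_tangent_iff (b := fun m => m) hm).2 ⟨contMDiffAt_id, ?_⟩
  refine (contMDiffAt_const (c := coordVec i)).congr_of_eventuallyEq ?_
  filter_upwards [e.open_source.mem_nhds hm] with m' hm'
  exact mfderiv_chartVec he hm' i

theorem sum_smul_coordVec {k : ℕ} (v : EuclideanSpace ℝ (Fin k)) : ∑ i, v i • coordVec i = v := by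
  ext j
  simp [coordVec, Finset.sum_apply, Pi.single_apply]

theorem sum_smul_chartVec (he : IsSmoothChart n e) {m : M} (hm : m ∈ e.source)
    (v : TangentSpace (𝓡 n) m) :
    ∑ i, (show EuclideanSpace ℝ (Fin n) from
      mfderiv (𝓡 n) 𝓘(ℝ, EuclideanSpace ℝ (Fin n)) e m v) i • chartVec e i m = v := by
  set L : EuclideanSpace ℝ (Fin n) →L[ℝ] TangentSpace (𝓡 n) m :=
    mfderiv (𝓡 n) (𝓡 n) e.symm (e m)
  set u : EuclideanSpace ℝ (Fin n) := mfderiv (𝓡 n) 𝓘(ℝ, EuclideanSpace ℝ (Fin n)) e m v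
  have h : L u = v := he.mfderiv_symm_mfderiv hm v
  rw [← sum_smul_coordVec u, map_sum] at h
  simp only [map_smul] at h
  exact h

theorem linearIndependent_chartVec (he : IsSmoothChart n e) {m : M} (hm : m ∈ e.source) :
    LinearIndependent ℝ (fun i => chartVec e i m) := by
  refine LinearIndependent.of_comp
    (mfderiv (𝓡 n) 𝓘(ℝ, EuclideanSpace ℝ (Fin n)) e m).toLinearMap ?_
  have h : (⇑(mfderiv (𝓡 n) 𝓘(ℝ, EuclideanSpace ℝ (Fin n)) e m).toLinearMap ∘
      fun i => chartVec e i m) = (EuclideanSpace.basisFun (Fin n) ℝ).toBasis := by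
    funext i
    simpa [coordVec] using mfderiv_chartVec he hm i
  rw [h]
  exact (EuclideanSpace.basisFun (Fin n) ℝ).toBasis.linearIndependent

end ChartFields

section Divisor

variable {n : ℕ} {M : Type*} [TopologicalSpace M] [ChartedSpace (EuclideanSpace ℝ (Fin n)) M]
  [IsManifold (𝓡 n) ∞ M]

theorem IsSmoothChart.hasFDerivAt_comp_symm {d : ℕ} {X V W : Type*} [TopologicalSpace X]
    [ChartedSpace (EuclideanSpace ℝ (Fin d)) X] [IsManifold (𝓡 d) ∞ X]
    [NormedAddCommGroup V] [NormedSpace ℝ V] [NormedAddCommGroup W] [NormedSpace ℝ W]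
    {e : OpenPartialHomeomorph X V} (he : IsSmoothChart d e) {x : X} (hx : x ∈ e.source)
    {f : X → W} (hf : MDifferentiableAt (𝓡 d) 𝓘(ℝ, W) f x) (v : TangentSpace (𝓡 d) x) :
    ∃ L : V →L[ℝ] W, HasFDerivAt (f ∘ e.symm) L (e x) ∧
      L (mfderiv (𝓡 d) 𝓘(ℝ, V) e x v) = mfderiv (𝓡 d) 𝓘(ℝ, W) f x v := by
  have h1 : MDifferentiableAt 𝓘(ℝ, V) (𝓡 d) e.symm (e x) :=
    (he.contMDiffAt_symm (e.map_source hx)).mdifferentiableAt (by simp)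
  have h2 : MDifferentiableAt (𝓡 d) 𝓘(ℝ, W) f (e.symm (e x)) := by rwa [e.left_inv hx]
  have h3 := (h2.comp (e x) h1).hasMFDerivAt
  have h4 := mfderiv_comp_apply (e x) h2 h1
  refine ⟨mfderiv 𝓘(ℝ, V) 𝓘(ℝ, W) (f ∘ e.symm) (e x), hasMFDerivAt_iff_hasFDerivAt.1 h3, ?_⟩
  refine (h4 (mfderiv (𝓡 d) 𝓘(ℝ, V) e x v)).trans ?_
  set L : X → EuclideanSpace ℝ (Fin d) →L[ℝ] W := fun y => mfderiv (𝓡 d) 𝓘(ℝ, W) f y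
  change L (e.symm (e x)) _ = L x v
  rw [e.left_inv hx]
  exact congrArg (L x) (he.mfderiv_symm_mfderiv hx v)

/-- A chart around the point at which it vanishes, in which the divisor is a union of coordinate
hyperplanes. -/
structure IsDivisorChart {n : ℕ} {M : Type*} [TopologicalSpace M]
    [ChartedSpace (EuclideanSpace ℝ (Fin n)) M] (𝒵 : Finset (Set M))
    (e : OpenPartialHomeomorph M (EuclideanSpace ℝ (Fin n))) (I : Finset (Fin n)) : Prop where
  mem_maximalAtlas : e ∈ IsManifold.maximalAtlas (𝓡 n) ∞ M
  exists_hyperplane : ∀ Z ∈ 𝒵, (∀ p ∈ e.source, p ∉ Z) ∨ ∃ i ∈ I, ∀ p ∈ e.source, p ∈ Z ↔ e p i = 0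
  exists_mem : ∀ i ∈ I, ∃ Z ∈ 𝒵, ∀ p ∈ e.source, p ∈ Z ↔ e p i = 0

theorem IsSimpleNormalCrossing.exists_isDivisorChart {𝒵 : Finset (Set M)}
    (h𝒵 : IsSimpleNormalCrossing n 𝒵) (m : M) :
    ∃ (e : OpenPartialHomeomorph M (EuclideanSpace ℝ (Fin n))) (I : Finset (Fin n)),
      IsDivisorChart 𝒵 e I ∧ m ∈ e.source ∧ e m = 0 := by
  classical
  obtain ⟨e, he, hm, hm0, ⟨c, -, hc⟩, hmiss⟩ := h𝒵 m
  have : Finite {Z : Set M // Z ∈ 𝒵 ∧ m ∈ Z} :=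
    Set.Finite.subset 𝒵.finite_toSet (fun Z hZ => hZ.1)
  have := Fintype.ofFinite {Z : Set M // Z ∈ 𝒵 ∧ m ∈ Z}
  refine ⟨e, Finset.univ.image c, ⟨he, fun Z hZ => ?_, fun i hi => ?_⟩, hm, hm0⟩
  · by_cases hmZ : m ∈ Z
    · exact Or.inr ⟨c ⟨Z, hZ, hmZ⟩, by simp, hc ⟨Z, hZ, hmZ⟩⟩
    · exact Or.inl (hmiss Z hZ hmZ)
  · obtain ⟨Z, -, rfl⟩ := Finset.mem_image.1 hi
    exact ⟨Z.1, Z.2.1, hc Z⟩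

namespace IsDivisorChart

variable {𝒵 : Finset (Set M)} {e : OpenPartialHomeomorph M (EuclideanSpace ℝ (Fin n))}
  {I : Finset (Fin n)}

theorem isSmoothChart (he : IsDivisorChart 𝒵 e I) : IsSmoothChart n e :=
  isSmoothChart_of_mem_maximalAtlas he.mem_maximalAtlas

theorem mem_divisorSupport_iff (he : IsDivisorChart 𝒵 e I) {m : M} (hm : m ∈ e.source) :
    m ∈ divisorSupport 𝒵 ↔ ∃ i ∈ I, e m i = 0 := by
  constructor
  · intro h
    obtain ⟨Z, hZ, hmZ⟩ := mem_iUnion₂.1 h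
    rcases he.exists_hyperplane Z hZ with h | ⟨i, hi, h⟩
    · exact absurd hmZ (h m hm)
    · exact ⟨i, hi, (h m hm).1 hmZ⟩
  · rintro ⟨i, hi, h⟩
    obtain ⟨Z, hZ, h'⟩ := he.exists_mem i hi
    exact mem_biUnion hZ ((h' m hm).2 h)

theorem restr (he : IsDivisorChart 𝒵 e I) {U : Set M} (hU : IsOpen U) :
    IsDivisorChart 𝒵 (e.restr U) I := by
  have hs : (e.restr U).source ⊆ e.source := fun m hm => hm.1
  refine ⟨restr_mem_maximalAtlas (contDiffGroupoid ∞ (𝓡 n)) he.mem_maximalAtlas hU,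
    fun Z hZ => ?_, fun i hi => ?_⟩
  · rcases he.exists_hyperplane Z hZ with h | ⟨i, hi, h⟩
    · exact Or.inl fun p hp => h p (hs hp)
    · exact Or.inr ⟨i, hi, fun p hp => h p (hs hp)⟩
  · obtain ⟨Z, hZ, h⟩ := he.exists_mem i hi
    exact ⟨Z, hZ, fun p hp => h p (hs hp)⟩

theorem isBVectorField (he : IsDivisorChart 𝒵 e I) {χ : M → ℝ}
    (hχ : ContMDiff (𝓡 n) 𝓘(ℝ, ℝ) ∞ χ) (hsupp : tsupport χ ⊆ e.source) (i : Fin n) :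
    IsBVectorField 𝒵 (fun m => χ m • (bWeight I i (e m) • chartVec e i m)) := by
  have hs := he.isSmoothChart
  refine ⟨contMDiff_tangent_smul_of_tsupport contMDiff_id hχ hsupp fun m hm =>
    contMDiffAt_tangent_smul (((contDiff_bWeight I i).contMDiff.contMDiffAt).comp m
      (hs.contMDiffAt hm)) (contMDiffAt_chartVec hs hm i), fun Z hZ h hh h0 p hp => ?_⟩
  rw [map_smul, map_smul]
  by_cases hpχ : χ p = 0
  · rw [hpχ, zero_smul]; rfl
  have hpe : p ∈ e.source := hsupp (subset_tsupport χ hpχ)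
  rcases he.exists_hyperplane Z hZ with h1 | ⟨j, hj, h1⟩
  · exact absurd hp (h1 p hpe)
  have hpj : e p j = 0 := (h1 p hpe).1 hp
  rcases eq_or_ne i j with rfl | hij
  · rw [bWeight, if_pos hj, hpj, zero_smul, smul_zero]; rfl
  obtain ⟨L, hL, hLv⟩ := hs.hasFDerivAt_comp_symm hpe
    ((hh p).mdifferentiableAt (by simp)) (chartVec e i p)
  rw [mfderiv_chartVec hs hpe] at hLv
  suffices hz : L (coordVec i) = 0 by
    have h2 : mfderiv (𝓡 n) 𝓘(ℝ, ℝ) h p (chartVec e i p) = (0 : ℝ) := by rw [← hLv, hz]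
    rw [h2]
    change χ p * (bWeight I i (e p) * 0) = 0
    simp
  have hl : HasDerivAt (fun t : ℝ => e p + t • coordVec i) (coordVec i) 0 := by
    simpa using ((hasDerivAt_id (0 : ℝ)).smul_const (coordVec i)).const_add (e p)
  have hL' : HasFDerivAt (h ∘ e.symm) L (e p + (0 : ℝ) • coordVec i) := by simpa using hL
  have h3 := hL'.comp_hasDerivAt 0 hl
  have h4 : ((h ∘ e.symm) ∘ fun t : ℝ => e p + t • coordVec i) =ᶠ[𝓝 0] fun _ => (0 : ℝ) := by
    have hc : ContinuousAt (fun t : ℝ => e p + t • coordVec i) 0 := hl.continuousAt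
    filter_upwards [hc.eventually (e.open_target.mem_nhds (by simpa using e.map_source hpe))]
      with t ht
    refine h0 _ ((h1 _ (e.map_target ht)).2 ?_)
    rw [e.right_inv ht]
    simp [coordVec, hpj, Ne.symm hij]
  exact h3.unique ((hasDerivAt_const (0 : ℝ) (0 : ℝ)).congr_of_eventuallyEq h4)

end IsDivisorChart

end Divisor

section ProductChart

variable {n d : ℕ} {M X F : Type*} [TopologicalSpace M]
  [ChartedSpace (EuclideanSpace ℝ (Fin n)) M] [IsManifold (𝓡 n) ∞ M]
  [TopologicalSpace X] [ChartedSpace (EuclideanSpace ℝ (Fin d)) X] [IsManifold (𝓡 d) ∞ X]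
  [NormedAddCommGroup F] [NormedSpace ℝ F] {s : X → M}
  {e : OpenPartialHomeomorph M (EuclideanSpace ℝ (Fin n))}
  {Ψ : OpenPartialHomeomorph X (EuclideanSpace ℝ (Fin n) × F)}

theorem IsProductChart.fst_mfderiv (h : IsProductChart d s e Ψ) (he : IsSmoothChart n e) {g : X}
    (hg : g ∈ Ψ.source) (hs : MDifferentiableAt (𝓡 d) (𝓡 n) s g) (v : TangentSpace (𝓡 d) g) :
    (show EuclideanSpace ℝ (Fin n) × F from
      mfderiv (𝓡 d) 𝓘(ℝ, EuclideanSpace ℝ (Fin n) × F) Ψ g v).1 =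
      mfderiv (𝓡 n) 𝓘(ℝ, EuclideanSpace ℝ (Fin n)) e (s g) (mfderiv (𝓡 d) (𝓡 n) s g v) := by
  have h1 := ((ContinuousLinearMap.fst ℝ (EuclideanSpace ℝ (Fin n)) F).hasMFDerivAt
    (x := Ψ g)).comp g (((h.toIsSmoothChart.contMDiffAt hg).mdifferentiableAt
      (by simp)).hasMFDerivAt)
  have h2 := (((he.contMDiffAt (h.mem_source g hg)).mdifferentiableAt
    (by simp)).hasMFDerivAt).comp g hs.hasMFDerivAt
  have h3 := h2.congr_of_eventuallyEq (f₁ := (ContinuousLinearMap.fst ℝ _ F) ∘ Ψ) (by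
    filter_upwards [Ψ.open_source.mem_nhds hg] with g' hg'
    exact h.fst_eq g' hg')
  exact congrArg (fun L : EuclideanSpace ℝ (Fin d) →L[ℝ] EuclideanSpace ℝ (Fin n) => L v)
    (hasMFDerivAt_unique h1 h3)

theorem IsProductChart.mfderiv_eq_zero_iff (h : IsProductChart d s e Ψ) (he : IsSmoothChart n e)
    {g : X} (hg : g ∈ Ψ.source) (hs : MDifferentiableAt (𝓡 d) (𝓡 n) s g)
    (v : TangentSpace (𝓡 d) g) :
    mfderiv (𝓡 d) (𝓡 n) s g v = 0 ↔ (show EuclideanSpace ℝ (Fin n) × F from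
      mfderiv (𝓡 d) 𝓘(ℝ, EuclideanSpace ℝ (Fin n) × F) Ψ g v).1 = 0 := by
  rw [h.fst_mfderiv he hg hs]
  constructor
  · intro h0
    rw [h0]
    exact map_zero _
  · intro h0
    have h1 := he.mfderiv_symm_mfderiv (h.mem_source g hg) (mfderiv (𝓡 d) (𝓡 n) s g v)
    rw [h0] at h1
    rw [← h1]
    exact map_zero _

/-- The inclusion of the vertical directions. -/
theorem IsProductChart.mfderiv_vertical (h : IsProductChart d s e Ψ) (he : IsSmoothChart n e)
    {g : X} (hg : g ∈ Ψ.source) (hs : MDifferentiableAt (𝓡 d) (𝓡 n) s g) (t : F) :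
    mfderiv (𝓡 d) (𝓡 n) s g (show EuclideanSpace ℝ (Fin d) from
      mfderiv 𝓘(ℝ, EuclideanSpace ℝ (Fin n) × F) (𝓡 d) Ψ.symm (Ψ g)
        ((0, t) : EuclideanSpace ℝ (Fin n) × F)) = 0 :=
  (h.mfderiv_eq_zero_iff he hg hs _).2 (congrArg Prod.fst
    (h.toIsSmoothChart.mfderiv_mfderiv_symm hg ((0, t) : EuclideanSpace ℝ (Fin n) × F)))

end ProductChart

namespace LieGroupoid

variable {n d : ℕ} {M G : Type*}
  [TopologicalSpace M] [ChartedSpace (EuclideanSpace ℝ (Fin n)) M] [IsManifold (𝓡 n) ∞ M]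
  [TopologicalSpace G] [ChartedSpace (EuclideanSpace ℝ (Fin d)) G] [IsManifold (𝓡 d) ∞ G]
  {𝒢 : LieGroupoid n d M G} {𝒵 : Finset (Set M)}

theorem contMDiff_r (𝒢 : LieGroupoid n d M G) : ContMDiff (𝓡 d) (𝓡 n) ∞ 𝒢.r :=
  𝒢.isSubmersion_r.contMDiff

theorem contMDiff_s (𝒢 : LieGroupoid n d M G) : ContMDiff (𝓡 d) (𝓡 n) ∞ 𝒢.s :=
  𝒢.isSubmersion_s.contMDiff

theorem mdifferentiableAt_s (𝒢 : LieGroupoid n d M G) (g : G) :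
    MDifferentiableAt (𝓡 d) (𝓡 n) 𝒢.s g :=
  (𝒢.contMDiff_s g).mdifferentiableAt (by simp)

theorem Integrates.section_ext (h𝒢 : 𝒢.Integrates 𝒵) {X Y : ∀ m, 𝒢.A m}
    (hX : 𝒢.IsSmoothSectionOn univ X) (hY : 𝒢.IsSmoothSectionOn univ Y)
    (h : ∀ m, 𝒢.anchor m (X m) = 𝒢.anchor m (Y m)) : X = Y := by
  obtain ⟨W, -, hW⟩ := h𝒢.2 _ (h𝒢.1 X hX)
  exact (hW X ⟨hX, fun m => rfl⟩).trans (hW Y ⟨hY, fun m => (h m).symm⟩).symm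

theorem exists_section [T2Space M] (m : M) (a : 𝒢.A m) :
    ∃ X : ∀ m, 𝒢.A m, 𝒢.IsSmoothSectionOn univ X ∧ X m = a := by
  have he := isSmoothChart_chartAt (d := n) m
  obtain ⟨Ψ, hm, hΨ⟩ := exists_isProductChart (𝒢.isSubmersion_s.isSubmersionAt (𝒢.one m))
    (IsManifold.chart_mem_maximalAtlas m) (by rw [𝒢.s_one]; exact mem_chart_source _ m)
  have hU : 𝒢.one ⁻¹' Ψ.source ∈ 𝓝 m :=
    (𝒢.contMDiff_one.continuous.continuousAt).preimage_mem_nhds (Ψ.open_source.mem_nhds hm)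
  obtain ⟨χ, hχ, -, hsupp, hχ1⟩ := exists_cutoff (d := n) hU
  set F := (𝒢.isSubmersion_s.isSubmersionAt (𝒢.one m)).complement
  let dΨ : TangentSpace (𝓡 d) (𝒢.one m) →L[ℝ] EuclideanSpace ℝ (Fin n) × F :=
    mfderiv (𝓡 d) 𝓘(ℝ, EuclideanSpace ℝ (Fin n) × F) Ψ (𝒢.one m)
  let t : F := (dΨ a.1).2
  let Y : ∀ m', TangentSpace (𝓡 d) (𝒢.one m') := fun m' =>
    show EuclideanSpace ℝ (Fin d) from mfderiv 𝓘(ℝ, EuclideanSpace ℝ (Fin n) × F) (𝓡 d) Ψ.symm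
      (Ψ (𝒢.one m')) ((0, t) : EuclideanSpace ℝ (Fin n) × F)
  have hYs : ∀ m' ∈ 𝒢.one ⁻¹' Ψ.source, ContMDiffAt (𝓡 n) (𝓡 d).tangent ∞
      (fun m => (⟨𝒢.one m, Y m⟩ : TangentBundle (𝓡 d) G)) m' := by
    intro m' hm'
    refine (hΨ.toIsSmoothChart.contMDiffAt_tangent_iff hm').2 ⟨𝒢.contMDiff_one m', ?_⟩
    refine (contMDiffAt_const (c := ((0, t) : EuclideanSpace ℝ (Fin n) × F))).congr_of_eventuallyEq
      ?_
    filter_upwards [(𝒢.contMDiff_one.continuous.continuousAt).preimage_mem_nhds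
      (Ψ.open_source.mem_nhds hm')] with m'' hm''
    exact hΨ.toIsSmoothChart.mfderiv_mfderiv_symm hm'' _
  have hker : ∀ m', χ m' • Y m' ∈
      LinearMap.ker (mfderiv (𝓡 d) (𝓡 n) 𝒢.s (𝒢.one m')).toLinearMap := by
    intro m'
    by_cases h : χ m' = 0
    · rw [h, zero_smul]; exact Submodule.zero_mem _
    · exact Submodule.smul_mem _ _ (hΨ.mfderiv_vertical he (hsupp (subset_tsupport χ h))
        (𝒢.mdifferentiableAt_s _) t)
  refine ⟨fun m' => ⟨χ m' • Y m', hker m'⟩, ?_, ?_⟩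
  · exact (contMDiff_tangent_smul_of_tsupport 𝒢.contMDiff_one hχ hsupp hYs).contMDiffOn
  · refine Subtype.ext ?_
    change χ m • Y m = a.1
    rw [hχ1.self_of_nhds, one_smul]
    have h1 : (dΨ a.1).1 = 0 :=
      (hΨ.mfderiv_eq_zero_iff he hm (𝒢.mdifferentiableAt_s _) a.1).1 a.2
    have h2 : ((0, t) : EuclideanSpace ℝ (Fin n) × F) = dΨ a.1 := Prod.ext h1.symm rfl
    change (show EuclideanSpace ℝ (Fin d) from mfderiv 𝓘(ℝ, EuclideanSpace ℝ (Fin n) × F) (𝓡 d)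
      Ψ.symm (Ψ (𝒢.one m)) ((0, t) : EuclideanSpace ℝ (Fin n) × F)) = _
    rw [h2]
    exact hΨ.toIsSmoothChart.mfderiv_symm_mfderiv hm a.1

theorem finrank_A (𝒢 : LieGroupoid n d M G) (m : M) : n + Module.finrank ℝ (𝒢.A m) = d := by
  have he := isSmoothChart_chartAt (d := n) m
  obtain ⟨Ψ, hm, hΨ⟩ := exists_isProductChart (𝒢.isSubmersion_s.isSubmersionAt (𝒢.one m))
    (IsManifold.chart_mem_maximalAtlas m) (by rw [𝒢.s_one]; exact mem_chart_source _ m)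
  set F := (𝒢.isSubmersion_s.isSubmersionAt (𝒢.one m)).complement
  have q : EuclideanSpace ℝ (Fin d) ≃L[ℝ] EuclideanSpace ℝ (Fin n) × F :=
    (𝒢.isSubmersion_s.isSubmersionAt (𝒢.one m)).equiv
  have : FiniteDimensional ℝ (EuclideanSpace ℝ (Fin n) × F) := q.toLinearEquiv.finiteDimensional
  have : FiniteDimensional ℝ F := FiniteDimensional.of_surjective
    (LinearMap.snd ℝ (EuclideanSpace ℝ (Fin n)) F) LinearMap.snd_surjective
  let dΨ : TangentSpace (𝓡 d) (𝒢.one m) →L[ℝ] EuclideanSpace ℝ (Fin n) × F :=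
    mfderiv (𝓡 d) 𝓘(ℝ, EuclideanSpace ℝ (Fin n) × F) Ψ (𝒢.one m)
  have h1 : ∀ a : 𝒢.A m, (dΨ a.1).1 = 0 := fun a =>
    (hΨ.mfderiv_eq_zero_iff he hm (𝒢.mdifferentiableAt_s _) a.1).1 a.2
  let L : 𝒢.A m →ₗ[ℝ] F :=
    ((LinearMap.snd ℝ (EuclideanSpace ℝ (Fin n)) F).comp dΨ.toLinearMap).comp
      (Submodule.subtype _)
  have hL : Function.Bijective L := by
    constructor
    · intro a b hab
      refine Subtype.ext ?_
      have h2 : dΨ a.1 = dΨ b.1 := Prod.ext ((h1 a).trans (h1 b).symm) hab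
      rw [← hΨ.toIsSmoothChart.mfderiv_symm_mfderiv hm a.1,
        ← hΨ.toIsSmoothChart.mfderiv_symm_mfderiv hm b.1]
      exact congrArg _ h2
    · intro t
      exact ⟨⟨_, hΨ.mfderiv_vertical he hm (𝒢.mdifferentiableAt_s _) t⟩,
        congrArg Prod.snd (hΨ.toIsSmoothChart.mfderiv_mfderiv_symm hm
          ((0, t) : EuclideanSpace ℝ (Fin n) × F))⟩
  rw [(LinearEquiv.ofBijective L hL).finrank_eq]
  have := q.toLinearEquiv.finrank_eq
  rw [Module.finrank_prod, finrank_euclideanSpace_fin, finrank_euclideanSpace_fin] at this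
  exact this.symm

end LieGroupoid

/-- Extension by zero of a function on `M`, read in a chart. -/
theorem IsSmoothChart.contDiff_indicator {d : ℕ} {X V W : Type*} [TopologicalSpace X]
    [ChartedSpace (EuclideanSpace ℝ (Fin d)) X] [IsManifold (𝓡 d) ∞ X]
    [NormedAddCommGroup V] [NormedSpace ℝ V] [NormedAddCommGroup W] [NormedSpace ℝ W]
    {e : OpenPartialHomeomorph X V} (he : IsSmoothChart d e) {f : X → W}
    (hf : ContMDiff (𝓡 d) 𝓘(ℝ, W) ∞ f) (hc : HasCompactSupport f) (hs : tsupport f ⊆ e.source) :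
    ContDiff ℝ ∞ (e.target.indicator (f ∘ e.symm)) := by
  rw [contDiff_iff_contDiffAt]
  intro x
  by_cases hx : x ∈ e.target
  · have h1 : ContMDiffAt 𝓘(ℝ, V) 𝓘(ℝ, W) ∞ (f ∘ e.symm) x :=
      (hf _).comp x (he.contMDiffAt_symm hx)
    refine (contMDiffAt_iff_contDiffAt.1 h1).congr_of_eventuallyEq ?_
    filter_upwards [e.open_target.mem_nhds hx] with y hy
    rw [indicator_of_mem hy]
  · have h1 : IsClosed (e '' tsupport f) :=
      (hc.isCompact.image_of_continuousOn (e.continuousOn.mono hs)).isClosed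
    have h2 : x ∉ e '' tsupport f := by
      rintro ⟨p, hp, rfl⟩
      exact hx (e.map_source (hs hp))
    refine (contDiffAt_const (c := (0 : W))).congr_of_eventuallyEq ?_
    filter_upwards [h1.isOpen_compl.mem_nhds h2] with y hy
    by_cases hyt : y ∈ e.target
    · rw [indicator_of_mem hyt]
      refine image_eq_zero_of_notMem_tsupport (f := f) fun h => hy ?_
      exact ⟨_, h, e.right_inv hyt⟩
    · rw [indicator_of_notMem hyt]

namespace LieGroupoid

variable {n d : ℕ} {M G : Type*}
  [TopologicalSpace M] [ChartedSpace (EuclideanSpace ℝ (Fin n)) M] [IsManifold (𝓡 n) ∞ M]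
  [TopologicalSpace G] [ChartedSpace (EuclideanSpace ℝ (Fin d)) G] [IsManifold (𝓡 d) ∞ G]
  {𝒢 : LieGroupoid n d M G} {𝒵 : Finset (Set M)}
  {e : OpenPartialHomeomorph M (EuclideanSpace ℝ (Fin n))} {I : Finset (Fin n)}

theorem _root_.PvTrace.IsBVectorField.coord_eq_zero {V : ∀ m : M, TangentSpace (𝓡 n) m}
    (hV : IsBVectorField 𝒵 V) (he : IsDivisorChart 𝒵 e I) {χ : M → ℝ}
    (hχ : ContMDiff (𝓡 n) 𝓘(ℝ, ℝ) ∞ χ) (hsupp : tsupport χ ⊆ e.source) {i : Fin n} (hi : i ∈ I)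
    {p : M} (hp : p ∈ e.source) (hpi : e p i = 0) :
    χ p * (show EuclideanSpace ℝ (Fin n) from
      mfderiv (𝓡 n) 𝓘(ℝ, EuclideanSpace ℝ (Fin n)) e p (V p)) i = 0 := by
  have hs := he.isSmoothChart
  obtain ⟨Z, hZ, hZi⟩ := he.exists_mem i hi
  have hh : ContMDiff (𝓡 n) 𝓘(ℝ, ℝ) ∞ (fun m => χ m • e m i) :=
    contMDiff_smul_of_tsupport hχ hsupp fun m hm =>
      ((EuclideanSpace.proj (𝕜 := ℝ) i).contDiff.contMDiff.contMDiffAt).comp m (hs.contMDiffAt hm)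
  have h1 := hV.2 Z hZ _ hh (fun q hq => by
    by_cases hq' : q ∈ e.source
    · rw [(hZi q hq').1 hq, smul_zero]
    · rw [image_eq_zero_of_notMem_tsupport fun h => hq' (hsupp h), zero_smul])
    p ((hZi p hp).2 hpi)
  obtain ⟨L, hL, hLv⟩ := hs.hasFDerivAt_comp_symm hp ((hh p).mdifferentiableAt (by simp)) (V p)
  obtain ⟨L', hL', -⟩ := hs.hasFDerivAt_comp_symm hp ((hχ p).mdifferentiableAt (by simp)) (V p)
  have h2 := hL'.mul (EuclideanSpace.proj (𝕜 := ℝ) i).hasFDerivAt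
  have h3 : ((fun m => χ m • e m i) ∘ e.symm) =ᶠ[𝓝 (e p)]
      (χ ∘ e.symm) * (EuclideanSpace.proj (𝕜 := ℝ) i) := by
    filter_upwards [e.open_target.mem_nhds (e.map_source hp)] with x hx
    simp [e.right_inv hx]
  have h4 := (h2.congr_of_eventuallyEq h3).unique hL
  rw [h1, ← h4] at hLv
  simp [hpi, e.left_inv hp] at hLv
  exact hLv

/-- Sections of `A` whose anchors are the standard local b-vector fields span `A`. -/
theorem Integrates.span_eq_top [T2Space M] (h𝒢 : 𝒢.Integrates 𝒵) (he : IsDivisorChart 𝒵 e I)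
    {χ : M → ℝ} (hχ : ContMDiff (𝓡 n) 𝓘(ℝ, ℝ) ∞ χ) (hχc : HasCompactSupport χ)
    (hsupp : tsupport χ ⊆ e.source) {X : Fin n → ∀ m, 𝒢.A m}
    (hX : ∀ i, 𝒢.IsSmoothSectionOn univ (X i))
    (hXa : ∀ i m, 𝒢.anchor m (X i m) = χ m • (bWeight I i (e m) • chartVec e i m))
    {m : M} (hm : χ m = 1) : Submodule.span ℝ (range fun i => X i m) = ⊤ := by
  have hs := he.isSmoothChart
  rw [eq_top_iff]
  rintro a -
  obtain ⟨Y, hY, rfl⟩ := 𝒢.exists_section m a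
  have hV := h𝒢.1 Y hY
  set V : ∀ m : M, TangentSpace (𝓡 n) m := fun m => 𝒢.anchor m (Y m) with hVdef
  set W : M → EuclideanSpace ℝ (Fin n) := fun p =>
    mfderiv (𝓡 n) 𝓘(ℝ, EuclideanSpace ℝ (Fin n)) e p (V p) with hW
  have hWs : ∀ p ∈ e.source, ContMDiffAt (𝓡 n) 𝓘(ℝ, EuclideanSpace ℝ (Fin n)) ∞ W p :=
    fun p hp => ((hs.contMDiffAt_tangent_iff (b := fun m => m) hp).1 (hV.1 p)).2
  have hF : ∀ j, ContMDiff (𝓡 n) 𝓘(ℝ, ℝ) ∞ (fun p => χ p • W p j) := fun j =>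
    contMDiff_smul_of_tsupport hχ hsupp fun p hp =>
      ((EuclideanSpace.proj (𝕜 := ℝ) j).contDiff.contMDiff.contMDiffAt).comp p (hWs p hp)
  have hf : ∀ j, ContDiff ℝ ∞ (e.target.indicator ((fun p => χ p • W p j) ∘ e.symm)) := fun j =>
    hs.contDiff_indicator (hF j) (hχc.smul_right)
      ((tsupport_smul_subset_left χ fun p => W p j).trans hsupp)
  have hg : ∀ j, ∃ g : EuclideanSpace ℝ (Fin n) → ℝ, ContDiff ℝ ∞ g ∧
      ∀ p ∈ e.source, χ p * W p j = bWeight I j (e p) * g (e p) := by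
    intro j
    have hval : ∀ p ∈ e.source,
        e.target.indicator ((fun p => χ p • W p j) ∘ e.symm) (e p) = χ p * W p j := by
      intro p hp
      rw [indicator_of_mem (e.map_source hp)]
      simp [e.left_inv hp]
    by_cases hj : j ∈ I
    · obtain ⟨g, hg, hfg⟩ := exists_contDiff_eq_mul (hf j) (EuclideanSpace.proj (𝕜 := ℝ) j)
        (v := coordVec j) (by simp [coordVec]) (fun x hx => by
          by_cases hxt : x ∈ e.target
          · rw [indicator_of_mem hxt]
            refine hV.coord_eq_zero he hχ hsupp hj (e.map_target hxt) ?_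
            rw [e.right_inv hxt]; exact hx
          · exact indicator_of_notMem hxt _)
      refine ⟨g, hg, fun p hp => ?_⟩
      rw [← hval p hp, hfg, bWeight, if_pos hj]
      rfl
    · exact ⟨_, hf j, fun p hp => by rw [hval p hp, bWeight, if_neg hj, _root_.one_mul]⟩
  choose g hg hfg using hg
  have hcoef : ∀ j, ContMDiff (𝓡 n) 𝓘(ℝ, ℝ) ∞ (fun p => χ p • g j (e p)) := fun j =>
    contMDiff_smul_of_tsupport hχ hsupp fun p hp =>
      ((hg j).contMDiff.contMDiffAt).comp p (hs.contMDiffAt hp)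
  have hsec : (fun p => (χ p * χ p * χ p) • Y p) =
      fun p => ∑ j, (χ p • g j (e p)) • X j p := by
    refine h𝒢.section_ext ?_ ?_ fun p => ?_
    · refine ContMDiff.contMDiffOn fun p => ?_
      exact contMDiffAt_tangent_smul (((hχ p).mul (hχ p)).mul (hχ p))
        ((hY p (mem_univ p)).contMDiffAt univ_mem)
    · refine ContMDiff.contMDiffOn fun p => ?_
      have := contMDiffAt_tangent_sum (t := Finset.univ)
        (v := fun j m => (χ m • g j (e m)) • (X j m).1) (𝒢.contMDiff_one p) fun j _ =>
        contMDiffAt_tangent_smul (hcoef j p) ((hX j p (mem_univ p)).contMDiffAt univ_mem)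
      refine this.congr_of_eventuallyEq (Eventually.of_forall fun m => ?_)
      simp
    · simp only [map_smul, map_sum, hXa]
      by_cases hp : p ∈ e.source
      · rw [← sum_smul_chartVec hs hp (𝒢.anchor p (Y p)), Finset.smul_sum]
        refine Finset.sum_congr rfl fun j _ => ?_
        simp only [smul_smul]
        congr 1
        have := hfg j p hp
        simp only [hW, hVdef] at this
        simp only [smul_eq_mul]
        linear_combination (χ p * χ p) * this
      · have : χ p = 0 := image_eq_zero_of_notMem_tsupport fun h => hp (hsupp h)
        simp [this]
  have h1 := congrFun hsec m
  simp only [hm, _root_.mul_one, one_smul] at h1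
  rw [h1]
  exact Submodule.sum_mem _ fun j _ => Submodule.smul_mem _ _ (Submodule.subset_span ⟨j, rfl⟩)

end LieGroupoid

section Orientation

variable {n : ℕ} {V W : Type*} [AddCommGroup V] [Module ℝ V] [AddCommGroup W] [Module ℝ W]

theorem isPositive_iff {o : Orientation ℝ V (Fin n)} (b : Module.Basis (Fin n) ℝ V) :
    IsPositive o b ↔ b.orientation = o := by
  constructor
  · rintro ⟨b', hb', rfl⟩
    rw [Module.Basis.eq_of_apply_eq (fun i => congrFun hb' i)]
  · exact fun h => ⟨b, rfl, h⟩

open Classical in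
theorem map_orientation_eq_iff (L : V ≃ₗ[ℝ] W) (b : Module.Basis (Fin n) ℝ V)
    (c : Module.Basis (Fin n) ℝ W) {w : Fin n → ℝ} (hw : ∀ i, w i ≠ 0)
    (hL : ∀ i, L (b i) = w i • c i) (oV : Orientation ℝ V (Fin n)) (oW : Orientation ℝ W (Fin n)) :
    Orientation.map (Fin n) L oV = oW ↔
      0 < ((if IsPositive oV b then 1 else -1) * (if IsPositive oW c then 1 else -1) : ℝ) *
        ∏ i, w i := by
  have hmap : b.map L = c.unitsSMul fun i => Units.mk0 (w i) (hw i) := by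
    refine Module.Basis.eq_of_apply_eq fun i => ?_
    rw [Module.Basis.map_apply, hL, Module.Basis.unitsSMul_apply]
    rfl
  have h1 : Orientation.map (Fin n) L b.orientation =
      (∏ i, Units.mk0 (w i) (hw i))⁻¹ • c.orientation := by
    rw [← Module.Basis.orientation_map, hmap, Module.Basis.orientation_unitsSMul]
  have hcoe : ((∏ i, Units.mk0 (w i) (hw i) : ℝˣ) : ℝ) = ∏ i, w i := by
    rw [Units.coe_prod]; rfl
  have hne : ∏ i, w i ≠ 0 := Finset.prod_ne_zero_iff.2 fun i _ => hw i
  have key : ∀ o : Orientation ℝ W (Fin n), o ≠ -o := fun o => Module.Ray.ne_neg_self o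
  have keyV : ∀ o : Orientation ℝ V (Fin n), o ≠ -o := fun o => Module.Ray.ne_neg_self o
  rw [isPositive_iff, isPositive_iff]
  rcases hne.lt_or_gt with hneg | hpos
  · have h2 : Orientation.map (Fin n) L b.orientation = -c.orientation := by
      rw [h1]
      exact Module.Ray.units_smul_of_neg _ (by
        rw [Units.val_inv_eq_inv_val, hcoe]; exact inv_lt_zero.2 hneg) _
    rcases b.orientation_eq_or_eq_neg oV with rfl | rfl <;>
    rcases c.orientation_eq_or_eq_neg oW with rfl | rfl <;>
    simp [h2, key, (key _).symm, keyV, Orientation.map_neg, hneg, hneg.le]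
    exact neg_neg c.orientation
  · have h2 : Orientation.map (Fin n) L b.orientation = c.orientation := by
      rw [h1]
      exact Module.Ray.units_smul_of_pos _ (by
        rw [Units.val_inv_eq_inv_val, hcoe]; exact inv_pos.2 hpos) _
    rcases b.orientation_eq_or_eq_neg oV with rfl | rfl <;>
    rcases c.orientation_eq_or_eq_neg oW with rfl | rfl <;>
    simp [h2, key, (key _).symm, keyV, Orientation.map_neg, hpos, hpos.le]

end Orientation

section Divisor

variable {n : ℕ} {M : Type*} [TopologicalSpace M] [ChartedSpace (EuclideanSpace ℝ (Fin n)) M]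
  [IsManifold (𝓡 n) ∞ M] {𝒵 : Finset (Set M)}

theorem IsDivisorChart.frequently_notMem
    {e : OpenPartialHomeomorph M (EuclideanSpace ℝ (Fin n))} {I : Finset (Fin n)}
    (he : IsDivisorChart 𝒵 e I) {m : M} (hm : m ∈ e.source) (hm0 : e m = 0) {U : Set M}
    (hU : U ∈ 𝓝 m) : ∃ p ∈ U ∩ e.source, p ∉ divisorSupport 𝒵 := by
  set v : EuclideanSpace ℝ (Fin n) := WithLp.toLp 2 fun _ => (1 : ℝ)
  have hc : ContinuousAt (fun t : ℝ => t • v) 0 := by fun_prop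
  have h0 : (fun t : ℝ => t • v) 0 = e m := by simp [hm0]
  have ht : e m ∈ e.target := e.map_source hm
  have h1 : ∀ᶠ t : ℝ in 𝓝 0, t • v ∈ e.target :=
    hc.eventually (by rw [h0]; exact e.open_target.mem_nhds ht)
  have h2 : ∀ᶠ t : ℝ in 𝓝 0, e.symm (t • v) ∈ U := by
    have h3 : ContinuousAt e.symm (e m) := e.continuousAt_symm ht
    refine (h3.comp_of_eq hc h0).preimage_mem_nhds ?_
    simp only [Function.comp, zero_smul]
    rwa [← hm0, e.left_inv hm]
  have h3 : ∀ᶠ t : ℝ in 𝓝[>] 0, t • v ∈ e.target ∧ e.symm (t • v) ∈ U ∧ 0 < t :=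
    ((h1.and h2).filter_mono nhdsWithin_le_nhds).and self_mem_nhdsWithin |>.mono
      fun t h => ⟨h.1.1, h.1.2, h.2⟩
  obtain ⟨t, ht1, ht2, ht3⟩ := h3.exists
  refine ⟨e.symm (t • v), ⟨ht2, e.map_target ht1⟩, fun hd => ?_⟩
  obtain ⟨i, -, hi⟩ := (he.mem_divisorSupport_iff (e.map_target ht1)).1 hd
  rw [e.right_inv ht1] at hi
  simp [v] at hi
  exact ht3.ne' hi

end Divisor

namespace LieGroupoid

variable {n d : ℕ} {M G : Type*}
  [TopologicalSpace M] [ChartedSpace (EuclideanSpace ℝ (Fin n)) M] [IsManifold (𝓡 n) ∞ M]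
  [TopologicalSpace G] [ChartedSpace (EuclideanSpace ℝ (Fin d)) G] [IsManifold (𝓡 d) ∞ G]
  {𝒢 : LieGroupoid n d M G} {𝒵 : Finset (Set M)}

theorem Integrates.exists_local_sections [T2Space M] (h𝒢 : 𝒢.Integrates 𝒵)
    {e : OpenPartialHomeomorph M (EuclideanSpace ℝ (Fin n))} {I : Finset (Fin n)}
    (he : IsDivisorChart 𝒵 e I) {m : M} (hm : m ∈ e.source) :
    ∃ (U : Set M) (X : Fin n → ∀ m, 𝒢.A m), IsOpen U ∧ m ∈ U ∧ U ⊆ e.source ∧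
      (∀ i, 𝒢.IsSmoothSectionOn univ (X i)) ∧
      (∀ i, ∀ p ∈ U, 𝒢.anchor p (X i p) = bWeight I i (e p) • chartVec e i p) ∧
      ∀ p ∈ U, Submodule.span ℝ (range fun i => X i p) = ⊤ := by
  obtain ⟨χ, hχ, hχc, hsupp, hχ1⟩ := exists_cutoff (d := n) (e.open_source.mem_nhds hm)
  choose X hX using fun i => (h𝒢.2 _ (he.isBVectorField hχ hsupp i)).exists
  have h1 : ∀ p ∈ interior {p | χ p = 1} ∩ e.source, χ p = 1 := fun p hp =>
    interior_subset (s := {p | χ p = 1}) hp.1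
  refine ⟨interior {p | χ p = 1} ∩ e.source, X, isOpen_interior.inter e.open_source,
    ⟨mem_interior_iff_mem_nhds.2 hχ1, hm⟩, inter_subset_right, fun i => (hX i).1,
    fun i p hp => ?_, fun p hp => ?_⟩
  · rw [(hX i).2, h1 p hp, one_smul]
  · exact h𝒢.span_eq_top he hχ hχc hsupp (fun i => (hX i).1) (fun i => (hX i).2) (h1 p hp)

theorem Integrates.dim_eq [T2Space M] [Nonempty M] (h𝒢 : 𝒢.Integrates 𝒵)
    (h𝒵 : IsSimpleNormalCrossing n 𝒵) : d = n + n := by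
  obtain ⟨m⟩ := ‹Nonempty M›
  obtain ⟨e, I, he, hm, hm0⟩ := h𝒵.exists_isDivisorChart m
  obtain ⟨U, X, hU, hmU, hUe, -, hXa, hspan⟩ := h𝒢.exists_local_sections he hm
  obtain ⟨p, ⟨hpU, hpe⟩, hpd⟩ := he.frequently_notMem hm hm0 (hU.mem_nhds hmU)
  have hw : ∀ i, bWeight I i (e p) ≠ 0 := by
    intro i h0
    rw [bWeight] at h0
    split_ifs at h0 with hi
    · exact hpd ((he.mem_divisorSupport_iff hpe).2 ⟨i, hi, h0⟩)
    · exact one_ne_zero h0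
  have hli : LinearIndependent ℝ (fun i => X i p) := by
    refine LinearIndependent.of_comp (𝒢.anchor p) ?_
    have h2 := (linearIndependent_chartVec he.isSmoothChart hpe).units_smul
      fun i => Units.mk0 _ (hw i)
    convert h2 using 1
    funext i
    exact hXa i p hpU
  have h3 := Module.finrank_eq_card_basis (Module.Basis.mk hli (hspan p hpU).ge)
  have h4 := 𝒢.finrank_A p
  rw [h3, Fintype.card_fin] at h4
  exact h4.symm

theorem Integrates.finrank_A [T2Space M] [Nonempty M] (h𝒢 : 𝒢.Integrates 𝒵)
    (h𝒵 : IsSimpleNormalCrossing n 𝒵) (m : M) : Module.finrank ℝ (𝒢.A m) = n := by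
  have h1 := h𝒢.dim_eq h𝒵
  have h2 := 𝒢.finrank_A m
  exact Nat.add_left_cancel (h2.trans h1)

variable (𝒢 𝒵) (oA : ∀ m, Orientation ℝ (𝒢.A m) (Fin n))
  (oM : ∀ m : M, Orientation ℝ (TangentSpace (𝓡 n) m) (Fin n))

/-- A chart of the divisor, together with a frame of `A` whose anchor is the standard local frame
of b-vector fields, on which the orientations are constant. -/
structure AdaptedChart where
  e : OpenPartialHomeomorph M (EuclideanSpace ℝ (Fin n))
  I : Finset (Fin n)
  isDivisorChart : IsDivisorChart 𝒵 e I
  X : ∀ m, Fin n → 𝒢.A m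
  isFrameOn : 𝒢.IsFrameOn e.source X
  anchor_eq : ∀ m ∈ e.source, ∀ i, 𝒢.anchor m (X m i) = bWeight I i (e m) • chartVec e i m
  sgn : ℝ
  sgn_eq : sgn = 1 ∨ sgn = -1
  preservesAt_iff : ∀ m ∈ e.source, m ∉ divisorSupport 𝒵 →
    (𝒢.PreservesAt oA oM m ↔ 0 < sgn * ∏ i ∈ I, e m i)

variable {𝒢 𝒵 oA oM}

theorem exists_adaptedChart [T2Space M] (h𝒢 : 𝒢.Integrates 𝒵)
    (h𝒵 : IsSimpleNormalCrossing n 𝒵) (hoM : IsTangentOrientation oM) (hoA : 𝒢.IsOrientation oA)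
    (m : M) : ∃ C : 𝒢.AdaptedChart 𝒵 oA oM, m ∈ C.e.source ∧ C.e m = 0 := by
  classical
  have : Nonempty M := ⟨m⟩
  obtain ⟨e, I, he, hm, hm0⟩ := h𝒵.exists_isDivisorChart m
  obtain ⟨U, X, hU, hmU, hUe, hX, hXa, hspan⟩ := h𝒢.exists_local_sections he hm
  have hli : ∀ p ∈ U, LinearIndependent ℝ (fun i => X i p) := fun p hp =>
    linearIndependent_of_top_le_span_of_card_eq_finrank (hspan p hp).ge
      (by rw [h𝒢.finrank_A h𝒵, Fintype.card_fin])
  have hframe : 𝒢.IsFrameOn U (fun p i => X i p) :=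
    ⟨hU, fun i => (hX i).mono (subset_univ _), hli, hspan⟩
  have hc : ∀ (P : M → Prop), IsOpen {p ∈ U | P p} → IsOpen {p ∈ U | ¬ P p} →
      ∃ U' ⊆ U, IsOpen U' ∧ m ∈ U' ∧ ∀ p ∈ U', P p ↔ P m := by
    intro P h1 h2
    by_cases h : P m
    · exact ⟨_, sep_subset _ _, h1, ⟨hmU, h⟩, fun p hp => iff_of_true hp.2 h⟩
    · exact ⟨_, sep_subset _ _, h2, ⟨hmU, h⟩, fun p hp => iff_of_false hp.2 h⟩
  have hA := hoA U _ hframe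
  have hM := hoM U (fun p i => chartVec e i p) hU
    (fun i p hp => (contMDiffAt_chartVec he.isSmoothChart (hUe hp) i).contMDiffWithinAt)
    (fun p hp => linearIndependent_chartVec he.isSmoothChart (hUe hp))
  obtain ⟨UA, hUA, hUAo, hmA, hPA⟩ := hc (fun p => IsPositive (oA p) fun i => X i p) hA.1 hA.2
  obtain ⟨UM, hUM, hUMo, hmM, hPM⟩ := hc (fun p => IsPositive (oM p) fun i => chartVec e i p)
    hM.1 hM.2
  have hW : IsOpen (UA ∩ UM) := hUAo.inter hUMo
  have hsrc : (e.restr (UA ∩ UM)).source = UA ∩ UM := by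
    rw [OpenPartialHomeomorph.restr_source, hW.interior_eq]
    exact inter_eq_right.2 fun p hp => hUe (hUA hp.1)
  refine ⟨⟨e.restr (UA ∩ UM), I, he.restr hW, fun p i => X i p, ?_, ?_,
    ((if IsPositive (oA m) (fun i => X i m) then 1 else -1) *
      (if IsPositive (oM m) (fun i => chartVec e i m) then 1 else -1) : ℝ), ?_, ?_⟩, ?_, hm0⟩
  · rw [hsrc]
    exact ⟨hW, fun i => (hX i).mono (subset_univ _), fun p hp => hli p (hUA hp.1),
      fun p hp => hspan p (hUA hp.1)⟩
  · intro p hp i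
    rw [hsrc] at hp
    exact hXa i p (hUA hp.1)
  · split_ifs <;> simp
  · intro p hp hpd
    rw [hsrc] at hp
    have hpe := hUe (hUA hp.1)
    have hw : ∀ i, bWeight I i (e p) ≠ 0 := by
      intro i h0
      rw [bWeight] at h0
      split_ifs at h0 with hi
      · exact hpd ((he.mem_divisorSupport_iff hpe).2 ⟨i, hi, h0⟩)
      · exact one_ne_zero h0
    let b := Module.Basis.mk (hli p (hUA hp.1)) (hspan p (hUA hp.1)).ge
    have hlc := linearIndependent_chartVec he.isSmoothChart hpe
    have hfr : Fintype.card (Fin n) = Module.finrank ℝ (TangentSpace (𝓡 n) p) := by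
      rw [Fintype.card_fin]
      exact (finrank_euclideanSpace_fin (𝕜 := ℝ) (n := n)).symm
    have : FiniteDimensional ℝ (TangentSpace (𝓡 n) p) :=
      inferInstanceAs (FiniteDimensional ℝ (EuclideanSpace ℝ (Fin n)))
    let c := Module.Basis.mk hlc (hlc.span_eq_top_of_card_eq_finrank' hfr).ge
    have hb : ∀ i, b i = X i p := fun i => Module.Basis.mk_apply _ _ i
    have hcv : ∀ i, c i = chartVec e i p := fun i => Module.Basis.mk_apply _ _ i
    have hbc : ∀ i, 𝒢.anchor p (b i) = bWeight I i (e p) • c i := fun i => by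
      rw [hb, hcv]; exact hXa i p (hUA hp.1)
    have hbij : Function.Bijective (𝒢.anchor p) := by
      let q : 𝒢.A p ≃ₗ[ℝ] TangentSpace (𝓡 n) p :=
        b.equiv (c.unitsSMul fun i => Units.mk0 _ (hw i)) (Equiv.refl _)
      have hq : (q : 𝒢.A p →ₗ[ℝ] TangentSpace (𝓡 n) p) = 𝒢.anchor p := by
        refine b.ext fun i => ?_
        rw [hbc]
        simp [q, Module.Basis.unitsSMul_apply, Units.smul_def]
      rw [← hq]
      exact q.bijective
    have h1 := map_orientation_eq_iff (LinearEquiv.ofBijective (𝒢.anchor p) hbij) b c hw hbc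
      (oA p) (oM p)
    have hb' : (⇑b) = fun i => X i p := funext hb
    have hc' : (⇑c) = fun i => chartVec e i p := funext hcv
    rw [hb', hc', prod_bWeight, hPA p hp.1, hPM p hp.2] at h1
    exact ⟨fun ⟨_, h⟩ => h1.1 h, fun h => ⟨hbij, h1.2 h⟩⟩
  · rw [hsrc]; exact ⟨hmA, hmM⟩

end LieGroupoid

section Homogeneous

variable {n : ℕ} {V : Type*} [AddCommGroup V] [Module ℝ V]

/-- Functions of a tuple of vectors that transform like a density. -/
def IsHomogeneous (μ : (Fin n → V) → ℂ) : Prop :=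
  ∀ (T : V →ₗ[ℝ] V) a, μ (fun i => T (a i)) = (|LinearMap.det T| : ℝ) * μ a

theorem IsHomogeneous.eq_zero [FiniteDimensional ℝ V] {μ : (Fin n → V) → ℂ}
    (hμ : IsHomogeneous μ) {a : Fin n → V} (ha : Submodule.span ℝ (range a) ≠ ⊤) : μ a = 0 := by
  obtain ⟨q, hq⟩ := Submodule.exists_isCompl (Submodule.span ℝ (range a))
  set T : V →ₗ[ℝ] V := Submodule.projection _ _ hq
  have hT : ∀ i, T (a i) = a i := fun i =>
    Submodule.projection_apply_of_mem_left hq (Submodule.subset_span ⟨i, rfl⟩)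
  have hdet : LinearMap.det T = 0 := by
    by_contra h
    have h1 := LinearMap.range_eq_top.2 ((LinearMap.equivOfDetNeZero T h).surjective)
    refine ha (top_le_iff.1 ?_)
    have h2 : LinearMap.range T = Submodule.span ℝ (range a) := Submodule.range_projection hq
    rw [← h2]
    exact h1.ge
  have h := hμ T a
  simp only [hT, hdet, abs_zero, Complex.ofReal_zero, zero_mul] at h
  exact h

theorem IsHomogeneous.matrix [FiniteDimensional ℝ V] {μ : (Fin n → V) → ℂ}
    (hμ : IsHomogeneous μ) (hn : Module.finrank ℝ V = n) (A : Matrix (Fin n) (Fin n) ℝ)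
    (a : Fin n → V) : μ (fun i => ∑ j, A j i • a j) = (|A.det| : ℝ) * μ a := by
  by_cases ha : Submodule.span ℝ (range a) = ⊤
  · have hli : LinearIndependent ℝ a :=
      linearIndependent_of_top_le_span_of_card_eq_finrank ha.ge (by rw [hn, Fintype.card_fin])
    let b := Module.Basis.mk hli ha.ge
    have hb : ∀ i, b i = a i := fun i => Module.Basis.mk_apply _ _ i
    have h := hμ (Matrix.toLin b b A) a
    rw [LinearMap.det_toLin] at h
    rw [← h]
    congr 1
    funext i
    rw [← hb i, Matrix.toLin_self]
    simp only [hb]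
  · rw [hμ.eq_zero ha, mul_zero]
    refine hμ.eq_zero fun h => ha (top_le_iff.1 (h.ge.trans (Submodule.span_le.2 ?_)))
    rintro _ ⟨i, rfl⟩
    exact Submodule.sum_mem _ fun j _ => Submodule.smul_mem _ _ (Submodule.subset_span ⟨j, rfl⟩)

theorem IsHomogeneous.smul [FiniteDimensional ℝ V] {μ : (Fin n → V) → ℂ}
    (hμ : IsHomogeneous μ) (hn : Module.finrank ℝ V = n) (w : Fin n → ℝ)
    (a : Fin n → V) : μ (fun i => w i • a i) = (|∏ i, w i| : ℝ) * μ a := by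
  rw [← Matrix.det_diagonal, ← hμ.matrix hn]
  congr 1
  funext i
  simp [Matrix.diagonal_apply]

theorem IsHomogeneous.comp_linearEquiv {W : Type*} [AddCommGroup W] [Module ℝ W]
    {μ : (Fin n → V) → ℂ} (hμ : IsHomogeneous μ) (L : W ≃ₗ[ℝ] V) :
    IsHomogeneous fun a : Fin n → W => μ fun i => L (a i) := by
  intro T a
  have h := hμ (L.toLinearMap ∘ₗ T ∘ₗ L.symm.toLinearMap) fun i => L (a i)
  rw [LinearMap.det_conj] at h
  simpa using h

/-- A family of densities along a submanifold has compatible local expressions. -/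
theorem IsCompatible.of_homogeneous {d k : ℕ} {X : Type*} [TopologicalSpace X]
    [ChartedSpace (EuclideanSpace ℝ (Fin d)) X] {S : Set X} {W : X → Type*}
    [∀ p, AddCommGroup (W p)] [∀ p, Module ℝ (W p)] [∀ p, FiniteDimensional ℝ (W p)]
    (hW : ∀ p ∈ S, Module.finrank ℝ (W p) = k) {μ : ∀ p, (Fin k → W p) → ℂ}
    (hμ : ∀ p ∈ S, IsHomogeneous (μ p))
    {D : ∀ (P : LocalParam d k S) (y : EuclideanSpace ℝ (Fin k)),
      EuclideanSpace ℝ (Fin k) →ₗ[ℝ] W (P.toFun y)}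
    (hD : ∀ (P Q : LocalParam d k S) (φ : EuclideanSpace ℝ (Fin k) → EuclideanSpace ℝ (Fin k))
      (L : EuclideanSpace ℝ (Fin k) →L[ℝ] EuclideanSpace ℝ (Fin k)) (y), y ∈ P.source →
      φ y ∈ Q.source → (∀ᶠ y' in 𝓝 y, Q.toFun (φ y') = P.toFun y') → HasFDerivAt φ L y →
      ∀ (h : Q.toFun (φ y) = P.toFun y) v, D P y v = h ▸ (D Q (φ y) (L v))) :
    IsCompatible (fun (P : LocalParam d k S) y => μ (P.toFun y) fun i => D P y (coordVec i)) := by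
  intro P Q φ L y hy hφy hev hL
  have h := hev.self_of_nhds
  have hS := Q.image_mem _ hφy
  have h1 := hD P Q φ L y hy hφy hev hL h
  have key : ∀ (p : X) (hp : Q.toFun (φ y) = p) (w : Fin k → W p),
      (∀ i, w i = hp ▸ (D Q (φ y) (L (coordVec i)))) →
      μ p w = (|L.det| : ℝ) * μ (Q.toFun (φ y)) fun i => D Q (φ y) (coordVec i) := by
    rintro p rfl w hw
    let A : Matrix (Fin k) (Fin k) ℝ := LinearMap.toMatrix
      (EuclideanSpace.basisFun (Fin k) ℝ).toBasis (EuclideanSpace.basisFun (Fin k) ℝ).toBasis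
      L.toLinearMap
    have hA : A.det = L.det := LinearMap.det_toMatrix _ _
    rw [← hA, ← (hμ _ hS).matrix (hW _ hS) A]
    congr 1
    funext i
    rw [hw i]
    change D Q (φ y) (L (coordVec i)) = _
    conv_lhs => rw [← sum_smul_coordVec (L (coordVec i)), map_sum]
    refine Finset.sum_congr rfl fun j _ => ?_
    rw [map_smul]
    simp [A, LinearMap.toMatrix_apply, coordVec]
  exact key _ h _ fun i => h1 (coordVec i)

end Homogeneous

section Slice

variable {d k : ℕ} {X V F : Type*} [TopologicalSpace X]
  [ChartedSpace (EuclideanSpace ℝ (Fin d)) X] [IsManifold (𝓡 d) ∞ X]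
  [NormedAddCommGroup V] [NormedSpace ℝ V] [NormedAddCommGroup F] [NormedSpace ℝ F]
  {Ψ : OpenPartialHomeomorph X V}

theorem ofSet_mem_maximalAtlas {U : Set (EuclideanSpace ℝ (Fin k))} (hU : IsOpen U) :
    OpenPartialHomeomorph.ofSet U hU ∈
      IsManifold.maximalAtlas (𝓡 k) ∞ (EuclideanSpace ℝ (Fin k)) :=
  OpenPartialHomeomorph.mem_maximalAtlas_of_contMDiffOn _ contMDiffOn_id contMDiffOn_id

theorem IsSmoothChart.trans_homeomorph_mem (hΨ : IsSmoothChart d Ψ)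
    (q : V ≃L[ℝ] EuclideanSpace ℝ (Fin d)) (c : V) :
    Ψ.trans ((Homeomorph.addLeft (-c)).trans q.toHomeomorph).toOpenPartialHomeomorph ∈
      IsManifold.maximalAtlas (𝓡 d) ∞ X := by
  have h1 : ContDiff ℝ ∞ fun z : V => q (-c + z) := q.contDiff.comp (contDiff_const.add contDiff_id)
  have h2 : ContDiff ℝ ∞ fun z : EuclideanSpace ℝ (Fin d) => c + q.symm z :=
    contDiff_const.add q.symm.contDiff
  refine OpenPartialHomeomorph.mem_maximalAtlas_of_contMDiffOn _ ?_ ?_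
  · exact h1.contMDiff.comp_contMDiffOn (hΨ.contMDiffOn.mono fun x hx => hx.1)
  · have h3 : (((Homeomorph.addLeft (-c)).trans
        q.toHomeomorph).toOpenPartialHomeomorph.symm : EuclideanSpace ℝ (Fin d) → V) =
        fun z => c + q.symm z := by
      funext z
      change -(-c) + q.symm z = _
      rw [neg_neg]
    refine hΨ.contMDiffOn_symm.comp (g := Ψ.symm) (f := ((Homeomorph.addLeft (-c)).trans
        q.toHomeomorph).toOpenPartialHomeomorph.symm) ?_ fun z hz => hz.2
    rw [h3]
    exact h2.contMDiff.contMDiffOn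

theorem IsSmoothChart.isImmersionAt_slice (hΨ : IsSmoothChart d Ψ)
    (κ : (EuclideanSpace ℝ (Fin k) × F) ≃L[ℝ] V) (q : V ≃L[ℝ] EuclideanSpace ℝ (Fin d)) (c : V)
    {y : EuclideanSpace ℝ (Fin k)} (hy : c + κ (y, 0) ∈ Ψ.target) :
    Manifold.IsImmersionAt (𝓡 k) (𝓡 d) ∞ (fun y => Ψ.symm (c + κ (y, 0))) y := by
  have hc : Continuous fun y : EuclideanSpace ℝ (Fin k) => c + κ (y, (0 : F)) := by fun_prop
  have hU : IsOpen ((fun y : EuclideanSpace ℝ (Fin k) => c + κ (y, (0 : F))) ⁻¹' Ψ.target) :=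
    Ψ.open_target.preimage hc
  refine Manifold.IsImmersionAt.mk_of_charts (κ.trans q) (OpenPartialHomeomorph.ofSet _ hU)
    (Ψ.trans ((Homeomorph.addLeft (-c)).trans q.toHomeomorph).toOpenPartialHomeomorph) hy ?_
    (ofSet_mem_maximalAtlas hU) (hΨ.trans_homeomorph_mem q c) ?_ ?_
  · simpa using Ψ.map_target hy
  · intro z hz
    have hz' : c + κ (z, (0 : F)) ∈ Ψ.target := hz
    simpa using Ψ.map_target hz'
  · intro z hz
    have hz' : c + κ (z, (0 : F)) ∈ Ψ.target := by simpa using hz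
    simp [Ψ.right_inv hz']

theorem isEmbedding_slice (Ψ : OpenPartialHomeomorph X V)
    (κ : (EuclideanSpace ℝ (Fin k) × F) ≃L[ℝ] V) (c : V) {U : Set (EuclideanSpace ℝ (Fin k))}
    (hU : ∀ y ∈ U, c + κ (y, 0) ∈ Ψ.target) :
    IsEmbedding (U.domRestrict fun y => Ψ.symm (c + κ (y, 0))) := by
  let f : U → Ψ.target := fun y => ⟨c + κ (y.1, 0), hU y y.2⟩
  have hf : IsEmbedding f := by
    refine IsEmbedding.of_comp (g := Subtype.val) ?_ continuous_subtype_val ?_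
    · exact Continuous.subtype_mk (by fun_prop) _
    · have h1 : IsEmbedding fun y : EuclideanSpace ℝ (Fin k) => c + κ (y, (0 : F)) :=
        (Homeomorph.addLeft c).isEmbedding.comp (κ.toHomeomorph.isEmbedding.comp
          (isEmbedding_prodMkLeft 0))
      exact h1.comp IsEmbedding.subtypeVal
  exact IsEmbedding.subtypeVal.comp (Ψ.toHomeomorphSourceTarget.symm.isEmbedding.comp hf)

end Slice

section Params

variable {n d : ℕ} {M G : Type*}
  [TopologicalSpace M] [ChartedSpace (EuclideanSpace ℝ (Fin n)) M] [IsManifold (𝓡 n) ∞ M]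
  [TopologicalSpace G] [ChartedSpace (EuclideanSpace ℝ (Fin d)) G] [IsManifold (𝓡 d) ∞ G]

/-- The local parametrization of `M` that is the inverse of a chart. -/
def chartParam {e : OpenPartialHomeomorph M (EuclideanSpace ℝ (Fin n))} (he : IsSmoothChart n e) :
    LocalParam n n (univ : Set M) where
  source := e.target
  toFun := e.symm
  isOpen_source := e.open_target
  isImmersionAt y hy := by
    have h := he.isImmersionAt_slice (F := PUnit.{1})
      (ContinuousLinearEquiv.prodUnique ℝ (EuclideanSpace ℝ (Fin n)) PUnit.{1})
      (ContinuousLinearEquiv.refl ℝ _) 0 (y := y) (by simpa using hy)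
    simpa using h
  isEmbedding := by
    have h := isEmbedding_slice e (F := PUnit.{1})
      (ContinuousLinearEquiv.prodUnique ℝ (EuclideanSpace ℝ (Fin n)) PUnit.{1}) 0
      (U := e.target) (by simp)
    simpa using h
  image_mem _ _ := mem_univ _
  isOpen_image := ⟨e.source, e.open_source, by
    rw [univ_inter, e.symm_image_target_eq_source]⟩

/-- The local parametrization of a fibre of a submersion given by a chart. -/
def fibreParam {k : ℕ} {s : G → M} {e : OpenPartialHomeomorph M (EuclideanSpace ℝ (Fin n))}
    {Ψ : OpenPartialHomeomorph G (EuclideanSpace ℝ (Fin n) × EuclideanSpace ℝ (Fin k))}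
    (hΨ : IsProductChart d s e Ψ) (hd : d = n + k) {x : M} (hx : x ∈ e.source) :
    LocalParam d k (s ⁻¹' {x}) where
  source := {t | (e x, t) ∈ Ψ.target}
  toFun t := Ψ.symm (e x, t)
  isOpen_source := Ψ.open_target.preimage (by fun_prop)
  isImmersionAt t ht := by
    have q : (EuclideanSpace ℝ (Fin n) × EuclideanSpace ℝ (Fin k)) ≃L[ℝ]
      EuclideanSpace ℝ (Fin d) := ContinuousLinearEquiv.ofFinrankEq (by simp [hd])
    have h := hΨ.toIsSmoothChart.isImmersionAt_slice
      (ContinuousLinearEquiv.prodComm ℝ (EuclideanSpace ℝ (Fin k)) (EuclideanSpace ℝ (Fin n)))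
      q (e x, 0) (y := t) (by simpa using ht)
    simpa using h
  isEmbedding := by
    have h := isEmbedding_slice Ψ
      (ContinuousLinearEquiv.prodComm ℝ (EuclideanSpace ℝ (Fin k)) (EuclideanSpace ℝ (Fin n)))
      (e x, 0) (U := {t | (e x, t) ∈ Ψ.target}) (by simp)
    simpa using h
  image_mem t ht := by
    have ht' : (e x, t) ∈ Ψ.target := ht
    have h := hΨ.fst_eq _ (Ψ.map_target ht')
    rw [Ψ.right_inv ht'] at h
    exact (e.injOn hx (hΨ.mem_source _ (Ψ.map_target ht')) h).symm
  isOpen_image := by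
    refine ⟨Ψ.source, Ψ.open_source, Subset.antisymm ?_ ?_⟩
    · rintro _ ⟨t, ht, rfl⟩
      have ht' : (e x, t) ∈ Ψ.target := ht
      have h := hΨ.fst_eq _ (Ψ.map_target ht')
      rw [Ψ.right_inv ht'] at h
      exact ⟨(e.injOn hx (hΨ.mem_source _ (Ψ.map_target ht')) h).symm, Ψ.map_target ht'⟩
    · rintro g ⟨hg, hgΨ⟩
      have hg' : s g = x := hg
      have h1 : (e x, (Ψ g).2) = Ψ g := Prod.ext (by rw [hΨ.fst_eq g hgΨ, hg']) rfl
      refine ⟨(Ψ g).2, ?_, ?_⟩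
      · change (e x, (Ψ g).2) ∈ Ψ.target
        rw [h1]; exact Ψ.map_source hgΨ
      · change Ψ.symm (e x, (Ψ g).2) = g
        rw [h1, Ψ.left_inv hgΨ]

theorem image_fibreParam {k : ℕ} {s : G → M}
    {e : OpenPartialHomeomorph M (EuclideanSpace ℝ (Fin n))}
    {Ψ : OpenPartialHomeomorph G (EuclideanSpace ℝ (Fin n) × EuclideanSpace ℝ (Fin k))}
    (hΨ : IsProductChart d s e Ψ) (hd : d = n + k) {x : M} (hx : x ∈ e.source) {g : G}
    (hg : s g = x) (hgΨ : g ∈ Ψ.source) :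
    g ∈ (fibreParam hΨ hd hx).toFun '' (fibreParam hΨ hd hx).source := by
  have h1 : (e x, (Ψ g).2) = Ψ g := Prod.ext (by rw [hΨ.fst_eq g hgΨ, hg]) rfl
  refine ⟨(Ψ g).2, ?_, ?_⟩
  · change (e x, (Ψ g).2) ∈ Ψ.target
    rw [h1]; exact Ψ.map_source hgΨ
  · change Ψ.symm (e x, (Ψ g).2) = g
    rw [h1, Ψ.left_inv hgΨ]

/-- A product chart with model `ℝⁿ × ℝᵏ`. -/
theorem exists_isProductChart_euclidean {k : ℕ} {s : G → M} {g₀ : G}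
    (hs : Manifold.IsSubmersionAt (𝓡 d) (𝓡 n) ∞ s g₀) (hd : d = n + k)
    {e : OpenPartialHomeomorph M (EuclideanSpace ℝ (Fin n))}
    (he : e ∈ IsManifold.maximalAtlas (𝓡 n) ∞ M) (hg : s g₀ ∈ e.source) :
    ∃ Ψ : OpenPartialHomeomorph G (EuclideanSpace ℝ (Fin n) × EuclideanSpace ℝ (Fin k)),
      g₀ ∈ Ψ.source ∧ IsProductChart d s e Ψ := by
  obtain ⟨Ψ, hg₀, hΨ⟩ := exists_isProductChart hs he hg
  have q := hs.equiv
  have : FiniteDimensional ℝ (EuclideanSpace ℝ (Fin n) × hs.complement) :=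
    q.toLinearEquiv.finiteDimensional
  have : FiniteDimensional ℝ hs.complement := FiniteDimensional.of_surjective
    (LinearMap.snd ℝ (EuclideanSpace ℝ (Fin n)) hs.complement) LinearMap.snd_surjective
  have h1 := q.toLinearEquiv.finrank_eq
  rw [Module.finrank_prod, finrank_euclideanSpace_fin, finrank_euclideanSpace_fin] at h1
  have κ : hs.complement ≃L[ℝ] EuclideanSpace ℝ (Fin k) :=
    ContinuousLinearEquiv.ofFinrankEq (by
      rw [finrank_euclideanSpace_fin]
      exact (Nat.add_left_cancel (hd.symm.trans h1)).symm)
  let κ' := (ContinuousLinearEquiv.refl ℝ (EuclideanSpace ℝ (Fin n))).prodCongr κ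
  refine ⟨Ψ.trans κ'.toHomeomorph.toOpenPartialHomeomorph, by simpa using hg₀, ⟨⟨?_, ?_⟩, ?_, ?_⟩⟩
  · exact κ'.contDiff.contMDiff.comp_contMDiffOn (hΨ.contMDiffOn.mono fun x hx => hx.1)
  · exact hΨ.contMDiffOn_symm.comp κ'.symm.contDiff.contMDiff.contMDiffOn fun z hz => hz.2
  · exact fun g hg => hΨ.mem_source g hg.1
  · exact fun g hg => hΨ.fst_eq g hg.1

end Params

section NormField

variable {n : ℕ}

/-- A family of norms on `ℝⁿ` that depends on a point of `K` in a Lipschitz way. -/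
structure IsNormField (K : Set (EuclideanSpace ℝ (Fin n))) (L C : ℝ)
    (N : EuclideanSpace ℝ (Fin n) → EuclideanSpace ℝ (Fin n) → ℝ) : Prop where
  one_le : 1 ≤ L
  nonneg : 0 ≤ C
  lower : ∀ x ∈ K, ∀ v, ‖v‖ ≤ L * N x v
  upper : ∀ x ∈ K, ∀ v, N x v ≤ L * ‖v‖
  lip : ∀ x ∈ K, ∀ y ∈ K, ∀ v, |N x v - N y v| ≤ C * ‖x - y‖ * ‖v‖
  smul : ∀ x ∈ K, ∀ (t : ℝ) v, N x (t • v) = |t| * N x v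

/-- The distance of the hyperplane `v j = 1` from the origin. -/
def coNorm (N : EuclideanSpace ℝ (Fin n) → EuclideanSpace ℝ (Fin n) → ℝ) (j : Fin n)
    (x : EuclideanSpace ℝ (Fin n)) : ℝ :=
  sInf (N x '' {v | v j = 1})

namespace IsNormField

variable {K : Set (EuclideanSpace ℝ (Fin n))} {L C : ℝ}
  {N : EuclideanSpace ℝ (Fin n) → EuclideanSpace ℝ (Fin n) → ℝ} {x y : EuclideanSpace ℝ (Fin n)}

theorem apply_nonneg (h : IsNormField K L C N) (hx : x ∈ K) (v) : 0 ≤ N x v := by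
  have h1 := (norm_nonneg v).trans (h.lower x hx v)
  have h2 := h.one_le
  by_contra! hc
  nlinarith

theorem coNorm_le (h : IsNormField K L C N) (hx : x ∈ K) {j : Fin n}
    {v : EuclideanSpace ℝ (Fin n)} (hv : v j = 1) : coNorm N j x ≤ N x v :=
  csInf_le ⟨0, by rintro _ ⟨w, -, rfl⟩; exact h.apply_nonneg hx w⟩ ⟨v, hv, rfl⟩

theorem le_coNorm {j : Fin n} {a : ℝ} (ha : ∀ v : EuclideanSpace ℝ (Fin n), v j = 1 → a ≤ N x v) :
    a ≤ coNorm N j x :=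
  le_csInf ⟨_, coordVec j, by simp [coordVec], rfl⟩ (by rintro _ ⟨w, hw, rfl⟩; exact ha w hw)

theorem norm_coordVec (j : Fin n) : ‖coordVec j‖ = 1 := by simp [coordVec]

theorem coNorm_upper (h : IsNormField K L C N) (hx : x ∈ K) (j : Fin n) : coNorm N j x ≤ L :=
  (h.coNorm_le hx (v := coordVec j) (by simp [coordVec])).trans
    ((h.upper x hx _).trans (by rw [norm_coordVec, mul_one]))

theorem coNorm_lower (h : IsNormField K L C N) (hx : x ∈ K) (j : Fin n) :
    L⁻¹ ≤ coNorm N j x := by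
  refine le_coNorm fun v hv => ?_
  have h1 : 1 ≤ ‖v‖ := by
    have := PiLp.norm_apply_le v j
    rwa [hv, norm_one] at this
  rw [inv_le_iff_one_le_mul₀ (by linarith [h.one_le])]
  linarith [h.lower x hx v, mul_comm L (N x v)]

theorem abs_mul_coNorm_le (h : IsNormField K L C N) (hx : x ∈ K) (j : Fin n)
    (v : EuclideanSpace ℝ (Fin n)) : |v j| * coNorm N j x ≤ N x v := by
  rcases eq_or_ne (v j) 0 with h0 | h0
  · rw [h0, abs_zero, zero_mul]; exact h.apply_nonneg hx v
  · have h1 := h.coNorm_le hx (j := j) (v := (v j)⁻¹ • v) (by simp [h0])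
    rw [h.smul x hx, abs_inv, inv_mul_eq_div, le_div_iff₀ (abs_pos.2 h0)] at h1
    linarith

theorem exists_coNorm (h : IsNormField K L C N) (hx : x ∈ K) (j : Fin n) {η : ℝ} (hη : 0 < η)
    (hη1 : η ≤ 1) : ∃ v : EuclideanSpace ℝ (Fin n), v j = 1 ∧ N x v ≤ coNorm N j x + η ∧
      ‖v‖ ≤ L * (L + 1) := by
  obtain ⟨_, ⟨v, hv, rfl⟩, hlt⟩ := exists_lt_of_csInf_lt
    (s := N x '' {v | v j = 1}) ⟨_, coordVec j, by simp [coordVec], rfl⟩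
    (b := coNorm N j x + η) (by unfold coNorm; linarith)
  refine ⟨v, hv, hlt.le, (h.lower x hx v).trans ?_⟩
  have := h.coNorm_upper hx j
  have := h.one_le
  gcongr
  linarith

theorem abs_coNorm_sub_le (h : IsNormField K L C N) (hx : x ∈ K) (hy : y ∈ K) (j : Fin n) :
    |coNorm N j x - coNorm N j y| ≤ C * (L * (L + 1)) * ‖x - y‖ := by
  have key : ∀ x ∈ K, ∀ y ∈ K, coNorm N j x ≤ coNorm N j y + C * (L * (L + 1)) * ‖x - y‖ := by
    intro x hx y hy
    refine le_of_forall_pos_le_add fun η hη => ?_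
    obtain ⟨v, hv, hv1, hv2⟩ := h.exists_coNorm hy j (lt_min hη one_pos) (min_le_right η 1)
    have h1 := h.coNorm_le hx hv
    have h2 := (abs_le.1 (h.lip x hx y hy v)).2
    have h3 : C * ‖x - y‖ * ‖v‖ ≤ C * ‖x - y‖ * (L * (L + 1)) :=
      mul_le_mul_of_nonneg_left hv2 (mul_nonneg h.nonneg (norm_nonneg _))
    have h4 := min_le_left η 1
    nlinarith
  rw [abs_le]
  constructor
  · have := key y hy x hx
    rw [norm_sub_rev] at this
    linarith
  · linarith [key x hx y hy]

end IsNormField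

/-- A smooth family of scalar products gives a family of norms. -/
theorem exists_isNormField {U K : Set (EuclideanSpace ℝ (Fin n))} (hU : IsOpen U)
    (hK : IsCompact K) (hKc : Convex ℝ K) (hKU : K ⊆ U)
    {q : EuclideanSpace ℝ (Fin n) → EuclideanSpace ℝ (Fin n) →ₗ[ℝ] EuclideanSpace ℝ (Fin n) →ₗ[ℝ] ℝ}
    (hq : ∀ i j, ContDiffOn ℝ 1 (fun x => q x (coordVec i) (coordVec j)) U)
    (hpos : ∀ x ∈ U, ∀ v, v ≠ 0 → 0 < q x v v) :
    ∃ L C, IsNormField K L C fun x v => Real.sqrt (q x v v) := by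
  have hexp : ∀ x v, q x v v = ∑ i, ∑ j, v i * v j * q x (coordVec i) (coordVec j) := by
    intro x v
    conv_lhs => rw [← sum_smul_coordVec v]
    simp only [map_sum, map_smul, LinearMap.sum_apply, LinearMap.smul_apply,
      smul_eq_mul, Finset.mul_sum]
    rw [Finset.sum_comm]
    exact Finset.sum_congr rfl fun i _ => Finset.sum_congr rfl fun j _ => by ring
  have hnn : ∀ x ∈ U, ∀ v, 0 ≤ q x v v := fun x hx v => by
    rcases eq_or_ne v 0 with rfl | hv
    · simp
    · exact (hpos x hx v hv).le
  have hhom : ∀ x (t : ℝ) v, q x (t • v) (t • v) = t ^ 2 * q x v v := by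
    intro x t v
    simp only [map_smul, LinearMap.smul_apply, smul_eq_mul]
    ring
  have hcont : ContinuousOn (fun p : EuclideanSpace ℝ (Fin n) × EuclideanSpace ℝ (Fin n) =>
      q p.1 p.2 p.2) (K ×ˢ Metric.sphere 0 1) := by
    simp only [hexp]
    refine continuousOn_finsetSum _ fun i _ => continuousOn_finsetSum _ fun j _ => ?_
    refine ContinuousOn.mul (by fun_prop) ?_
    exact ((hq i j).continuousOn.comp continuousOn_fst fun p hp => hKU hp.1)
  have hcpt : IsCompact (K ×ˢ Metric.sphere (0 : EuclideanSpace ℝ (Fin n)) 1) :=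
    hK.prod (isCompact_sphere _ _)
  obtain ⟨B, hB⟩ := hcpt.exists_bound_of_continuousOn hcont
  obtain ⟨b, hb0, hb⟩ : ∃ b : ℝ, 0 < b ∧ ∀ x ∈ K, ∀ v ∈ Metric.sphere
      (0 : EuclideanSpace ℝ (Fin n)) 1, b ≤ q x v v := by
    rcases (K ×ˢ Metric.sphere (0 : EuclideanSpace ℝ (Fin n)) 1).eq_empty_or_nonempty with he | hne
    · exact ⟨1, one_pos, fun x hx v hv => absurd (mk_mem_prod hx hv) (by rw [he]; exact id)⟩
    · obtain ⟨p, hp, hmin⟩ := hcpt.exists_isMinOn hne hcont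
      refine ⟨q p.1 p.2 p.2, hpos _ (hKU hp.1) _ ?_, fun x hx v hv => hmin (mk_mem_prod hx hv)⟩
      intro h0
      have := hp.2
      rw [h0] at this
      simp at this
  obtain ⟨D, hD0, hD⟩ : ∃ D : ℝ, 0 ≤ D ∧ ∀ i j, ∀ x ∈ K, ∀ y ∈ K,
      |q x (coordVec i) (coordVec j) - q y (coordVec i) (coordVec j)| ≤ D * ‖x - y‖ := by
    have h1 : ∀ i j, ∃ D : ℝ, ∀ x ∈ K,
        ‖fderiv ℝ (fun x => q x (coordVec i) (coordVec j)) x‖ ≤ D := fun i j =>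
      hK.exists_bound_of_continuousOn
        (((hq i j).continuousOn_fderiv_of_isOpen hU le_rfl).mono hKU)
    choose D hD using h1
    refine ⟨∑ i, ∑ j, |D i j|, Finset.sum_nonneg fun i _ => Finset.sum_nonneg fun j _ =>
      abs_nonneg _, fun i j x hx y hy => ?_⟩
    have h2 := hKc.norm_image_sub_le_of_norm_fderiv_le (𝕜 := ℝ)
      (f := fun x => q x (coordVec i) (coordVec j)) (C := D i j) (fun z hz =>
      ((hq i j).differentiableOn (by simp) z (hKU hz)).differentiableAt (hU.mem_nhds (hKU hz)))
      (hD i j) hy hx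
    refine h2.trans (mul_le_mul_of_nonneg_right ?_ (norm_nonneg _))
    refine (le_abs_self _).trans ((Finset.single_le_sum (f := fun j => |D i j|)
      (fun j _ => abs_nonneg _) (Finset.mem_univ j)).trans ?_)
    exact Finset.single_le_sum (f := fun i => ∑ j, |D i j|)
      (fun i _ => Finset.sum_nonneg fun j _ => abs_nonneg _) (Finset.mem_univ i)
  have hsph : ∀ v : EuclideanSpace ℝ (Fin n), v ≠ 0 → ‖v‖⁻¹ • v ∈ Metric.sphere
      (0 : EuclideanSpace ℝ (Fin n)) 1 := fun v hv => by
    rw [mem_sphere_zero_iff_norm, norm_smul, norm_inv, norm_norm, inv_mul_cancel₀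
      (norm_ne_zero_iff.2 hv)]
  have hscale : ∀ x v, v ≠ 0 → q x v v = ‖v‖ ^ 2 * q x (‖v‖⁻¹ • v) (‖v‖⁻¹ • v) := by
    intro x v hv
    rw [hhom, inv_pow, mul_inv_cancel_left₀ (pow_ne_zero _ (norm_ne_zero_iff.2 hv))]
  have hlow : ∀ x ∈ K, ∀ v, b * ‖v‖ ^ 2 ≤ q x v v := by
    intro x hx v
    rcases eq_or_ne v 0 with rfl | hv
    · simp
    · rw [hscale x v hv]
      nlinarith [hb x hx _ (hsph v hv), sq_nonneg ‖v‖]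
  have hupp : ∀ x ∈ K, ∀ v, q x v v ≤ |B| * ‖v‖ ^ 2 := by
    intro x hx v
    rcases eq_or_ne v 0 with rfl | hv
    · simp
    · rw [hscale x v hv]
      have := (le_abs_self _).trans ((hB _ (mk_mem_prod hx (hsph v hv))).trans (le_abs_self B))
      nlinarith [sq_nonneg ‖v‖]
  have hsb : 0 < Real.sqrt b := Real.sqrt_pos.2 hb0
  have hlow' : ∀ x ∈ K, ∀ v, Real.sqrt b * ‖v‖ ≤ Real.sqrt (q x v v) := by
    intro x hx v
    rw [← Real.sqrt_sq (norm_nonneg v), ← Real.sqrt_mul hb0.le]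
    exact Real.sqrt_le_sqrt (hlow x hx v)
  have hlipq : ∀ x ∈ K, ∀ y ∈ K, ∀ v, |q x v v - q y v v| ≤ n ^ 2 * D * ‖x - y‖ * ‖v‖ ^ 2 := by
    intro x hx y hy v
    rw [hexp, hexp, ← Finset.sum_sub_distrib]
    have h1 : ∀ i j, |v i * v j * q x (coordVec i) (coordVec j) -
        v i * v j * q y (coordVec i) (coordVec j)| ≤ ‖v‖ ^ 2 * (D * ‖x - y‖) := by
      intro i j
      rw [← mul_sub, abs_mul, abs_mul, sq]
      have hi := PiLp.norm_apply_le v i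
      have hj := PiLp.norm_apply_le v j
      rw [Real.norm_eq_abs] at hi hj
      exact mul_le_mul (mul_le_mul hi hj (abs_nonneg _) (norm_nonneg _)) (hD i j x hx y hy)
        (abs_nonneg _) (by positivity)
    calc _ ≤ ∑ i : Fin n, |∑ j, v i * v j * q x (coordVec i) (coordVec j) -
        ∑ j, v i * v j * q y (coordVec i) (coordVec j)| := Finset.abs_sum_le_sum_abs _ _
      _ ≤ ∑ i : Fin n, ∑ j : Fin n, ‖v‖ ^ 2 * (D * ‖x - y‖) := by
        refine Finset.sum_le_sum fun i _ => ?_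
        rw [← Finset.sum_sub_distrib]
        exact (Finset.abs_sum_le_sum_abs _ _).trans (Finset.sum_le_sum fun j _ => h1 i j)
      _ = _ := by simp; ring
  refine ⟨1 + (Real.sqrt b)⁻¹ + Real.sqrt |B|, n ^ 2 * D / Real.sqrt b, ?_, by positivity, ?_, ?_,
    ?_, ?_⟩
  · have := inv_pos.2 hsb
    linarith [Real.sqrt_nonneg |B|]
  · intro x hx v
    have h1 := hlow' x hx v
    have h2 : ‖v‖ ≤ (Real.sqrt b)⁻¹ * Real.sqrt (q x v v) := by
      rw [inv_mul_eq_div, le_div_iff₀ hsb]; linarith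
    refine h2.trans (mul_le_mul_of_nonneg_right ?_ (Real.sqrt_nonneg _))
    linarith [Real.sqrt_nonneg |B|]
  · intro x hx v
    have h2 : Real.sqrt (q x v v) ≤ Real.sqrt |B| * ‖v‖ := by
      rw [← Real.sqrt_sq (norm_nonneg v), ← Real.sqrt_mul (abs_nonneg B)]
      exact Real.sqrt_le_sqrt (hupp x hx v)
    refine h2.trans (mul_le_mul_of_nonneg_right ?_ (norm_nonneg _))
    have := inv_pos.2 hsb
    linarith
  · intro x hx y hy v
    rcases eq_or_ne v 0 with rfl | hv
    · simp
    have hvp := norm_pos_iff.2 hv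
    have h1 := hlow' x hx v
    have h2 := Real.sqrt_nonneg (q y v v)
    have h3 := hlipq x hx y hy v
    have h4 : (Real.sqrt (q x v v) - Real.sqrt (q y v v)) *
        (Real.sqrt (q x v v) + Real.sqrt (q y v v)) = q x v v - q y v v := by
      have e1 := Real.mul_self_sqrt (hnn x (hKU hx) v)
      have e2 := Real.mul_self_sqrt (hnn y (hKU hy) v)
      linarith
    rw [← h4, abs_mul, abs_of_nonneg (a := Real.sqrt (q x v v) + Real.sqrt (q y v v))
      (by positivity)] at h3
    have h5 : |Real.sqrt (q x v v) - Real.sqrt (q y v v)| * (Real.sqrt b * ‖v‖) ≤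
        n ^ 2 * D * ‖x - y‖ * ‖v‖ ^ 2 :=
      (mul_le_mul_of_nonneg_left (by linarith) (abs_nonneg _)).trans h3
    rw [div_mul_eq_mul_div, div_mul_eq_mul_div, le_div_iff₀ hsb]
    refine le_of_mul_le_mul_right ?_ hvp
    calc _ = |Real.sqrt (q x v v) - Real.sqrt (q y v v)| * (Real.sqrt b * ‖v‖) := by ring
      _ ≤ _ := h5
      _ = _ := by ring
  · intro x hx t v
    rw [hhom, Real.sqrt_mul (sq_nonneg t), Real.sqrt_sq_eq_abs]

end NormField

section Metric

open scoped Bundle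

variable {n : ℕ} {M : Type*} [TopologicalSpace M] [ChartedSpace (EuclideanSpace ℝ (Fin n)) M]
  [IsManifold (𝓡 n) ∞ M]

namespace RiemMetric

/-- The norms on the tangent spaces given by a metric. -/
@[reducible] def enorm (h : RiemMetric n M) (m : M) : ENorm (TangentSpace (𝓡 n) m) :=
  ⟨fun v => ENNReal.ofReal (Real.sqrt (h.inner m v v))⟩

theorem enorm_eq (h : RiemMetric n M) :
    letI : Bundle.RiemannianBundle (fun m : M => TangentSpace (𝓡 n) m) := ⟨h.toRiemannianMetric⟩
    (fun m : M => (inferInstance : ENorm (TangentSpace (𝓡 n) m))) = h.enorm := by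
  let : Bundle.RiemannianBundle (fun m : M => TangentSpace (𝓡 n) m) := ⟨h.toRiemannianMetric⟩
  funext m
  refine congrArg ENorm.mk ?_
  funext v
  change ‖v‖ₑ = _
  rw [← ofReal_norm, norm_eq_sqrt_real_inner]
  rfl

theorem dist_self_comm (h : RiemMetric n M) (p q : M) : h.dist p q = h.dist q p := by
  let : Bundle.RiemannianBundle (fun m : M => TangentSpace (𝓡 n) m) := ⟨h.toRiemannianMetric⟩
  unfold RiemMetric.dist
  change @Manifold.riemannianEDist _ _ _ _ _ (𝓡 n) M _ _ h.enorm p q =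
    @Manifold.riemannianEDist _ _ _ _ _ (𝓡 n) M _ _ h.enorm q p
  rw [← h.enorm_eq]
  have : IsManifold (𝓡 n) 1 M := IsManifold.of_le (n := ∞) (by simp)
  exact Manifold.riemannianEDist_comm

theorem dist_triangle (h : RiemMetric n M) (p q z : M) : h.dist p z ≤ h.dist p q + h.dist q z := by
  let : Bundle.RiemannianBundle (fun m : M => TangentSpace (𝓡 n) m) := ⟨h.toRiemannianMetric⟩
  unfold RiemMetric.dist
  change @Manifold.riemannianEDist _ _ _ _ _ (𝓡 n) M _ _ h.enorm p z ≤
    @Manifold.riemannianEDist _ _ _ _ _ (𝓡 n) M _ _ h.enorm p q +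
    @Manifold.riemannianEDist _ _ _ _ _ (𝓡 n) M _ _ h.enorm q z
  rw [← h.enorm_eq]
  have : IsManifold (𝓡 n) 1 M := IsManifold.of_le (n := ∞) (by simp)
  exact Manifold.riemannianEDist_triangle

theorem eventually_dist_lt (h : RiemMetric n M) (p : M) {c : ENNReal} (hc : 0 < c) :
    ∀ᶠ q in 𝓝 p, h.dist p q < c := by
  let : Bundle.RiemannianBundle (fun m : M => TangentSpace (𝓡 n) m) := ⟨h.toRiemannianMetric⟩
  unfold RiemMetric.dist
  change ∀ᶠ q in 𝓝 p, @Manifold.riemannianEDist _ _ _ _ _ (𝓡 n) M _ _ h.enorm p q < c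
  rw [← h.enorm_eq]
  have : IsManifold (𝓡 n) 1 M := IsManifold.of_le (n := ∞) (by simp)
  have : IsContinuousRiemannianBundle (EuclideanSpace ℝ (Fin n))
      (fun m : M => TangentSpace (𝓡 n) m) := ⟨h.inner, h.contMDiff.continuous, fun _ _ _ => rfl⟩
  exact _root_.eventually_riemannianEDist_lt (𝓡 n) p hc

theorem exists_dist_lt_subset [RegularSpace M] (h : RiemMetric n M) {p : M} {U : Set M}
    (hU : U ∈ 𝓝 p) : ∃ c : ENNReal, 0 < c ∧ ∀ q, h.dist p q < c → q ∈ U := by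
  let : Bundle.RiemannianBundle (fun m : M => TangentSpace (𝓡 n) m) := ⟨h.toRiemannianMetric⟩
  unfold RiemMetric.dist
  change ∃ c : ENNReal, 0 < c ∧ ∀ q,
    @Manifold.riemannianEDist _ _ _ _ _ (𝓡 n) M _ _ h.enorm p q < c → q ∈ U
  rw [← h.enorm_eq]
  have : IsManifold (𝓡 n) 1 M := IsManifold.of_le (n := ∞) (by simp)
  have : IsContinuousRiemannianBundle (EuclideanSpace ℝ (Fin n))
      (fun m : M => TangentSpace (𝓡 n) m) := ⟨h.inner, h.contMDiff.continuous, fun _ _ _ => rfl⟩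
  obtain ⟨c, hc, hcU⟩ := _root_.setOfPred_riemannianEDist_lt_subset_nhds' (𝓡 n) hU
  exact ⟨c, hc, fun q hq => hcU hq⟩

/-- The length of a path. -/
def length (h : RiemMetric n M) (γ : ℝ → M) (a b : ℝ) : ENNReal :=
  ∫⁻ t in Ioo a b, ENNReal.ofReal (Real.sqrt (h.inner (γ t)
    (mfderiv 𝓘(ℝ, ℝ) (𝓡 n) γ t (1 : ℝ)) (mfderiv 𝓘(ℝ, ℝ) (𝓡 n) γ t (1 : ℝ))))

theorem length_eq (h : RiemMetric n M) (γ : ℝ → M) (a b : ℝ) :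
    h.length γ a b = @Manifold.pathELength _ _ _ _ _ (𝓡 n) M _ _ h.enorm γ a b := by
  let := h.enorm
  rw [Manifold.pathELength_eq_lintegral_mfderiv_Ioo]
  rfl

theorem length_mono (h : RiemMetric n M) (γ : ℝ → M) {a b a' b' : ℝ} (ha : a' ≤ a) (hb : b ≤ b') :
    h.length γ a b ≤ h.length γ a' b' :=
  lintegral_mono_set (Ioo_subset_Ioo ha hb)

theorem dist_le_length (h : RiemMetric n M) {γ : ℝ → M} {a b : ℝ} (hab : a ≤ b)
    (hγ : ContMDiffOn 𝓘(ℝ, ℝ) (𝓡 n) 1 γ (Icc a b)) : h.dist (γ a) (γ b) ≤ h.length γ a b := by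
  let : Bundle.RiemannianBundle (fun m : M => TangentSpace (𝓡 n) m) := ⟨h.toRiemannianMetric⟩
  rw [length_eq]
  unfold RiemMetric.dist
  change @Manifold.riemannianEDist _ _ _ _ _ (𝓡 n) M _ _ h.enorm (γ a) (γ b) ≤ _
  rw [← h.enorm_eq]
  exact Manifold.riemannianEDist_le_pathELength hγ rfl rfl hab

theorem exists_path_of_dist_lt (h : RiemMetric n M) {p q : M} {c : ENNReal} (hc : h.dist p q < c) :
    ∃ γ : ℝ → M, γ 0 = p ∧ γ 1 = q ∧ ContMDiffOn 𝓘(ℝ, ℝ) (𝓡 n) 1 γ (Icc 0 1) ∧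
      h.length γ 0 1 < c := by
  simp only [length_eq]
  unfold RiemMetric.dist at hc
  let := h.enorm
  exact Manifold.exists_lt_of_riemannianEDist_lt hc

theorem isClosed_truncation (h : RiemMetric n M) (𝒵 : Finset (Set M)) (ε : ℝ) :
    IsClosed (truncation 𝒵 h ε) := by
  rw [← isOpen_compl_iff, isOpen_iff_mem_nhds]
  intro m hm
  have hm' : ⨅ z ∈ divisorSupport 𝒵, h.dist m z < ENNReal.ofReal ε := not_le.1 hm
  simp only [iInf_lt_iff] at hm'
  obtain ⟨z, hz, hmz⟩ := hm'
  filter_upwards [h.eventually_dist_lt m (tsub_pos_of_lt hmz)] with p hp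
  refine not_le.2 (lt_of_le_of_lt (iInf₂_le (f := fun z _ => h.dist p z) z hz)
    ((h.dist_triangle p m z).trans_lt ?_))
  rw [h.dist_self_comm p m]
  calc _ < (ENNReal.ofReal ε - h.dist m z) + h.dist m z :=
        ENNReal.add_lt_add_right hmz.ne_top hp
    _ = _ := tsub_add_cancel_of_le hmz.le

theorem exists_dist_lt_uniform [RegularSpace M] (h : RiemMetric n M) {K U : Set M}
    (hK : IsCompact K) (hU : IsOpen U) (hKU : K ⊆ U) :
    ∃ δ : ℝ, 0 < δ ∧ ∀ p ∈ K, ∀ q, h.dist p q < ENNReal.ofReal δ → q ∈ U := by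
  classical
  have h1 : ∀ p ∈ K, ∃ c : ENNReal, 0 < c ∧ ∀ q, h.dist p q < c → q ∈ U := fun p hp =>
    h.exists_dist_lt_subset (hU.mem_nhds (hKU hp))
  choose! c hc hcU using h1
  obtain ⟨t, ht⟩ := hK.elim_nhds_subcover' (fun p hp => {q | h.dist p q < c p / 2})
    (fun p hp => h.eventually_dist_lt p (ENNReal.half_pos (hc p hp).ne'))
  obtain ⟨δ, hδ, hδt⟩ : ∃ δ : ℝ, 0 < δ ∧ ∀ p ∈ t, ENNReal.ofReal δ ≤ c p / 2 := by
    clear ht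
    induction t using Finset.induction with
    | empty => exact ⟨1, one_pos, by simp⟩
    | insert p t _ ih =>
      obtain ⟨δ, hδ, hδt⟩ := ih
      have hp := ENNReal.half_pos (hc p p.2).ne'
      obtain ⟨δ', hδ', hδp⟩ : ∃ δ' : ℝ, 0 < δ' ∧ ENNReal.ofReal δ' ≤ c p / 2 := by
        obtain ⟨r, hr0, hr⟩ := ENNReal.lt_iff_exists_nnreal_btwn.1 hp
        exact ⟨r, by exact_mod_cast hr0, by simpa using hr.le⟩
      refine ⟨min δ δ', lt_min hδ hδ', fun p' hp' => ?_⟩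
      rcases Finset.mem_insert.1 hp' with rfl | hp'
      · exact (ENNReal.ofReal_le_ofReal (min_le_right _ _)).trans hδp
      · exact (ENNReal.ofReal_le_ofReal (min_le_left _ _)).trans (hδt p' hp')
  refine ⟨δ, hδ, fun p hp q hpq => ?_⟩
  obtain ⟨p', hp't, hpp'⟩ := mem_iUnion₂.1 (ht hp)
  refine hcU p' p'.2 q ((h.dist_triangle p' p q).trans_lt ?_)
  calc _ < c p' / 2 + c p' / 2 := ENNReal.add_lt_add hpp' (hpq.trans_le (hδt p' hp't))
    _ = c p' := ENNReal.add_halves _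

end RiemMetric

end Metric

section ChartMetric

open scoped Bundle

variable {n : ℕ} {M : Type*} [TopologicalSpace M] [ChartedSpace (EuclideanSpace ℝ (Fin n)) M]
  [IsManifold (𝓡 n) ∞ M]

namespace RiemMetric

/-- The scalar products of a metric, read in a chart. -/
def chartForm (h : RiemMetric n M) (e : OpenPartialHomeomorph M (EuclideanSpace ℝ (Fin n)))
    (x : EuclideanSpace ℝ (Fin n)) :
    EuclideanSpace ℝ (Fin n) →ₗ[ℝ] EuclideanSpace ℝ (Fin n) →ₗ[ℝ] ℝ :=
  let D : EuclideanSpace ℝ (Fin n) →L[ℝ] TangentSpace (𝓡 n) (e.symm x) :=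
    mfderiv (𝓡 n) (𝓡 n) e.symm x
  LinearMap.mk₂ ℝ (fun v w => h.inner (e.symm x) (D v) (D w))
    (by simp) (by simp) (by simp) (by simp)

theorem contDiffOn_chartForm (h : RiemMetric n M)
    {e : OpenPartialHomeomorph M (EuclideanSpace ℝ (Fin n))} (he : IsSmoothChart n e)
    (i j : Fin n) :
    ContDiffOn ℝ 1 (fun x => h.chartForm e x (coordVec i) (coordVec j)) e.target := by
  let : Bundle.RiemannianBundle (fun m : M => TangentSpace (𝓡 n) m) := ⟨h.toRiemannianMetric⟩
  have : IsContMDiffRiemannianBundle (𝓡 n) ∞ (EuclideanSpace ℝ (Fin n))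
      (fun m : M => TangentSpace (𝓡 n) m) := ⟨h.inner, h.contMDiff, fun _ _ _ => rfl⟩
  have h1 : ∀ i, ∀ m ∈ e.source, ContMDiffAt (𝓡 n) (𝓡 n).tangent ∞
      (fun m => (⟨m, chartVec e i m⟩ : TangentBundle (𝓡 n) M)) m :=
    fun i m hm => contMDiffAt_chartVec he hm i
  intro x hx
  have hm := e.map_target hx
  have h2 := ContMDiffAt.inner_bundle (h1 i _ hm) (h1 j _ hm)
  have h3 := (contMDiffAt_iff_contDiffAt.1 (h2.comp x (he.contMDiffAt_symm hx)))
  refine (ContDiffAt.of_le (h3.congr_of_eventuallyEq ?_) (by simp)).contDiffWithinAt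
  filter_upwards [e.open_target.mem_nhds hx] with y hy
  simp only [Function.comp]
  change h.inner _ _ _ = h.inner _ (chartVec e i (e.symm y)) (chartVec e j (e.symm y))
  unfold chartVec
  rw [e.right_inv hy]
  rfl

theorem chartForm_pos (h : RiemMetric n M)
    {e : OpenPartialHomeomorph M (EuclideanSpace ℝ (Fin n))} (he : IsSmoothChart n e)
    {x : EuclideanSpace ℝ (Fin n)} (hx : x ∈ e.target) {v : EuclideanSpace ℝ (Fin n)}
    (hv : v ≠ 0) : 0 < h.chartForm e x v v := by
  refine h.pos _ _ fun h0 => hv ?_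
  have h1 := he.mfderiv_mfderiv_symm (e.map_target hx) v
  rw [e.right_inv hx] at h1
  rw [← h1]
  exact (congrArg _ h0).trans (map_zero _)

/-- The norms of a metric, read in a chart. -/
def chartNorm (h : RiemMetric n M) (e : OpenPartialHomeomorph M (EuclideanSpace ℝ (Fin n)))
    (x v : EuclideanSpace ℝ (Fin n)) : ℝ :=
  Real.sqrt (h.chartForm e x v v)

variable {h : RiemMetric n M} {e : OpenPartialHomeomorph M (EuclideanSpace ℝ (Fin n))} {γ : ℝ → M}
  {b : ℝ}

theorem contDiffOn_chart_comp (he : IsSmoothChart n e)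
    (hγ : ContMDiffOn 𝓘(ℝ, ℝ) (𝓡 n) 1 γ (Icc 0 b)) (hs : ∀ t ∈ Icc 0 b, γ t ∈ e.source) :
    ContDiffOn ℝ 1 (e ∘ γ) (Icc 0 b) := by
  rw [← contMDiffOn_iff_contDiffOn]
  exact (he.contMDiffOn.of_le (by simp)).comp hγ hs

theorem length_eq_chart (he : IsSmoothChart n e)
    (hγ : ContMDiffOn 𝓘(ℝ, ℝ) (𝓡 n) 1 γ (Icc 0 b)) (hs : ∀ t ∈ Icc 0 b, γ t ∈ e.source) :
    h.length γ 0 b =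
      ∫⁻ t in Ioo 0 b, ENNReal.ofReal (h.chartNorm e (e (γ t)) (deriv (e ∘ γ) t)) := by
  refine setLIntegral_congr_fun measurableSet_Ioo fun t ht => ?_
  have hts := hs t (Ioo_subset_Icc_self ht)
  have h1 : MDifferentiableAt 𝓘(ℝ, ℝ) (𝓡 n) γ t :=
    ((hγ t (Ioo_subset_Icc_self ht)).contMDiffAt (Icc_mem_nhds ht.1 ht.2)).mdifferentiableAt
      (by simp)
  have h2 : MDifferentiableAt (𝓡 n) 𝓘(ℝ, EuclideanSpace ℝ (Fin n)) e (γ t) :=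
    (he.contMDiffAt hts).mdifferentiableAt (by simp)
  let A : ℝ →L[ℝ] EuclideanSpace ℝ (Fin n) :=
    (mfderiv (𝓡 n) 𝓘(ℝ, EuclideanSpace ℝ (Fin n)) e (γ t)).comp (mfderiv 𝓘(ℝ, ℝ) (𝓡 n) γ t)
  have h3 : HasFDerivAt (e ∘ γ) A t :=
    hasMFDerivAt_iff_hasFDerivAt.1 (h2.hasMFDerivAt.comp t h1.hasMFDerivAt)
  set u : TangentSpace (𝓡 n) (γ t) := mfderiv 𝓘(ℝ, ℝ) (𝓡 n) γ t (1 : ℝ) with hu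
  have h4 : deriv (e ∘ γ) t = mfderiv (𝓡 n) 𝓘(ℝ, EuclideanSpace ℝ (Fin n)) e (γ t) u :=
    h3.hasDerivAt.deriv
  have h5 := he.mfderiv_symm_mfderiv hts u
  refine congrArg (fun r => ENNReal.ofReal (Real.sqrt r)) ?_
  have h6 : ∀ p (hp : p = γ t) (w : TangentSpace (𝓡 n) p),
      (show EuclideanSpace ℝ (Fin n) from w) = u → h.inner (γ t) u u = h.inner p w w := by
    rintro p rfl w hw
    have hw' : w = u := hw
    rw [hw']
  let D : EuclideanSpace ℝ (Fin n) →L[ℝ] TangentSpace (𝓡 n) (e.symm (e (γ t))) :=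
    mfderiv (𝓡 n) (𝓡 n) e.symm (e (γ t))
  exact h6 (e.symm (e (γ t))) (e.left_inv hts) (D (deriv (e ∘ γ) t)) ((congrArg D h4).trans h5)

theorem ofReal_le_length (he : IsSmoothChart n e) (hb : 0 ≤ b)
    (hγ : ContMDiffOn 𝓘(ℝ, ℝ) (𝓡 n) 1 γ (Icc 0 b)) (hs : ∀ t ∈ Icc 0 b, γ t ∈ e.source)
    {F : Type*} [NormedAddCommGroup F] [NormedSpace ℝ F] [CompleteSpace F]
    (l : EuclideanSpace ℝ (Fin n) →L[ℝ] F) {a : ℝ} (ha : 0 ≤ a)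
    (hl : ∀ t ∈ Icc 0 b, ∀ v, a * ‖l v‖ ≤ h.chartNorm e (e (γ t)) v) :
    ENNReal.ofReal (a * ‖l (e (γ b) - e (γ 0))‖) ≤ h.length γ 0 b := by
  have hc := contDiffOn_chart_comp he hγ hs
  rw [length_eq_chart he hγ hs, ENNReal.ofReal_mul ha, ofReal_norm, map_sub]
  have h1 := enorm_sub_le_lintegral_deriv_of_contDiffOn_Icc
    (l.contDiff.comp_contDiffOn hc) hb
  rw [← restrict_Ioo_eq_restrict_Icc] at h1
  refine (mul_le_mul_right h1 _).trans ?_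
  rw [← lintegral_const_mul' _ _ ENNReal.ofReal_ne_top]
  refine setLIntegral_mono' measurableSet_Ioo fun t ht => ?_
  have h2 : DifferentiableAt ℝ (e ∘ γ) t :=
    ((hc t (Ioo_subset_Icc_self ht)).contDiffAt (Icc_mem_nhds ht.1 ht.2)).differentiableAt
      (by simp)
  have h3 : deriv (l ∘ (e ∘ γ)) t = l (deriv (e ∘ γ) t) :=
    (l.hasFDerivAt.comp_hasDerivAt t h2.hasDerivAt).deriv
  rw [h3, ← ofReal_norm, ← ENNReal.ofReal_mul ha]
  exact ENNReal.ofReal_le_ofReal (hl t (Ioo_subset_Icc_self ht) _)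

end RiemMetric

/-- The box of radius `R`. -/
def box (n : ℕ) (R : ℝ) : Set (EuclideanSpace ℝ (Fin n)) := {x | ∀ i, |x i| ≤ R}

theorem isCompact_box (R : ℝ) : IsCompact (box n R) := by
  have h1 : box n R = WithLp.toLp 2 '' (univ.pi fun _ => Icc (-R) R) := by
    ext x
    constructor
    · intro hx
      exact ⟨x.ofLp, fun i _ => abs_le.1 (hx i), rfl⟩
    · rintro ⟨y, hy, rfl⟩ i
      exact abs_le.2 (hy i (mem_univ i))
  rw [h1]
  exact (isCompact_univ_pi fun _ => isCompact_Icc).image (PiLp.continuous_toLp 2 _)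

theorem convex_box (R : ℝ) : Convex ℝ (box n R) := by
  intro x hx y hy a b ha hb hab i
  simp only [PiLp.add_apply, PiLp.smul_apply, smul_eq_mul]
  calc |a * x i + b * y i| ≤ a * |x i| + b * |y i| := by
        refine (abs_add_le _ _).trans ?_
        rw [abs_mul, abs_mul, abs_of_nonneg ha, abs_of_nonneg hb]
    _ ≤ a * R + b * R := by
        have := hx i
        have := hy i
        gcongr
    _ = R := by rw [← add_mul, hab, one_mul]

/-- The distance truncations, read in a chart of the divisor. -/
def chartTruncation (𝒵 : Finset (Set M)) (h : RiemMetric n M)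
    (e : OpenPartialHomeomorph M (EuclideanSpace ℝ (Fin n))) (ε : ℝ) :
    Set (EuclideanSpace ℝ (Fin n)) :=
  {x | x ∈ e.target ∧ e.symm x ∈ truncation 𝒵 h ε}

theorem measurableSet_chartTruncation (𝒵 : Finset (Set M)) (h : RiemMetric n M)
    (e : OpenPartialHomeomorph M (EuclideanSpace ℝ (Fin n))) (ε : ℝ) :
    MeasurableSet (chartTruncation 𝒵 h e ε) := by
  have h1 : chartTruncation 𝒵 h e ε =
      e.target \ (e.target ∩ e.symm ⁻¹' (truncation 𝒵 h ε)ᶜ) := by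
    ext x
    simp only [chartTruncation, mem_ofPred_eq, Set.mem_sdiff, mem_inter_iff, mem_preimage,
      mem_compl_iff]
    tauto
  rw [h1]
  exact e.open_target.measurableSet.diff (e.continuousOn_symm.isOpen_inter_preimage e.open_target
    (h.isClosed_truncation 𝒵 ε).isOpen_compl).measurableSet

end ChartMetric

section ChartMetric

variable {n : ℕ} {M : Type*} [TopologicalSpace M] [ChartedSpace (EuclideanSpace ℝ (Fin n)) M]
  [IsManifold (𝓡 n) ∞ M] {𝒵 : Finset (Set M)}
  {e : OpenPartialHomeomorph M (EuclideanSpace ℝ (Fin n))} {I : Finset (Fin n)}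
  {h : RiemMetric n M} {R L C ε : ℝ}

theorem IsDivisorChart.coNorm_le_of_dist_lt (he : IsDivisorChart 𝒵 e I)
    (hN : IsNormField (box n (2 * R)) L C (h.chartNorm e))
    {x : EuclideanSpace ℝ (Fin n)} (hx : x ∈ box n (2 * R)) (hxt : x ∈ e.target) (hε : 0 < ε)
    (hstay : ∀ q, h.dist (e.symm x) q < ENNReal.ofReal ε → q ∈ e.source ∧ e q ∈ box n (2 * R))
    {z : M} (hz : z ∈ divisorSupport 𝒵) (hd : h.dist (e.symm x) z < ENNReal.ofReal ε) :
    ∃ j ∈ I, |x j| * coNorm (h.chartNorm e) j x ≤ ε * (1 + C * (L * (L + 1)) * L ^ 2 * ε) := by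
  have hL := hN.one_le
  have hC := hN.nonneg
  have hs := he.isSmoothChart
  obtain ⟨γ, hγ0, hγ1, hγ, hlen⟩ := h.exists_path_of_dist_lt hd
  have hsub : ∀ t ∈ Icc (0 : ℝ) 1, γ t ∈ e.source ∧ e (γ t) ∈ box n (2 * R) := by
    intro t ht
    refine hstay _ ?_
    rw [← hγ0]
    exact (h.dist_le_length ht.1 (hγ.mono (Icc_subset_Icc le_rfl ht.2))).trans_lt
      ((h.length_mono γ le_rfl ht.2).trans_lt hlen)
  have h0 : e (γ 0) = x := by rw [hγ0, e.right_inv hxt]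
  have hdisp : ∀ t ∈ Icc (0 : ℝ) 1, ‖e (γ t) - x‖ ≤ L * ε := by
    intro t ht
    have h1 := RiemMetric.ofReal_le_length (h := h) hs ht.1 (hγ.mono (Icc_subset_Icc le_rfl ht.2))
      (fun τ hτ => (hsub τ ⟨hτ.1, hτ.2.trans ht.2⟩).1)
      (ContinuousLinearMap.id ℝ (EuclideanSpace ℝ (Fin n))) (a := L⁻¹) (by positivity)
      (fun τ hτ v => by
        rw [inv_mul_le_iff₀ (by positivity)]
        exact hN.lower _ (hsub τ ⟨hτ.1, hτ.2.trans ht.2⟩).2 v)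
    have h2 := (h1.trans (h.length_mono γ le_rfl ht.2)).trans_lt hlen
    rw [ENNReal.ofReal_lt_ofReal_iff hε, inv_mul_lt_iff₀ (by positivity), h0] at h2
    exact h2.le
  have h1m : (1 : ℝ) ∈ Icc (0 : ℝ) 1 := by simp
  obtain ⟨j, hj, hj0⟩ := (he.mem_divisorSupport_iff (hsub 1 h1m).1).1 (hγ1 ▸ hz)
  refine ⟨j, hj, ?_⟩
  set D := C * (L * (L + 1)) with hD
  have hD0 : 0 ≤ D := by positivity
  set a := coNorm (h.chartNorm e) j x - D * (L * ε) with ha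
  have hxj : |x j| ≤ L * ε := by
    have h1 := (PiLp.norm_apply_le (e (γ 1) - x) j).trans (hdisp 1 h1m)
    rwa [PiLp.sub_apply, hj0, zero_sub, norm_neg, Real.norm_eq_abs] at h1
  have key : |x j| * a ≤ ε := by
    rcases le_or_gt a 0 with h1 | h1
    · nlinarith [abs_nonneg (x j)]
    · have h2 := RiemMetric.ofReal_le_length (h := h) hs zero_le_one hγ
        (fun τ hτ => (hsub τ hτ).1) (EuclideanSpace.proj (𝕜 := ℝ) j) h1.le
        (fun τ hτ v => by
          refine le_trans ?_ (hN.abs_mul_coNorm_le (hsub τ hτ).2 j v)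
          change a * |v j| ≤ _
          rw [mul_comm]
          refine mul_le_mul_of_nonneg_left ?_ (abs_nonneg _)
          have h3 := (abs_le.1 (hN.abs_coNorm_sub_le hx (hsub τ hτ).2 j)).2
          rw [norm_sub_rev] at h3
          have h4 := mul_le_mul_of_nonneg_left (hdisp τ hτ) hD0
          linarith)
      have h5 := h2.trans_lt hlen
      rw [ENNReal.ofReal_lt_ofReal_iff hε, h0] at h5
      change a * |(e (γ 1) - x) j| < ε at h5
      rw [PiLp.sub_apply, hj0, zero_sub, abs_neg, mul_comm] at h5
      exact h5.le
  have h6 : |x j| * (D * (L * ε)) ≤ (L * ε) * (D * (L * ε)) :=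
    mul_le_mul_of_nonneg_right hxj (by positivity)
  have h7 : |x j| * coNorm (h.chartNorm e) j x = |x j| * a + |x j| * (D * (L * ε)) := by
    rw [ha]; ring
  rw [h7]
  calc _ ≤ ε + (L * ε) * (D * (L * ε)) := add_le_add key h6
    _ = _ := by ring

theorem IsDivisorChart.le_coNorm_of_le_dist (he : IsDivisorChart 𝒵 e I)
    (hN : IsNormField (box n (2 * R)) L C (h.chartNorm e)) (hR : 0 < R)
    (hbox : box n (2 * R) ⊆ e.target)
    {x : EuclideanSpace ℝ (Fin n)} (hx : x ∈ box n R) (hε : 0 < ε)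
    (hεR : L * ε * (L * (L + 1)) ≤ R)
    (hd : ∀ z ∈ divisorSupport 𝒵, ENNReal.ofReal ε ≤ h.dist (e.symm x) z) {j : Fin n}
    (hj : j ∈ I) :
    ε * (1 - C * (L * (L + 1)) ^ 2 * L ^ 2 * ε) ≤ |x j| * coNorm (h.chartNorm e) j x := by
  have hL := hN.one_le
  have hC := hN.nonneg
  have hs := he.isSmoothChart
  have hx2 : x ∈ box n (2 * R) := fun i => (hx i).trans (by linarith)
  set D := C * (L * (L + 1)) ^ 2 * L ^ 2 with hD
  have hD0 : 0 ≤ D := by positivity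
  rcases le_or_gt ε (|x j| * coNorm (h.chartNorm e) j x) with h1 | h1
  · nlinarith [mul_nonneg hD0 (sq_nonneg ε)]
  have hc := hN.coNorm_lower hx2 j
  have hxj : |x j| ≤ L * ε := by
    have h2 := mul_le_mul_of_nonneg_left hc (abs_nonneg (x j))
    rw [mul_inv_le_iff₀ (by positivity)] at h2
    nlinarith
  suffices hη : ∀ η, 0 < η → ε ≤ |x j| * coNorm (h.chartNorm e) j x + D * ε ^ 2 + L * ε * η by
    have : ε ≤ |x j| * coNorm (h.chartNorm e) j x + D * ε ^ 2 := by
      refine le_of_forall_pos_le_add fun η hη' => ?_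
      have h2 := hη (η / (L * ε)) (by positivity)
      rwa [mul_div_cancel₀ _ (by positivity)] at h2
    nlinarith
  intro η hη
  obtain ⟨v, hv, hv1, hv2⟩ := hN.exists_coNorm hx2 j (lt_min hη one_pos) (min_le_right η 1)
  set y : ℝ → EuclideanSpace ℝ (Fin n) := fun t => x + t • (-(x j) • v) with hy
  have hydiff : ∀ t ∈ Icc (0 : ℝ) 1, ‖x - y t‖ ≤ L * ε * (L * (L + 1)) := by
    intro t ht
    have : x - y t = (t * x j) • v := by
      simp only [hy]
      rw [sub_add_cancel_left, ← smul_neg, ← neg_smul, neg_neg, smul_smul]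
    rw [this, norm_smul, Real.norm_eq_abs, abs_mul, abs_of_nonneg ht.1]
    refine mul_le_mul ?_ hv2 (norm_nonneg _) (by positivity)
    nlinarith [abs_nonneg (x j), ht.2]
  have hyK : ∀ t ∈ Icc (0 : ℝ) 1, y t ∈ box n (2 * R) := by
    intro t ht i
    have h2 := (PiLp.norm_apply_le (x - y t) i).trans ((hydiff t ht).trans hεR)
    rw [PiLp.sub_apply, Real.norm_eq_abs] at h2
    have h3 := hx i
    rw [abs_le] at h2 h3 ⊢
    constructor <;> linarith
  have hyt : ∀ t ∈ Icc (0 : ℝ) 1, y t ∈ e.target := fun t ht => hbox (hyK t ht)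
  have hys : ContDiff ℝ 1 y := by fun_prop
  have hγ : ContMDiffOn 𝓘(ℝ, ℝ) (𝓡 n) 1 (e.symm ∘ y) (Icc 0 1) :=
    (hs.contMDiffOn_symm.of_le (by simp)).comp hys.contMDiff.contMDiffOn hyt
  have hsub : ∀ t ∈ Icc (0 : ℝ) 1, (e.symm ∘ y) t ∈ e.source := fun t ht => e.map_target (hyt t ht)
  have hy0 : y 0 = x := by simp [hy]
  have hy1 : y 1 j = 0 := by simp [hy, hv]
  have hz : e.symm (y 1) ∈ divisorSupport 𝒵 := by
    refine (he.mem_divisorSupport_iff (hsub 1 (by simp))).2 ?_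
    exact ⟨j, hj, by rw [Function.comp_apply, e.right_inv (hyt 1 (by simp)), hy1]⟩
  have hlen := (hd _ hz).trans ((le_of_eq (by
    rw [Function.comp_apply, Function.comp_apply, hy0])).trans
      (h.dist_le_length zero_le_one hγ))
  rw [RiemMetric.length_eq_chart hs hγ hsub] at hlen
  set B := |x j| * (coNorm (h.chartNorm e) j x + min η 1 + C * (L * ε * (L * (L + 1))) *
    (L * (L + 1))) with hB
  have hpt : ∀ t ∈ Ioo (0 : ℝ) 1, ENNReal.ofReal
      (h.chartNorm e (e ((e.symm ∘ y) t)) (deriv (e ∘ e.symm ∘ y) t)) ≤ ENNReal.ofReal B := by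
    intro t ht
    have ht' := Ioo_subset_Icc_self ht
    refine ENNReal.ofReal_le_ofReal ?_
    have h2 : deriv (e ∘ e.symm ∘ y) t = -(x j) • v := by
      have h3 : (e ∘ e.symm ∘ y) =ᶠ[𝓝 t] y := by
        filter_upwards [Ioo_mem_nhds ht.1 ht.2] with τ hτ
        exact e.right_inv (hyt τ (Ioo_subset_Icc_self hτ))
      rw [h3.deriv_eq]
      have : HasDerivAt y (-(x j) • v) t := by
        have h5 := ((hasDerivAt_id t).smul_const (-(x j) • v)).const_add x
        rwa [one_smul] at h5
      exact this.deriv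
    rw [h2, Function.comp_apply, e.right_inv (hyt t ht'), hN.smul _ (hyK t ht'), abs_neg, hB]
    refine mul_le_mul_of_nonneg_left ?_ (abs_nonneg _)
    have h4 := (abs_le.1 (hN.lip x hx2 _ (hyK t ht') v)).1
    have h5 : C * ‖x - y t‖ * ‖v‖ ≤ C * (L * ε * (L * (L + 1))) * (L * (L + 1)) :=
      mul_le_mul (mul_le_mul_of_nonneg_left (hydiff t ht') hC) hv2 (norm_nonneg _) (by positivity)
    linarith
  have hc0 : 0 ≤ coNorm (h.chartNorm e) j x := le_trans (by positivity) hc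
  have hB0 : 0 ≤ B := by positivity
  have h6 := hlen.trans (setLIntegral_mono' measurableSet_Ioo hpt)
  rw [setLIntegral_const, Real.volume_Ioo, sub_zero, ENNReal.ofReal_one, mul_one,
    ENNReal.ofReal_le_ofReal_iff hB0] at h6
  refine h6.trans ?_
  have h7 : |x j| * min η 1 ≤ L * ε * η :=
    mul_le_mul hxj (min_le_left _ _) (by positivity) (by positivity)
  have h8 : |x j| * (C * (L * ε * (L * (L + 1))) * (L * (L + 1))) ≤
      L * ε * (C * (L * ε * (L * (L + 1))) * (L * (L + 1))) :=
    mul_le_mul_of_nonneg_right hxj (by positivity)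
  calc B = |x j| * coNorm (h.chartNorm e) j x + |x j| * min η 1 +
        |x j| * (C * (L * ε * (L * (L + 1))) * (L * (L + 1))) := by rw [hB]; ring
    _ ≤ |x j| * coNorm (h.chartNorm e) j x + L * ε * η +
        L * ε * (C * (L * ε * (L * (L + 1))) * (L * (L + 1))) := by gcongr
    _ = _ := by rw [hD]; ring

/-- In a chart of the divisor, the distance truncations are cutoff sets. -/
theorem IsDivisorChart.exists_isCutoff [RegularSpace M] (he : IsDivisorChart 𝒵 e I)
    (h : RiemMetric n M) (hR : 0 < R) (hbox : box n (2 * R) ⊆ e.target) :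
    ∃ L C c, 1 ≤ L ∧ 0 ≤ C ∧
      IsCutoff I R L C (fun ε => WithLp.toLp 2 ⁻¹' (chartTruncation 𝒵 h e ε)) c := by
  have hs := he.isSmoothChart
  obtain ⟨L, C, hN⟩ := exists_isNormField e.open_target (isCompact_box (2 * R))
    (convex_box (2 * R)) hbox (fun i j => h.contDiffOn_chartForm hs i j)
    (fun x hx v hv => h.chartForm_pos hs hx hv)
  have hL := hN.one_le
  have hC := hN.nonneg
  have hbox1 : box n R ⊆ box n (2 * R) := fun x hx i => (hx i).trans (by linarith)
  have hK : IsCompact (e.symm '' box n R) :=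
    (isCompact_box R).image_of_continuousOn (e.continuousOn_symm.mono (hbox1.trans hbox))
  have hbo : IsOpen {x : EuclideanSpace ℝ (Fin n) | ∀ i, |x i| < 2 * R} := by
    simp only [ofPred_forall]
    exact isOpen_iInter_of_finite fun i => isOpen_lt (by fun_prop) continuous_const
  obtain ⟨δ, hδ, hstay⟩ := h.exists_dist_lt_uniform hK (e.isOpen_inter_preimage hbo) (by
    rintro _ ⟨x, hx, rfl⟩
    have hxt := hbox (hbox1 hx)
    refine ⟨e.map_target hxt, fun i => ?_⟩
    rw [e.right_inv hxt]
    exact (hx i).trans_lt (by linarith))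
  let A : (Fin n → ℝ) →L[ℝ] EuclideanSpace ℝ (Fin n) := (EuclideanSpace.equiv (Fin n) ℝ).symm
  have hA : ∀ x, A x = WithLp.toLp 2 x := fun x => rfl
  set C1 := C * (L * (L + 1)) * L ^ 2
  set C2 := C * (L * (L + 1)) ^ 2 * L ^ 2
  set C3 := L * (L * (L + 1)) / R
  set C4 := C * (L * (L + 1)) * ‖A‖
  have hC1 : 0 ≤ C1 := by positivity
  have hC2 : 0 ≤ C2 := by positivity
  have hC3 : 0 ≤ C3 := by positivity
  have hC4 : 0 ≤ C4 := by positivity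
  have hδ' : 0 ≤ δ⁻¹ := by positivity
  refine ⟨L, C1 + C2 + C3 + C4 + δ⁻¹, fun j x => coNorm (h.chartNorm e) j (WithLp.toLp 2 x), hL,
    by positivity, fun ε => ?_, ?_, ?_, ?_, ?_, ?_⟩
  · exact (PiLp.continuous_toLp 2 _).measurable (measurableSet_chartTruncation 𝒵 h e ε)
  · exact fun j x hx => hN.coNorm_lower (hbox1 hx) j
  · exact fun j x hx => hN.coNorm_upper (hbox1 hx) j
  · intro j x y hx hy
    refine (hN.abs_coNorm_sub_le (hbox1 hx) (hbox1 hy) j).trans ?_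
    rw [← hA, ← hA, ← map_sub]
    calc _ ≤ C * (L * (L + 1)) * (‖A‖ * ‖x - y‖) :=
          mul_le_mul_of_nonneg_left (A.le_opNorm _) (by positivity)
      _ = C4 * ‖x - y‖ := by ring
      _ ≤ _ := mul_le_mul_of_nonneg_right (by linarith) (norm_nonneg _)
  · intro ε hε hεC x hx hxS j hj
    have h1 := he.le_coNorm_of_le_dist hN hR hbox (x := WithLp.toLp 2 x) hx hε (by
      have h2 : C3 * ε ≤ 1 := by nlinarith
      calc L * ε * (L * (L + 1)) = C3 * ε * R := by simp only [C3]; field_simp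
        _ ≤ R := by nlinarith) (fun z hz => le_trans hxS.2 (iInf₂_le z hz)) hj
    refine le_trans ?_ h1
    have : C2 * ε ≤ (C1 + C2 + C3 + C4 + δ⁻¹) * ε :=
      mul_le_mul_of_nonneg_right (by linarith) hε.le
    nlinarith
  · intro ε hε hεC x hx hxS
    have hxt : WithLp.toLp 2 x ∈ e.target := hbox (hbox1 hx)
    have hnt : ¬ ENNReal.ofReal ε ≤ ⨅ z ∈ divisorSupport 𝒵, h.dist (e.symm (WithLp.toLp 2 x)) z :=
      fun hc => hxS ⟨hxt, hc⟩
    rw [not_le] at hnt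
    simp only [iInf_lt_iff] at hnt
    obtain ⟨z, hz, hdz⟩ := hnt
    have hεδ : ε ≤ δ := by
      have h2 : δ⁻¹ * ε ≤ 1 := by nlinarith
      rwa [inv_mul_le_iff₀ hδ, mul_one] at h2
    obtain ⟨j, hj, hle⟩ := he.coNorm_le_of_dist_lt hN (hbox1 hx) hxt hε (fun q hq => by
      have h3 := hstay _ (mem_image_of_mem _ hx) q (hq.trans_le (ENNReal.ofReal_le_ofReal hεδ))
      exact ⟨h3.1, fun i => (h3.2 i).le⟩) hz hdz
    refine ⟨j, hj, hle.trans ?_⟩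
    have : C1 * ε ≤ (C1 + C2 + C3 + C4 + δ⁻¹) * ε :=
      mul_le_mul_of_nonneg_right (by linarith) hε.le
    nlinarith

end ChartMetric

section Box

variable {n : ℕ} {I : Finset (Fin n)} {R K : ℝ} {f g : (Fin n → ℝ) → ℂ}

theorem IsBoxLipschitz.integrable_antisymm_div (hf : IsBoxLipschitz R K f) :
    Integrable fun x => antisymm I f x / ((∏ i ∈ I, x i : ℝ) : ℂ) := by
  refine Integrable.mono' ((integrable_boxWeight R).const_mul K) ?_
    (ae_of_all _ fun x => hf.norm_antisymm_div_le x)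
  refine (hf.measurable_antisymm.div ?_).aestronglyMeasurable
  exact measurable_prod_coord I

theorem IsBoxLipschitz.pvBox_add {K' : ℝ} (hf : IsBoxLipschitz R K f)
    (hg : IsBoxLipschitz R K' g) : pvBox I (f + g) = pvBox I f + pvBox I g := by
  unfold pvBox
  rw [← integral_add hf.integrable_antisymm_div hg.integrable_antisymm_div]
  congr 1
  funext x
  rw [← add_div]
  congr 1
  simp only [antisymm, Pi.add_apply, mul_add, Finset.sum_add_distrib]

theorem pvBox_const_mul (c : ℂ) : pvBox I (fun x => c * f x) = c * pvBox I f := by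
  unfold pvBox
  rw [← integral_const_mul]
  congr 1
  funext x
  rw [← mul_div_assoc]
  congr 1
  simp only [antisymm, Finset.mul_sum]
  refine Finset.sum_congr rfl fun s _ => ?_
  ring

theorem IsCutoff.eventually {L C : ℝ} :
    ∀ᶠ ε in 𝓝[>] (0 : ℝ), 0 < ε ∧ ε ≤ 1 ∧ C * ε ≤ 1 / 2 ∧ ε / (2 * L) ≤ 1 := by
  have h1 : Tendsto (fun ε : ℝ => C * ε) (𝓝[>] 0) (𝓝 0) :=
    ((continuous_const.mul continuous_id).tendsto' (0 : ℝ) 0 (by simp)).mono_left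
      nhdsWithin_le_nhds
  have h3 : Tendsto (fun ε : ℝ => ε / (2 * L)) (𝓝[>] 0) (𝓝 0) :=
    ((continuous_id.div_const _).tendsto' (0 : ℝ) 0 (by simp)).mono_left nhdsWithin_le_nhds
  have h2 : Tendsto (fun ε : ℝ => ε) (𝓝[>] 0) (𝓝 0) := tendsto_id.mono_left nhdsWithin_le_nhds
  filter_upwards [self_mem_nhdsWithin, h2.eventually (eventually_le_nhds one_pos),
    h1.eventually (eventually_le_nhds (by norm_num : (0 : ℝ) < 1 / 2)),
    h3.eventually (eventually_le_nhds one_pos)] with ε e1 e2 e3 e4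
  exact ⟨e1, e2, e3, e4⟩

theorem IsCutoff.tendsto {L C : ℝ} {S : ℝ → Set (Fin n → ℝ)} {c : Fin n → (Fin n → ℝ) → ℝ}
    (h : IsCutoff I R L C S c) (hR : 0 < R) (hL : 1 ≤ L) (hC : 0 ≤ C)
    (hf : IsBoxLipschitz R K f) :
    Tendsto (fun ε => ∫ x in S ε, f x / ((∏ i ∈ I, x i : ℝ) : ℂ)) (𝓝[>] 0) (𝓝 (pvBox I f)) := by
  have h1 : Tendsto (fun ε : ℝ => 2 * L * ε) (𝓝[>] 0) (𝓝[>] 0) := by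
    refine tendsto_nhdsWithin_iff.2 ⟨((continuous_const.mul continuous_id).tendsto'
      (0 : ℝ) 0 (by simp)).mono_left nhdsWithin_le_nhds, ?_⟩
    filter_upwards [self_mem_nhdsWithin] with ε hε
    have : (0 : ℝ) < ε := hε
    exact mul_pos (by linarith) this
  have h2 := hf.tendsto_pvBox (I := I) |>.comp h1
  have h3 : Tendsto (fun ε => (∫ x in S ε, f x / ((∏ i ∈ I, x i : ℝ) : ℂ)) -
      ∫ x in awayFrom I (2 * L * ε), f x / ((∏ i ∈ I, x i : ℝ) : ℂ)) (𝓝[>] 0) (𝓝 0) := by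
    refine squeeze_zero_norm' ?_ (by
      have h4 := Tendsto.const_mul K (tendsto_cutoffError n (R := R) (C := C) hL)
      rwa [mul_zero] at h4)
    filter_upwards [IsCutoff.eventually (L := L) (C := C)] with ε hε
    exact h.norm_sub_le hR hL hC hε.1 hε.2.1 hε.2.2.1 hf
  have h5 := h3.add h2
  rw [zero_add] at h5
  exact h5.congr fun ε => sub_add_cancel _ _

theorem IsCutoff.eventually_integrableOn {L C : ℝ} {S : ℝ → Set (Fin n → ℝ)}
    {c : Fin n → (Fin n → ℝ) → ℝ} (h : IsCutoff I R L C S c) (hL : 1 ≤ L)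
    (hf : IsBoxLipschitz R K f) :
    ∀ᶠ ε in 𝓝[>] (0 : ℝ), IntegrableOn (fun x => f x / ((∏ i ∈ I, x i : ℝ) : ℂ)) (S ε) := by
  filter_upwards [IsCutoff.eventually (L := L) (C := C)] with ε hε
  exact integrableOn_div_prod (div_pos hε.1 (by linarith)) hε.2.2.2 hf (h.measurable ε)
    fun x hx hxR i hi => h.le_abs hL hε.1 hε.2.2.1 hxR hx hi

end Box

section Euclidean

variable {n : ℕ}

/-- The identity from the sup norm to the Euclidean norm. -/
def toLpL (n : ℕ) : (Fin n → ℝ) →L[ℝ] EuclideanSpace ℝ (Fin n) :=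
  ((EuclideanSpace.equiv (Fin n) ℝ).symm : (Fin n → ℝ) →L[ℝ] EuclideanSpace ℝ (Fin n))

theorem isBoxLipschitz_of_contDiff {R B : ℝ} {f : EuclideanSpace ℝ (Fin n) → ℂ}
    (hf : ContDiff ℝ 1 f) (hsupp : ∀ x ∉ box n R, f x = 0) (hB : ∀ x, ‖f x‖ ≤ B)
    (hB' : ∀ x, ‖fderiv ℝ f x‖ ≤ B) :
    IsBoxLipschitz R (B * (1 + ‖toLpL n‖)) fun x => f (WithLp.toLp 2 x) := by
  have hB0 : 0 ≤ B := (norm_nonneg _).trans (hB 0)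
  refine ⟨fun x => (hB _).trans ?_, fun x y => ?_, fun x ⟨i, hi⟩ => hsupp _ fun h => ?_⟩
  · nlinarith [norm_nonneg (toLpL n)]
  · have h1 := convex_univ.norm_image_sub_le_of_norm_fderiv_le (𝕜 := ℝ) (f := f) (C := B)
      (fun z _ => hf.differentiable (by simp) z) (fun z _ => hB' z)
      (mem_univ (WithLp.toLp 2 y)) (mem_univ (WithLp.toLp 2 x))
    have h2 : ‖(WithLp.toLp 2 x : EuclideanSpace ℝ (Fin n)) - WithLp.toLp 2 y‖ ≤
        ‖toLpL n‖ * ‖x - y‖ := by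
      have := (toLpL n).le_opNorm (x - y)
      rwa [map_sub] at this
    calc _ ≤ B * (‖toLpL n‖ * ‖x - y‖) := h1.trans (mul_le_mul_of_nonneg_left h2 hB0)
      _ ≤ _ := by nlinarith [mul_nonneg hB0 (norm_nonneg (x - y))]
  · exact absurd (h i) (not_le.2 hi)

theorem exists_isBoxLipschitz {R : ℝ} {f : EuclideanSpace ℝ (Fin n) → ℂ}
    (hf : ContDiff ℝ 1 f) (hsupp : ∀ x ∉ box n R, f x = 0) :
    ∃ K, IsBoxLipschitz R K fun x => f (WithLp.toLp 2 x) := by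
  have hc : HasCompactSupport f := HasCompactSupport.intro (isCompact_box R) hsupp
  obtain ⟨B, hB⟩ := hc.exists_bound_of_continuous hf.continuous
  obtain ⟨B', hB'⟩ := (hc.fderiv (𝕜 := ℝ)).exists_bound_of_continuous
    (hf.continuous_fderiv (by simp))
  exact ⟨_, isBoxLipschitz_of_contDiff hf hsupp (fun x => (hB x).trans (le_max_left B B'))
    (fun x => (hB' x).trans (le_max_right B B'))⟩

theorem measurePreserving_toLp :
    MeasurePreserving (fun x : Fin n → ℝ => (WithLp.toLp 2 x : EuclideanSpace ℝ (Fin n))) :=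
  PiLp.volume_preserving_toLp (Fin n)

theorem measurableEmbedding_toLp :
    MeasurableEmbedding (fun x : Fin n → ℝ => (WithLp.toLp 2 x : EuclideanSpace ℝ (Fin n))) :=
  (MeasurableEquiv.toLp 2 (Fin n → ℝ)).measurableEmbedding

variable {M : Type*} [TopologicalSpace M] [ChartedSpace (EuclideanSpace ℝ (Fin n)) M]
  [IsManifold (𝓡 n) ∞ M] [RegularSpace M] {𝒵 : Finset (Set M)}
  {e : OpenPartialHomeomorph M (EuclideanSpace ℝ (Fin n))} {I : Finset (Fin n)} {R K : ℝ}
  {f : EuclideanSpace ℝ (Fin n) → ℂ}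

theorem IsDivisorChart.tendsto (he : IsDivisorChart 𝒵 e I) (h : RiemMetric n M) (hR : 0 < R)
    (hbox : box n (2 * R) ⊆ e.target) (hf : IsBoxLipschitz R K fun x => f (WithLp.toLp 2 x)) :
    Tendsto (fun ε => ∫ y in chartTruncation 𝒵 h e ε, f y / ((∏ i ∈ I, y i : ℝ) : ℂ)) (𝓝[>] 0)
      (𝓝 (pvBox I fun x => f (WithLp.toLp 2 x))) ∧
    ∀ᶠ ε in 𝓝[>] (0 : ℝ), IntegrableOn (fun y => f y / ((∏ i ∈ I, y i : ℝ) : ℂ))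
      (chartTruncation 𝒵 h e ε) := by
  obtain ⟨L, C, c, hL, hC, hcut⟩ := he.exists_isCutoff h hR hbox
  constructor
  · refine (hcut.tendsto hR hL hC hf).congr fun ε => ?_
    exact measurePreserving_toLp.setIntegral_preimage_emb measurableEmbedding_toLp
      (fun y : EuclideanSpace ℝ (Fin n) => f y / ((∏ i ∈ I, y i : ℝ) : ℂ)) _
  · refine (hcut.eventually_integrableOn hL hf).mono fun ε hε => ?_
    exact (measurePreserving_toLp.integrableOn_comp_preimage measurableEmbedding_toLp).1 hε

end Euclidean

section Density

variable {n : ℕ} {M : Type*} [TopologicalSpace M] [ChartedSpace (EuclideanSpace ℝ (Fin n)) M]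
  [IsManifold (𝓡 n) ∞ M]

theorem cast_tangent {d : ℕ} {X : Type*} [TopologicalSpace X]
    [ChartedSpace (EuclideanSpace ℝ (Fin d)) X] {p q : X} (h : p = q) (v : TangentSpace (𝓡 d) p) :
    (h ▸ v : TangentSpace (𝓡 d) q) = (show EuclideanSpace ℝ (Fin d) from v) := by
  subst h; rfl

/-- The chain rule for a change of parametrization. -/
theorem LocalParam.mfderiv_apply_of_eventuallyEq {d k : ℕ} {X : Type*} [TopologicalSpace X]
    [ChartedSpace (EuclideanSpace ℝ (Fin d)) X] {S : Set X} (P Q : LocalParam d k S)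
    {φ : EuclideanSpace ℝ (Fin k) → EuclideanSpace ℝ (Fin k)}
    {L : EuclideanSpace ℝ (Fin k) →L[ℝ] EuclideanSpace ℝ (Fin k)} {y : EuclideanSpace ℝ (Fin k)}
    (hφy : φ y ∈ Q.source) (hev : ∀ᶠ y' in 𝓝 y, Q.toFun (φ y') = P.toFun y')
    (hL : HasFDerivAt φ L y) (v : EuclideanSpace ℝ (Fin k)) :
    (show EuclideanSpace ℝ (Fin d) from mfderiv (𝓡 k) (𝓡 d) P.toFun y v) =
      (show EuclideanSpace ℝ (Fin d) from mfderiv (𝓡 k) (𝓡 d) Q.toFun (φ y) (L v)) := by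
  have h1 : MDifferentiableAt (𝓡 k) (𝓡 d) Q.toFun (φ y) :=
    ((Q.isImmersionAt _ hφy).contMDiffAt).mdifferentiableAt (by simp)
  have h2 := h1.hasMFDerivAt.comp y hL.hasMFDerivAt
  have h3 := h2.congr_of_eventuallyEq (f₁ := P.toFun) (hev.mono fun z hz => hz.symm)
  exact congrArg (fun A : EuclideanSpace ℝ (Fin k) →L[ℝ] EuclideanSpace ℝ (Fin d) => A v) h3.mfderiv

theorem isCompatible_integralDensity {μ : ∀ m : M, (Fin n → TangentSpace (𝓡 n) m) → ℂ}
    (hμ : ∀ m, IsHomogeneous (μ m)) :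
    IsCompatible (fun (P : LocalParam n n (univ : Set M)) y =>
      μ (P.toFun y) (fun i => mfderiv (𝓡 n) (𝓡 n) P.toFun y (coordVec i))) := by
  have : ∀ m : M, FiniteDimensional ℝ (TangentSpace (𝓡 n) m) := fun m =>
    inferInstanceAs (FiniteDimensional ℝ (EuclideanSpace ℝ (Fin n)))
  refine IsCompatible.of_homogeneous (W := fun m : M => TangentSpace (𝓡 n) m)
    (fun m _ => finrank_euclideanSpace_fin (𝕜 := ℝ) (n := n)) (fun m _ => hμ m)
    (D := fun P y => (mfderiv (𝓡 n) (𝓡 n) P.toFun y).toLinearMap) ?_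
  intro P Q φ L y _ hφy hev hL h v
  refine Eq.trans ?_ (cast_tangent h _).symm
  exact P.mfderiv_apply_of_eventuallyEq Q hφy hev hL v

theorem exists_nat_params {d k : ℕ} {X : Type*} [TopologicalSpace X]
    [ChartedSpace (EuclideanSpace ℝ (Fin d)) X] {S : Set X} {ι : Type*} [Countable ι] [Nonempty ι]
    (P : ι → LocalParam d k S) (hP : S ⊆ ⋃ i, (P i).toFun '' (P i).source) :
    ∃ P : ℕ → LocalParam d k S, S ⊆ ⋃ i, (P i).toFun '' (P i).source := by
  obtain ⟨f, hf⟩ := exists_surjective_nat ι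
  refine ⟨P ∘ f, hP.trans ?_⟩
  rw [← hf.iUnion_comp]
  rfl

end Density

namespace LieGroupoid

variable {n d : ℕ} {M G : Type*}
  [TopologicalSpace M] [ChartedSpace (EuclideanSpace ℝ (Fin n)) M] [IsManifold (𝓡 n) ∞ M]
  [TopologicalSpace G] [ChartedSpace (EuclideanSpace ℝ (Fin d)) G] [IsManifold (𝓡 d) ∞ G]
  {𝒢 : LieGroupoid n d M G} {𝒵 : Finset (Set M)} {oA : ∀ m, Orientation ℝ (𝒢.A m) (Fin n)}
  {oM : ∀ m : M, Orientation ℝ (TangentSpace (𝓡 n) m) (Fin n)}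

theorem isHomogeneous_signedDensity {φ : ∀ m, (Fin n → 𝒢.A m) → ℂ}
    (hφ : ∀ m, IsHomogeneous (φ m)) (m : M) : IsHomogeneous (𝒢.signedDensity oA oM φ m) := by
  intro T w
  by_cases h : Function.Bijective (𝒢.anchor m)
  · have h1 := (hφ m).comp_linearEquiv (LinearEquiv.ofBijective (𝒢.anchor m) h).symm T w
    simp only at h1
    simp only [signedDensity, dif_pos h, h1]
    ring
  · simp [signedDensity, dif_neg h]

namespace AdaptedChart

variable (C : 𝒢.AdaptedChart 𝒵 oA oM)

theorem isSmoothChart : IsSmoothChart n C.e := C.isDivisorChart.isSmoothChart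

theorem bWeight_ne_zero {m : M} (hm : m ∈ C.e.source) (hd : m ∉ divisorSupport 𝒵) (i : Fin n) :
    bWeight C.I i (C.e m) ≠ 0 := by
  intro h0
  rw [bWeight] at h0
  split_ifs at h0 with hi
  · exact hd ((C.isDivisorChart.mem_divisorSupport_iff hm).2 ⟨i, hi, h0⟩)
  · exact one_ne_zero h0

theorem prod_eq_zero_iff {m : M} (hm : m ∈ C.e.source) :
    ∏ i ∈ C.I, C.e m i = 0 ↔ m ∈ divisorSupport 𝒵 := by
  rw [Finset.prod_eq_zero_iff, C.isDivisorChart.mem_divisorSupport_iff hm]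

/-- The frame as a basis. -/
def basis {m : M} (hm : m ∈ C.e.source) : Module.Basis (Fin n) ℝ (𝒢.A m) :=
  Module.Basis.mk (C.isFrameOn.linearIndependent m hm) (C.isFrameOn.span_eq_top m hm).ge

theorem basis_apply {m : M} (hm : m ∈ C.e.source) (i : Fin n) : C.basis hm i = C.X m i :=
  Module.Basis.mk_apply _ _ i

theorem finrank_eq {m : M} (hm : m ∈ C.e.source) : Module.finrank ℝ (𝒢.A m) = n := by
  rw [Module.finrank_eq_card_basis (C.basis hm), Fintype.card_fin]

theorem anchor_injective {m : M} (hm : m ∈ C.e.source) (hd : m ∉ divisorSupport 𝒵) :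
    Function.Injective (𝒢.anchor m) := by
  refine (LinearMap.ker_eq_bot).1 (LinearMap.ker_eq_bot'.2 fun a ha => ?_)
  have h1 := (C.basis hm).sum_repr a
  rw [← h1, map_sum] at ha
  simp only [map_smul, C.basis_apply, C.anchor_eq m hm, smul_smul] at ha
  have h2 := Fintype.linearIndependent_iff.1 (linearIndependent_chartVec C.isSmoothChart hm) _ ha
  have h3 : ∀ i, (C.basis hm).repr a i = 0 := fun i =>
    (mul_eq_zero.1 (h2 i)).resolve_right (C.bWeight_ne_zero hm hd i)
  rw [← h1]
  simp [h3]

theorem anchor_bijective_iff {m : M} (hm : m ∈ C.e.source) :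
    Function.Bijective (𝒢.anchor m) ↔ m ∉ divisorSupport 𝒵 := by
  have : FiniteDimensional ℝ (TangentSpace (𝓡 n) m) :=
    inferInstanceAs (FiniteDimensional ℝ (EuclideanSpace ℝ (Fin n)))
  constructor
  · intro h hd
    obtain ⟨i, hi, h0⟩ := (C.isDivisorChart.mem_divisorSupport_iff hm).1 hd
    refine (C.isFrameOn.linearIndependent m hm).ne_zero i (h.1 ?_)
    rw [C.anchor_eq m hm, bWeight, if_pos hi, h0, zero_smul, map_zero]
  · intro hd
    have h1 := C.anchor_injective hm hd
    have : FiniteDimensional ℝ (𝒢.A m) := Module.Basis.finiteDimensional_of_finite (C.basis hm)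
    have h2 : Module.finrank ℝ (𝒢.A m) = Module.finrank ℝ (TangentSpace (𝓡 n) m) := by
      rw [C.finrank_eq hm]
      exact (finrank_euclideanSpace_fin (𝕜 := ℝ) (n := n)).symm
    exact ⟨h1, (LinearMap.injective_iff_surjective_of_finrank_eq_finrank h2).1 h1⟩

theorem signedDensity_eq {φ : ∀ m, (Fin n → 𝒢.A m) → ℂ} (hφ : ∀ m, IsHomogeneous (φ m))
    {y : EuclideanSpace ℝ (Fin n)} (hy : y ∈ C.e.target) :
    𝒢.signedDensity oA oM φ (C.e.symm y)
        (fun i => mfderiv (𝓡 n) (𝓡 n) C.e.symm y (coordVec i)) =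
      C.sgn * φ (C.e.symm y) (C.X (C.e.symm y)) / ((∏ i ∈ C.I, y i : ℝ) : ℂ) := by
  have hm := C.e.map_target hy
  have hy' := C.e.right_inv hy
  have hframe : (fun i => mfderiv (𝓡 n) (𝓡 n) C.e.symm y (coordVec i)) =
      fun i => chartVec C.e i (C.e.symm y) := by
    funext i
    unfold chartVec
    rw [hy']
  rw [hframe]
  generalize hmdef : C.e.symm y = m at *
  by_cases hd : m ∈ divisorSupport 𝒵
  · have h0 := (C.prod_eq_zero_iff hm).2 hd
    rw [hy'] at h0
    rw [signedDensity, dif_neg (fun h => (C.anchor_bijective_iff hm).1 h hd), h0]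
    simp
  have hb := (C.anchor_bijective_iff hm).2 hd
  have hw := C.bWeight_ne_zero hm hd
  have hinv : ∀ i, (LinearEquiv.ofBijective (𝒢.anchor m) hb).symm (chartVec C.e i m) =
      (bWeight C.I i (C.e m))⁻¹ • C.X m i := by
    intro i
    rw [LinearEquiv.symm_apply_eq, LinearEquiv.ofBijective_apply, map_smul, C.anchor_eq m hm,
      smul_smul, inv_mul_cancel₀ (hw i), one_smul]
  have : FiniteDimensional ℝ (𝒢.A m) := Module.Basis.finiteDimensional_of_finite (C.basis hm)
  have hsm := (hφ m).smul (C.finrank_eq hm) (fun i => (bWeight C.I i (C.e m))⁻¹) (C.X m)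
  rw [Finset.prod_inv_distrib, prod_bWeight, hy'] at hsm
  have hne : ∏ i ∈ C.I, y i ≠ 0 := by
    rw [← hy', Ne, C.prod_eq_zero_iff hm]; exact hd
  have hpres := C.preservesAt_iff m hm hd
  rw [hy'] at hpres
  simp only [signedDensity, dif_pos hb, hinv, hpres]
  rw [hy'] at *
  rw [hsm, abs_inv, mul_div_assoc]
  have key : (if 0 < C.sgn * ∏ i ∈ C.I, y i then (1 : ℂ) else -1) *
      ((|∏ i ∈ C.I, y i|⁻¹ : ℝ) : ℂ) = C.sgn * ((∏ i ∈ C.I, y i : ℝ) : ℂ)⁻¹ := by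
    have : (if 0 < C.sgn * ∏ i ∈ C.I, y i then (1 : ℝ) else -1) *
      |∏ i ∈ C.I, y i|⁻¹ = C.sgn * (∏ i ∈ C.I, y i)⁻¹ := by
      rcases C.sgn_eq with h | h <;> rw [h] <;>
      rcases hne.lt_or_gt with h1 | h1 <;>
      simp [h1, abs_of_neg, abs_of_pos, h1.not_gt, inv_neg]
    have h2 := congrArg (fun r : ℝ => (r : ℂ)) this
    push_cast at h2 ⊢
    rw [← h2]
    split_ifs <;> simp
  rw [← _root_.mul_assoc, key]
  ring

end AdaptedChart

end LieGroupoid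

namespace LieGroupoid

variable {n d : ℕ} {M G : Type*}
  [TopologicalSpace M] [ChartedSpace (EuclideanSpace ℝ (Fin n)) M] [IsManifold (𝓡 n) ∞ M]
  [TopologicalSpace G] [ChartedSpace (EuclideanSpace ℝ (Fin d)) G] [IsManifold (𝓡 d) ∞ G]

theorem exists_chart_cover (n : ℕ) (M : Type*) [TopologicalSpace M]
    [ChartedSpace (EuclideanSpace ℝ (Fin n)) M] [IsManifold (𝓡 n) ∞ M] [CompactSpace M]
    [Nonempty M] :
    ∃ P : ℕ → LocalParam n n (univ : Set M), univ ⊆ ⋃ i, (P i).toFun '' (P i).source := by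
  obtain ⟨t, ht⟩ := isCompact_univ.elim_finite_subcover
    (fun x : M => (chartAt (EuclideanSpace ℝ (Fin n)) x).source)
    (fun x => (chartAt (EuclideanSpace ℝ (Fin n)) x).open_source)
    (fun x _ => mem_iUnion.2 ⟨x, mem_chart_source _ x⟩)
  have hne : Nonempty t := by
    obtain ⟨x⟩ := ‹Nonempty M›
    obtain ⟨y, hy, -⟩ := mem_iUnion₂.1 (ht (mem_univ x))
    exact ⟨⟨y, hy⟩⟩
  refine exists_nat_params (ι := t) (fun x => chartParam (isSmoothChart_chartAt x.1)) ?_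
  intro x _
  obtain ⟨y, hy, hxy⟩ := mem_iUnion₂.1 (ht (mem_univ x))
  refine mem_iUnion.2 ⟨⟨y, hy⟩, ?_⟩
  change x ∈ (chartAt _ y).symm '' (chartAt _ y).target
  rwa [OpenPartialHomeomorph.symm_image_target_eq_source]

variable {𝒢 : LieGroupoid n d M G} {𝒵 : Finset (Set M)} {oA : ∀ m, Orientation ℝ (𝒢.A m) (Fin n)}
  {oM : ∀ m : M, Orientation ℝ (TangentSpace (𝓡 n) m) (Fin n)}

namespace AdaptedChart

/-- The coefficient of `ρ φ` in the frame of an adapted chart, as a function of the coordinates. -/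
def coef (C : 𝒢.AdaptedChart 𝒵 oA oM) (ρ : M → ℝ) (φ : ∀ m, (Fin n → 𝒢.A m) → ℂ) :
    EuclideanSpace ℝ (Fin n) → ℂ :=
  C.e.target.indicator ((fun m => ρ m • φ m (C.X m)) ∘ C.e.symm)

variable (C : 𝒢.AdaptedChart 𝒵 oA oM)

theorem coef_apply {ρ : M → ℝ} {φ : ∀ m, (Fin n → 𝒢.A m) → ℂ} {y : EuclideanSpace ℝ (Fin n)}
    (hy : y ∈ C.e.target) : C.coef ρ φ y = ρ (C.e.symm y) • φ (C.e.symm y) (C.X (C.e.symm y)) :=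
  indicator_of_mem hy _

theorem coef_add (ρ : M → ℝ) (φ ψ : ∀ m, (Fin n → 𝒢.A m) → ℂ) (y : EuclideanSpace ℝ (Fin n)) :
    C.coef ρ (φ + ψ) y = C.coef ρ φ y + C.coef ρ ψ y := by
  by_cases hy : y ∈ C.e.target
  · simp only [C.coef_apply hy, Pi.add_apply, smul_add]
  · simp [coef, indicator_of_notMem hy]

theorem coef_smul (ρ : M → ℝ) (c : ℂ) (φ : ∀ m, (Fin n → 𝒢.A m) → ℂ)
    (y : EuclideanSpace ℝ (Fin n)) : C.coef ρ (c • φ) y = c * C.coef ρ φ y := by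
  by_cases hy : y ∈ C.e.target
  · simp only [C.coef_apply hy, Pi.smul_apply, smul_eq_mul, Complex.real_smul]
    ring
  · simp [coef, indicator_of_notMem hy]

theorem contMDiffAt_density {φ : ∀ m, (Fin n → 𝒢.A m) → ℂ} (hφ : φ ∈ 𝒢.densities) {m : M}
    (hm : m ∈ C.e.source) : ContMDiffAt (𝓡 n) 𝓘(ℝ, ℂ) ∞ (fun m => φ m (C.X m)) m :=
  (hφ.2 _ _ C.isFrameOn).contMDiffAt (C.e.open_source.mem_nhds hm)

theorem contDiff_coef [CompactSpace M] {ρ : M → ℝ} (hρ : ContMDiff (𝓡 n) 𝓘(ℝ, ℝ) ∞ ρ)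
    (hs : tsupport ρ ⊆ C.e.source) {φ : ∀ m, (Fin n → 𝒢.A m) → ℂ} (hφ : φ ∈ 𝒢.densities) :
    ContDiff ℝ ∞ (C.coef ρ φ) := by
  have hss : tsupport (fun m => ρ m • φ m (C.X m)) ⊆ tsupport ρ := by
    refine closure_mono fun m hm h0 => hm ?_
    simp [h0]
  exact C.isSmoothChart.contDiff_indicator
    (contMDiff_smul_of_tsupport hρ hs fun m hm => C.contMDiffAt_density hφ hm)
    (HasCompactSupport.of_compactSpace _) (hss.trans hs)

/-- The integrals of a signed density over the distance truncations, in adapted charts. -/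
theorem truncatedIntegral_eq_sum [CompactSpace M] [Nonempty M] (h : RiemMetric n M)
    {φ : ∀ m, (Fin n → 𝒢.A m) → ℂ} (hφ : ∀ m, IsHomogeneous (φ m)) {α : Type*} [Fintype α]
    (C : α → 𝒢.AdaptedChart 𝒵 oA oM) (ρ : α → M → ℝ)
    (hsum : ∀ m, φ m ≠ 0 → ∑ a, ρ a m = 1)
    (hsupp : ∀ a m, φ m ≠ 0 → ρ a m ≠ 0 → m ∈ (C a).e.source) (ε : ℝ)
    (hint : ∀ a, IntegrableOn (fun y => (C a).coef (ρ a) φ y / ((∏ i ∈ (C a).I, y i : ℝ) : ℂ))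
      (chartTruncation 𝒵 h (C a).e ε)) :
    truncatedIntegral 𝒵 h (𝒢.signedDensity oA oM φ) ε =
      ∑ a, (C a).sgn * ∫ y in chartTruncation 𝒵 h (C a).e ε,
        (C a).coef (ρ a) φ y / ((∏ i ∈ (C a).I, y i : ℝ) : ℂ) := by
  classical
  have hnz : ∀ m w, (if m ∈ truncation 𝒵 h ε then 𝒢.signedDensity oA oM φ m w else 0) ≠ 0 →
      φ m ≠ 0 := by
    intro m w hm h0
    refine hm ?_
    split_ifs
    · simp [signedDensity, h0]
    · rfl
  have heq : ∀ a, ∀ y ∈ (C a).e.target, ((ρ a ((C a).e.symm y) : ℝ) : ℂ) *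
      (if (C a).e.symm y ∈ truncation 𝒵 h ε then 𝒢.signedDensity oA oM φ ((C a).e.symm y)
        (fun i => mfderiv (𝓡 n) (𝓡 n) (C a).e.symm y (coordVec i)) else 0) =
      (chartTruncation 𝒵 h (C a).e ε).indicator (fun y => ((C a).sgn : ℂ) *
        ((C a).coef (ρ a) φ y / ((∏ i ∈ (C a).I, y i : ℝ) : ℂ))) y := by
    intro a y hy
    by_cases ht : (C a).e.symm y ∈ truncation 𝒵 h ε
    · rw [if_pos ht, indicator_of_mem (show y ∈ chartTruncation 𝒵 h (C a).e ε from ⟨hy, ht⟩),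
        (C a).signedDensity_eq hφ hy, (C a).coef_apply hy, Complex.real_smul]
      ring
    · rw [if_neg ht, indicator_of_notMem (fun h' => ht h'.2), mul_zero]
  have hsub : ∀ a, chartTruncation 𝒵 h (C a).e ε ∩ (C a).e.target =
      chartTruncation 𝒵 h (C a).e ε := fun a => inter_eq_left.2 fun y hy => hy.1
  unfold truncatedIntegral integralDensity
  rw [integralOver_eq_sum (isCompatible_integralDensity (μ := fun m w =>
      if m ∈ truncation 𝒵 h ε then 𝒢.signedDensity oA oM φ m w else 0) ?_)
    (exists_chart_cover n M) (fun a => chartParam (C a).isSmoothChart)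
    (fun a m => ((ρ a m : ℝ) : ℂ)) ?_ ?_ ?_]
  · refine Finset.sum_congr rfl fun a _ => ?_
    change ∫ y in (C a).e.target, _ = _
    refine (setIntegral_congr_fun (C a).e.open_target.measurableSet (heq a)).trans ?_
    rw [setIntegral_indicator (measurableSet_chartTruncation _ _ _ _), inter_comm, hsub,
      integral_const_mul]
  · intro m T w
    by_cases ht : m ∈ truncation 𝒵 h ε
    · simp only [if_pos ht]
      exact isHomogeneous_signedDensity hφ m T w
    · simp [if_neg ht]
  · intro P y _ h0
    exact_mod_cast hsum _ (hnz _ _ h0)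
  · intro a P y _ h0 h1
    refine ⟨(C a).e (P.toFun y), ?_, ?_⟩
    · exact (C a).e.map_source (hsupp a _ (hnz _ _ h0) (by exact_mod_cast h1))
    · exact (C a).e.left_inv (hsupp a _ (hnz _ _ h0) (by exact_mod_cast h1))
  · intro a
    change IntegrableOn _ (C a).e.target
    refine IntegrableOn.congr_fun ?_ (fun y hy => (heq a y hy).symm)
      (C a).e.open_target.measurableSet
    exact ((integrable_indicator_iff (measurableSet_chartTruncation _ _ _ _)).2
      (Integrable.const_mul (hint a) _)).integrableOn

end AdaptedChart

variable (𝒢 𝒵 oA oM) in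
/-- A finite partition of unity subordinate to adapted charts with room around a box. -/
structure AdaptedPartition where
  ι : Type
  fintype : Fintype ι
  x : ι → M
  C : ι → 𝒢.AdaptedChart 𝒵 oA oM
  R : ι → ℝ
  ρ : ι → M → ℝ
  R_pos : ∀ a, 0 < R a
  box_subset : ∀ a, box n (2 * R a) ⊆ (C a).e.target
  smooth : ∀ a, ContMDiff (𝓡 n) 𝓘(ℝ, ℝ) ∞ (ρ a)
  tsupport_subset : ∀ a, tsupport (ρ a) ⊆ (C a).e.source
  tsupport_subset_chartAt : ∀ a,
    tsupport (ρ a) ⊆ (chartAt (EuclideanSpace ℝ (Fin n)) (x a)).source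
  mem_box : ∀ a m, ρ a m ≠ 0 → (C a).e m ∈ box n (R a)
  sum_eq_one : ∀ m, ∑ a, ρ a m = 1

theorem exists_box_subset {U : Set (EuclideanSpace ℝ (Fin n))} (hU : U ∈ 𝓝 0) :
    ∃ R > 0, box n (2 * R) ⊆ U ∧ box n R ∈ 𝓝 0 := by
  have h1 : Tendsto (fun x : Fin n → ℝ => (WithLp.toLp 2 x : EuclideanSpace ℝ (Fin n))) (𝓝 0)
      (𝓝 0) := (toLpL n).continuous.tendsto' _ _ (map_zero _)
  obtain ⟨δ, hδ, hδU⟩ := Metric.mem_nhds_iff.1 (h1 hU)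
  refine ⟨δ / 4, by positivity, fun y hy => ?_, ?_⟩
  · have : (WithLp.ofLp y) ∈ Metric.ball (0 : Fin n → ℝ) δ := by
      rw [mem_ball_zero_iff]
      refine ((pi_norm_le_iff_of_nonneg (by positivity)).2 fun i => hy i).trans_lt ?_
      linarith
    exact hδU this
  · have h2 : Tendsto (fun x : EuclideanSpace ℝ (Fin n) => WithLp.ofLp x) (𝓝 0) (𝓝 0) :=
      (PiLp.continuous_ofLp 2 _).tendsto' _ _ rfl
    filter_upwards [h2 (Metric.ball_mem_nhds 0 (show 0 < δ / 4 by positivity))] with y hy i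
    exact (norm_le_pi_norm (WithLp.ofLp y) i).trans (mem_ball_zero_iff.1 hy).le

theorem exists_adaptedPartition [T2Space M] [CompactSpace M] (h𝒢 : 𝒢.Integrates 𝒵)
    (h𝒵 : IsSimpleNormalCrossing n 𝒵) (hoM : IsTangentOrientation oM) (hoA : 𝒢.IsOrientation oA) :
    Nonempty (𝒢.AdaptedPartition 𝒵 oA oM) := by
  choose C hC hC0 using exists_adaptedChart h𝒢 h𝒵 hoM hoA
  have hR : ∀ m, ∃ R > 0, box n (2 * R) ⊆ (C m).e.target ∧ box n R ∈ 𝓝 0 := fun m =>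
    exists_box_subset ((C m).e.open_target.mem_nhds (hC0 m ▸ (C m).e.map_source (hC m)))
  choose R hR0 hRs hRn using hR
  let U : M → Set M := fun m => ((C m).e.source ∩ (C m).e ⁻¹' interior (box n (R m))) ∩
    (chartAt (EuclideanSpace ℝ (Fin n)) m).source
  have hUo : ∀ m, IsOpen (U m) := fun m =>
    ((C m).e.isOpen_inter_preimage isOpen_interior).inter (chartAt _ m).open_source
  have hUm : ∀ m, m ∈ U m := fun m => ⟨⟨hC m, by
    rw [mem_preimage, hC0]; exact mem_interior_iff_mem_nhds.2 (hRn m)⟩, mem_chart_source _ m⟩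
  obtain ⟨t, ht⟩ := isCompact_univ.elim_finite_subcover U hUo
    (fun x _ => mem_iUnion.2 ⟨x, hUm x⟩)
  let f : Fin t.card → M := fun a => (t.equivFin.symm a).1
  have hcov : (univ : Set M) ⊆ ⋃ a, U (f a) := by
    intro x hx
    obtain ⟨y, hy, hxy⟩ := mem_iUnion₂.1 (ht hx)
    exact mem_iUnion.2 ⟨t.equivFin ⟨y, hy⟩, by simpa [f] using hxy⟩
  obtain ⟨ρ, hρ⟩ := SmoothPartitionOfUnity.exists_isSubordinate (𝓡 n) (isClosed_univ)
    (fun a => U (f a)) (fun a => hUo _) hcov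
  refine ⟨⟨Fin t.card, inferInstance, f, fun a => C (f a), fun a => R (f a), fun a => ρ a,
    fun a => hR0 _, fun a => hRs _, fun a => (ρ a).contMDiff,
    fun a => (hρ a).trans fun x hx => hx.1.1, fun a => (hρ a).trans fun x hx => hx.2,
    fun a m hm => ?_, fun m => ?_⟩⟩
  · exact interior_subset (hρ a (subset_tsupport _ hm)).1.2
  · have := ρ.sum_eq_one (mem_univ m)
    rwa [finsum_eq_sum_of_fintype] at this

namespace AdaptedPartition

attribute [local instance] AdaptedPartition.fintype

variable (Q : 𝒢.AdaptedPartition 𝒵 oA oM) [CompactSpace M]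

theorem coef_eq_zero (a : Q.ι) (φ : ∀ m, (Fin n → 𝒢.A m) → ℂ) :
    ∀ y ∉ box n (Q.R a), (Q.C a).coef (Q.ρ a) φ y = 0 := by
  intro y hy
  by_cases ht : y ∈ (Q.C a).e.target
  · rw [(Q.C a).coef_apply ht]
    by_contra h0
    refine hy ?_
    rw [← (Q.C a).e.right_inv ht]
    exact Q.mem_box a _ (left_ne_zero_of_smul h0)
  · exact indicator_of_notMem ht _

theorem contDiff_coef (a : Q.ι) (φ : 𝒢.densities) : ContDiff ℝ ∞ ((Q.C a).coef (Q.ρ a) φ.1) :=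
  (Q.C a).contDiff_coef (Q.smooth a) (Q.tsupport_subset a) φ.2

theorem exists_isBoxLipschitz (a : Q.ι) (φ : 𝒢.densities) :
    ∃ K, IsBoxLipschitz (Q.R a) K fun x => (Q.C a).coef (Q.ρ a) φ.1 (WithLp.toLp 2 x) :=
  PvTrace.exists_isBoxLipschitz ((Q.contDiff_coef a φ).of_le (by simp)) (Q.coef_eq_zero a φ.1)

/-- The principal value functional. -/
def pv : 𝒢.densities →ₗ[ℂ] ℂ where
  toFun φ := ∑ a, (Q.C a).sgn *
    pvBox (Q.C a).I fun x => (Q.C a).coef (Q.ρ a) φ.1 (WithLp.toLp 2 x)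
  map_add' φ ψ := by
    rw [← Finset.sum_add_distrib]
    refine Finset.sum_congr rfl fun a _ => ?_
    obtain ⟨K, hK⟩ := Q.exists_isBoxLipschitz a φ
    obtain ⟨K', hK'⟩ := Q.exists_isBoxLipschitz a ψ
    rw [← mul_add, ← hK.pvBox_add hK']
    congr 2
    funext x
    exact (Q.C a).coef_add _ _ _ _
  map_smul' c φ := by
    rw [RingHom.id_apply, smul_eq_mul, Finset.mul_sum]
    refine Finset.sum_congr rfl fun a _ => ?_
    rw [mul_left_comm, ← pvBox_const_mul c]
    congr 2
    funext x
    exact (Q.C a).coef_smul _ _ _ _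

theorem tendsto_truncatedIntegral [T2Space M] [Nonempty M] (h : RiemMetric n M)
    (φ : 𝒢.densities) :
    Tendsto (truncatedIntegral 𝒵 h (𝒢.signedDensity oA oM φ)) (𝓝[>] 0) (𝓝 (Q.pv φ)) := by
  choose K hK using fun a => Q.exists_isBoxLipschitz a φ
  have h1 := fun a =>
    (Q.C a).isDivisorChart.tendsto h (Q.R_pos a) (Q.box_subset a) (hK a)
  have h2 := tendsto_finsetSum Finset.univ
    (fun a _ => ((h1 a).1.const_mul (((Q.C a).sgn : ℝ) : ℂ)))
  refine h2.congr' ?_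
  filter_upwards [eventually_all.2 fun a => (h1 a).2] with ε hε
  refine (AdaptedChart.truncatedIntegral_eq_sum h φ.2.1 Q.C Q.ρ (fun m _ => Q.sum_eq_one m)
    (fun a m _ hm => ?_) ε hε).symm
  exact Q.tsupport_subset a (subset_tsupport _ hm)

theorem pv_eq [T2Space M] [Nonempty M] (h : RiemMetric n M) (φ : 𝒢.densities) :
    Q.pv φ = pvIntegral 𝒵 h (𝒢.signedDensity oA oM φ) :=
  (Q.tendsto_truncatedIntegral h φ).limUnder_eq.symm

end AdaptedPartition

end LieGroupoid

namespace LieGroupoid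

variable {n d : ℕ} {M G : Type*}
  [TopologicalSpace M] [ChartedSpace (EuclideanSpace ℝ (Fin n)) M] [IsManifold (𝓡 n) ∞ M]
  [TopologicalSpace G] [ChartedSpace (EuclideanSpace ℝ (Fin d)) G] [IsManifold (𝓡 d) ∞ G]
  {𝒢 : LieGroupoid n d M G} {𝒵 : Finset (Set M)} {oA : ∀ m, Orientation ℝ (𝒢.A m) (Fin n)}
  {oM : ∀ m : M, Orientation ℝ (TangentSpace (𝓡 n) m) (Fin n)}

/-- The coefficient of `φ` in the frame `X`, in the chart at `x`. -/
def chartCoef (x : M) (X : ∀ m, Fin n → 𝒢.A m) (φ : 𝒢.densities) :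
    EuclideanSpace ℝ (Fin n) → ℂ :=
  fun y => φ.1 ((chartAt (EuclideanSpace ℝ (Fin n)) x).symm y)
    (X ((chartAt (EuclideanSpace ℝ (Fin n)) x).symm y))

theorem contDiffAt_chartCoef {x : M} {U : Set M} {X : ∀ m, Fin n → 𝒢.A m} (hX : 𝒢.IsFrameOn U X)
    (φ : 𝒢.densities) {y : EuclideanSpace ℝ (Fin n)}
    (hy : y ∈ (chartAt (EuclideanSpace ℝ (Fin n)) x).target)
    (hyU : (chartAt (EuclideanSpace ℝ (Fin n)) x).symm y ∈ U) :
    ContDiffAt ℝ ∞ (chartCoef x X φ) y := by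
  have h1 : ContMDiffAt (𝓡 n) 𝓘(ℝ, ℂ) ∞ (fun m => φ.1 m (X m)) _ :=
    (φ.2.2 U X hX).contMDiffAt (hX.isOpen.mem_nhds hyU)
  exact contMDiffAt_iff_contDiffAt.1
    (h1.comp y ((isSmoothChart_chartAt x).contMDiffAt_symm hy))

theorem eventually_chartCoef_sub_lt {x : M} {U : Set M} {X : ∀ m, Fin n → 𝒢.A m}
    (hX : 𝒢.IsFrameOn U X) {K : Set (EuclideanSpace ℝ (Fin n))} (hK : IsCompact K)
    (hKU : ∀ y ∈ K, y ∈ (chartAt (EuclideanSpace ℝ (Fin n)) x).target ∧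
      (chartAt (EuclideanSpace ℝ (Fin n)) x).symm y ∈ U) (j : ℕ) (φ₀ : 𝒢.densities) {δ : ℝ}
    (hδ : 0 < δ) :
    ∀ᶠ φ in @nhds _ 𝒢.densitiesTopology φ₀, ∀ y ∈ K,
      ‖iteratedFDeriv ℝ j (chartCoef x X (φ - φ₀)) y‖ < δ := by
  let T : TopologicalSpace 𝒢.densities := TopologicalSpace.induced
      (fun φ : 𝒢.densities => UniformOnFun.ofFun {K} (iteratedFDeriv ℝ j (chartCoef x X φ)))
      inferInstance
  have hle : 𝒢.densitiesTopology ≤ T :=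
    iInf_le_of_le x <| iInf_le_of_le U <| iInf_le_of_le X <| iInf_le_of_le hX <|
      iInf_le_of_le K <| iInf_le_of_le hK <| iInf_le_of_le hKU <| iInf_le_of_le j le_rfl
  have h1 : Tendsto (fun φ : 𝒢.densities =>
      UniformOnFun.ofFun {K} (iteratedFDeriv ℝ j (chartCoef x X φ)))
      (@nhds _ 𝒢.densitiesTopology φ₀)
      (𝓝 (UniformOnFun.ofFun {K} (iteratedFDeriv ℝ j (chartCoef x X φ₀)))) :=
    (@Continuous.tendsto _ _ T _ _ continuous_induced_dom φ₀).mono_left (nhds_mono hle)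
  rw [UniformOnFun.tendsto_iff_tendstoUniformlyOn] at h1
  filter_upwards [Metric.tendstoUniformlyOn_iff.1 (h1 K rfl) δ hδ] with φ hφ y hy
  have h2 := hφ y hy
  rw [dist_comm, dist_eq_norm] at h2
  have h3 : chartCoef x X (φ - φ₀) = chartCoef x X φ - chartCoef x X φ₀ := rfl
  have h4 : ∀ ψ : 𝒢.densities, ContDiffAt ℝ j (chartCoef x X ψ) y := fun ψ =>
    (contDiffAt_chartCoef hX ψ (hKU y hy).1 (hKU y hy).2).of_le (by exact_mod_cast le_top)
  rw [h3, iteratedFDeriv_sub_apply (h4 φ) (h4 φ₀)]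
  exact h2

namespace AdaptedPartition

attribute [local instance] AdaptedPartition.fintype

variable (Q : 𝒢.AdaptedPartition 𝒵 oA oM) [CompactSpace M]

/-- The coefficients in adapted charts are controlled by those in the charts of the atlas. -/
theorem exists_bound_coef [T2Space M] (a : Q.ι) : ∃ c, 0 ≤ c ∧ ∀ (φ : 𝒢.densities) (δ : ℝ), 0 ≤ δ →
    (∀ y ∈ chartAt (EuclideanSpace ℝ (Fin n)) (Q.x a) '' tsupport (Q.ρ a),
      ‖chartCoef (Q.x a) (Q.C a).X φ y‖ ≤ δ ∧ ‖fderiv ℝ (chartCoef (Q.x a) (Q.C a).X φ) y‖ ≤ δ) →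
    ∀ y, ‖(Q.C a).coef (Q.ρ a) φ.1 y‖ ≤ c * δ ∧
      ‖fderiv ℝ ((Q.C a).coef (Q.ρ a) φ.1) y‖ ≤ c * δ := by
  set e := (Q.C a).e with he
  set κ := chartAt (EuclideanSpace ℝ (Fin n)) (Q.x a) with hκ
  have hes : IsSmoothChart n e := (Q.C a).isSmoothChart
  have hκs : IsSmoothChart n κ := isSmoothChart_chartAt _
  have hcpt : IsCompact (tsupport (Q.ρ a)) := (isClosed_tsupport _).isCompact
  have hsub := Q.tsupport_subset a
  have hsubκ := Q.tsupport_subset_chartAt a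
  have hK : IsCompact (e '' tsupport (Q.ρ a)) :=
    hcpt.image_of_continuousOn (e.continuousOn.mono hsub)
  let V := e.target ∩ e.symm ⁻¹' κ.source
  have hV : IsOpen V := e.symm.isOpen_inter_preimage κ.open_source
  have hKV : e '' tsupport (Q.ρ a) ⊆ V := by
    rintro _ ⟨m, hm, rfl⟩
    refine ⟨e.map_source (hsub hm), ?_⟩
    rw [mem_preimage, e.left_inv (hsub hm)]
    exact hsubκ hm
  have hχ : ContDiffOn ℝ ∞ (fun y => Q.ρ a (e.symm y)) V := fun y hy =>
    (contMDiffAt_iff_contDiffAt.1 ((Q.smooth a _).comp y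
      (hes.contMDiffAt_symm hy.1))).contDiffWithinAt
  have hT : ContDiffOn ℝ ∞ (fun y => κ (e.symm y)) V := fun y hy =>
    (contMDiffAt_iff_contDiffAt.1 ((hκs.contMDiffAt hy.2).comp y
      (hes.contMDiffAt_symm hy.1))).contDiffWithinAt
  obtain ⟨B₀, hB₀⟩ := hK.exists_bound_of_continuousOn (hχ.continuousOn.mono hKV)
  obtain ⟨B₁, hB₁⟩ := hK.exists_bound_of_continuousOn
    ((hχ.continuousOn_fderiv_of_isOpen hV (by simp)).mono hKV)
  obtain ⟨B₂, hB₂⟩ := hK.exists_bound_of_continuousOn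
    ((hT.continuousOn_fderiv_of_isOpen hV (by simp)).mono hKV)
  let B := max (max B₀ B₁) (max B₂ 0)
  have hB : 0 ≤ B := (le_max_right _ _).trans (le_max_right _ _)
  have hb₀ : B₀ ≤ B := (le_max_left _ _).trans (le_max_left _ _)
  have hb₁ : B₁ ≤ B := (le_max_right _ _).trans (le_max_left _ _)
  have hb₂ : B₂ ≤ B := (le_max_left _ _).trans (le_max_right _ _)
  refine ⟨B * B + B, by positivity, fun φ δ hδ hφ y => ?_⟩
  by_cases hy : y ∈ e '' tsupport (Q.ρ a)
  · have hyV := hKV hy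
    have hTy : κ (e.symm y) ∈ κ '' tsupport (Q.ρ a) := by
      obtain ⟨m, hm, rfl⟩ := hy
      rw [e.left_inv (hsub hm)]
      exact mem_image_of_mem _ hm
    have hev : (Q.C a).coef (Q.ρ a) φ.1 =ᶠ[𝓝 y] fun y =>
        Q.ρ a (e.symm y) • chartCoef (Q.x a) (Q.C a).X φ (κ (e.symm y)) := by
      filter_upwards [hV.mem_nhds hyV] with z hz
      rw [(Q.C a).coef_apply hz.1, chartCoef, κ.left_inv hz.2]
    have hd1 : HasFDerivAt (fun y => Q.ρ a (e.symm y)) _ y :=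
      ((hχ.contDiffAt (hV.mem_nhds hyV)).differentiableAt (by simp)).hasFDerivAt
    have hd2 : HasFDerivAt (fun y => κ (e.symm y)) _ y :=
      ((hT.contDiffAt (hV.mem_nhds hyV)).differentiableAt (by simp)).hasFDerivAt
    have hd3 : HasFDerivAt (chartCoef (Q.x a) (Q.C a).X φ) _ (κ (e.symm y)) :=
      ((contDiffAt_chartCoef (Q.C a).isFrameOn φ (κ.map_source hyV.2) (by
        rw [κ.left_inv hyV.2]; exact e.map_target hyV.1)).differentiableAt (by simp)).hasFDerivAt
    have hd4 := (hd1.smul (hd3.comp y hd2)).congr_of_eventuallyEq hev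
    have b0 := (hB₀ y hy).trans hb₀
    have b1 := (hB₁ y hy).trans hb₁
    have b2 := (hB₂ y hy).trans hb₂
    obtain ⟨g0, g1⟩ := hφ _ hTy
    constructor
    · rw [hev.self_of_nhds, norm_smul]
      calc _ ≤ B * δ := mul_le_mul b0 g0 (norm_nonneg _) hB
        _ ≤ _ := by nlinarith [mul_nonneg (mul_nonneg hB hB) hδ]
    · rw [hd4.fderiv]
      refine (norm_add_le _ _).trans ?_
      rw [norm_smul, ContinuousLinearMap.norm_smulRight_apply, add_mul]
      refine add_le_add ?_ (mul_le_mul b1 g0 (norm_nonneg _) hB)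
      rw [_root_.mul_assoc]
      refine mul_le_mul b0 ?_ (norm_nonneg _) hB
      refine (ContinuousLinearMap.opNorm_comp_le _ _).trans ?_
      rw [mul_comm]
      exact mul_le_mul b2 g1 (norm_nonneg _) hB
  · have hev : (Q.C a).coef (Q.ρ a) φ.1 =ᶠ[𝓝 y] fun _ => 0 := by
      filter_upwards [hK.isClosed.isOpen_compl.mem_nhds hy] with z hz
      by_cases ht : z ∈ e.target
      · have h0 : Q.ρ a (e.symm z) = 0 :=
          image_eq_zero_of_notMem_tsupport fun h => hz ⟨_, h, e.right_inv ht⟩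
        rw [(Q.C a).coef_apply ht, h0, zero_smul]
      · exact indicator_of_notMem ht _
    rw [hev.fderiv_eq, hev.self_of_nhds]
    simp only [norm_zero, fderiv_fun_const, Pi.zero_apply]
    have : 0 ≤ (B * B + B) * δ := by positivity
    exact ⟨this, this⟩

theorem continuous_pv [T2Space M] : @Continuous _ _ 𝒢.densitiesTopology _ Q.pv := by
  let := 𝒢.densitiesTopology
  rw [continuous_iff_continuousAt]
  intro φ₀
  choose c hc0 hc using fun a => Q.exists_bound_coef a
  let W : Q.ι → ℝ := fun a => ∫ x, (boxWeight (Q.R a) x : ℝ) ∂(volume : Measure (Fin n → ℝ))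
  have hW : ∀ a, 0 ≤ W a := fun a => integral_nonneg fun x => boxWeight_nonneg _ _
  let N := ∑ a, c a * (1 + ‖toLpL n‖) * W a
  have hN : 0 ≤ N := Finset.sum_nonneg fun a _ => by
    have := hc0 a; have := hW a; positivity
  refine Metric.tendsto_nhds.2 fun ε hε => ?_
  have hδ : 0 < ε / (N + 1) := by positivity
  have hcomp : ∀ a, IsCompact (chartAt (EuclideanSpace ℝ (Fin n)) (Q.x a) '' tsupport (Q.ρ a)) :=
    fun a => (isClosed_tsupport _).isCompact.image_of_continuousOn
      ((chartAt _ _).continuousOn.mono (Q.tsupport_subset_chartAt a))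
  have hsub : ∀ a, ∀ y ∈ chartAt (EuclideanSpace ℝ (Fin n)) (Q.x a) '' tsupport (Q.ρ a),
      y ∈ (chartAt (EuclideanSpace ℝ (Fin n)) (Q.x a)).target ∧
      (chartAt (EuclideanSpace ℝ (Fin n)) (Q.x a)).symm y ∈ (Q.C a).e.source := by
    rintro a _ ⟨m, hm, rfl⟩
    have h1 := Q.tsupport_subset_chartAt a hm
    refine ⟨(chartAt _ _).map_source h1, ?_⟩
    rw [(chartAt _ _).left_inv h1]
    exact Q.tsupport_subset a hm
  filter_upwards [eventually_all.2 fun a => eventually_chartCoef_sub_lt (Q.C a).isFrameOn (hcomp a)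
    (hsub a) 0 φ₀ hδ, eventually_all.2 fun a => eventually_chartCoef_sub_lt (Q.C a).isFrameOn
    (hcomp a) (hsub a) 1 φ₀ hδ] with φ h0 h1
  have key : ∀ a, ‖(Q.C a).sgn * pvBox (Q.C a).I fun x =>
      (Q.C a).coef (Q.ρ a) (φ - φ₀).1 (WithLp.toLp 2 x)‖ ≤
      (c a * (1 + ‖toLpL n‖) * W a) * (ε / (N + 1)) := by
    intro a
    have hb := hc a (φ - φ₀) _ hδ.le fun y hy => by
      have := h0 a y hy
      have h2 := h1 a y hy
      rw [norm_iteratedFDeriv_zero] at this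
      rw [norm_iteratedFDeriv_one] at h2
      exact ⟨this.le, h2.le⟩
    have hbox := isBoxLipschitz_of_contDiff ((Q.contDiff_coef a (φ - φ₀)).of_le (by simp))
      (Q.coef_eq_zero a _) (fun x => (hb x).1) (fun x => (hb x).2)
    have hs : ‖(((Q.C a).sgn : ℝ) : ℂ)‖ = 1 := by
      rcases (Q.C a).sgn_eq with h | h <;> simp [h]
    rw [norm_mul, hs, _root_.one_mul]
    refine hbox.norm_pvBox_le.trans (le_of_eq ?_)
    ring
  rw [dist_eq_norm, ← map_sub]
  calc ‖Q.pv (φ - φ₀)‖ ≤ ∑ a, (c a * (1 + ‖toLpL n‖) * W a) * (ε / (N + 1)) :=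
        (norm_sum_le _ _).trans (Finset.sum_le_sum fun a _ => key a)
    _ = N * (ε / (N + 1)) := (Finset.sum_mul _ _ _).symm
    _ < ε := by
        rw [mul_div_assoc', div_lt_iff₀ (by positivity)]
        nlinarith

end AdaptedPartition

end LieGroupoid

theorem IsCompatible.congr {d k : ℕ} {X : Type*} [TopologicalSpace X]
    [ChartedSpace (EuclideanSpace ℝ (Fin d)) X] {S : Set X}
    {F F' : LocalParam d k S → EuclideanSpace ℝ (Fin k) → ℂ} (hF : IsCompatible F)
    (h : ∀ P, ∀ y ∈ P.source, F P y = F' P y) : IsCompatible F' := by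
  intro P Q φ L y hy hφ hev hL
  rw [← h P y hy, ← h Q _ hφ]
  exact hF P Q φ L y hy hφ hev hL

theorem integralOver_congr {d k : ℕ} {X : Type*} [TopologicalSpace X]
    [ChartedSpace (EuclideanSpace ℝ (Fin d)) X] {S : Set X}
    {F F' : LocalParam d k S → EuclideanSpace ℝ (Fin k) → ℂ} (h : ∀ P, ∀ y, F P y = F' P y) :
    integralOver d k S F = integralOver d k S F' := by
  have : F = F' := by funext P y; exact h P y
  rw [this]

namespace LieGroupoid

variable {n d : ℕ} {M G : Type*}
  [TopologicalSpace M] [ChartedSpace (EuclideanSpace ℝ (Fin n)) M] [IsManifold (𝓡 n) ∞ M]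
  [TopologicalSpace G] [ChartedSpace (EuclideanSpace ℝ (Fin d)) G] [IsManifold (𝓡 d) ∞ G]
  {𝒢 : LieGroupoid n d M G} {𝒵 : Finset (Set M)}

/-! ### Smoothness of products -/

theorem contMDiffAt_mul {E' H' N : Type*} [NormedAddCommGroup E'] [NormedSpace ℝ E']
    [TopologicalSpace H'] {I' : ModelWithCorners ℝ E' H'} [TopologicalSpace N] [ChartedSpace H' N]
    {a b : N → G} {z : N} (ha : ContMDiffAt I' (𝓡 d) ∞ a z) (hb : ContMDiffAt I' (𝓡 d) ∞ b z)
    (h : ∀ᶠ z' in 𝓝 z, 𝒢.s (a z') = 𝒢.r (b z')) :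
    ContMDiffAt I' (𝓡 d) ∞ (fun z' => 𝒢.mul (a z') (b z')) z := by
  obtain ⟨V, hVs, hV, hz⟩ := mem_nhds_iff.1 h
  have h1 : ContMDiffWithinAt I' ((𝓡 d).prod (𝓡 d)) ∞ (fun z' => (a z', b z')) V z :=
    (ha.prodMk hb).contMDiffWithinAt
  exact (ContMDiffWithinAt.comp z (𝒢.contMDiffOn_mul _ (hVs hz)) h1
    (fun z' hz' => hVs hz')).contMDiffAt (hV.mem_nhds hz)

theorem LocalParam_contMDiffAt {k : ℕ} {S : Set G} (P : LocalParam d k S)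
    {y : EuclideanSpace ℝ (Fin k)} (hy : y ∈ P.source) : ContMDiffAt (𝓡 k) (𝓡 d) ∞ P.toFun y :=
  (P.isImmersionAt y hy).contMDiffAt

variable {x : M}

theorem contMDiffAt_translate (P : LocalParam d n (𝒢.s ⁻¹' {x})) {y : EuclideanSpace ℝ (Fin n)}
    (hy : y ∈ P.source) {g : G} (hg : 𝒢.s g = x) :
    ContMDiffAt (𝓡 n) (𝓡 d) ∞ (fun z => 𝒢.mul (P.toFun z) (𝒢.inv g)) y := by
  refine contMDiffAt_mul (LocalParam_contMDiffAt P hy) contMDiffAt_const ?_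
  filter_upwards [P.isOpen_source.mem_nhds hy] with z hz
  rw [𝒢.r_inv, hg]
  exact P.image_mem z hz

open Classical in
/-- Right translation of the vectors tangent to a source fibre, read in a parametrization. -/
def translateMap (P : LocalParam d n (𝒢.s ⁻¹' {x})) (y : EuclideanSpace ℝ (Fin n)) :
    EuclideanSpace ℝ (Fin n) →ₗ[ℝ] 𝒢.A (𝒢.r (P.toFun y)) :=
  if hy : y ∈ P.source then
    LinearMap.codRestrict _ (show EuclideanSpace ℝ (Fin n) →ₗ[ℝ] TangentSpace (𝓡 d) _ from
      (mfderiv (𝓡 n) (𝓡 d) (fun z => 𝒢.mul (P.toFun z) (𝒢.inv (P.toFun y))) y).toLinearMap)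
      (fun v => 𝒢.rightTranslate_mem P hy v)
  else 0

theorem translateMap_coordVec (P : LocalParam d n (𝒢.s ⁻¹' {x})) {y : EuclideanSpace ℝ (Fin n)}
    (hy : y ∈ P.source) (i : Fin n) :
    translateMap P y (coordVec i) = 𝒢.rightTranslate P hy i := by
  rw [translateMap, dif_pos hy]
  rfl

theorem coe_translateMap (P : LocalParam d n (𝒢.s ⁻¹' {x})) {y : EuclideanSpace ℝ (Fin n)}
    (hy : y ∈ P.source) (v : EuclideanSpace ℝ (Fin n)) :
    (show EuclideanSpace ℝ (Fin d) from (translateMap P y v).1) =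
      mfderiv (𝓡 n) (𝓡 d) (fun z => 𝒢.mul (P.toFun z) (𝒢.inv (P.toFun y))) y v := by
  rw [translateMap, dif_pos hy]
  rfl

theorem A_ext_cast {p q : M} (h : p = q) (a : 𝒢.A p) (b : 𝒢.A q)
    (hab : (show EuclideanSpace ℝ (Fin d) from a.1) = (show EuclideanSpace ℝ (Fin d) from b.1)) :
    b = h ▸ a := by
  subst h
  exact Subtype.ext hab.symm

theorem translateMap_comp (P Q : LocalParam d n (𝒢.s ⁻¹' {x}))
    (φ : EuclideanSpace ℝ (Fin n) → EuclideanSpace ℝ (Fin n))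
    (L : EuclideanSpace ℝ (Fin n) →L[ℝ] EuclideanSpace ℝ (Fin n)) (y : EuclideanSpace ℝ (Fin n))
    (hy : y ∈ P.source) (hφy : φ y ∈ Q.source) (hev : ∀ᶠ y' in 𝓝 y, Q.toFun (φ y') = P.toFun y')
    (hL : HasFDerivAt φ L y) (h : Q.toFun (φ y) = P.toFun y) (v : EuclideanSpace ℝ (Fin n)) :
    translateMap P y v = (congrArg 𝒢.r h) ▸ translateMap Q (φ y) (L v) := by
  refine A_ext_cast _ _ _ ?_
  rw [coe_translateMap P hy, coe_translateMap Q hφy, h]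
  have h1 : MDifferentiableAt (𝓡 n) (𝓡 d) (fun z => 𝒢.mul (Q.toFun z) (𝒢.inv (P.toFun y)))
      (φ y) := (contMDiffAt_translate Q hφy (P.image_mem y hy)).mdifferentiableAt (by simp)
  have h2 := h1.hasMFDerivAt.comp y hL.hasMFDerivAt
  have h3 := h2.congr_of_eventuallyEq
    (f₁ := fun z => 𝒢.mul (P.toFun z) (𝒢.inv (P.toFun y)))
    (hev.mono fun z hz => by simp only [Function.comp]; rw [hz])
  exact (congrArg (fun A : EuclideanSpace ℝ (Fin n) →L[ℝ] EuclideanSpace ℝ (Fin d) => A v)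
    h3.mfderiv).symm

/-! ### Homogeneity of half-densities -/

theorem psi_cast {f : ∀ g, (Fin n → 𝒢.A (𝒢.r g)) → (Fin n → 𝒢.A (𝒢.s g)) → ℂ} (hf : f ∈ 𝒢.Psi)
    (g : G) {p q : M} (hp : p = 𝒢.r g) (hq : q = 𝒢.s g) (S : 𝒢.A p →ₗ[ℝ] 𝒢.A p)
    (T : 𝒢.A q →ₗ[ℝ] 𝒢.A q) (a : Fin n → 𝒢.A p) (b : Fin n → 𝒢.A q) :
    f g (𝒢.castTuple hp fun i => S (a i)) (𝒢.castTuple hq fun i => T (b i)) =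
      (Real.sqrt |LinearMap.det S| : ℝ) * (Real.sqrt |LinearMap.det T| : ℝ) *
        f g (𝒢.castTuple hp a) (𝒢.castTuple hq b) := by
  subst hp; subst hq
  exact hf.1 g S T a b

theorem psi_cast_left {f : ∀ g, (Fin n → 𝒢.A (𝒢.r g)) → (Fin n → 𝒢.A (𝒢.s g)) → ℂ}
    (hf : f ∈ 𝒢.Psi) (g : G) {p q : M} (hp : p = 𝒢.r g) (hq : q = 𝒢.s g)
    (S : 𝒢.A p →ₗ[ℝ] 𝒢.A p) (a : Fin n → 𝒢.A p) (b : Fin n → 𝒢.A q) :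
    f g (𝒢.castTuple hp fun i => S (a i)) (𝒢.castTuple hq b) =
      (Real.sqrt |LinearMap.det S| : ℝ) * f g (𝒢.castTuple hp a) (𝒢.castTuple hq b) := by
  simpa using psi_cast hf g hp hq S LinearMap.id a b

theorem psi_cast_right {f : ∀ g, (Fin n → 𝒢.A (𝒢.r g)) → (Fin n → 𝒢.A (𝒢.s g)) → ℂ}
    (hf : f ∈ 𝒢.Psi) (g : G) {p q : M} (hp : p = 𝒢.r g) (hq : q = 𝒢.s g)
    (T : 𝒢.A q →ₗ[ℝ] 𝒢.A q) (a : Fin n → 𝒢.A p) (b : Fin n → 𝒢.A q) :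
    f g (𝒢.castTuple hp a) (𝒢.castTuple hq fun i => T (b i)) =
      (Real.sqrt |LinearMap.det T| : ℝ) * f g (𝒢.castTuple hp a) (𝒢.castTuple hq b) := by
  simpa using psi_cast hf g hp hq LinearMap.id T a b

theorem castTuple_rfl {p : M} (h : p = p) (a : Fin n → 𝒢.A p) : 𝒢.castTuple h a = a := rfl

variable {f₁ f₀ : ∀ g, (Fin n → 𝒢.A (𝒢.r g)) → (Fin n → 𝒢.A (𝒢.s g)) → ℂ}

theorem isHomogeneous_convIntegrand (h₁ : f₁ ∈ 𝒢.Psi) (h₀ : f₀ ∈ 𝒢.Psi) {g g₀ : G}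
    (h : 𝒢.s g₀ = 𝒢.s g) (a : Fin n → 𝒢.A (𝒢.r g)) (b : Fin n → 𝒢.A (𝒢.s g)) :
    IsHomogeneous (𝒢.convIntegrand f₁ f₀ g g₀ h a b) := by
  intro T u
  simp only [convIntegrand]
  have h2 := psi_cast_left h₀ g₀ rfl h.symm T u b
  rw [castTuple_rfl, castTuple_rfl] at h2
  rw [psi_cast_right h₁, h2]
  have h3 := Real.mul_self_sqrt (abs_nonneg (LinearMap.det T))
  have h4 : ((|LinearMap.det T| : ℝ) : ℂ) = (Real.sqrt |LinearMap.det T| : ℝ) *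
      (Real.sqrt |LinearMap.det T| : ℝ) := by rw [← Complex.ofReal_mul, h3]
  rw [h4]
  ring

theorem convIntegrand_smul (h₁ : f₁ ∈ 𝒢.Psi) (h₀ : f₀ ∈ 𝒢.Psi) {g g₀ : G}
    (h : 𝒢.s g₀ = 𝒢.s g) (S : 𝒢.A (𝒢.r g) →ₗ[ℝ] 𝒢.A (𝒢.r g)) (T : 𝒢.A (𝒢.s g) →ₗ[ℝ] 𝒢.A (𝒢.s g))
    (a : Fin n → 𝒢.A (𝒢.r g)) (b : Fin n → 𝒢.A (𝒢.s g)) (u : Fin n → 𝒢.A (𝒢.r g₀)) :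
    𝒢.convIntegrand f₁ f₀ g g₀ h (fun i => S (a i)) (fun i => T (b i)) u =
      (Real.sqrt |LinearMap.det S| : ℝ) * (Real.sqrt |LinearMap.det T| : ℝ) *
        𝒢.convIntegrand f₁ f₀ g g₀ h a b u := by
  simp only [convIntegrand]
  have h2 := psi_cast_right h₀ g₀ rfl h.symm T u b
  rw [castTuple_rfl] at h2
  rw [psi_cast_left h₁, h2]
  ring

open Classical in
theorem isCompatible_conv [T2Space M] (h𝒢 : 𝒢.Integrates 𝒵) (h𝒵 : IsSimpleNormalCrossing n 𝒵)
    (h₁ : f₁ ∈ 𝒢.Psi) (h₀ : f₀ ∈ 𝒢.Psi) (g : G) (a : Fin n → 𝒢.A (𝒢.r g))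
    (b : Fin n → 𝒢.A (𝒢.s g)) :
    IsCompatible (fun (P : LocalParam d n (𝒢.s ⁻¹' {𝒢.s g})) y =>
      if hy : y ∈ P.source then
        𝒢.convIntegrand f₁ f₀ g (P.toFun y) (P.image_mem y hy) a b (𝒢.rightTranslate P hy)
      else 0) := by
  have : Nonempty M := ⟨𝒢.r g⟩
  have hfin : ∀ p : G, FiniteDimensional ℝ (𝒢.A (𝒢.r p)) := fun p =>
    inferInstanceAs (FiniteDimensional ℝ (LinearMap.ker _ : Submodule ℝ (EuclideanSpace ℝ (Fin d))))
  have h := IsCompatible.of_homogeneous (S := 𝒢.s ⁻¹' {𝒢.s g}) (W := fun p => 𝒢.A (𝒢.r p))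
    (fun p _ => h𝒢.finrank_A h𝒵 (𝒢.r p))
    (μ := fun p u => if hp : 𝒢.s p = 𝒢.s g then 𝒢.convIntegrand f₁ f₀ g p hp a b u else 0)
    (fun p hp => by
      have hp' : 𝒢.s p = 𝒢.s g := hp
      simp only [dif_pos hp']
      exact isHomogeneous_convIntegrand h₁ h₀ hp' a b)
    (D := translateMap) (fun P Q φ L y hy hφy hev hL hh v => by
      rw [translateMap_comp P Q φ L y hy hφy hev hL hh v]
      generalize translateMap Q (φ y) (L v) = w
      clear hev v
      revert w
      generalize P.toFun y = p at hh
      subst hh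
      intro w; rfl)
  refine h.congr fun P y hy => ?_
  have hp : 𝒢.s (P.toFun y) = 𝒢.s g := P.image_mem y hy
  simp only [dif_pos hp, dif_pos hy, translateMap_coordVec P hy]

end LieGroupoid

theorem IsHomogeneous.basis {n : ℕ} {V : Type*} [AddCommGroup V] [Module ℝ V]
    {μ : (Fin n → V) → ℂ} (hμ : IsHomogeneous μ) (b : Module.Basis (Fin n) ℝ V) (u : Fin n → V) :
    μ u = (|b.det u| : ℝ) * μ b := by
  have h := hμ (b.constr ℝ u) b
  have h1 : (fun i => b.constr ℝ u (b i)) = u := by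
    funext i; exact b.constr_basis ℝ u i
  have h2 := b.det_comp (b.constr ℝ u) b
  rw [b.det_self, _root_.mul_one] at h2
  rw [h1, ← h2] at h
  rw [h]
  congr 3
  exact congrArg b.det h1

/-- The determinant with respect to the standard basis. -/
def stdDet (n : ℕ) : (EuclideanSpace ℝ (Fin n)) [⋀^Fin n]→ₗ[ℝ] ℝ :=
  (EuclideanSpace.basisFun (Fin n) ℝ).toBasis.det

theorem stdDet_apply {n : ℕ} (v : Fin n → EuclideanSpace ℝ (Fin n)) :
    stdDet n v = (Matrix.of fun i j => v j i).det := by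
  rw [stdDet, Module.Basis.det_apply]
  rfl

theorem stdDet_coordVec (n : ℕ) : stdDet n coordVec = 1 := by
  have h := (EuclideanSpace.basisFun (Fin n) ℝ).toBasis.det_self
  rw [stdDet]
  convert h using 2
  funext i
  simp [coordVec]

theorem stdDet_map {n : ℕ} (L : EuclideanSpace ℝ (Fin n) →L[ℝ] EuclideanSpace ℝ (Fin n)) :
    stdDet n (fun i => L (coordVec i)) = L.det := by
  have h := (EuclideanSpace.basisFun (Fin n) ℝ).toBasis.det_comp L.toLinearMap coordVec
  have h1 := stdDet_coordVec n
  rw [stdDet] at h1 ⊢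
  rw [h1, _root_.mul_one] at h
  exact h

theorem stdDet_comp_basis {n : ℕ} {V : Type*} [AddCommGroup V] [Module ℝ V]
    (b : Module.Basis (Fin n) ℝ V) (L : V →ₗ[ℝ] EuclideanSpace ℝ (Fin n)) (u : Fin n → V) :
    stdDet n (fun i => L (u i)) = stdDet n (fun i => L (b i)) * b.det u := by
  have h := ((stdDet n).compLinearMap L).eq_smul_basis_det b
  exact congrArg (fun f => f u) h

theorem stdDet_ne_zero {n : ℕ} {v : Fin n → EuclideanSpace ℝ (Fin n)}
    (hv : LinearIndependent ℝ v) : stdDet n v ≠ 0 := by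
  have h := (EuclideanSpace.basisFun (Fin n) ℝ).toBasis.is_basis_iff_det.1
    ⟨hv, hv.span_eq_top_of_card_eq_finrank' (by simp)⟩
  exact h.ne_zero

theorem contDiffAt_stdDet {n : ℕ} {E : Type*} [NormedAddCommGroup E] [NormedSpace ℝ E]
    {v : Fin n → E → EuclideanSpace ℝ (Fin n)} {z : E} (hv : ∀ i, ContDiffAt ℝ ∞ (v i) z) :
    ContDiffAt ℝ ∞ (fun z => stdDet n fun i => v i z) z := by
  simp only [stdDet_apply, Matrix.det_apply]
  refine ContDiffAt.sum fun σ _ => ContDiffAt.const_smul _ (contDiffAt_prod fun i _ => ?_)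
  exact ((EuclideanSpace.proj (𝕜 := ℝ) (σ i)).contDiff.contDiffAt.comp z (hv i))

namespace LieGroupoid

variable {n d : ℕ} {M G : Type*}
  [TopologicalSpace M] [ChartedSpace (EuclideanSpace ℝ (Fin n)) M] [IsManifold (𝓡 n) ∞ M]
  [TopologicalSpace G] [ChartedSpace (EuclideanSpace ℝ (Fin d)) G] [IsManifold (𝓡 d) ∞ G]

variable (𝒢 : LieGroupoid n d M G) (𝒵 : Finset (Set M))
  (oA : ∀ m, Orientation ℝ (𝒢.A m) (Fin n))
  (oM : ∀ m : M, Orientation ℝ (TangentSpace (𝓡 n) m) (Fin n))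

/-- A chart of `G` in which the source is a projection, with adapted charts around the source and
the range. -/
structure FibreChart where
  S : 𝒢.AdaptedChart 𝒵 oA oM
  T : 𝒢.AdaptedChart 𝒵 oA oM
  Ψ : OpenPartialHomeomorph G (EuclideanSpace ℝ (Fin n) × EuclideanSpace ℝ (Fin n))
  isProductChart : IsProductChart d 𝒢.s S.e Ψ
  range_mem : ∀ g ∈ Ψ.source, 𝒢.r g ∈ T.e.source
  dim_eq : d = n + n

variable {𝒢 𝒵 oA oM}

theorem _root_.PvTrace.IsProductChart.restrOpen {F : Type*} [NormedAddCommGroup F]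
    [NormedSpace ℝ F] {s : G → M}
    {e : OpenPartialHomeomorph M (EuclideanSpace ℝ (Fin n))}
    {Ψ : OpenPartialHomeomorph G (EuclideanSpace ℝ (Fin n) × F)} (h : IsProductChart d s e Ψ)
    {U : Set G} (hU : IsOpen U) : IsProductChart d s e (Ψ.restrOpen U hU) := by
  refine ⟨⟨h.contMDiffOn.mono ?_, h.contMDiffOn_symm.mono ?_⟩, ?_, ?_⟩
  · intro g hg
    rw [OpenPartialHomeomorph.restrOpen_source] at hg
    exact hg.1
  · intro z hz
    exact hz.1
  · intro g hg
    rw [OpenPartialHomeomorph.restrOpen_source] at hg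
    exact h.mem_source g hg.1
  · intro g hg
    rw [OpenPartialHomeomorph.restrOpen_source] at hg
    exact h.fst_eq g hg.1

theorem exists_fibreChart [T2Space M] (h𝒢 : 𝒢.Integrates 𝒵)
    (h𝒵 : IsSimpleNormalCrossing n 𝒵) (hoM : IsTangentOrientation oM) (hoA : 𝒢.IsOrientation oA)
    (g : G) : ∃ C : 𝒢.FibreChart 𝒵 oA oM, g ∈ C.Ψ.source ∧ C.S.e (𝒢.s g) = 0 ∧
      C.T.e (𝒢.r g) = 0 := by
  have : Nonempty M := ⟨𝒢.r g⟩
  obtain ⟨S, hS, hS0⟩ := exists_adaptedChart h𝒢 h𝒵 hoM hoA (𝒢.s g)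
  obtain ⟨T, hT, hT0⟩ := exists_adaptedChart h𝒢 h𝒵 hoM hoA (𝒢.r g)
  obtain ⟨Ψ, hg, hΨ⟩ := exists_isProductChart_euclidean (𝒢.isSubmersion_s.isSubmersionAt g)
    (h𝒢.dim_eq h𝒵) S.isDivisorChart.mem_maximalAtlas hS
  have hU : IsOpen (𝒢.r ⁻¹' T.e.source) := T.e.open_source.preimage 𝒢.contMDiff_r.continuous
  exact ⟨⟨S, T, Ψ.restrOpen _ hU, hΨ.restrOpen hU, fun g hg => by
    rw [OpenPartialHomeomorph.restrOpen_source] at hg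
    exact hg.2, h𝒢.dim_eq h𝒵⟩, by
    rw [OpenPartialHomeomorph.restrOpen_source]
    exact ⟨hg, hT⟩, hS0, hT0⟩

namespace FibreChart

variable (C : 𝒢.FibreChart 𝒵 oA oM)
  {z : EuclideanSpace ℝ (Fin n) × EuclideanSpace ℝ (Fin n)}

theorem isSmoothChart : IsSmoothChart d C.Ψ := C.isProductChart.toIsSmoothChart

theorem source_mem (hz : z ∈ C.Ψ.target) : 𝒢.s (C.Ψ.symm z) ∈ C.S.e.source :=
  C.isProductChart.mem_source _ (C.Ψ.map_target hz)

theorem chart_source (hz : z ∈ C.Ψ.target) : C.S.e (𝒢.s (C.Ψ.symm z)) = z.1 := by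
  rw [← C.isProductChart.fst_eq _ (C.Ψ.map_target hz), C.Ψ.right_inv hz]

theorem source_eq (hz : z ∈ C.Ψ.target) : 𝒢.s (C.Ψ.symm z) = C.S.e.symm z.1 := by
  rw [← C.chart_source hz, C.S.e.left_inv (C.source_mem hz)]

theorem target_mem (hz : z ∈ C.Ψ.target) : z.1 ∈ C.S.e.target := by
  rw [← C.chart_source hz]; exact C.S.e.map_source (C.source_mem hz)

/-- The range, in coordinates. -/
def range (z : EuclideanSpace ℝ (Fin n) × EuclideanSpace ℝ (Fin n)) : EuclideanSpace ℝ (Fin n) :=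
  C.T.e (𝒢.r (C.Ψ.symm z))

/-- Translation of the vertical coordinate vectors to the unit space. -/
def translate (z : EuclideanSpace ℝ (Fin n) × EuclideanSpace ℝ (Fin n)) :
    EuclideanSpace ℝ (Fin n) →L[ℝ] EuclideanSpace ℝ (Fin d) :=
  mfderiv (𝓡 n) (𝓡 d)
    (fun t => 𝒢.mul (C.Ψ.symm (z.1, t)) (𝒢.inv (C.Ψ.symm z))) z.2

theorem translate_mem (hz : z ∈ C.Ψ.target) (v : EuclideanSpace ℝ (Fin n)) :
    C.translate z v ∈ LinearMap.ker
      (mfderiv (𝓡 d) (𝓡 n) 𝒢.s (𝒢.one (𝒢.r (C.Ψ.symm z)))).toLinearMap := by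
  have : Nonempty M := ⟨𝒢.r (C.Ψ.symm z)⟩
  have key : ∀ m (hm : m ∈ C.S.e.source) (t : EuclideanSpace ℝ (Fin n)),
      (C.S.e m, t) ∈ C.Ψ.target → C.translate (C.S.e m, t) v ∈ LinearMap.ker
      (mfderiv (𝓡 d) (𝓡 n) 𝒢.s (𝒢.one (𝒢.r (C.Ψ.symm (C.S.e m, t))))).toLinearMap :=
    fun m hm t ht => 𝒢.rightTranslate_mem (fibreParam C.isProductChart C.dim_eq hm) (y := t) ht v
  have h := key _ (C.source_mem hz) z.2
  rw [C.chart_source hz] at h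
  exact h hz

/-- The translated coordinate vectors, as a tuple in `A`. -/
def frame (hz : z ∈ C.Ψ.target) : Fin n → 𝒢.A (𝒢.r (C.Ψ.symm z)) :=
  fun i => ⟨C.translate z (coordVec i), C.translate_mem hz (coordVec i)⟩

open Classical in
/-- The size of the translated coordinate frame with respect to the adapted frame. -/
def jac (z : EuclideanSpace ℝ (Fin n) × EuclideanSpace ℝ (Fin n)) : ℝ :=
  if hz : z ∈ C.Ψ.target then
    |(C.T.basis (C.range_mem _ (C.Ψ.map_target hz))).det (C.frame hz)| else 0

theorem _root_.PvTrace.IsHomogeneous.frame (hz : z ∈ C.Ψ.target)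
    {μ : (Fin n → 𝒢.A (𝒢.r (C.Ψ.symm z))) → ℂ} (hμ : IsHomogeneous μ) :
    μ (C.frame hz) = C.jac z * μ (C.T.X (𝒢.r (C.Ψ.symm z))) := by
  have h := hμ.basis (C.T.basis (C.range_mem _ (C.Ψ.map_target hz))) (C.frame hz)
  rw [jac, dif_pos hz, h]
  congr 2
  funext i
  exact C.T.basis_apply _ i

theorem abs_stdDet_frame (hz : z ∈ C.Ψ.target)
    (L : 𝒢.A (𝒢.r (C.Ψ.symm z)) →ₗ[ℝ] EuclideanSpace ℝ (Fin n)) :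
    |stdDet n fun i => L (C.frame hz i)| =
      C.jac z * |stdDet n fun i => L (C.T.X (𝒢.r (C.Ψ.symm z)) i)| := by
  rw [stdDet_comp_basis (C.T.basis (C.range_mem _ (C.Ψ.map_target hz))), abs_mul, jac,
    dif_pos hz, mul_comm]
  simp only [C.T.basis_apply]

/-- The product `γ(x,t') γ(x,t)⁻¹`. -/
def quot (z : EuclideanSpace ℝ (Fin n) × EuclideanSpace ℝ (Fin n)) (t : EuclideanSpace ℝ (Fin n)) :
    G := 𝒢.mul (C.Ψ.symm (z.1, t)) (𝒢.inv (C.Ψ.symm z))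

theorem quot_self (z : EuclideanSpace ℝ (Fin n) × EuclideanSpace ℝ (Fin n)) :
    C.quot z z.2 = 𝒢.one (𝒢.r (C.Ψ.symm z)) := 𝒢.mul_inv _

theorem composable (hz : z ∈ C.Ψ.target) {t : EuclideanSpace ℝ (Fin n)}
    (ht : (z.1, t) ∈ C.Ψ.target) : 𝒢.s (C.Ψ.symm (z.1, t)) = 𝒢.r (𝒢.inv (C.Ψ.symm z)) := by
  rw [𝒢.r_inv, C.source_eq hz, C.source_eq ht]

theorem contMDiffAt_quot (hz : z ∈ C.Ψ.target) {t : EuclideanSpace ℝ (Fin n)}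
    (ht : (z.1, t) ∈ C.Ψ.target) :
    ContMDiffAt 𝓘(ℝ, (EuclideanSpace ℝ (Fin n) × EuclideanSpace ℝ (Fin n)) ×
      EuclideanSpace ℝ (Fin n)) (𝓡 d) ∞ (fun p => C.quot p.1 p.2) (z, t) := by
  have h1 : ContMDiffAt 𝓘(ℝ, (EuclideanSpace ℝ (Fin n) × EuclideanSpace ℝ (Fin n)) ×
      EuclideanSpace ℝ (Fin n)) 𝓘(ℝ, EuclideanSpace ℝ (Fin n) × EuclideanSpace ℝ (Fin n)) ∞
      (fun p => (p.1.1, p.2)) (z, t) := by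
    refine ContDiffAt.contMDiffAt ?_
    fun_prop
  have h2 : ContMDiffAt 𝓘(ℝ, (EuclideanSpace ℝ (Fin n) × EuclideanSpace ℝ (Fin n)) ×
      EuclideanSpace ℝ (Fin n)) 𝓘(ℝ, EuclideanSpace ℝ (Fin n) × EuclideanSpace ℝ (Fin n)) ∞
      (fun p => p.1) (z, t) := contDiff_fst.contDiffAt.contMDiffAt
  have h3 := (C.isSmoothChart.contMDiffAt_symm ht).comp (z, t) h1
  have h4 := (𝒢.contMDiff_inv _).comp (z, t)
    ((C.isSmoothChart.contMDiffAt_symm hz).comp (z, t) h2)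
  refine contMDiffAt_mul h3 h4 ?_
  filter_upwards [h1.continuousAt.preimage_mem_nhds (C.Ψ.open_target.mem_nhds ht),
    h2.continuousAt.preimage_mem_nhds (C.Ψ.open_target.mem_nhds hz)] with p hp hp'
  exact C.composable hp' hp

end FibreChart

end LieGroupoid

theorem IsProductChart.apply_symm {d n : ℕ} {X : Type*} [TopologicalSpace X]
    [ChartedSpace (EuclideanSpace ℝ (Fin d)) X] {M F : Type*} [TopologicalSpace M]
    [NormedAddCommGroup F] [NormedSpace ℝ F] {s : X → M}
    {e : OpenPartialHomeomorph M (EuclideanSpace ℝ (Fin n))}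
    {Ψ : OpenPartialHomeomorph X (EuclideanSpace ℝ (Fin n) × F)} (h : IsProductChart d s e Ψ)
    {m : M} (hm : m ∈ e.source) {t : F} (ht : (e m, t) ∈ Ψ.target) : s (Ψ.symm (e m, t)) = m := by
  have h1 := h.fst_eq _ (Ψ.map_target ht)
  rw [Ψ.right_inv ht] at h1
  exact (e.injOn hm (h.mem_source _ (Ψ.map_target ht)) h1).symm

namespace LieGroupoid

variable {n d : ℕ} {M G : Type*}
  [TopologicalSpace M] [ChartedSpace (EuclideanSpace ℝ (Fin n)) M] [IsManifold (𝓡 n) ∞ M]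
  [TopologicalSpace G] [ChartedSpace (EuclideanSpace ℝ (Fin d)) G] [IsManifold (𝓡 d) ∞ G]
  {𝒢 : LieGroupoid n d M G} {𝒵 : Finset (Set M)}
  {oA : ∀ m, Orientation ℝ (𝒢.A m) (Fin n)}
  {oM : ∀ m : M, Orientation ℝ (TangentSpace (𝓡 n) m) (Fin n)}

namespace FibreChart

variable (C : 𝒢.FibreChart 𝒵 oA oM)
  {z : EuclideanSpace ℝ (Fin n) × EuclideanSpace ℝ (Fin n)}

theorem mfderiv_translate {E' : Type*} [NormedAddCommGroup E'] [NormedSpace ℝ E'] {f : G → E'}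
    (hz : z ∈ C.Ψ.target)
    (hf : MDifferentiableAt (𝓡 d) 𝓘(ℝ, E') f (𝒢.one (𝒢.r (C.Ψ.symm z))))
    (v : EuclideanSpace ℝ (Fin n)) :
    (show EuclideanSpace ℝ (Fin d) →L[ℝ] E' from
      mfderiv (𝓡 d) 𝓘(ℝ, E') f (𝒢.one (𝒢.r (C.Ψ.symm z)))) (C.translate z v) =
    fderiv ℝ (fun t => f (C.quot z t)) z.2 v := by
  rw [← C.quot_self z] at hf
  have h0 : ContMDiffAt 𝓘(ℝ, EuclideanSpace ℝ (Fin n)) (𝓡 d) ∞ (C.quot z) z.2 :=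
    (C.contMDiffAt_quot hz (t := z.2) hz).comp z.2
      (g := fun p : (EuclideanSpace ℝ (Fin n) × EuclideanSpace ℝ (Fin n)) ×
        EuclideanSpace ℝ (Fin n) => C.quot p.1 p.2) (f := fun t => (z, t))
      (ContDiffAt.contMDiffAt (by fun_prop))
  have h1 := hf.hasMFDerivAt.comp z.2 ((h0.mdifferentiableAt (by simp)).hasMFDerivAt)
  have h2 := congrArg (fun A : EuclideanSpace ℝ (Fin n) →L[ℝ] E' => A v)
    (h1.mfderiv.symm.trans mfderiv_eq_fderiv)
  have h3 : ∀ p q : G, p = q → (show EuclideanSpace ℝ (Fin d) →L[ℝ] E' from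
      mfderiv (𝓡 d) 𝓘(ℝ, E') f p) = (show EuclideanSpace ℝ (Fin d) →L[ℝ] E' from
      mfderiv (𝓡 d) 𝓘(ℝ, E') f q) := by rintro p q rfl; rfl
  rw [h3 _ _ (C.quot_self z).symm]
  exact h2

theorem mul_quot (hz : z ∈ C.Ψ.target) {t : EuclideanSpace ℝ (Fin n)}
    (ht : (z.1, t) ∈ C.Ψ.target) :
    𝒢.mul (C.quot z t) (C.Ψ.symm z) = C.Ψ.symm (z.1, t) := by
  rw [quot, 𝒢.mul_assoc _ _ _ (C.composable hz ht) (𝒢.s_inv _), 𝒢.inv_mul,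
    ← 𝒢.r_inv, ← C.composable hz ht, 𝒢.mul_one]

theorem s_quot (hz : z ∈ C.Ψ.target) {t : EuclideanSpace ℝ (Fin n)}
    (ht : (z.1, t) ∈ C.Ψ.target) : 𝒢.s (C.quot z t) = 𝒢.r (C.Ψ.symm z) := by
  rw [quot, 𝒢.s_mul _ _ (C.composable hz ht), 𝒢.s_inv]

theorem r_quot (hz : z ∈ C.Ψ.target) {t : EuclideanSpace ℝ (Fin n)}
    (ht : (z.1, t) ∈ C.Ψ.target) : 𝒢.r (C.quot z t) = 𝒢.r (C.Ψ.symm (z.1, t)) := by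
  rw [quot, 𝒢.r_mul _ _ (C.composable hz ht)]

theorem eventually_mem_target (hz : z ∈ C.Ψ.target) :
    ∀ᶠ t in 𝓝 z.2, (z.1, t) ∈ C.Ψ.target :=
  (Continuous.prodMk_right z.1).continuousAt.preimage_mem_nhds
    (C.Ψ.open_target.mem_nhds (show (z.1, z.2) ∈ C.Ψ.target from hz))

theorem injective_fderiv_quot (hz : z ∈ C.Ψ.target)
    {Φ : OpenPartialHomeomorph G (EuclideanSpace ℝ (Fin n) × EuclideanSpace ℝ (Fin n))}
    (hΦ : IsProductChart d 𝒢.s C.T.e Φ) (hm : 𝒢.one (𝒢.r (C.Ψ.symm z)) ∈ Φ.source)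
    (hh : DifferentiableAt ℝ (fun t => (Φ (C.quot z t)).2) z.2) :
    Function.Injective (fderiv ℝ (fun t => (Φ (C.quot z t)).2) z.2) := by
  set g₀ := C.Ψ.symm z with hg₀
  have hT : 𝒢.r g₀ ∈ C.T.e.source := C.range_mem _ (C.Ψ.map_target hz)
  let N : EuclideanSpace ℝ (Fin n) → EuclideanSpace ℝ (Fin n) := fun τ =>
    (C.Ψ (𝒢.mul (Φ.symm (C.T.e (𝒢.r g₀), τ)) g₀)).2
  have hΦ1 : Φ (𝒢.one (𝒢.r g₀)) = (C.T.e (𝒢.r g₀), (Φ (C.quot z z.2)).2) := by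
    refine Prod.ext ?_ ?_
    · rw [hΦ.fst_eq _ hm, 𝒢.s_one]
    · rw [C.quot_self]
  have hmem : (C.T.e (𝒢.r g₀), (Φ (C.quot z z.2)).2) ∈ Φ.target := hΦ1 ▸ Φ.map_source hm
  have hsm : Φ.symm (C.T.e (𝒢.r g₀), (Φ (C.quot z z.2)).2) = 𝒢.one (𝒢.r g₀) := by
    rw [← hΦ1, Φ.left_inv hm]
  have hN : DifferentiableAt ℝ N (Φ (C.quot z z.2)).2 := by
    have h1 : ContMDiffAt 𝓘(ℝ, EuclideanSpace ℝ (Fin n)) (𝓡 d) ∞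
        (fun τ => Φ.symm (C.T.e (𝒢.r g₀), τ)) (Φ (C.quot z z.2)).2 :=
      (hΦ.toIsSmoothChart.contMDiffAt_symm hmem).comp (Φ (C.quot z z.2)).2
        (ContDiffAt.contMDiffAt (by fun_prop))
    have h2 := contMDiffAt_mul (𝒢 := 𝒢) h1 (contMDiffAt_const (c := g₀)) (by
      filter_upwards [(Continuous.prodMk_right (C.T.e (𝒢.r g₀))).continuousAt.preimage_mem_nhds
        (Φ.open_target.mem_nhds hmem)] with τ hτ
      exact hΦ.apply_symm hT hτ)
    have h3 : 𝒢.mul (Φ.symm (C.T.e (𝒢.r g₀), (Φ (C.quot z z.2)).2)) g₀ = g₀ := by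
      rw [hsm, 𝒢.one_mul]
    have h4 : ContMDiffAt (𝓡 d)
        𝓘(ℝ, EuclideanSpace ℝ (Fin n) × EuclideanSpace ℝ (Fin n)) ∞ C.Ψ
        (𝒢.mul (Φ.symm (C.T.e (𝒢.r g₀), (Φ (C.quot z z.2)).2)) g₀) := by
      rw [h3]
      exact C.isSmoothChart.contMDiffAt (C.Ψ.map_target hz)
    have h5 := contMDiffAt_iff_contDiffAt.1 (ContMDiffAt.comp (Φ (C.quot z z.2)).2 (g := C.Ψ)
      (f := fun τ => 𝒢.mul (Φ.symm (C.T.e (𝒢.r g₀), τ)) g₀) h4 h2)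
    exact (contDiffAt_snd.comp _ h5).differentiableAt (by simp)
  have hc : ∀ᶠ t in 𝓝 z.2, C.quot z t ∈ Φ.source := by
    have h0 : ContMDiffAt 𝓘(ℝ, EuclideanSpace ℝ (Fin n)) (𝓡 d) ∞ (C.quot z) z.2 :=
      (C.contMDiffAt_quot hz (t := z.2) hz).comp z.2
        (g := fun p : (EuclideanSpace ℝ (Fin n) × EuclideanSpace ℝ (Fin n)) ×
          EuclideanSpace ℝ (Fin n) => C.quot p.1 p.2) (f := fun t => (z, t))
        (ContDiffAt.contMDiffAt (by fun_prop))
    exact h0.continuousAt.preimage_mem_nhds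
      (Φ.open_source.mem_nhds (by rw [C.quot_self]; exact hm))
  have hid : (fun t => N (Φ (C.quot z t)).2) =ᶠ[𝓝 z.2] fun t => t := by
    filter_upwards [hc, C.eventually_mem_target hz] with t ht ht'
    have h1 : (C.T.e (𝒢.r g₀), (Φ (C.quot z t)).2) = Φ (C.quot z t) := by
      refine Prod.ext ?_ rfl
      rw [hΦ.fst_eq _ ht, C.s_quot hz ht']
    simp only [N]
    rw [h1, Φ.left_inv ht, C.mul_quot hz ht', C.Ψ.right_inv ht']
  have h1 := hN.hasFDerivAt.comp z.2 hh.hasFDerivAt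
  have h2 := h1.unique ((hasFDerivAt_id z.2).congr_of_eventuallyEq hid)
  intro v w hvw
  have h3 : ∀ v, fderiv ℝ N (Φ (C.quot z z.2)).2
      (fderiv ℝ (fun t => (Φ (C.quot z t)).2) z.2 v) = v :=
    fun v => congrArg (fun A : EuclideanSpace ℝ (Fin n) →L[ℝ] EuclideanSpace ℝ (Fin n) => A v) h2
  rw [← h3 v, hvw, h3 w]

theorem contDiffAt_jac (hz : z ∈ C.Ψ.target) : ContDiffAt ℝ ∞ C.jac z ∧ 0 < C.jac z := by
  have hT : 𝒢.r (C.Ψ.symm z) ∈ C.T.e.source := C.range_mem _ (C.Ψ.map_target hz)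
  obtain ⟨Φ, hm, hΦ⟩ := exists_isProductChart_euclidean
    (𝒢.isSubmersion_s.isSubmersionAt (𝒢.one (𝒢.r (C.Ψ.symm z)))) C.dim_eq
    C.T.isDivisorChart.mem_maximalAtlas (by rw [𝒢.s_one]; exact hT)
  let h : EuclideanSpace ℝ (Fin n) × EuclideanSpace ℝ (Fin n) → EuclideanSpace ℝ (Fin n) →
    EuclideanSpace ℝ (Fin n) := fun z t => (Φ (C.quot z t)).2
  have hh : ContDiffAt ℝ ∞ (Function.uncurry h) (z, z.2) := by
    have h1 : ContMDiffAt (𝓡 d)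
        𝓘(ℝ, EuclideanSpace ℝ (Fin n) × EuclideanSpace ℝ (Fin n)) ∞ Φ (C.quot z z.2) := by
      rw [C.quot_self]
      exact hΦ.toIsSmoothChart.contMDiffAt hm
    have h2 := contMDiffAt_iff_contDiffAt.1
      (ContMDiffAt.comp (z, z.2) (g := Φ) (f := fun p : (EuclideanSpace ℝ (Fin n) ×
        EuclideanSpace ℝ (Fin n)) × EuclideanSpace ℝ (Fin n) => C.quot p.1 p.2) h1
        (C.contMDiffAt_quot hz (t := z.2) hz))
    exact contDiffAt_snd.comp _ h2
  have hA : ContDiffAt ℝ ∞ (fun z => stdDet n fun i => fderiv ℝ (h z) z.2 (coordVec i)) z :=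
    contDiffAt_stdDet fun i => (ContDiffAt.fderiv (m := ∞) hh contDiffAt_snd (by simp)).clm_apply
      contDiffAt_const
  have hr : ContMDiffAt 𝓘(ℝ, EuclideanSpace ℝ (Fin n) × EuclideanSpace ℝ (Fin n)) (𝓡 n) ∞
      (fun z => 𝒢.r (C.Ψ.symm z)) z :=
    (𝒢.contMDiff_r _).comp z (C.isSmoothChart.contMDiffAt_symm hz)
  have hB : ContDiffAt ℝ ∞ (fun z => stdDet n fun i =>
      ((show EuclideanSpace ℝ (Fin d) →L[ℝ] EuclideanSpace ℝ (Fin n) × EuclideanSpace ℝ (Fin n)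
        from mfderiv (𝓡 d) 𝓘(ℝ, EuclideanSpace ℝ (Fin n) × EuclideanSpace ℝ (Fin n)) Φ
          (𝒢.one (𝒢.r (C.Ψ.symm z)))) (C.T.X (𝒢.r (C.Ψ.symm z)) i).1).2) z := by
    refine contDiffAt_stdDet fun i => ?_
    have h1 := (C.T.isFrameOn.smooth i).contMDiffAt (C.T.e.open_source.mem_nhds hT)
    have h2 := ((hΦ.toIsSmoothChart.contMDiffAt_tangent_iff (b := 𝒢.one) hm).1 h1).2
    exact contDiffAt_snd.comp z (contMDiffAt_iff_contDiffAt.1 (h2.comp z hr))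
  have hone : ContinuousAt (fun z => 𝒢.one (𝒢.r (C.Ψ.symm z))) z :=
    (𝒢.contMDiff_one.continuous.continuousAt).comp hr.continuousAt
  have hrel : ∀ᶠ z in 𝓝 z, |stdDet n fun i => fderiv ℝ (h z) z.2 (coordVec i)| =
      C.jac z * |stdDet n fun i =>
      ((show EuclideanSpace ℝ (Fin d) →L[ℝ] EuclideanSpace ℝ (Fin n) × EuclideanSpace ℝ (Fin n)
        from mfderiv (𝓡 d) 𝓘(ℝ, EuclideanSpace ℝ (Fin n) × EuclideanSpace ℝ (Fin n)) Φ
          (𝒢.one (𝒢.r (C.Ψ.symm z)))) (C.T.X (𝒢.r (C.Ψ.symm z)) i).1).2| := by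
    filter_upwards [C.Ψ.open_target.mem_nhds hz,
      hone.preimage_mem_nhds (Φ.open_source.mem_nhds hm)] with z' hz' hm'
    have hd : MDifferentiableAt (𝓡 d) 𝓘(ℝ, EuclideanSpace ℝ (Fin n)) (fun g => (Φ g).2)
        (𝒢.one (𝒢.r (C.Ψ.symm z'))) :=
      ((contDiffAt_snd.contMDiffAt).comp _ (hΦ.toIsSmoothChart.contMDiffAt hm')).mdifferentiableAt
        (by simp)
    have hd' : ∀ v : EuclideanSpace ℝ (Fin d),
        (show EuclideanSpace ℝ (Fin d) →L[ℝ] EuclideanSpace ℝ (Fin n) from mfderiv (𝓡 d)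
          𝓘(ℝ, EuclideanSpace ℝ (Fin n)) (fun g => (Φ g).2) (𝒢.one (𝒢.r (C.Ψ.symm z')))) v =
        ((show EuclideanSpace ℝ (Fin d) →L[ℝ] EuclideanSpace ℝ (Fin n) × EuclideanSpace ℝ (Fin n)
        from mfderiv (𝓡 d) 𝓘(ℝ, EuclideanSpace ℝ (Fin n) × EuclideanSpace ℝ (Fin n)) Φ
          (𝒢.one (𝒢.r (C.Ψ.symm z')))) v).2 := by
      intro v
      have h1 := ((ContinuousLinearMap.snd ℝ (EuclideanSpace ℝ (Fin n))
        (EuclideanSpace ℝ (Fin n))).hasMFDerivAt (x := Φ (𝒢.one (𝒢.r (C.Ψ.symm z'))))).comp _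
        (((hΦ.toIsSmoothChart.contMDiffAt hm').mdifferentiableAt (by simp)).hasMFDerivAt)
      exact congrArg (fun A : EuclideanSpace ℝ (Fin d) →L[ℝ] EuclideanSpace ℝ (Fin n) => A v)
        h1.mfderiv
    have h1 := C.abs_stdDet_frame hz' (((show EuclideanSpace ℝ (Fin d) →L[ℝ]
      EuclideanSpace ℝ (Fin n) from mfderiv (𝓡 d) 𝓘(ℝ, EuclideanSpace ℝ (Fin n))
        (fun g => (Φ g).2) (𝒢.one (𝒢.r (C.Ψ.symm z')))).toLinearMap).comp (Submodule.subtype _))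
    refine Eq.trans ?_ (h1.trans ?_)
    · congr 2
      funext i
      exact (C.mfderiv_translate hz' hd (coordVec i)).symm
    · congr 3
      funext i
      exact hd' _
  have hA0 : stdDet n (fun i => fderiv ℝ (h z) z.2 (coordVec i)) ≠ 0 := by
    have hdiff : DifferentiableAt ℝ (h z) z.2 := by
      have h1 := (hh.differentiableAt (by simp))
      exact h1.comp (f := fun t => (z, t)) z.2 (by fun_prop)
    have hinj := C.injective_fderiv_quot hz hΦ hm hdiff
    refine stdDet_ne_zero (LinearIndependent.map' (v := coordVec) ?_
      (fderiv ℝ (h z) z.2).toLinearMap (LinearMap.ker_eq_bot.2 hinj))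
    have := (EuclideanSpace.basisFun (Fin n) ℝ).toBasis.linearIndependent
    have he : coordVec = ⇑(EuclideanSpace.basisFun (Fin n) ℝ).toBasis := by
      funext i
      simp [coordVec]
    rw [he]
    exact this
  have hrel0 := hrel.self_of_nhds
  have hB0 := right_ne_zero_of_mul (hrel0 ▸ abs_ne_zero.2 hA0)
  have hev : C.jac =ᶠ[𝓝 z] _ := hrel.mp ((hB.continuousAt.eventually_ne (abs_ne_zero.1 hB0)).mono
    fun z' h1 h2 => (eq_div_iff (abs_ne_zero.2 h1)).2 h2.symm)
  refine ⟨((hA.abs hA0).div (hB.abs (abs_ne_zero.1 hB0)) hB0).congr_of_eventuallyEq hev, ?_⟩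
  rw [hev.self_of_nhds]
  exact div_pos (abs_pos.2 hA0) (abs_pos.2 (abs_ne_zero.1 hB0))

theorem contDiffAt_range (hz : z ∈ C.Ψ.target) : ContDiffAt ℝ ∞ C.range z :=
  contMDiffAt_iff_contDiffAt.1 ((C.T.isSmoothChart.contMDiffAt
    (C.range_mem _ (C.Ψ.map_target hz))).comp z ((𝒢.contMDiff_r _).comp z
      (C.isSmoothChart.contMDiffAt_symm hz)))

/-- The vertical derivative of the range. -/
theorem abs_det_fderiv_range (hz : z ∈ C.Ψ.target) :
    |(fderiv ℝ (fun t => C.range (z.1, t)) z.2).det| =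
      C.jac z * |∏ i ∈ C.T.I, C.range z i| := by
  have hT : 𝒢.r (C.Ψ.symm z) ∈ C.T.e.source := C.range_mem _ (C.Ψ.map_target hz)
  have hf : MDifferentiableAt (𝓡 d) 𝓘(ℝ, EuclideanSpace ℝ (Fin n)) (fun g => C.T.e (𝒢.r g))
      (𝒢.one (𝒢.r (C.Ψ.symm z))) := by
    refine ContMDiffAt.mdifferentiableAt (n := ∞) ?_ (by simp)
    refine ContMDiffAt.comp (I' := 𝓡 n) _ (g := C.T.e) ?_ (𝒢.contMDiff_r _)
    rw [𝒢.r_one]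
    exact C.T.isSmoothChart.contMDiffAt hT
  have h1 := C.abs_stdDet_frame hz (((show EuclideanSpace ℝ (Fin d) →L[ℝ]
      EuclideanSpace ℝ (Fin n) from mfderiv (𝓡 d) 𝓘(ℝ, EuclideanSpace ℝ (Fin n))
        (fun g => C.T.e (𝒢.r g)) (𝒢.one (𝒢.r (C.Ψ.symm z)))).toLinearMap).comp
        (Submodule.subtype _))
  have h2 : (fun t => C.T.e (𝒢.r (C.quot z t))) =ᶠ[𝓝 z.2] fun t => C.range (z.1, t) := by
    filter_upwards [C.eventually_mem_target hz] with t ht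
    rw [C.r_quot hz ht, range]
  rw [← stdDet_map]
  refine Eq.trans ?_ (h1.trans ?_)
  · congr 2
    funext i
    rw [← h2.fderiv_eq]
    exact (C.mfderiv_translate hz hf (coordVec i)).symm
  · congr 1
    have h3 : ∀ i, (show EuclideanSpace ℝ (Fin d) →L[ℝ]
      EuclideanSpace ℝ (Fin n) from mfderiv (𝓡 d) 𝓘(ℝ, EuclideanSpace ℝ (Fin n))
        (fun g => C.T.e (𝒢.r g)) (𝒢.one (𝒢.r (C.Ψ.symm z))))
          (C.T.X (𝒢.r (C.Ψ.symm z)) i).1 = bWeight C.T.I i (C.range z) • coordVec i := by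
      intro i
      have he : MDifferentiableAt (𝓡 n) 𝓘(ℝ, EuclideanSpace ℝ (Fin n)) C.T.e
          (𝒢.r (𝒢.one (𝒢.r (C.Ψ.symm z)))) := by
        rw [𝒢.r_one]
        exact (C.T.isSmoothChart.contMDiffAt hT).mdifferentiableAt (by simp)
      have h4 := he.hasMFDerivAt.comp _
        (((𝒢.contMDiff_r (𝒢.one (𝒢.r (C.Ψ.symm z)))).mdifferentiableAt (by simp)).hasMFDerivAt)
      have h5 := congrArg (fun A : EuclideanSpace ℝ (Fin d) →L[ℝ] EuclideanSpace ℝ (Fin n) =>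
        A (C.T.X (𝒢.r (C.Ψ.symm z)) i).1) h4.mfderiv
      refine Eq.trans h5 ?_
      have h6 : ∀ p q : M, p = q →
          (show EuclideanSpace ℝ (Fin n) →L[ℝ] EuclideanSpace ℝ (Fin n) from
        mfderiv (𝓡 n) 𝓘(ℝ, EuclideanSpace ℝ (Fin n)) C.T.e p) =
        (show EuclideanSpace ℝ (Fin n) →L[ℝ] EuclideanSpace ℝ (Fin n) from
        mfderiv (𝓡 n) 𝓘(ℝ, EuclideanSpace ℝ (Fin n)) C.T.e q) := by rintro p q rfl; rfl
      have h7 : (show EuclideanSpace ℝ (Fin n) →L[ℝ] EuclideanSpace ℝ (Fin n) from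
        mfderiv (𝓡 n) 𝓘(ℝ, EuclideanSpace ℝ (Fin n)) C.T.e (𝒢.r (C.Ψ.symm z)))
          (𝒢.anchor _ (C.T.X (𝒢.r (C.Ψ.symm z)) i)) =
          bWeight C.T.I i (C.range z) • coordVec i := by
        rw [C.T.anchor_eq _ hT]
        refine (map_smul _ _ _).trans ?_
        congr 1
        exact mfderiv_chartVec C.T.isSmoothChart hT i
      rw [← h7, ← h6 _ _ (𝒢.r_one _)]
      rfl
    have h8 : stdDet n (fun i => bWeight C.T.I i (C.range z) • coordVec i) =
        ∏ i ∈ C.T.I, C.range z i := by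
      rw [AlternatingMap.map_smul_univ, stdDet_coordVec, prod_bWeight, smul_eq_mul,
        _root_.mul_one]
    rw [← h8]
    congr 2
    funext i
    exact h3 i

end FibreChart

end LieGroupoid

theorem exists_smooth_partition {d : ℕ} {X : Type*} [TopologicalSpace X]
    [ChartedSpace (EuclideanSpace ℝ (Fin d)) X] [IsManifold (𝓡 d) ∞ X] [T2Space X]
    [SigmaCompactSpace X] {K : Set X} (hK : IsCompact K) {N : X → Set X} (hN : ∀ x, N x ∈ 𝓝 x) :
    ∃ (k : ℕ) (x : Fin k → X) (χ : Fin k → X → ℝ), (∀ a, ContMDiff (𝓡 d) 𝓘(ℝ, ℝ) ∞ (χ a)) ∧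
      (∀ a, HasCompactSupport (χ a)) ∧ (∀ a, tsupport (χ a) ⊆ N (x a)) ∧
      ∀ g ∈ K, ∑ a, χ a g = 1 := by
  have : LocallyCompactSpace X := Manifold.locallyCompact_of_finiteDimensional (𝓡 d)
  have hc : ∀ x : X, ∃ L, IsCompact L ∧ L ∈ 𝓝 x := fun x => exists_compact_mem_nhds x
  choose L hL hLx using hc
  let U : X → Set X := fun x => interior (N x ∩ L x)
  have hU : ∀ x, x ∈ U x := fun x => mem_interior_iff_mem_nhds.2 (inter_mem (hN x) (hLx x))
  obtain ⟨t, ht⟩ := hK.elim_finite_subcover U (fun x => isOpen_interior)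
    (fun x _ => mem_iUnion.2 ⟨x, hU x⟩)
  let f : Fin t.card → X := fun a => (t.equivFin.symm a).1
  have hcov : K ⊆ ⋃ a, U (f a) := by
    intro x hx
    obtain ⟨y, hy, hxy⟩ := mem_iUnion₂.1 (ht hx)
    exact mem_iUnion.2 ⟨t.equivFin ⟨y, hy⟩, by simpa [f] using hxy⟩
  obtain ⟨ρ, hρ⟩ := SmoothPartitionOfUnity.exists_isSubordinate (𝓡 d) hK.isClosed
    (fun a => U (f a)) (fun a => isOpen_interior) hcov
  refine ⟨t.card, f, fun a => ρ a, fun a => (ρ a).contMDiff, fun a => ?_, fun a => ?_,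
    fun g hg => ?_⟩
  · exact (hL (f a)).of_isClosed_subset (isClosed_tsupport _)
      ((hρ a).trans (interior_subset.trans inter_subset_right))
  · exact (hρ a).trans (interior_subset.trans inter_subset_left)
  · have := ρ.sum_eq_one hg
    rwa [finsum_eq_sum_of_fintype] at this

namespace LieGroupoid

variable {n d : ℕ} {M G : Type*}
  [TopologicalSpace M] [ChartedSpace (EuclideanSpace ℝ (Fin n)) M] [IsManifold (𝓡 n) ∞ M]
  [TopologicalSpace G] [ChartedSpace (EuclideanSpace ℝ (Fin d)) G] [IsManifold (𝓡 d) ∞ G]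
  {𝒢 : LieGroupoid n d M G} {𝒵 : Finset (Set M)}
  {oA : ∀ m, Orientation ℝ (𝒢.A m) (Fin n)}
  {oM : ∀ m : M, Orientation ℝ (TangentSpace (𝓡 n) m) (Fin n)}

theorem exists_fibre_cover [SigmaCompactSpace G] (hd : d = n + n) (m : M) :
    ∃ P : ℕ → LocalParam d n (𝒢.s ⁻¹' {m}),
      𝒢.s ⁻¹' {m} ⊆ ⋃ i, (P i).toFun '' (P i).source := by
  have hch : ∀ g : 𝒢.s ⁻¹' {m}, ∃ Ψ : OpenPartialHomeomorph G
      (EuclideanSpace ℝ (Fin n) × EuclideanSpace ℝ (Fin n)), g.1 ∈ Ψ.source ∧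
      IsProductChart d 𝒢.s (chartAt (EuclideanSpace ℝ (Fin n)) m) Ψ := fun g =>
    exists_isProductChart_euclidean (𝒢.isSubmersion_s.isSubmersionAt g.1) hd
      (IsManifold.chart_mem_maximalAtlas m) (by
        have : 𝒢.s g.1 = m := g.2
        rw [this]; exact mem_chart_source _ m)
  choose Ψ hg hΨ using hch
  have := ChartedSpace.secondCountable_of_sigmaCompact (EuclideanSpace ℝ (Fin d)) G
  obtain ⟨t, htc, ht⟩ := TopologicalSpace.countable_cover_nhds
    (f := fun g : 𝒢.s ⁻¹' {m} => Subtype.val ⁻¹' (Ψ g).source)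
    (fun g => ((Ψ g).open_source.preimage continuous_subtype_val).mem_nhds (hg g))
  have := htc.to_subtype
  have hcov : ∀ g (hgm : 𝒢.s g = m), ∃ a ∈ t, g ∈ (Ψ a).source := by
    intro g hgm
    have h := ht.ge (mem_univ (⟨g, hgm⟩ : 𝒢.s ⁻¹' {m}))
    obtain ⟨a, ha, hga⟩ := mem_iUnion₂.1 h
    exact ⟨a, ha, hga⟩
  have : Nonempty t := by
    obtain ⟨a, ha, -⟩ := hcov (𝒢.one m) (𝒢.s_one m)
    exact ⟨⟨a, ha⟩⟩
  refine exists_nat_params (ι := t)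
    (fun a => fibreParam (hΨ a.1) hd (mem_chart_source _ m)) fun g hgm => ?_
  obtain ⟨a, ha, hga⟩ := hcov g hgm
  exact mem_iUnion.2 ⟨⟨a, ha⟩, image_fibreParam (hΨ a) hd (mem_chart_source _ m) hgm hga⟩

/-- The integrand of the convolution product, evaluated on local frames. -/
def kernel (f₁ f₀ : ∀ g, (Fin n → 𝒢.A (𝒢.r g)) → (Fin n → 𝒢.A (𝒢.s g)) → ℂ)
    (X B Y : ∀ m, Fin n → 𝒢.A m) (g γ : G) : ℂ :=
  f₁ (𝒢.mul g (𝒢.inv γ)) (X (𝒢.r (𝒢.mul g (𝒢.inv γ)))) (B (𝒢.s (𝒢.mul g (𝒢.inv γ)))) *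
    f₀ γ (B (𝒢.r γ)) (Y (𝒢.s γ))

variable {f₁ f₀ : ∀ g, (Fin n → 𝒢.A (𝒢.r g)) → (Fin n → 𝒢.A (𝒢.s g)) → ℂ}
  {X Y : ∀ m, Fin n → 𝒢.A m} {U V : Set M}

theorem convIntegrand_frames (B : ∀ m, Fin n → 𝒢.A m) {g γ : G} (h : 𝒢.s γ = 𝒢.s g) :
    𝒢.convIntegrand f₁ f₀ g γ h (X (𝒢.r g)) (Y (𝒢.s g)) (B (𝒢.r γ)) =
      kernel f₁ f₀ X B Y g γ := by
  simp only [convIntegrand, kernel, castTuple_section]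

namespace FibreChart

variable (C : 𝒢.FibreChart 𝒵 oA oM) {χ : G → ℝ}

open Classical in
/-- The integrand of the convolution product, weighted with `χ`, in a chart. -/
def localIntegrand (χ : G → ℝ)
    (f₁ f₀ : ∀ g, (Fin n → 𝒢.A (𝒢.r g)) → (Fin n → 𝒢.A (𝒢.s g)) → ℂ)
    (X Y : ∀ m, Fin n → 𝒢.A m) (g : G) (t : EuclideanSpace ℝ (Fin n)) : ℂ :=
  if 𝒢.s g ∈ C.S.e.source ∧ (C.S.e (𝒢.s g), t) ∈ C.Ψ.target then
    χ (C.Ψ.symm (C.S.e (𝒢.s g), t)) • (C.jac (C.S.e (𝒢.s g), t) •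
      kernel f₁ f₀ X C.T.X Y g (C.Ψ.symm (C.S.e (𝒢.s g), t)))
  else 0

theorem localIntegrand_eq_zero {g : G} {t : EuclideanSpace ℝ (Fin n)}
    (h : (C.S.e (𝒢.s g), t) ∉ C.Ψ '' tsupport χ) : C.localIntegrand χ f₁ f₀ X Y g t = 0 := by
  rw [localIntegrand]
  split_ifs with hg
  · have h0 : χ (C.Ψ.symm (C.S.e (𝒢.s g), t)) = 0 :=
      image_eq_zero_of_notMem_tsupport fun h' => h ⟨_, h', C.Ψ.right_inv hg.2⟩
    rw [h0, zero_smul]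
  · rfl

theorem isCompact_image (hc : HasCompactSupport χ) (hs : tsupport χ ⊆ C.Ψ.source) :
    IsCompact (C.Ψ '' tsupport χ) :=
  hc.image_of_continuousOn (C.Ψ.continuousOn.mono hs)

theorem contMDiffAt_localIntegrand (hχ : ContMDiff (𝓡 d) 𝓘(ℝ, ℝ) ∞ χ) (hc : HasCompactSupport χ)
    (hs : tsupport χ ⊆ C.Ψ.source) (h₁ : f₁ ∈ 𝒢.Psi) (h₀ : f₀ ∈ 𝒢.Psi) (hX : 𝒢.IsFrameOn U X)
    (hY : 𝒢.IsFrameOn V Y) {E' H' N : Type*} [NormedAddCommGroup E'] [NormedSpace ℝ E']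
    [TopologicalSpace H'] {I' : ModelWithCorners ℝ E' H'} [TopologicalSpace N] [ChartedSpace H' N]
    {g : N → G} {t : N → EuclideanSpace ℝ (Fin n)} {q : N} (hg : ContMDiffAt I' (𝓡 d) ∞ g q)
    (ht : ContMDiffAt I' 𝓘(ℝ, EuclideanSpace ℝ (Fin n)) ∞ t q) (hgS : 𝒢.s (g q) ∈ C.S.e.source)
    (hgU : 𝒢.r (g q) ∈ U) (hgV : 𝒢.s (g q) ∈ V) :
    ContMDiffAt I' 𝓘(ℝ, ℂ) ∞ (fun p => C.localIntegrand χ f₁ f₀ X Y (g p) (t p)) q := by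
  have hsg : ContMDiffAt I' (𝓡 n) ∞
    (fun p : N => 𝒢.s (g p)) q :=
    (𝒢.contMDiff_s _).comp q hg
  have hx : ContMDiffAt I'
      𝓘(ℝ, EuclideanSpace ℝ (Fin n) × EuclideanSpace ℝ (Fin n)) ∞
      (fun p : N => (C.S.e (𝒢.s (g p)), (t p))) q :=
    ContMDiffAt.prodMk_space ((C.S.isSmoothChart.contMDiffAt hgS).comp q hsg) ht
  by_cases hK : (C.S.e (𝒢.s (g q)), t q) ∈ C.Ψ '' tsupport χ
  · have hz : (C.S.e (𝒢.s (g q)), t q) ∈ C.Ψ.target := by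
      obtain ⟨g', hg', he⟩ := hK
      rw [← he]; exact C.Ψ.map_source (hs hg')
    set γ : N → G := fun p => C.Ψ.symm (C.S.e (𝒢.s (g p)), (t p)) with hγdef
    have hγ : ContMDiffAt I' (𝓡 d) ∞ γ q :=
      (C.isSmoothChart.contMDiffAt_symm hz).comp q hx
    have hev : ∀ᶠ p in 𝓝 q, 𝒢.s (g p) ∈ C.S.e.source ∧
        (C.S.e (𝒢.s (g p)), (t p)) ∈ C.Ψ.target := by
      filter_upwards [hsg.continuousAt.preimage_mem_nhds (C.S.e.open_source.mem_nhds hgS),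
        hx.continuousAt.preimage_mem_nhds (C.Ψ.open_target.mem_nhds hz)] with p h1 h2
      exact ⟨h1, h2⟩
    have hsγ : ∀ p : N, (𝒢.s (g p) ∈ C.S.e.source ∧
        (C.S.e (𝒢.s (g p)), (t p)) ∈ C.Ψ.target) → 𝒢.s (γ p) = 𝒢.s (g p) := fun p hp =>
      C.isProductChart.apply_symm hp.1 hp.2
    have hcomp : ∀ p : N, (𝒢.s (g p) ∈ C.S.e.source ∧
        (C.S.e (𝒢.s (g p)), (t p)) ∈ C.Ψ.target) → 𝒢.s (g p) = 𝒢.r (𝒢.inv (γ p)) := fun p hp => by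
      rw [𝒢.r_inv, hsγ p hp]
    have hmul : ContMDiffAt I' (𝓡 d) ∞
        (fun p => 𝒢.mul (g p) (𝒢.inv (γ p))) q :=
      contMDiffAt_mul hg ((𝒢.contMDiff_inv _).comp q hγ) (hev.mono hcomp)
    have h1 : ContMDiffAt I' 𝓘(ℝ, ℂ) ∞
        (fun p => f₁ (𝒢.mul (g p) (𝒢.inv (γ p))) (X (𝒢.r (𝒢.mul (g p) (𝒢.inv (γ p)))))
          (C.T.X (𝒢.s (𝒢.mul (g p) (𝒢.inv (γ p)))))) q := by
      have h2 := (h₁.2.1 U X C.T.e.source C.T.X hX C.T.isFrameOn).contMDiffAt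
        (x := 𝒢.mul (g q) (𝒢.inv (γ q))) (((hX.isOpen.preimage 𝒢.contMDiff_r.continuous).inter
          (C.T.e.open_source.preimage 𝒢.contMDiff_s.continuous)).mem_nhds ⟨by
            rw [mem_preimage, 𝒢.r_mul _ _ (hcomp q ⟨hgS, hz⟩)]; exact hgU, by
            rw [mem_preimage, 𝒢.s_mul _ _ (hcomp q ⟨hgS, hz⟩), 𝒢.s_inv]
            exact C.range_mem _ (C.Ψ.map_target hz)⟩)
      exact ContMDiffAt.comp q h2 hmul
    have h3 : ContMDiffAt I' 𝓘(ℝ, ℂ) ∞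
        (fun p => f₀ (γ p) (C.T.X (𝒢.r (γ p))) (Y (𝒢.s (γ p)))) q := by
      have h4 := (h₀.2.1 C.T.e.source C.T.X V Y C.T.isFrameOn hY).contMDiffAt
        (x := γ q) (((C.T.e.open_source.preimage 𝒢.contMDiff_r.continuous).inter
          (hY.isOpen.preimage 𝒢.contMDiff_s.continuous)).mem_nhds
            ⟨C.range_mem _ (C.Ψ.map_target hz), by
              rw [mem_preimage, hsγ q ⟨hgS, hz⟩]; exact hgV⟩)
      exact ContMDiffAt.comp q h4 hγ
    have h5 : ContMDiffAt I' 𝓘(ℝ, ℝ) ∞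
        (fun p : N => C.jac (C.S.e (𝒢.s (g p)), (t p))) q :=
      ((C.contDiffAt_jac hz).1.contMDiffAt).comp q hx
    have h6 := ((hχ _).comp q hγ).smul (h5.smul
      ((contDiff_mul (𝕜 := ℝ) (𝔸 := ℂ)).contMDiff.contMDiffAt.comp q (h1.prodMk_space h3)))
    refine h6.congr_of_eventuallyEq ?_
    filter_upwards [hev] with p hp
    rw [localIntegrand, if_pos hp]
    rfl
  · refine (contMDiffAt_const (c := (0 : ℂ))).congr_of_eventuallyEq ?_
    filter_upwards [hx.continuousAt.preimage_mem_nhds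
      ((C.isCompact_image hc hs).isClosed.isOpen_compl.mem_nhds hK)] with p hp
    exact C.localIntegrand_eq_zero hp

/-- The contribution of a chart to the convolution product. -/
def localConv (χ : G → ℝ)
    (f₁ f₀ : ∀ g, (Fin n → 𝒢.A (𝒢.r g)) → (Fin n → 𝒢.A (𝒢.s g)) → ℂ)
    (X Y : ∀ m, Fin n → 𝒢.A m) (g : G) : ℂ := ∫ t, C.localIntegrand χ f₁ f₀ X Y g t

theorem integrable_localIntegrand (hχ : ContMDiff (𝓡 d) 𝓘(ℝ, ℝ) ∞ χ) (hc : HasCompactSupport χ)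
    (hs : tsupport χ ⊆ C.Ψ.source) (h₁ : f₁ ∈ 𝒢.Psi) (h₀ : f₀ ∈ 𝒢.Psi) (hX : 𝒢.IsFrameOn U X)
    (hY : 𝒢.IsFrameOn V Y) {g : G} (hgS : 𝒢.s g ∈ C.S.e.source) (hgU : 𝒢.r g ∈ U)
    (hgV : 𝒢.s g ∈ V) : Integrable (C.localIntegrand χ f₁ f₀ X Y g) := by
  refine Continuous.integrable_of_hasCompactSupport ?_ ?_
  · rw [continuous_iff_continuousAt]
    intro t
    exact (C.contMDiffAt_localIntegrand (I' := 𝓘(ℝ, EuclideanSpace ℝ (Fin n))) hχ hc hs h₁ h₀ hX hY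
      (contMDiffAt_const (c := g)) contMDiffAt_id hgS hgU hgV (q := t)).continuousAt
  · refine HasCompactSupport.intro ((C.isCompact_image hc hs).image continuous_snd) fun t ht => ?_
    exact C.localIntegrand_eq_zero fun h => ht ⟨_, h, rfl⟩

theorem localConv_add_left {f₁' : ∀ g, (Fin n → 𝒢.A (𝒢.r g)) → (Fin n → 𝒢.A (𝒢.s g)) → ℂ}
    (hχ : ContMDiff (𝓡 d) 𝓘(ℝ, ℝ) ∞ χ) (hc : HasCompactSupport χ)
    (hs : tsupport χ ⊆ C.Ψ.source) (h₁ : f₁ ∈ 𝒢.Psi) (h₁' : f₁' ∈ 𝒢.Psi) (h₀ : f₀ ∈ 𝒢.Psi)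
    (hX : 𝒢.IsFrameOn U X) (hY : 𝒢.IsFrameOn V Y) {g : G} (hgU : 𝒢.r g ∈ U) (hgV : 𝒢.s g ∈ V) :
    C.localConv χ (f₁ + f₁') f₀ X Y g =
      C.localConv χ f₁ f₀ X Y g + C.localConv χ f₁' f₀ X Y g := by
  by_cases hgS : 𝒢.s g ∈ C.S.e.source
  · rw [localConv, localConv, localConv,
      ← integral_add (C.integrable_localIntegrand hχ hc hs h₁ h₀ hX hY hgS hgU hgV)
        (C.integrable_localIntegrand hχ hc hs h₁' h₀ hX hY hgS hgU hgV)]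
    refine integral_congr_ae (Eventually.of_forall fun t => ?_)
    simp only [localIntegrand, kernel, Pi.add_apply]
    split_ifs
    · rw [← smul_add, ← smul_add, add_mul]
    · rw [add_zero]
  · simp [localConv, localIntegrand, hgS]

theorem localConv_add_right {f₀' : ∀ g, (Fin n → 𝒢.A (𝒢.r g)) → (Fin n → 𝒢.A (𝒢.s g)) → ℂ}
    (hχ : ContMDiff (𝓡 d) 𝓘(ℝ, ℝ) ∞ χ) (hc : HasCompactSupport χ)
    (hs : tsupport χ ⊆ C.Ψ.source) (h₁ : f₁ ∈ 𝒢.Psi) (h₀ : f₀ ∈ 𝒢.Psi) (h₀' : f₀' ∈ 𝒢.Psi)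
    (hX : 𝒢.IsFrameOn U X) (hY : 𝒢.IsFrameOn V Y) {g : G} (hgU : 𝒢.r g ∈ U) (hgV : 𝒢.s g ∈ V) :
    C.localConv χ f₁ (f₀ + f₀') X Y g =
      C.localConv χ f₁ f₀ X Y g + C.localConv χ f₁ f₀' X Y g := by
  by_cases hgS : 𝒢.s g ∈ C.S.e.source
  · rw [localConv, localConv, localConv,
      ← integral_add (C.integrable_localIntegrand hχ hc hs h₁ h₀ hX hY hgS hgU hgV)
        (C.integrable_localIntegrand hχ hc hs h₁ h₀' hX hY hgS hgU hgV)]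
    refine integral_congr_ae (Eventually.of_forall fun t => ?_)
    simp only [localIntegrand, kernel, Pi.add_apply]
    split_ifs
    · rw [← smul_add, ← smul_add, mul_add]
    · rw [add_zero]
  · simp [localConv, localIntegrand, hgS]

theorem contMDiffAt_localConv [T2Space M] (hχ : ContMDiff (𝓡 d) 𝓘(ℝ, ℝ) ∞ χ)
    (hc : HasCompactSupport χ) (hs : tsupport χ ⊆ C.Ψ.source) (h₁ : f₁ ∈ 𝒢.Psi) (h₀ : f₀ ∈ 𝒢.Psi)
    (hX : 𝒢.IsFrameOn U X) (hY : 𝒢.IsFrameOn V Y) {g : G} (hgU : 𝒢.r g ∈ U) (hgV : 𝒢.s g ∈ V) :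
    ContMDiffAt (𝓡 d) 𝓘(ℝ, ℂ) ∞ (C.localConv χ f₁ f₀ X Y) g := by
  by_cases hgS : 𝒢.s g ∈ C.S.e.source
  · set κ := chartAt (EuclideanSpace ℝ (Fin d)) g with hκ
    have hκs : IsSmoothChart d κ := isSmoothChart_chartAt g
    let W : Set G := (𝒢.s ⁻¹' C.S.e.source ∩ 𝒢.r ⁻¹' U) ∩ 𝒢.s ⁻¹' V
    have hW : IsOpen W := ((C.S.e.open_source.preimage 𝒢.contMDiff_s.continuous).inter
      (hX.isOpen.preimage 𝒢.contMDiff_r.continuous)).inter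
      (hY.isOpen.preimage 𝒢.contMDiff_s.continuous)
    let O : Set (EuclideanSpace ℝ (Fin d)) := κ.target ∩ κ.symm ⁻¹' W
    have hO : IsOpen O := κ.symm.isOpen_inter_preimage hW
    have hgO : κ g ∈ O := ⟨mem_chart_target _ g, by
      rw [mem_preimage, κ.left_inv (mem_chart_source _ g)]
      exact ⟨⟨hgS, hgU⟩, hgV⟩⟩
    have h1 : ContDiffOn ℝ ∞ (Function.uncurry fun p t =>
        C.localIntegrand χ f₁ f₀ X Y (κ.symm p) t) (O ×ˢ univ) := by
      rintro ⟨p, t⟩ ⟨⟨hp, hpW⟩, -⟩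
      have h2 : ContMDiffAt 𝓘(ℝ, EuclideanSpace ℝ (Fin d) × EuclideanSpace ℝ (Fin n)) (𝓡 d) ∞
          (fun q : EuclideanSpace ℝ (Fin d) × EuclideanSpace ℝ (Fin n) => κ.symm q.1) (p, t) :=
        (hκs.contMDiffAt_symm hp).comp (p, t) contDiffAt_fst.contMDiffAt
      exact (contMDiffAt_iff_contDiffAt.1 (C.contMDiffAt_localIntegrand hχ hc hs h₁ h₀ hX hY h2
        contDiffAt_snd.contMDiffAt hpW.1.1 hpW.1.2 hpW.2)).contDiffWithinAt
    have h4 := contDiffOn_integral_param (μ := volume) hO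
      ((C.isCompact_image hc hs).image continuous_snd)
      (fun p _ t ht => C.localIntegrand_eq_zero (f₁ := f₁) (f₀ := f₀) (X := X) (Y := Y)
        (g := κ.symm p) fun h => ht ⟨_, h, rfl⟩) h1
      (h := fun _ => 1) (locallyIntegrable_const 1)
    have h5 : ContMDiffAt 𝓘(ℝ, EuclideanSpace ℝ (Fin d)) 𝓘(ℝ, ℂ) ∞
        (fun p => ∫ t, (1 : ℝ) • C.localIntegrand χ f₁ f₀ X Y (κ.symm p) t) (κ g) :=
      (h4.contDiffAt (hO.mem_nhds hgO)).contMDiffAt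
    refine (h5.comp g (hκs.contMDiffAt (mem_chart_source _ g))).congr_of_eventuallyEq ?_
    filter_upwards [κ.open_source.mem_nhds (mem_chart_source _ g)] with g' hg'
    simp only [localConv, Function.comp, one_smul]
    rw [κ.left_inv hg']
  · have hK : IsCompact (C.S.e.symm '' (Prod.fst '' (C.Ψ '' tsupport χ))) := by
      refine ((C.isCompact_image hc hs).image continuous_fst).image_of_continuousOn
        (C.S.e.continuousOn_symm.mono ?_)
      rintro _ ⟨_, ⟨g', hg', rfl⟩, rfl⟩
      exact C.target_mem (C.Ψ.map_source (hs hg'))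
    have hgK : 𝒢.s g ∉ C.S.e.symm '' (Prod.fst '' (C.Ψ '' tsupport χ)) := by
      rintro ⟨_, ⟨_, ⟨g', hg', rfl⟩, rfl⟩, h⟩
      refine hgS ?_
      rw [← h]
      exact C.S.e.map_target (C.target_mem (C.Ψ.map_source (hs hg')))
    refine (contMDiffAt_const (c := (0 : ℂ))).congr_of_eventuallyEq ?_
    filter_upwards [𝒢.contMDiff_s.continuous.continuousAt.preimage_mem_nhds
      (hK.isClosed.isOpen_compl.mem_nhds hgK)] with g' hg'
    rw [localConv]
    refine (integral_congr_ae (Eventually.of_forall fun t => ?_)).trans (integral_zero _ _)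
    by_cases hS : 𝒢.s g' ∈ C.S.e.source
    · exact C.localIntegrand_eq_zero fun h => hg' ⟨_, ⟨_, h, rfl⟩, C.S.e.left_inv hS⟩
    · simp [localIntegrand, hS]

end FibreChart

/-- The convolution product as a finite sum of integrals in charts. -/
theorem conv_eq_sum [T2Space M] [SigmaCompactSpace G] (h𝒢 : 𝒢.Integrates 𝒵)
    (h𝒵 : IsSimpleNormalCrossing n 𝒵)
    {ι : Type*} [Fintype ι] (C : ι → 𝒢.FibreChart 𝒵 oA oM) {χ : ι → G → ℝ}
    (hχ : ∀ a, ContMDiff (𝓡 d) 𝓘(ℝ, ℝ) ∞ (χ a)) (hc : ∀ a, HasCompactSupport (χ a))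
    (hs : ∀ a, tsupport (χ a) ⊆ (C a).Ψ.source) (h₁ : f₁ ∈ 𝒢.Psi) (h₀ : f₀ ∈ 𝒢.Psi) (g : G)
    (hsum : ∀ γ, 𝒢.s γ = 𝒢.s g → f₀ γ ≠ 0 → f₁ (𝒢.mul g (𝒢.inv γ)) ≠ 0 → ∑ a, χ a γ = 1)
    (hX : 𝒢.IsFrameOn U X) (hY : 𝒢.IsFrameOn V Y) (hgU : 𝒢.r g ∈ U) (hgV : 𝒢.s g ∈ V) :
    𝒢.conv f₁ f₀ g (X (𝒢.r g)) (Y (𝒢.s g)) = ∑ a, (C a).localConv (χ a) f₁ f₀ X Y g := by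
  classical
  have : Nonempty M := ⟨𝒢.r g⟩
  have hF := isCompatible_conv h𝒢 h𝒵 h₁ h₀ g (X (𝒢.r g)) (Y (𝒢.s g))
  set F : LocalParam d n (𝒢.s ⁻¹' {𝒢.s g}) → EuclideanSpace ℝ (Fin n) → ℂ := fun P y =>
      if hy : y ∈ P.source then
        𝒢.convIntegrand f₁ f₀ g (P.toFun y) (P.image_mem y hy) (X (𝒢.r g)) (Y (𝒢.s g))
          (𝒢.rightTranslate P hy)
      else 0 with hFdef
  have hF0 : ∀ P, ∀ y ∈ P.source, F P y ≠ 0 →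
      f₀ (P.toFun y) ≠ 0 ∧ f₁ (𝒢.mul g (𝒢.inv (P.toFun y))) ≠ 0 := by
    intro P y hy h
    constructor <;> intro h0 <;> refine h ?_ <;>
    simp [hFdef, dif_pos hy, convIntegrand, h0]
  let Q : {a // 𝒢.s g ∈ (C a).S.e.source} → LocalParam d n (𝒢.s ⁻¹' {𝒢.s g}) := fun a =>
    fibreParam (C a.1).isProductChart (C a.1).dim_eq a.2
  have hFQ : ∀ a, ∀ t ∈ (Q a).source, ((χ a.1 ((Q a).toFun t) : ℝ) : ℂ) * F (Q a) t =
      (C a.1).localIntegrand (χ a.1) f₁ f₀ X Y g t := by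
    intro a t ht
    have ht' : ((C a.1).S.e (𝒢.s g), t) ∈ (C a.1).Ψ.target := ht
    rw [FibreChart.localIntegrand, if_pos ⟨a.2, ht'⟩, Complex.real_smul, Complex.real_smul, hFdef]
    simp only [dif_pos ht]
    congr 1
    refine (IsHomogeneous.frame (C a.1) ht'
      (isHomogeneous_convIntegrand h₁ h₀ ((Q a).image_mem t ht) _ _)).trans ?_
    exact congrArg (fun c : ℂ => ((C a.1).jac ((C a.1).S.e (𝒢.s g), t) : ℂ) * c)
      (convIntegrand_frames (C a.1).T.X ((Q a).image_mem t ht))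
  have hzero : ∀ a, ∀ t ∉ (Q a).source, (C a.1).localIntegrand (χ a.1) f₁ f₀ X Y g t = 0 := by
    intro a t ht
    rw [FibreChart.localIntegrand, if_neg fun h => ht h.2]
  have h1 := integralOver_eq_sum hF (exists_fibre_cover (h𝒢.dim_eq h𝒵) (𝒢.s g)) Q
    (fun a γ => ((χ a.1 γ : ℝ) : ℂ)) ?_ ?_ ?_
  · refine h1.trans ?_
    have h2 : ∀ a : {a // 𝒢.s g ∈ (C a).S.e.source},
        ∫ y in (Q a).source, ((χ a.1 ((Q a).toFun y) : ℝ) : ℂ) * F (Q a) y =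
        (C a.1).localConv (χ a.1) f₁ f₀ X Y g := by
      intro a
      rw [setIntegral_congr_fun (Q a).isOpen_source.measurableSet (hFQ a),
        setIntegral_eq_integral_of_forall_compl_eq_zero (fun t ht => hzero a t ht)]
      rfl
    rw [Finset.sum_congr rfl fun a _ => h2 a,
      ← Finset.sum_subtype (Finset.univ.filter fun a => 𝒢.s g ∈ (C a).S.e.source) (by simp)
        (fun a => (C a).localConv (χ a) f₁ f₀ X Y g)]
    refine Finset.sum_filter_of_ne fun a _ h => ?_
    by_contra hS
    refine h ?_
    rw [FibreChart.localConv]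
    refine (integral_congr_ae (Eventually.of_forall fun t => ?_)).trans (integral_zero _ _)
    simp [FibreChart.localIntegrand, hS]
  · intro P y hy h
    have h2 := hsum _ (P.image_mem y hy) (hF0 P y hy h).1 (hF0 P y hy h).2
    have hz : ∀ a, 𝒢.s g ∉ (C a).S.e.source → χ a (P.toFun y) = 0 := by
      intro a ha
      refine image_eq_zero_of_notMem_tsupport fun h' => ha ?_
      have h3 := (C a).isProductChart.mem_source _ (hs a h')
      have h4 : 𝒢.s (P.toFun y) = 𝒢.s g := P.image_mem y hy
      rwa [h4] at h3
    rw [← Finset.sum_subtype (Finset.univ.filter fun a => 𝒢.s g ∈ (C a).S.e.source) (by simp)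
        (fun a => ((χ a (P.toFun y) : ℝ) : ℂ)), Finset.sum_filter_of_ne]
    · exact_mod_cast h2
    · intro a _ h3
      by_contra hS
      exact h3 (by simp [hz a hS])
  · intro a P y hy _ h3
    have h4 : P.toFun y ∈ (C a.1).Ψ.source := hs a.1 (subset_tsupport _ (by exact_mod_cast h3))
    exact image_fibreParam _ _ _ (P.image_mem y hy) h4
  · intro a
    exact (((C a.1).integrable_localIntegrand (hχ _) (hc _) (hs _) h₁ h₀ hX hY a.2 hgU
      hgV).integrableOn).congr_fun (fun t ht => (hFQ a t ht).symm) (Q a).isOpen_source.measurableSet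

end LieGroupoid

namespace LieGroupoid

variable {n d : ℕ} {M G : Type*}
  [TopologicalSpace M] [ChartedSpace (EuclideanSpace ℝ (Fin n)) M] [IsManifold (𝓡 n) ∞ M]
  [TopologicalSpace G] [ChartedSpace (EuclideanSpace ℝ (Fin d)) G] [IsManifold (𝓡 d) ∞ G]
  {𝒢 : LieGroupoid n d M G} {𝒵 : Finset (Set M)}
  {oA : ∀ m, Orientation ℝ (𝒢.A m) (Fin n)}
  {oM : ∀ m : M, Orientation ℝ (TangentSpace (𝓡 n) m) (Fin n)}
  {f₁ f₀ : ∀ g, (Fin n → 𝒢.A (𝒢.r g)) → (Fin n → 𝒢.A (𝒢.s g)) → ℂ}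

theorem conv_eq_zero {g : G}
    (h : ∀ γ, 𝒢.s γ = 𝒢.s g → f₀ γ ≠ 0 → f₁ (𝒢.mul g (𝒢.inv γ)) = 0) :
    𝒢.conv f₁ f₀ g = 0 := by
  classical
  funext a b
  have h1 := integralOver_const_mul (d := d) (k := n) (S := 𝒢.s ⁻¹' {𝒢.s g}) (fun _ _ => 0) 0
  simp only [zero_mul] at h1
  refine Eq.trans (integralOver_congr fun P y => ?_) h1
  split_ifs with hy
  · by_cases h0 : f₀ (P.toFun y) = 0
    · simp [convIntegrand, h0]
    · simp [convIntegrand, h _ (P.image_mem y hy) h0]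
  · rfl

theorem conv_smul (h₁ : f₁ ∈ 𝒢.Psi) (h₀ : f₀ ∈ 𝒢.Psi) (g : G)
    (S : 𝒢.A (𝒢.r g) →ₗ[ℝ] 𝒢.A (𝒢.r g)) (T : 𝒢.A (𝒢.s g) →ₗ[ℝ] 𝒢.A (𝒢.s g))
    (a : Fin n → 𝒢.A (𝒢.r g)) (b : Fin n → 𝒢.A (𝒢.s g)) :
    𝒢.conv f₁ f₀ g (fun i => S (a i)) (fun i => T (b i)) =
      (Real.sqrt |LinearMap.det S| : ℝ) * (Real.sqrt |LinearMap.det T| : ℝ) *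
        𝒢.conv f₁ f₀ g a b := by
  classical
  unfold conv
  rw [← integralOver_const_mul]
  refine integralOver_congr fun P y => ?_
  split_ifs with hy
  · exact convIntegrand_smul h₁ h₀ _ S T a b _
  · rw [mul_zero]

theorem exists_support_conv [T2Space M] (h₁ : f₁ ∈ 𝒢.Psi) (h₀ : f₀ ∈ 𝒢.Psi) :
    ∃ K : Set G, IsCompact K ∧ ∀ g ∉ K, 𝒢.conv f₁ f₀ g = 0 := by
  obtain ⟨-, -, K₁, hK₁, hf₁⟩ := h₁
  obtain ⟨-, -, K₀, hK₀, hf₀⟩ := h₀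
  have hcl : IsClosed {p : G × G | 𝒢.s p.1 = 𝒢.r p.2} :=
    isClosed_eq (𝒢.contMDiff_s.continuous.comp continuous_fst)
      (𝒢.contMDiff_r.continuous.comp continuous_snd)
  refine ⟨(fun p : G × G => 𝒢.mul p.1 p.2) '' ((K₁ ×ˢ K₀) ∩ {p : G × G | 𝒢.s p.1 = 𝒢.r p.2}),
    ((hK₁.prod hK₀).inter_right hcl).image_of_continuousOn
      (𝒢.contMDiffOn_mul.continuousOn.mono inter_subset_right), fun g hg => ?_⟩
  refine conv_eq_zero fun γ hγ h0 => ?_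
  by_contra h1
  have hc : 𝒢.s g = 𝒢.r (𝒢.inv γ) := by rw [𝒢.r_inv, hγ]
  refine hg ⟨(𝒢.mul g (𝒢.inv γ), γ), ⟨⟨?_, ?_⟩, ?_⟩, ?_⟩
  · by_contra h; exact h1 (hf₁ _ h)
  · by_contra h; exact h0 (hf₀ _ h)
  · change 𝒢.s _ = _
    rw [𝒢.s_mul _ _ hc, 𝒢.s_inv]
  · change 𝒢.mul (𝒢.mul g (𝒢.inv γ)) γ = g
    rw [𝒢.mul_assoc _ _ _ hc (𝒢.s_inv _), 𝒢.inv_mul, hγ, 𝒢.mul_one]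

theorem psi_ext {f f' : ∀ g, (Fin n → 𝒢.A (𝒢.r g)) → (Fin n → 𝒢.A (𝒢.s g)) → ℂ} (hf : f ∈ 𝒢.Psi)
    (hf' : f' ∈ 𝒢.Psi) (h : ∀ g, ∃ X Y U V, 𝒢.IsFrameOn U X ∧ 𝒢.IsFrameOn V Y ∧ 𝒢.r g ∈ U ∧
      𝒢.s g ∈ V ∧ f g (X (𝒢.r g)) (Y (𝒢.s g)) = f' g (X (𝒢.r g)) (Y (𝒢.s g))) : f = f' := by
  funext g a b
  obtain ⟨X, Y, U, V, hX, hY, hgU, hgV, hXY⟩ := h g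
  let bX : Module.Basis (Fin n) ℝ (𝒢.A (𝒢.r g)) :=
    Module.Basis.mk (hX.linearIndependent _ hgU) (hX.span_eq_top _ hgU).ge
  let bY : Module.Basis (Fin n) ℝ (𝒢.A (𝒢.s g)) :=
    Module.Basis.mk (hY.linearIndependent _ hgV) (hY.span_eq_top _ hgV).ge
  have ha : (fun i => bX.constr ℝ a (X (𝒢.r g) i)) = a := by
    funext i
    have h1 := bX.constr_basis ℝ a i
    rwa [Module.Basis.mk_apply] at h1
  have hb : (fun i => bY.constr ℝ b (Y (𝒢.s g) i)) = b := by
    funext i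
    have h1 := bY.constr_basis ℝ b i
    rwa [Module.Basis.mk_apply] at h1
  have h1 := hf.1 g (bX.constr ℝ a) (bY.constr ℝ b) (X (𝒢.r g)) (Y (𝒢.s g))
  have h2 := hf'.1 g (bX.constr ℝ a) (bY.constr ℝ b) (X (𝒢.r g)) (Y (𝒢.s g))
  rw [ha, hb] at h1 h2
  rw [h1, h2, hXY]

variable [T2Space M] [T2Space G] [SigmaCompactSpace G]

/-- Charts and cutoff functions that compute all convolution products with a given right factor. -/
theorem exists_convData (h𝒢 : 𝒢.Integrates 𝒵)
    (h𝒵 : IsSimpleNormalCrossing n 𝒵) (hoM : IsTangentOrientation oM) (hoA : 𝒢.IsOrientation oA)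
    {K : Set G} (hK : IsCompact K) :
    ∃ (k : ℕ) (C : Fin k → 𝒢.FibreChart 𝒵 oA oM) (χ : Fin k → G → ℝ),
      (∀ a, ContMDiff (𝓡 d) 𝓘(ℝ, ℝ) ∞ (χ a)) ∧ (∀ a, HasCompactSupport (χ a)) ∧
      (∀ a, tsupport (χ a) ⊆ (C a).Ψ.source) ∧ ∀ g ∈ K, ∑ a, χ a g = 1 := by
  choose C hC using exists_fibreChart h𝒢 h𝒵 hoM hoA
  obtain ⟨k, x, χ, h1, h2, h3, h4⟩ := exists_smooth_partition (d := d) hK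
    (N := fun g => (C g).Ψ.source) (fun g => (C g).Ψ.open_source.mem_nhds (hC g).1)
  exact ⟨k, fun a => C (x a), χ, h1, h2, h3, h4⟩

theorem conv_mem_Psi (h𝒢 : 𝒢.Integrates 𝒵)
    (h𝒵 : IsSimpleNormalCrossing n 𝒵) (hoM : IsTangentOrientation oM) (hoA : 𝒢.IsOrientation oA)
    (h₁ : f₁ ∈ 𝒢.Psi) (h₀ : f₀ ∈ 𝒢.Psi) : 𝒢.conv f₁ f₀ ∈ 𝒢.Psi := by
  refine ⟨fun g S T a b => conv_smul h₁ h₀ g S T a b, fun U X V Y hX hY => ?_,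
    exists_support_conv h₁ h₀⟩
  obtain ⟨K₀, hK₀, hf₀⟩ := h₀.2.2
  obtain ⟨k, C, χ, hχ, hc, hs, hsum⟩ := exists_convData h𝒢 h𝒵 hoM hoA hK₀
  have hO : IsOpen (𝒢.r ⁻¹' U ∩ 𝒢.s ⁻¹' V) := (hX.isOpen.preimage 𝒢.contMDiff_r.continuous).inter
    (hY.isOpen.preimage 𝒢.contMDiff_s.continuous)
  rintro g ⟨hgU, hgV⟩
  refine ContMDiffAt.contMDiffWithinAt ?_
  have h1 : ContMDiffAt (𝓡 d) 𝓘(ℝ, ℂ) ∞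
      (fun g => ∑ a, (C a).localConv (χ a) f₁ f₀ X Y g) g :=
    contMDiffAt_finsetSum fun a _ =>
      (C a).contMDiffAt_localConv (hχ a) (hc a) (hs a) h₁ h₀ hX hY hgU hgV
  refine h1.congr_of_eventuallyEq ?_
  filter_upwards [hO.mem_nhds ⟨hgU, hgV⟩] with g' hg'
  refine conv_eq_sum h𝒢 h𝒵 C hχ hc hs h₁ h₀ g' (fun γ _ h0 _ => hsum γ ?_) hX hY hg'.1 hg'.2
  by_contra h
  exact h0 (hf₀ _ h)

theorem conv_add_left (h𝒢 : 𝒢.Integrates 𝒵)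
    (h𝒵 : IsSimpleNormalCrossing n 𝒵) (hoM : IsTangentOrientation oM) (hoA : 𝒢.IsOrientation oA)
    {f₁' : ∀ g, (Fin n → 𝒢.A (𝒢.r g)) → (Fin n → 𝒢.A (𝒢.s g)) → ℂ}
    (h₁ : f₁ ∈ 𝒢.Psi) (h₁' : f₁' ∈ 𝒢.Psi) (h₀ : f₀ ∈ 𝒢.Psi) :
    𝒢.conv (f₁ + f₁') f₀ = 𝒢.conv f₁ f₀ + 𝒢.conv f₁' f₀ := by
  have hmem := fun {f} (h : f ∈ 𝒢.Psi) => conv_mem_Psi h𝒢 h𝒵 hoM hoA h h₀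
  refine psi_ext (hmem (add_mem h₁ h₁')) (add_mem (hmem h₁) (hmem h₁')) fun g => ?_
  obtain ⟨S, hS, -⟩ := exists_adaptedChart h𝒢 h𝒵 hoM hoA (𝒢.s g)
  obtain ⟨T, hT, -⟩ := exists_adaptedChart h𝒢 h𝒵 hoM hoA (𝒢.r g)
  refine ⟨T.X, S.X, _, _, T.isFrameOn, S.isFrameOn, hT, hS, ?_⟩
  obtain ⟨K₀, hK₀, hf₀⟩ := h₀.2.2
  obtain ⟨k, C, χ, hχ, hc, hs, hsum⟩ := exists_convData h𝒢 h𝒵 hoM hoA hK₀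
  have key := fun {f} (h : f ∈ 𝒢.Psi) => conv_eq_sum h𝒢 h𝒵 C hχ hc hs h h₀ g (fun γ _ h0 _ => hsum γ
    (by by_contra h; exact h0 (hf₀ _ h))) T.isFrameOn S.isFrameOn hT hS
  simp only [Pi.add_apply]
  rw [key h₁, key h₁', key (add_mem h₁ h₁'), ← Finset.sum_add_distrib]
  exact Finset.sum_congr rfl fun a _ => (C a).localConv_add_left (hχ a) (hc a) (hs a) h₁ h₁' h₀
    T.isFrameOn S.isFrameOn hT hS

theorem conv_add_right (h𝒢 : 𝒢.Integrates 𝒵)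
    (h𝒵 : IsSimpleNormalCrossing n 𝒵) (hoM : IsTangentOrientation oM) (hoA : 𝒢.IsOrientation oA)
    {f₀' : ∀ g, (Fin n → 𝒢.A (𝒢.r g)) → (Fin n → 𝒢.A (𝒢.s g)) → ℂ}
    (h₁ : f₁ ∈ 𝒢.Psi) (h₀ : f₀ ∈ 𝒢.Psi) (h₀' : f₀' ∈ 𝒢.Psi) :
    𝒢.conv f₁ (f₀ + f₀') = 𝒢.conv f₁ f₀ + 𝒢.conv f₁ f₀' := by
  have hmem := fun {f} (h : f ∈ 𝒢.Psi) => conv_mem_Psi h𝒢 h𝒵 hoM hoA h₁ h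
  refine psi_ext (hmem (add_mem h₀ h₀')) (add_mem (hmem h₀) (hmem h₀')) fun g => ?_
  obtain ⟨S, hS, -⟩ := exists_adaptedChart h𝒢 h𝒵 hoM hoA (𝒢.s g)
  obtain ⟨T, hT, -⟩ := exists_adaptedChart h𝒢 h𝒵 hoM hoA (𝒢.r g)
  refine ⟨T.X, S.X, _, _, T.isFrameOn, S.isFrameOn, hT, hS, ?_⟩
  obtain ⟨K, hK, hf₀⟩ := h₀.2.2
  obtain ⟨K', hK', hf₀'⟩ := h₀'.2.2
  obtain ⟨k, C, χ, hχ, hc, hs, hsum⟩ := exists_convData h𝒢 h𝒵 hoM hoA (hK.union hK')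
  have key := fun {f} (h : f ∈ 𝒢.Psi) (hf : ∀ g ∉ K ∪ K', f g = 0) =>
    conv_eq_sum h𝒢 h𝒵 C hχ hc hs h₁ h g (fun γ _ h0 _ => hsum γ
    (by by_contra h; exact h0 (hf _ h))) T.isFrameOn S.isFrameOn hT hS
  have h3 : ∀ g ∉ K ∪ K', f₀ g = 0 := fun g hg => hf₀ g fun h => hg (Or.inl h)
  have h4 : ∀ g ∉ K ∪ K', f₀' g = 0 := fun g hg => hf₀' g fun h => hg (Or.inr h)
  simp only [Pi.add_apply]
  rw [key h₀ h3, key h₀' h4, key (add_mem h₀ h₀') (fun g hg => by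
    rw [Pi.add_apply, h3 g hg, h4 g hg, add_zero]), ← Finset.sum_add_distrib]
  exact Finset.sum_congr rfl fun a _ => (C a).localConv_add_right (hχ a) (hc a) (hs a) h₁ h₀ h₀'
    T.isFrameOn S.isFrameOn hT hS

/-- The product of an element of `Ψ^{-∞}(G)` and a smooth function. -/
theorem smul_mem_Psi {f : ∀ g, (Fin n → 𝒢.A (𝒢.r g)) → (Fin n → 𝒢.A (𝒢.s g)) → ℂ}
    (hf : f ∈ 𝒢.Psi) {χ : G → ℝ} (hχ : ContMDiff (𝓡 d) 𝓘(ℝ, ℝ) ∞ χ) :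
    (fun g => χ g • f g) ∈ 𝒢.Psi := by
  obtain ⟨h1, h2, K, hK, h3⟩ := hf
  refine ⟨fun g S T a b => ?_, fun U X V Y hX hY => ?_, K, hK, fun g hg => ?_⟩
  · simp only [Pi.smul_apply, h1, Complex.real_smul]
    ring
  · exact hχ.contMDiffOn.smul (h2 U X V Y hX hY)
  · simp only [h3 g hg, smul_zero]

/-- A functional is a trace if it is one on products of which a factor has small support. -/
theorem isTrace_of_local (h𝒢 : 𝒢.Integrates 𝒵)
    (h𝒵 : IsSimpleNormalCrossing n 𝒵) (hoM : IsTangentOrientation oM) (hoA : 𝒢.IsOrientation oA)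
    (t : 𝒢.Psi →ₗ[ℂ] ℂ)
    (h : ∀ g₀ : G, ∃ N ∈ 𝓝 g₀, ∀ χ : G → ℝ, ContMDiff (𝓡 d) 𝓘(ℝ, ℝ) ∞ χ → HasCompactSupport χ →
      tsupport χ ⊆ N → ∀ f₁ f₀ : 𝒢.Psi, ∀ (h₁₀ : 𝒢.conv f₁ (fun g => χ g • f₀.1 g) ∈ 𝒢.Psi)
        (h₀₁ : 𝒢.conv (fun g => χ g • f₀.1 g) f₁ ∈ 𝒢.Psi), t ⟨_, h₁₀⟩ = t ⟨_, h₀₁⟩) :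
    𝒢.IsTrace t := by
  have hmem := fun f₁ f₀ : 𝒢.Psi => conv_mem_Psi h𝒢 h𝒵 hoM hoA f₁.2 f₀.2
  intro f₁ f₀
  refine ⟨hmem f₁ f₀, hmem f₀ f₁, ?_⟩
  let D : 𝒢.Psi →+ ℂ := AddMonoidHom.mk'
    (fun f => t (⟨𝒢.conv f₁ f, hmem f₁ f⟩ - ⟨𝒢.conv f f₁, hmem f f₁⟩)) fun f f' => by
      rw [← map_add]
      congr 1
      refine Subtype.ext ?_
      change 𝒢.conv f₁ (f.1 + f'.1) - 𝒢.conv (f.1 + f'.1) f₁ = _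
      rw [conv_add_right h𝒢 h𝒵 hoM hoA f₁.2 f.2 f'.2, conv_add_left h𝒢 h𝒵 hoM hoA f.2 f'.2 f₁.2]
      exact add_sub_add_comm _ _ _ _
  change D f₀ = 0
  choose N hN hloc using h
  obtain ⟨K, hK, hf₀⟩ := f₀.2.2.2
  obtain ⟨k, x, χ, hχ, hc, hs, hsum⟩ := exists_smooth_partition (d := d) hK hN
  have hdec : f₀ = ∑ a, (⟨fun g => χ a g • f₀.1 g, smul_mem_Psi f₀.2 (hχ a)⟩ : 𝒢.Psi) := by
    refine Subtype.ext ?_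
    rw [AddSubmonoidClass.coe_finsetSum]
    funext g
    rw [Finset.sum_apply]
    simp only
    by_cases hg : g ∈ K
    · rw [← Finset.sum_smul, hsum g hg, one_smul]
    · simp [hf₀ g hg]
  rw [hdec, map_sum]
  refine Finset.sum_eq_zero fun a _ => ?_
  change t (_ - _) = 0
  rw [map_sub, sub_eq_zero]
  exact hloc (x a) (χ a) (hχ a) (hc a) (hs a) f₁ f₀ _ _

end LieGroupoid

section BlockTriangular

variable {E F : Type*} [AddCommGroup E] [Module ℝ E] [AddCommGroup F] [Module ℝ F]
  [FiniteDimensional ℝ E] [FiniteDimensional ℝ F]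

/-- The shear `(x, y) ↦ (x, y + K x)`. -/
def shear (K : E →ₗ[ℝ] F) : E × F →ₗ[ℝ] E × F :=
  (LinearMap.fst ℝ E F).prod (LinearMap.snd ℝ E F + K ∘ₗ LinearMap.fst ℝ E F)

theorem det_shear (K : E →ₗ[ℝ] F) : LinearMap.det (shear K) = 1 := by
  let e : (E × F) ≃ₗ[ℝ] E × F :=
    (LinearEquiv.refl ℝ E).prodCongr (LinearEquiv.smulOfNeZero ℝ F (2 : ℝ) two_ne_zero)
  have h1 : e.toLinearMap ∘ₗ shear K ∘ₗ e.symm.toLinearMap = shear K ∘ₗ shear K := by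
    refine LinearMap.ext fun p => ?_
    obtain ⟨p, rfl⟩ := e.surjective p
    simp only [LinearMap.comp_apply, LinearEquiv.coe_coe, LinearEquiv.symm_apply_apply]
    refine Prod.ext ?_ ?_
    · simp [e, shear]
    · simp [e, shear, two_smul, add_assoc]
  have h2 : shear K ∘ₗ shear (-K) = LinearMap.id := by
    refine LinearMap.ext fun p => Prod.ext ?_ ?_ <;> simp [shear]
  have h3 := congrArg LinearMap.det h1
  rw [LinearMap.det_conj, LinearMap.det_comp] at h3
  have h4 := congrArg LinearMap.det h2
  rw [LinearMap.det_comp, LinearMap.det_id] at h4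
  exact (mul_eq_left₀ (left_ne_zero_of_mul_eq_one h4)).1 h3.symm

theorem det_fst_prod (L : E × F →ₗ[ℝ] F) :
    LinearMap.det ((LinearMap.fst ℝ E F).prod L) = LinearMap.det (L ∘ₗ LinearMap.inr ℝ E F) := by
  have h : (LinearMap.fst ℝ E F).prod L = shear (L ∘ₗ LinearMap.inl ℝ E F) ∘ₗ
      LinearMap.prodMap LinearMap.id (L ∘ₗ LinearMap.inr ℝ E F) := by
    refine LinearMap.ext fun p => Prod.ext ?_ ?_
    · simp [shear]
    · simp only [shear, LinearMap.prod_apply, Function.prod, LinearMap.comp_apply,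
        LinearMap.add_apply, LinearMap.prodMap_apply, LinearMap.fst_apply, LinearMap.snd_apply,
        LinearMap.inr_apply, LinearMap.inl_apply, LinearMap.id_apply]
      rw [← map_add]
      simp
  rw [h, LinearMap.det_comp, det_shear, _root_.one_mul, LinearMap.det_prodMap, LinearMap.det_id,
    _root_.one_mul]

theorem abs_det_prod_fst (L : E × E →ₗ[ℝ] E) :
    |LinearMap.det (L.prod (LinearMap.fst ℝ E E))| =
      |LinearMap.det (L ∘ₗ LinearMap.inr ℝ E E)| := by
  let e : (E × E) ≃ₗ[ℝ] E × E := LinearEquiv.prodComm ℝ E E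
  have h : L.prod (LinearMap.fst ℝ E E) = e.toLinearMap ∘ₗ (LinearMap.fst ℝ E E).prod L :=
    LinearMap.ext fun p => rfl
  have h2 : e.toLinearMap ∘ₗ e.toLinearMap = LinearMap.id := LinearMap.ext fun p => rfl
  have h3 := congrArg LinearMap.det h2
  rw [LinearMap.det_comp, LinearMap.det_id] at h3
  have h4 : |LinearMap.det e.toLinearMap| = 1 := by
    rcases mul_self_eq_one_iff.1 h3 with h | h <;> rw [h] <;> simp
  rw [h, LinearMap.det_comp, abs_mul, h4, _root_.one_mul, det_fst_prod]

end BlockTriangular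

section Matching

variable {V ι κ : Type*} [NormedAddCommGroup V] [NormedSpace ℝ V]

theorem linearIndependent_pair {W : Type*} [AddCommGroup W] [Module ℝ W] {f : ι → W}
    (hf : LinearIndependent ℝ f) {i j : ι} (h : i ≠ j) :
    LinearIndependent ℝ ![f i, f j] := by
  have hinj : Function.Injective ![i, j] := by
    intro a b hab
    fin_cases a <;> fin_cases b <;> simp_all
  convert hf.comp _ hinj using 1
  ext a
  fin_cases a <;> rfl

/-- If the union of some coordinate hyperplanes is contained in a union of smooth hypersurfaces with
independent conormals, then every hyperplane is contained in one of the hypersurfaces. -/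
theorem exists_matching [Finite κ] {ξ : ι → V →L[ℝ] ℝ} (hξ : LinearIndependent ℝ ξ)
    {η : κ → V → ℝ} {p : V} (hη : ∀ j, ContDiffAt ℝ ∞ (η j) p)
    (hdη : LinearIndependent ℝ fun j => fderiv ℝ (η j) p) (hp : ∀ i, ξ i p = 0)
    (h : ∀ᶠ z in 𝓝 p, (∃ i, ξ i z = 0) → ∃ j, η j z = 0) :
    ∃ σ : ι → κ, Function.Injective σ ∧ ∀ i, ∀ᶠ z in 𝓝 p, ξ i z = 0 → η (σ i) z = 0 := by
  have hprop : ∀ i j, (∀ v, ξ i v = 0 → fderiv ℝ (η j) p v = 0) →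
      ∃ a : ℝ, fderiv ℝ (η j) p = a • ξ i := by
    intro i j hij
    obtain ⟨w, hw⟩ : ∃ w, ξ i w ≠ 0 := by
      by_contra! h0
      exact hξ.ne_zero i (ContinuousLinearMap.ext h0)
    refine ⟨fderiv ℝ (η j) p w / ξ i w, ContinuousLinearMap.ext fun v => ?_⟩
    have h1 := hij (v - (ξ i v / ξ i w) • w) (by
      rw [map_sub, map_smul, smul_eq_mul, div_mul_cancel₀ _ hw, sub_self])
    rw [map_sub, map_smul, smul_eq_mul, sub_eq_zero] at h1
    rw [_root_.smul_apply, smul_eq_mul, h1]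
    ring
  have hpts : ∀ i, ∃ v, ξ i v = 0 ∧ ∀ j, (∃ v, ξ i v = 0 ∧ fderiv ℝ (η j) p v ≠ 0) →
      fderiv ℝ (η j) p v ≠ 0 := by
    intro i
    obtain ⟨v, hv, hvj⟩ := Module.Dual.exists_forall_mem_ne_zero_of_forall_exists
      (K := ℝ) (LinearMap.ker (ξ i).toLinearMap)
      (fun j : {j // ∃ v, ξ i v = 0 ∧ fderiv ℝ (η j) p v ≠ 0} =>
        (fderiv ℝ (η j.1) p).toLinearMap) (fun j => j.2)
    exact ⟨v, hv, fun j hj => hvj ⟨j, hj⟩⟩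
  have key : ∀ i, ∀ᶠ z in 𝓝 p, ξ i z = 0 → ∃ v, ∀ᶠ t in 𝓝[≠] (0 : ℝ), ∃ j,
      (∀ v, ξ i v = 0 → fderiv ℝ (η j) p v = 0) ∧ η j (z + t • v) = 0 := by
    intro i
    obtain ⟨v, hv, hvj⟩ := hpts i
    have h1 : ∀ᶠ z in 𝓝 p, ∀ j, (∃ v, ξ i v = 0 ∧ fderiv ℝ (η j) p v ≠ 0) →
        DifferentiableAt ℝ (η j) z ∧ fderiv ℝ (η j) z v ≠ 0 := by
      refine eventually_all.2 fun j => ?_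
      by_cases hj : ∃ v, ξ i v = 0 ∧ fderiv ℝ (η j) p v ≠ 0
      · have h2 : ContinuousAt (fun z => fderiv ℝ (η j) z v) p :=
          (((hη j).fderiv_right (m := 0) (by simp)).continuousAt).clm_apply continuousAt_const
        have h3 : ∀ᶠ z in 𝓝 p, ContDiffAt ℝ 1 (η j) z :=
          ((hη j).of_le (by simp)).eventually (by simp)
        filter_upwards [h2.eventually_ne (hvj j hj), h3] with z hz hz' _
        exact ⟨hz'.differentiableAt (by simp), hz⟩
      · exact Eventually.of_forall fun z hj' => absurd hj' hj
    filter_upwards [h1, h.eventually_nhds] with z hz hz' hiz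
    refine ⟨v, ?_⟩
    have hline : Tendsto (fun t : ℝ => z + t • v) (𝓝[≠] 0) (𝓝 z) :=
      (Continuous.tendsto' (by fun_prop) _ _ (by simp)).mono_left nhdsWithin_le_nhds
    have h4 : ∀ᶠ t in 𝓝[≠] (0 : ℝ), ∀ j, (∃ v, ξ i v = 0 ∧ fderiv ℝ (η j) p v ≠ 0) →
        η j (z + t • v) ≠ 0 := by
      refine eventually_all.2 fun j => ?_
      by_cases hj : ∃ v, ξ i v = 0 ∧ fderiv ℝ (η j) p v ≠ 0
      · have h5 : HasDerivAt (fun t : ℝ => z + t • v) v 0 := by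
          simpa using ((hasDerivAt_id (0 : ℝ)).smul_const v).const_add z
        have h6 : HasFDerivAt (η j) (fderiv ℝ (η j) z) (z + (0 : ℝ) • v) := by
          rw [zero_smul, add_zero]
          exact (hz j hj).1.hasFDerivAt
        have h7 := h6.comp_hasDerivAt (0 : ℝ) h5
        filter_upwards [h7.eventually_ne (c := 0) (hz j hj).2] with t ht _
        exact ht
      · exact Eventually.of_forall fun z hj' => absurd hj' hj
    filter_upwards [h4, hline.eventually hz'] with t ht ht'
    obtain ⟨j, hj⟩ := ht' ⟨i, by rw [map_add, map_smul, hiz, hv]; simp⟩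
    refine ⟨j, fun w hw => ?_, hj⟩
    by_contra h0
    exact ht j ⟨w, hw, h0⟩ hj
  have hex : ∀ i, ∃ j, ∀ v, ξ i v = 0 → fderiv ℝ (η j) p v = 0 := by
    intro i
    obtain ⟨v, hv⟩ := (key i).self_of_nhds (hp i)
    obtain ⟨t, j, hj, -⟩ := hv.exists
    exact ⟨j, hj⟩
  choose σ hσ using hex
  choose a ha using fun i => hprop i (σ i) (hσ i)
  have ha0 : ∀ i, a i ≠ 0 := by
    intro i h0
    have := ha i
    rw [h0, zero_smul] at this
    exact hdη.ne_zero (σ i) this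
  have huniq : ∀ i j, (∀ v, ξ i v = 0 → fderiv ℝ (η j) p v = 0) → j = σ i := by
    intro i j hj
    obtain ⟨b, hb⟩ := hprop i j hj
    by_contra hne
    refine ha0 i (LinearIndependent.pair_iff.1 (linearIndependent_pair hdη hne) (a i) (-b) ?_).1
    rw [hb, ha i, smul_smul, smul_smul, ← add_smul]
    have : a i * b + -b * a i = 0 := by ring
    rw [this, zero_smul]
  refine ⟨σ, fun i i' hii => ?_, fun i => ?_⟩
  · by_contra hne
    have h1 := ha i
    rw [hii, ha i'] at h1
    refine ha0 i' (LinearIndependent.pair_iff.1 (linearIndependent_pair hξ hne) (-a i) (a i') ?_).2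
    rw [h1, neg_smul, neg_add_cancel]
  · have hc : ∀ᶠ z in 𝓝 p, ContDiffAt ℝ 1 (η (σ i)) z :=
      ((hη (σ i)).of_le (by simp)).eventually (by simp)
    filter_upwards [key i, hc] with z hz hcz hiz
    obtain ⟨v, hv⟩ := hz hiz
    have hline : Tendsto (fun t : ℝ => z + t • v) (𝓝[≠] 0) (𝓝 z) :=
      (Continuous.tendsto' (by fun_prop) _ _ (by simp)).mono_left nhdsWithin_le_nhds
    refine tendsto_nhds_unique (hcz.continuousAt.tendsto.comp hline)
      (tendsto_const_nhds.congr' ?_)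
    filter_upwards [hv] with t ht
    obtain ⟨j, hj, hj0⟩ := ht
    rw [huniq i j hj] at hj0
    exact hj0.symm

end Matching

namespace LieGroupoid

variable {n d : ℕ} {M G : Type*}
  [TopologicalSpace M] [ChartedSpace (EuclideanSpace ℝ (Fin n)) M] [IsManifold (𝓡 n) ∞ M]
  [TopologicalSpace G] [ChartedSpace (EuclideanSpace ℝ (Fin d)) G] [IsManifold (𝓡 d) ∞ G]

theorem inv_inv (𝒢 : LieGroupoid n d M G) (g : G) : 𝒢.inv (𝒢.inv g) = g := by
  have h1 := 𝒢.mul_assoc g (𝒢.inv g) (𝒢.inv (𝒢.inv g)) (𝒢.r_inv g).symm (𝒢.r_inv _).symm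
  rw [𝒢.mul_inv, 𝒢.mul_inv, 𝒢.r_inv, 𝒢.mul_one, ← 𝒢.s_inv, ← 𝒢.r_inv, 𝒢.one_mul] at h1
  exact h1

variable (𝒢 : LieGroupoid n d M G) (𝒵 : Finset (Set M))
  (oA : ∀ m, Orientation ℝ (𝒢.A m) (Fin n))
  (oM : ∀ m : M, Orientation ℝ (TangentSpace (𝓡 n) m) (Fin n))

/-- A chart of `G` in which the source is a projection, together with a chart of the set of
inverses with the same property. -/
structure ArrowChart extends 𝒢.FibreChart 𝒵 oA oM where
  Φ : OpenPartialHomeomorph G (EuclideanSpace ℝ (Fin n) × EuclideanSpace ℝ (Fin n))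
  isProductChart_inv : IsProductChart d 𝒢.s T.e Φ
  inv_mem : ∀ g, 𝒢.inv g ∈ Φ.source ↔ g ∈ Ψ.source

variable {𝒢 𝒵 oA oM}

theorem exists_arrowChart [T2Space M] (h𝒢 : 𝒢.Integrates 𝒵)
    (h𝒵 : IsSimpleNormalCrossing n 𝒵) (hoM : IsTangentOrientation oM) (hoA : 𝒢.IsOrientation oA)
    (g : G) : ∃ C : 𝒢.ArrowChart 𝒵 oA oM, g ∈ C.Ψ.source ∧ C.S.e (𝒢.s g) = 0 ∧
      C.T.e (𝒢.r g) = 0 := by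
  obtain ⟨C, hg, hS, hT⟩ := exists_fibreChart h𝒢 h𝒵 hoM hoA g
  obtain ⟨Φ, hg', hΦ⟩ := exists_isProductChart_euclidean
    (𝒢.isSubmersion_s.isSubmersionAt (𝒢.inv g)) C.dim_eq C.T.isDivisorChart.mem_maximalAtlas
    (by rw [𝒢.s_inv]; exact C.range_mem g hg)
  have hc := 𝒢.contMDiff_inv.continuous
  have hU : IsOpen (𝒢.inv ⁻¹' Φ.source) := Φ.open_source.preimage hc
  have hV : IsOpen (𝒢.inv ⁻¹' C.Ψ.source) := C.Ψ.open_source.preimage hc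
  refine ⟨⟨⟨C.S, C.T, C.Ψ.restrOpen _ hU, C.isProductChart.restrOpen hU, fun g hg => ?_,
    C.dim_eq⟩, Φ.restrOpen _ hV, hΦ.restrOpen hV, fun g => ?_⟩, ?_, hS, hT⟩
  · rw [OpenPartialHomeomorph.restrOpen_source] at hg
    exact C.range_mem g hg.1
  · simp only [OpenPartialHomeomorph.restrOpen_source, mem_inter_iff, mem_preimage, inv_inv]
    exact and_comm
  · rw [OpenPartialHomeomorph.restrOpen_source]
    exact ⟨hg, hg'⟩

namespace ArrowChart

variable (C : 𝒢.ArrowChart 𝒵 oA oM)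
  {z : EuclideanSpace ℝ (Fin n) × EuclideanSpace ℝ (Fin n)}

/-- The chart of the inverses. -/
def opp : 𝒢.ArrowChart 𝒵 oA oM where
  S := C.T
  T := C.S
  Ψ := C.Φ
  isProductChart := C.isProductChart_inv
  range_mem g hg := by
    have h := (C.inv_mem (𝒢.inv g)).1 (by rwa [inv_inv])
    rw [← 𝒢.s_inv]
    exact C.isProductChart.mem_source _ h
  dim_eq := C.dim_eq
  Φ := C.Ψ
  isProductChart_inv := C.isProductChart
  inv_mem g := by rw [← C.inv_mem, inv_inv]

/-- The coordinates of the inverse. -/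
def swap (z : EuclideanSpace ℝ (Fin n) × EuclideanSpace ℝ (Fin n)) :
    EuclideanSpace ℝ (Fin n) × EuclideanSpace ℝ (Fin n) := C.Φ (𝒢.inv (C.Ψ.symm z))

variable {C}

theorem inv_mem_source (hz : z ∈ C.Ψ.target) : 𝒢.inv (C.Ψ.symm z) ∈ C.opp.Ψ.source :=
  (C.inv_mem _).2 (C.Ψ.map_target hz)

theorem swap_mem (hz : z ∈ C.Ψ.target) : C.swap z ∈ C.opp.Ψ.target :=
  C.opp.Ψ.map_source (inv_mem_source hz)

theorem opp_symm_swap (hz : z ∈ C.Ψ.target) : C.opp.Ψ.symm (C.swap z) = 𝒢.inv (C.Ψ.symm z) :=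
  C.opp.Ψ.left_inv (inv_mem_source hz)

theorem swap_swap (hz : z ∈ C.Ψ.target) : C.opp.swap (C.swap z) = z := by
  unfold swap
  rw [show C.opp.Ψ.symm (C.Φ (𝒢.inv (C.Ψ.symm z))) = 𝒢.inv (C.Ψ.symm z) from opp_symm_swap hz,
    inv_inv]
  exact C.Ψ.right_inv hz

theorem injOn_swap : InjOn C.swap C.Ψ.target := fun z hz w hw h => by
  rw [← swap_swap hz, h, swap_swap hw]

theorem swap_fst (hz : z ∈ C.Ψ.target) : (C.swap z).1 = C.range z := by
  rw [← C.opp.chart_source (swap_mem hz), opp_symm_swap hz, 𝒢.s_inv]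
  rfl

theorem opp_range_swap (hz : z ∈ C.Ψ.target) : C.opp.range (C.swap z) = z.1 := by
  rw [FibreChart.range, opp_symm_swap hz, 𝒢.r_inv]
  exact C.chart_source hz

theorem contDiffAt_swap (hz : z ∈ C.Ψ.target) : ContDiffAt ℝ ∞ C.swap z :=
  contMDiffAt_iff_contDiffAt.1 ((C.opp.isSmoothChart.contMDiffAt (inv_mem_source hz)).comp z
    ((𝒢.contMDiff_inv _).comp z (C.isSmoothChart.contMDiffAt_symm hz)))

theorem fderiv_swap_comp (hz : z ∈ C.Ψ.target) :
    (fderiv ℝ C.opp.swap (C.swap z)).comp (fderiv ℝ C.swap z) = ContinuousLinearMap.id ℝ _ := by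
  have h1 := ((contDiffAt_swap (swap_mem hz)).differentiableAt (by simp)).hasFDerivAt.comp z
    ((contDiffAt_swap hz).differentiableAt (by simp)).hasFDerivAt
  refine h1.unique ((hasFDerivAt_id z).congr_of_eventuallyEq ?_)
  filter_upwards [C.Ψ.open_target.mem_nhds hz] with w hw
  exact swap_swap hw

theorem det_fderiv_swap_ne_zero (hz : z ∈ C.Ψ.target) : (fderiv ℝ C.swap z).det ≠ 0 := by
  have h : LinearMap.det ((fderiv ℝ C.opp.swap (C.swap z)).toLinearMap ∘ₗ
      (fderiv ℝ C.swap z).toLinearMap) = LinearMap.det LinearMap.id :=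
    congrArg (fun L => LinearMap.det L.toLinearMap) (fderiv_swap_comp hz)
  rw [LinearMap.det_comp, LinearMap.det_id] at h
  exact right_ne_zero_of_mul_eq_one h

theorem fderiv_slice {f : EuclideanSpace ℝ (Fin n) × EuclideanSpace ℝ (Fin n) →
      EuclideanSpace ℝ (Fin n)} (hf : DifferentiableAt ℝ f z) :
    fderiv ℝ (fun t => f (z.1, t)) z.2 =
      (fderiv ℝ f z).comp (ContinuousLinearMap.inr ℝ _ _) :=
  (HasFDerivAt.comp z.2 (g := f) (show HasFDerivAt f (fderiv ℝ f z) (z.1, z.2) from hf.hasFDerivAt)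
    (hasFDerivAt_prodMk_right z.1 z.2)).fderiv

/-- The Jacobian of the inversion. -/
theorem jac_mul_prod_range (hz : z ∈ C.Ψ.target) :
    C.jac z * |∏ i ∈ C.T.I, C.range z i| =
      |(fderiv ℝ C.swap z).det| * (C.opp.jac (C.swap z) * |∏ i ∈ C.S.I, z.1 i|) := by
  have hw := swap_mem hz
  have hr := (C.contDiffAt_range hz).differentiableAt (by simp)
  have hr' := (C.opp.contDiffAt_range hw).differentiableAt (by simp)
  have h1 := (hasFDerivAt_fst.prodMk hr'.hasFDerivAt).comp z
    ((contDiffAt_swap hz).differentiableAt (by simp)).hasFDerivAt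
  have h2 := (hr.hasFDerivAt.prodMk hasFDerivAt_fst)
  have h3 := h2.unique (h1.congr_of_eventuallyEq (by
    filter_upwards [C.Ψ.open_target.mem_nhds hz] with w hw
    simp only [Function.comp]
    rw [swap_fst hw, opp_range_swap hw]))
  have h4 : |LinearMap.det ((fderiv ℝ C.range z).toLinearMap.prod (LinearMap.fst ℝ _ _))| =
      |LinearMap.det (((LinearMap.fst ℝ _ _).prod
        (fderiv ℝ C.opp.range (C.swap z)).toLinearMap) ∘ₗ (fderiv ℝ C.swap z).toLinearMap)| :=
    congrArg (fun L => |LinearMap.det L.toLinearMap|) h3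
  rw [LinearMap.det_comp, abs_mul] at h4
  have h5 := abs_det_prod_fst (fderiv ℝ C.range z).toLinearMap
  have h6 := det_fst_prod (fderiv ℝ C.opp.range (C.swap z)).toLinearMap
  rw [← C.abs_det_fderiv_range hz, fderiv_slice hr]
  refine h5.symm.trans (h4.trans ?_)
  rw [mul_comm, ← opp_range_swap hz]
  refine congrArg₂ _ rfl (Eq.trans ?_ (C.opp.abs_det_fderiv_range hw))
  rw [fderiv_slice hr']
  exact congrArg _ h6

theorem prod_range_eq_zero_iff (hz : z ∈ C.Ψ.target) :
    ∏ i ∈ C.T.I, C.range z i = 0 ↔ ∏ i ∈ C.S.I, z.1 i = 0 := by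
  have h := jac_mul_prod_range hz
  have h1 := (C.contDiffAt_jac hz).2.ne'
  have h2 := (C.opp.contDiffAt_jac (swap_mem hz)).2.ne'
  have h3 := abs_ne_zero.2 (det_fderiv_swap_ne_zero hz)
  rw [← abs_eq_zero, ← abs_eq_zero (a := ∏ i ∈ C.S.I, z.1 i)]
  constructor <;> intro h0 <;> rw [h0] at h
  · rw [mul_zero, eq_comm] at h
    exact ((mul_eq_zero.1 ((mul_eq_zero.1 h).resolve_left h3)).resolve_left h2)
  · rw [mul_zero, mul_zero] at h
    exact (mul_eq_zero.1 h).resolve_left h1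

end ArrowChart

end LieGroupoid

section Cutoff

variable {n : ℕ} {I J : Finset (Fin n)} {R M C : ℝ} {S : ℝ → Set (Fin n → ℝ)}
  {c : Fin n → (Fin n → ℝ) → ℝ}

theorem IsCutoff.mono (h : IsCutoff I R M C S c) (hM : 0 < M) {M' C' : ℝ} (hMM : M ≤ M')
    (hCC : C ≤ C') : IsCutoff I R M' C' S c where
  measurable := h.measurable
  lower j x hx := (inv_anti₀ hM hMM).trans (h.lower j x hx)
  upper j x hx := (h.upper j x hx).trans hMM
  lip j x y hx hy := (h.lip j x y hx hy).trans (by gcongr)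
  of_mem ε hε hCε x hx hxS j hj := by
    have h1 : C * ε ≤ C' * ε := by gcongr
    refine le_trans ?_ (h.of_mem ε hε (h1.trans hCε) x hx hxS j hj)
    gcongr
  of_notMem ε hε hCε x hx hxS := by
    have h1 : C * ε ≤ C' * ε := by gcongr
    obtain ⟨j, hj, hle⟩ := h.of_notMem ε hε (h1.trans hCε) x hx hxS
    exact ⟨j, hj, hle.trans (by gcongr)⟩

theorem IsCutoff.pullback {R' : ℝ} (h : IsCutoff J R' M C S c) (hM : 1 ≤ M) (hC : 0 ≤ C)
    {f : (Fin n → ℝ) → Fin n → ℝ} {u : Fin n → (Fin n → ℝ) → ℝ} {σ : Fin n → Fin n} {a L : ℝ}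
    {S' : ℝ → Set (Fin n → ℝ)} (ha : 1 ≤ a) (hL : 0 ≤ L) (hσ : ∀ i ∈ I, σ i ∈ J)
    (hσ' : ∀ j ∈ J, ∃ i ∈ I, σ i = j) (hf : ∀ x, (∀ i, |x i| ≤ R) → ∀ i, |f x i| ≤ R')
    (hLf : ∀ x y, (∀ i, |x i| ≤ R) → (∀ i, |y i| ≤ R) → ‖f x - f y‖ ≤ L * ‖x - y‖)
    (hul : ∀ j x, (∀ i, |x i| ≤ R) → a⁻¹ ≤ u j x) (huu : ∀ j x, (∀ i, |x i| ≤ R) → u j x ≤ a)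
    (hLu : ∀ j x y, (∀ i, |x i| ≤ R) → (∀ i, |y i| ≤ R) → |u j x - u j y| ≤ L * ‖x - y‖)
    (heq : ∀ j ∈ I, ∀ x, (∀ i, |x i| ≤ R) → |f x (σ j)| = |x j| * u j x)
    (hS : ∀ ε, MeasurableSet (S' ε))
    (hS' : ∀ ε x, (∀ i, |x i| ≤ R) → (x ∈ S' ε ↔ f x ∈ S ε)) :
    IsCutoff I R (a * M) (C + a * C * L + M * L) S' (fun j x => u j x * c (σ j) (f x)) := by
  have ha0 : 0 < a := by linarith
  have hM0 : 0 < M := by linarith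
  have hCC : C ≤ C + a * C * L + M * L := by
    have : 0 ≤ a * C * L + M * L := by positivity
    linarith
  refine ⟨hS, fun j x hx => ?_, fun j x hx => ?_, fun j x y hx hy => ?_,
    fun ε hε hCε x hx hxS j hj => ?_, fun ε hε hCε x hx hxS => ?_⟩
  · have h1 := hul j x hx
    have h2 := h.lower (σ j) (f x) (hf x hx)
    rw [mul_inv]
    exact mul_le_mul h1 h2 (by positivity) ((inv_pos.2 ha0).le.trans h1)
  · have h1 := huu j x hx
    have h2 := h.upper (σ j) (f x) (hf x hx)
    have h3 := h.lower (σ j) (f x) (hf x hx)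
    exact mul_le_mul h1 h2 ((inv_pos.2 hM0).le.trans h3) ha0.le
  · have h1 := h.lip (σ j) (f x) (f y) (hf x hx) (hf y hy)
    have h2 := hLf x y hx hy
    have h3 := hLu j x y hx hy
    have h4 : |u j x| ≤ a := abs_le.2 ⟨by
      have := (inv_pos.2 ha0).le.trans (hul j x hx)
      linarith, huu j x hx⟩
    have h5 : |c (σ j) (f y)| ≤ M := abs_le.2 ⟨by
      have := (inv_pos.2 hM0).le.trans (h.lower (σ j) (f y) (hf y hy))
      linarith, h.upper (σ j) (f y) (hf y hy)⟩
    calc |u j x * c (σ j) (f x) - u j y * c (σ j) (f y)|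
        = |u j x * (c (σ j) (f x) - c (σ j) (f y)) + (u j x - u j y) * c (σ j) (f y)| := by
          congr 1; ring
      _ ≤ |u j x| * |c (σ j) (f x) - c (σ j) (f y)| + |u j x - u j y| * |c (σ j) (f y)| := by
          rw [← abs_mul, ← abs_mul]; exact abs_add_le _ _
      _ ≤ a * (C * (L * ‖x - y‖)) + (L * ‖x - y‖) * M := by
          refine add_le_add (mul_le_mul h4 (h1.trans (by gcongr)) (abs_nonneg _) ha0.le)
            (mul_le_mul h3 h5 (abs_nonneg _) (by positivity))
      _ = (a * C * L + M * L) * ‖x - y‖ := by ring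
      _ ≤ _ := by
          refine mul_le_mul_of_nonneg_right ?_ (norm_nonneg _)
          linarith
  · have h1 : C * ε ≤ (C + a * C * L + M * L) * ε := by gcongr
    have h2 := h.of_mem ε hε (h1.trans hCε) (f x) (hf x hx) ((hS' ε x hx).1 hxS) (σ j) (hσ j hj)
    rw [heq j hj x hx, mul_assoc] at h2
    exact le_trans (by gcongr) h2
  · have h1 : C * ε ≤ (C + a * C * L + M * L) * ε := by gcongr
    obtain ⟨j, hj, hle⟩ := h.of_notMem ε hε (h1.trans hCε) (f x) (hf x hx)
      (fun hfS => hxS ((hS' ε x hx).2 hfS))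
    obtain ⟨i, hi, rfl⟩ := hσ' j hj
    rw [heq i hi x hx, mul_assoc] at hle
    exact ⟨i, hi, hle.trans (by gcongr)⟩

end Cutoff

namespace LieGroupoid

variable {n d : ℕ} {M G : Type*}
  [TopologicalSpace M] [ChartedSpace (EuclideanSpace ℝ (Fin n)) M] [IsManifold (𝓡 n) ∞ M]
  [TopologicalSpace G] [ChartedSpace (EuclideanSpace ℝ (Fin d)) G] [IsManifold (𝓡 d) ∞ G]
  {𝒢 : LieGroupoid n d M G} {𝒵 : Finset (Set M)}
  {oA : ∀ m, Orientation ℝ (𝒢.A m) (Fin n)}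
  {oM : ∀ m : M, Orientation ℝ (TangentSpace (𝓡 n) m) (Fin n)}

namespace ArrowChart

variable {C : 𝒢.ArrowChart 𝒵 oA oM}
  {z : EuclideanSpace ℝ (Fin n) × EuclideanSpace ℝ (Fin n)}

/-- The horizontal coordinates. -/
def horizontal (n : ℕ) (i : Fin n) :
    EuclideanSpace ℝ (Fin n) × EuclideanSpace ℝ (Fin n) →L[ℝ] ℝ :=
  (EuclideanSpace.proj i).comp (ContinuousLinearMap.fst ℝ _ _)

theorem linearIndependent_horizontal (I : Finset (Fin n)) :
    LinearIndependent ℝ fun i : I => horizontal n i := by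
  classical
  rw [Fintype.linearIndependent_iff]
  intro g hg i
  have h := congrArg (fun L => L (coordVec i.1, (0 : EuclideanSpace ℝ (Fin n)))) hg
  simpa [horizontal, coordVec, _root_.sum_apply, Finset.sum_ite_eq,
    Pi.single_apply, Subtype.ext_iff.symm] using h

theorem fderiv_range_apply (hz : z ∈ C.Ψ.target) (j : Fin n) :
    ContDiffAt ℝ ∞ (fun z => C.range z j) z ∧
      fderiv ℝ (fun z => C.range z j) z = (horizontal n j).comp (fderiv ℝ C.swap z) := by
  have hr : (fun z => C.range z j) =ᶠ[𝓝 z] fun z => horizontal n j (C.swap z) := by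
    filter_upwards [C.Ψ.open_target.mem_nhds hz] with w hw
    rw [← swap_fst hw]
    rfl
  have hs := contDiffAt_swap hz
  refine ⟨((horizontal n j).contDiff.contDiffAt.comp z hs).congr_of_eventuallyEq hr, ?_⟩
  rw [hr.fderiv_eq]
  exact ((horizontal n j).hasFDerivAt.comp z (hs.differentiableAt (by simp)).hasFDerivAt).fderiv

theorem linearIndependent_fderiv_range (hz : z ∈ C.Ψ.target) (I : Finset (Fin n)) :
    LinearIndependent ℝ fun j : I => fderiv ℝ (fun z => C.range z j) z := by
  have h1 := Fintype.linearIndependent_iff.1 (linearIndependent_horizontal (n := n) I)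
  rw [Fintype.linearIndependent_iff]
  intro g hg i
  refine h1 g (ContinuousLinearMap.ext fun v => ?_) i
  have h2 : fderiv ℝ C.swap z (fderiv ℝ C.opp.swap (C.swap z) v) = v := by
    have h3 := fderiv_swap_comp (C := C.opp) (swap_mem hz)
    rw [swap_swap hz] at h3
    exact congrArg (fun L => L v) h3
  have h := congrArg (fun L => L (fderiv ℝ C.opp.swap (C.swap z) v)) hg
  simp only [_root_.sum_apply, _root_.smul_apply, (fderiv_range_apply hz _).2,
    ContinuousLinearMap.comp_apply, h2] at h ⊢
  exact h

theorem exists_injective (hz : z ∈ C.Ψ.target) (h0 : z.1 = 0) :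
    ∃ σ : C.S.I → C.T.I, Function.Injective σ ∧
      ∀ i, ∀ᶠ w in 𝓝 z, w.1 i = 0 → C.range w (σ i) = 0 := by
  refine exists_matching (linearIndependent_horizontal C.S.I)
    (η := fun (j : C.T.I) w => C.range w j)
    (fun j => (fderiv_range_apply hz j).1) (linearIndependent_fderiv_range hz C.T.I)
    (fun i => by simp [horizontal, h0]) ?_
  filter_upwards [C.Ψ.open_target.mem_nhds hz] with w hw
  rintro ⟨i, hi⟩
  obtain ⟨j, hj, hj0⟩ := Finset.prod_eq_zero_iff.1
    ((prod_range_eq_zero_iff hw).2 (Finset.prod_eq_zero i.2 hi))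
  exact ⟨⟨j, hj⟩, hj0⟩

/-- The range is related to the source by a permutation of the hyperplanes and multiplication by
invertible functions. -/
theorem exists_range_eq_mul (hz : z ∈ C.Ψ.target) (h0 : z.1 = 0) (h0' : C.range z = 0) :
    ∃ (σ : Fin n → Fin n) (u : Fin n → EuclideanSpace ℝ (Fin n) × EuclideanSpace ℝ (Fin n) → ℝ),
      (∀ i ∈ C.S.I, σ i ∈ C.T.I) ∧ (∀ j ∈ C.T.I, ∃ i ∈ C.S.I, σ i = j) ∧
      (∀ i, ContDiff ℝ ∞ (u i)) ∧ (∀ i, u i z ≠ 0) ∧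
      ∀ᶠ w in 𝓝 z, ∀ i ∈ C.S.I, C.range w (σ i) = w.1 i * u i w := by
  classical
  obtain ⟨σ, hσ, hσ0⟩ := exists_injective hz h0
  obtain ⟨σ', hσ', -⟩ := exists_injective (C := C.opp) (swap_mem hz) (by rw [swap_fst hz, h0'])
  have hsurj : Function.Surjective σ :=
    ((Fintype.bijective_iff_injective_and_card σ).2 ⟨hσ, le_antisymm
      (Fintype.card_le_of_injective σ hσ) (Fintype.card_le_of_injective σ' hσ')⟩).2
  have hu : ∀ i : C.S.I, ∃ u : EuclideanSpace ℝ (Fin n) × EuclideanSpace ℝ (Fin n) → ℝ,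
      ContDiff ℝ ∞ u ∧ u z ≠ 0 ∧ ∀ᶠ w in 𝓝 z, C.range w (σ i) = w.1 i * u w := by
    intro i
    obtain ⟨r, hr, hrU⟩ := Metric.mem_nhds_iff.1
      (inter_mem (C.Ψ.open_target.mem_nhds hz) (hσ0 i))
    let χ : ContDiffBump z := ⟨r / 4, r / 2, by linarith, by linarith⟩
    have hχ : tsupport χ ⊆ Metric.ball z r := by
      rw [χ.tsupport_eq]
      exact Metric.closedBall_subset_ball (by simp only [χ]; linarith)
    have h1 : ContDiff ℝ ∞ fun w => χ w • C.range w (σ i) :=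
      contMDiff_iff_contDiff.1 (contMDiff_smul_of_tsupport (contMDiff_iff_contDiff.2 χ.contDiff)
        hχ fun w hw => contMDiffAt_iff_contDiffAt.2 (fderiv_range_apply (hrU hw).1 _).1)
    obtain ⟨u, hu, hu'⟩ := exists_contDiff_eq_mul h1 (horizontal n i) (v := (coordVec i.1, 0))
      (by simp [horizontal, coordVec]) (fun w hw => by
        by_cases hws : w ∈ tsupport χ
        · rw [(hrU (hχ hws)).2 hw, smul_zero]
        · rw [image_eq_zero_of_notMem_tsupport hws, zero_smul])
    have h2 : ∀ᶠ w in 𝓝 z, C.range w (σ i) = w.1 i * u w := by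
      filter_upwards [χ.eventuallyEq_one] with w hw
      have := hu' w
      rw [hw, Pi.one_apply, one_smul] at this
      exact this
    refine ⟨u, hu, fun hu0 => ?_, h2⟩
    have h3 : HasFDerivAt (fun w => horizontal n i w * u w)
        (horizontal n i z • fderiv ℝ u z + u z • horizontal n i) z :=
      (horizontal n i).hasFDerivAt.mul (hu.differentiable (by simp) z).hasFDerivAt
    have h4 : horizontal n i z = 0 := by simp [horizontal, h0]
    rw [h4, hu0, zero_smul, zero_smul, add_zero] at h3
    have h5 : fderiv ℝ (fun w => C.range w (σ i)) z = 0 :=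
      (h3.congr_of_eventuallyEq h2).fderiv
    exact (linearIndependent_fderiv_range hz C.T.I).ne_zero (σ i) h5
  choose u hu hu0 hur using hu
  refine ⟨fun i => if hi : i ∈ C.S.I then (σ ⟨i, hi⟩).1 else i,
    fun i => if hi : i ∈ C.S.I then u ⟨i, hi⟩ else fun _ => 1, fun i hi => ?_, fun j hj => ?_,
    fun i => ?_, fun i => ?_, ?_⟩
  · simp only [dif_pos hi]; exact (σ _).2
  · obtain ⟨i, hi⟩ := hsurj ⟨j, hj⟩
    exact ⟨i, i.2, by simp [hi]⟩
  · beta_reduce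
    split_ifs
    · exact hu _
    · exact contDiff_const
  · beta_reduce
    split_ifs
    · exact hu0 _
    · exact one_ne_zero
  · filter_upwards [eventually_all.2 hur] with w hw i hi
    simp only [dif_pos hi]
    exact hw ⟨i, hi⟩

end ArrowChart

end LieGroupoid

theorem exists_bound_inv_bound {ι V : Type*} [Finite ι] [TopologicalSpace V] {u : ι → V → ℝ} {z : V}
    (hu : ∀ i, ContinuousAt (u i) z) (h0 : ∀ i, u i z ≠ 0) :
    ∃ a, 1 ≤ a ∧ ∀ᶠ w in 𝓝 z, ∀ i, a⁻¹ ≤ |u i w| ∧ |u i w| ≤ a := by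
  have := Fintype.ofFinite ι
  have hpos : ∀ i, 0 < |u i z| := fun i => abs_pos.2 (h0 i)
  set a := 1 + ∑ i, (|u i z| + |u i z|⁻¹) with ha
  have hle : ∀ i, |u i z| + |u i z|⁻¹ < a := fun i => by
    have := Finset.single_le_sum (f := fun i => |u i z| + |u i z|⁻¹)
      (fun i _ => (add_pos (hpos i) (inv_pos.2 (hpos i))).le) (Finset.mem_univ i)
    linarith
  refine ⟨a, ?_, eventually_all.2 fun i => ?_⟩
  · have : 0 ≤ ∑ i, (|u i z| + |u i z|⁻¹) :=
      Finset.sum_nonneg fun i _ => (add_pos (hpos i) (inv_pos.2 (hpos i))).le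
    linarith
  · have h1 : a⁻¹ < |u i z| := by
      rw [inv_lt_comm₀ (by linarith [hle i, hpos i, inv_pos.2 (hpos i)]) (hpos i)]
      linarith [hle i, hpos i]
    have h2 : |u i z| < a := by linarith [hle i, inv_pos.2 (hpos i)]
    filter_upwards [(hu i).abs.eventually (lt_mem_nhds h1), (hu i).abs.eventually (gt_mem_nhds h2)]
      with w hw hw'
    exact ⟨hw.le, hw'.le⟩

namespace LieGroupoid

variable {n d : ℕ} {M G : Type*}
  [TopologicalSpace M] [ChartedSpace (EuclideanSpace ℝ (Fin n)) M] [IsManifold (𝓡 n) ∞ M]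
  [TopologicalSpace G] [ChartedSpace (EuclideanSpace ℝ (Fin d)) G] [IsManifold (𝓡 d) ∞ G]
  {𝒢 : LieGroupoid n d M G} {𝒵 : Finset (Set M)}
  {oA : ∀ m, Orientation ℝ (𝒢.A m) (Fin n)}
  {oM : ∀ m : M, Orientation ℝ (TangentSpace (𝓡 n) m) (Fin n)}

/-- The arrows with range in the truncation of `M`, in coordinates. -/
def FibreChart.rangeTruncation (C : 𝒢.FibreChart 𝒵 oA oM) (h : RiemMetric n M) (ε : ℝ) :
    Set (EuclideanSpace ℝ (Fin n) × EuclideanSpace ℝ (Fin n)) :=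
  {z | z ∈ C.Ψ.target ∧ C.range z ∈ chartTruncation 𝒵 h C.T.e ε}

theorem FibreChart.measurableSet_rangeTruncation (C : 𝒢.FibreChart 𝒵 oA oM) (h : RiemMetric n M)
    (ε : ℝ) : MeasurableSet (C.rangeTruncation h ε) := by
  have h1 : C.rangeTruncation h ε = C.Ψ.target \ (C.Ψ.target ∩
      (fun z => 𝒢.r (C.Ψ.symm z)) ⁻¹' (truncation 𝒵 h ε)ᶜ) := by
    ext z
    simp only [rangeTruncation, chartTruncation, mem_ofPred_eq, Set.mem_sdiff, mem_inter_iff,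
      mem_preimage, mem_compl_iff, range]
    constructor
    · rintro ⟨hz, -, h2⟩
      rw [C.T.e.left_inv (C.range_mem _ (C.Ψ.map_target hz))] at h2
      exact ⟨hz, fun h3 => h3.2 h2⟩
    · rintro ⟨hz, h2⟩
      have hr := C.range_mem _ (C.Ψ.map_target hz)
      refine ⟨hz, C.T.e.map_source hr, ?_⟩
      rw [C.T.e.left_inv hr]
      by_contra h3
      exact h2 ⟨hz, h3⟩
  rw [h1]
  exact C.Ψ.open_target.measurableSet.diff ((𝒢.contMDiff_r.continuous.comp_continuousOn
    C.Ψ.continuousOn_symm).isOpen_inter_preimage C.Ψ.open_target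
    (h.isClosed_truncation 𝒵 ε).isOpen_compl).measurableSet

namespace ArrowChart

variable {C : 𝒢.ArrowChart 𝒵 oA oM}
  {z : EuclideanSpace ℝ (Fin n) × EuclideanSpace ℝ (Fin n)}

/-- On a box, both the truncation of the source and the truncation of the range are, up to errors
of second order, truncations along coordinate hyperplanes, uniformly in the vertical variable. -/
theorem exists_isCutoff [RegularSpace M] (h : RiemMetric n M) (hz : z ∈ C.Ψ.target)
    (h0 : z.1 = 0) (h0' : C.range z = 0) :
    ∃ R > 0, ∃ δ > 0, ∃ L K, 1 ≤ L ∧ 0 ≤ K ∧ box n (2 * R) ⊆ C.S.e.target ∧ box n R ∈ 𝓝 0 ∧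
      box n R ×ˢ Metric.closedBall z.2 δ ⊆ C.Ψ.target ∧
      (∃ c, IsCutoff C.S.I R L K (fun ε => WithLp.toLp 2 ⁻¹' (chartTruncation 𝒵 h C.S.e ε)) c) ∧
      ∀ t ∈ Metric.closedBall z.2 δ, ∃ c, IsCutoff C.S.I R L K
        (fun ε => {x | (WithLp.toLp 2 x, t) ∈ C.rangeTruncation h ε}) c := by
  obtain ⟨σ, u, hσ, hσ', hu, hu0, heq⟩ := exists_range_eq_mul hz h0 h0'
  have h0T : C.T.e.target ∈ 𝓝 (0 : EuclideanSpace ℝ (Fin n)) := by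
    rw [← h0', ← swap_fst hz]
    exact C.T.e.open_target.mem_nhds (C.opp.target_mem (swap_mem hz))
  have h0S : C.S.e.target ∈ 𝓝 (0 : EuclideanSpace ℝ (Fin n)) := by
    rw [← h0]
    exact C.S.e.open_target.mem_nhds (C.target_mem hz)
  obtain ⟨R', hR', hbox', hbox0'⟩ := exists_box_subset h0T
  obtain ⟨L', K', c', hL', hK', hc'⟩ := C.T.isDivisorChart.exists_isCutoff h hR' hbox'
  have hr := C.contDiffAt_range hz
  obtain ⟨Kr, Wr, hWr, hLr⟩ := (hr.of_le (m := 1) (by simp)).exists_lipschitzOnWith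
  choose Ku Wu hWu hLu using fun i =>
    ((hu i).contDiffAt (x := z) |>.of_le (m := 1) (by simp)).exists_lipschitzOnWith
  obtain ⟨a, ha, hau⟩ := exists_bound_inv_bound (fun i => (hu i).continuous.continuousAt) hu0
  have hW : ∀ᶠ w in 𝓝 z, w ∈ C.Ψ.target ∧ C.range w ∈ box n R' ∧ w ∈ Wr ∧ (∀ i, w ∈ Wu i) ∧
      (∀ i, a⁻¹ ≤ |u i w| ∧ |u i w| ≤ a) ∧ ∀ i ∈ C.S.I, C.range w (σ i) = w.1 i * u i w := by
    filter_upwards [C.Ψ.open_target.mem_nhds hz, hr.continuousAt.preimage_mem_nhds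
      (by rw [h0']; exact hbox0'), hWr, eventually_all.2 hWu, hau, heq] with w h1 h2 h3 h4 h5 h6
    exact ⟨h1, h2, h3, h4, h5, h6⟩
  obtain ⟨U, hU, V, hV, hUV⟩ := mem_nhds_prod_iff.1
    (show {w | _} ∈ 𝓝 ((0 : EuclideanSpace ℝ (Fin n)), z.2) by rw [← h0]; exact hW)
  obtain ⟨R, hR, hbox, hbox0⟩ := exists_box_subset (inter_mem hU h0S)
  obtain ⟨δ, hδ, hδV⟩ := Metric.nhds_basis_closedBall.mem_iff.1 hV
  obtain ⟨L₁, K₁, c₁, hL₁, hK₁, hc₁⟩ := C.S.isDivisorChart.exists_isCutoff h hR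
    (hbox.trans inter_subset_right)
  have hmem : ∀ x ∈ box n R, ∀ t ∈ Metric.closedBall z.2 δ, (x, t) ∈ {w | _} := fun x hx t ht =>
    hUV ⟨(hbox (fun i => (hx i).trans (by linarith))).1, hδV ht⟩
  set A := ((Kr : ℝ) + ∑ i, (Ku i : ℝ)) * ‖toLpL n‖ with hA
  have hA0 : 0 ≤ A := by positivity
  set K₂ := K' + a * K' * A + L' * A with hK₂
  have hK₂0 : 0 ≤ K₂ := by positivity
  have haL : 1 ≤ a * L' := by nlinarith
  refine ⟨R, hR, δ, hδ, max L₁ (a * L'), max K₁ K₂, le_max_of_le_left hL₁, le_max_of_le_left hK₁,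
    hbox.trans inter_subset_right, hbox0, fun w hw => (hmem w.1 hw.1 w.2 hw.2).1,
    ⟨c₁, hc₁.mono (by linarith) (le_max_left _ _) (le_max_left _ _)⟩, fun t ht => ?_⟩
  have hm : ∀ x : Fin n → ℝ, (∀ i, |x i| ≤ R) → _ := fun x hx => hmem (WithLp.toLp 2 x) hx t ht
  have hdist : ∀ x y : Fin n → ℝ, dist ((WithLp.toLp 2 x : EuclideanSpace ℝ (Fin n)), t)
      (WithLp.toLp 2 y, t) ≤ ‖toLpL n‖ * ‖x - y‖ := by
    intro x y
    rw [Prod.dist_eq, dist_self, max_eq_left dist_nonneg, dist_eq_norm]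
    have := (toLpL n).le_opNorm (x - y)
    rwa [map_sub] at this
  have hKu : ∀ i, (Ku i : ℝ) ≤ ∑ i, (Ku i : ℝ) := fun i =>
    Finset.single_le_sum (f := fun i => (Ku i : ℝ)) (fun i _ => (Ku i).2) (Finset.mem_univ i)
  have hS0 : (0 : ℝ) ≤ ∑ i, (Ku i : ℝ) := Finset.sum_nonneg fun i _ => (Ku i).2
  refine ⟨_, (hc'.pullback hL' hK' (R := R) (a := a) (L := A)
    (f := fun x => (C.range (WithLp.toLp 2 x, t)).ofLp)
    (u := fun i x => |u i (WithLp.toLp 2 x, t)|) (σ := σ)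
    (S' := fun ε => {x | (WithLp.toLp 2 x, t) ∈ C.rangeTruncation h ε}) ha hA0 hσ hσ'
    (fun x hx => (hm x hx).2.1) ?_ (fun j x hx => ((hm x hx).2.2.2.2.1 j).1)
    (fun j x hx => ((hm x hx).2.2.2.2.1 j).2) ?_ ?_ ?_ ?_).mono (by linarith)
      (le_max_right _ _) (le_max_right _ _)⟩
  · intro x y hx hy
    have h1 := hLr.dist_le_mul _ (hm x hx).2.2.1 _ (hm y hy).2.2.1
    refine (pi_norm_le_iff_of_nonneg (by positivity)).2 fun i => ?_
    have h2 := PiLp.norm_apply_le (C.range (WithLp.toLp 2 x, t) - C.range (WithLp.toLp 2 y, t)) i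
    rw [← dist_eq_norm (C.range _)] at h2
    refine h2.trans (h1.trans ?_)
    calc (Kr : ℝ) * _ ≤ Kr * (‖toLpL n‖ * ‖x - y‖) := by gcongr; exact hdist x y
      _ ≤ (Kr + ∑ i, (Ku i : ℝ)) * (‖toLpL n‖ * ‖x - y‖) := by gcongr; linarith
      _ = A * ‖x - y‖ := by rw [hA]; ring
  · intro j x y hx hy
    have h1 := (hLu j).dist_le_mul _ ((hm x hx).2.2.2.1 j) _ ((hm y hy).2.2.2.1 j)
    refine (abs_abs_sub_abs_le_abs_sub _ _).trans ((Real.dist_eq _ _).symm.le.trans (h1.trans ?_))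
    calc (Ku j : ℝ) * _ ≤ Ku j * (‖toLpL n‖ * ‖x - y‖) := by gcongr; exact hdist x y
      _ ≤ (Kr + ∑ i, (Ku i : ℝ)) * (‖toLpL n‖ * ‖x - y‖) := by
          gcongr
          have := hKu j
          have := Kr.2
          linarith [Kr.coe_nonneg]
      _ = A * ‖x - y‖ := by rw [hA]; ring
  · intro j hj x hx
    rw [(hm x hx).2.2.2.2.2 j hj, abs_mul]
  · intro ε
    exact ((Continuous.prodMk_left t).comp (PiLp.continuous_toLp 2 _)).measurable
      (C.measurableSet_rangeTruncation h ε)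
  · intro ε x hx
    exact and_iff_right (hm x hx).1

end ArrowChart

end LieGroupoid

section Slices

variable {n : ℕ} {I : Finset (Fin n)} {R δ L K : ℝ} {t₀ : EuclideanSpace ℝ (Fin n)}
  {k : EuclideanSpace ℝ (Fin n) × EuclideanSpace ℝ (Fin n) → ℂ}
  {A B : ℝ → Set (EuclideanSpace ℝ (Fin n) × EuclideanSpace ℝ (Fin n))}

/-- The slices of the truncations are truncations along coordinate hyperplanes, uniformly. -/
def HasCutoffSlices (I : Finset (Fin n)) (R L K : ℝ) (T : Set (EuclideanSpace ℝ (Fin n)))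
    (A : ℝ → Set (EuclideanSpace ℝ (Fin n) × EuclideanSpace ℝ (Fin n))) : Prop :=
  ∀ t ∈ T, ∃ c, IsCutoff I R L K (fun ε => {x | (WithLp.toLp 2 x, t) ∈ A ε}) c

theorem exists_isBoxLipschitz_slice (hk : ContDiff ℝ 1 k) (hc : HasCompactSupport k)
    (hsupp : ∀ z, z.1 ∉ box n R → k z = 0) :
    ∃ D, 0 ≤ D ∧ (∀ z, ‖k z‖ ≤ D) ∧
      ∀ t, IsBoxLipschitz R D fun x => k (WithLp.toLp 2 x, t) := by
  obtain ⟨D, hD⟩ := hc.exists_bound_of_continuous hk.continuous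
  obtain ⟨D', hD'⟩ := (hc.fderiv (𝕜 := ℝ)).exists_bound_of_continuous
    (hk.continuous_fderiv (by simp))
  have hD0 : 0 ≤ D := (norm_nonneg _).trans (hD 0)
  have hD0' : 0 ≤ D' := (norm_nonneg _).trans (hD' 0)
  have hl : ∀ t, IsBoxLipschitz R ((D + D') * (1 + ‖toLpL n‖))
      fun x => k (WithLp.toLp 2 x, t) := fun t => by
    refine isBoxLipschitz_of_contDiff (f := fun x => k (x, t))
      (hk.comp (contDiff_id.prodMk contDiff_const)) (fun x hx => hsupp _ hx)
      (fun x => (hD _).trans (by linarith)) fun x => ?_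
    have h1 : HasFDerivAt (fun x => k (x, t)) ((fderiv ℝ k (x, t)).comp
        (ContinuousLinearMap.inl ℝ _ _)) x :=
      (hk.differentiable (by simp) (x, t)).hasFDerivAt.comp x (hasFDerivAt_prodMk_left x t)
    rw [h1.fderiv]
    refine (ContinuousLinearMap.opNorm_comp_le _ _).trans ?_
    calc _ ≤ D' * 1 := by
          gcongr
          · exact hD' _
          · exact ContinuousLinearMap.norm_inl_le_one _ _ _
      _ ≤ _ := by linarith
  exact ⟨_, by positivity, fun z => (hD z).trans (by nlinarith [norm_nonneg (toLpL n)]), hl⟩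

theorem HasCutoffSlices.integrableOn {T : Set (EuclideanSpace ℝ (Fin n))}
    (hA : HasCutoffSlices I R L K T A) (hL : 1 ≤ L) (hAm : ∀ ε, MeasurableSet (A ε))
    (hk : Continuous k) (hc : HasCompactSupport k) (hsupp : ∀ z ∉ box n R ×ˢ T, k z = 0) {ε : ℝ}
    (hε : 0 < ε) (hKε : K * ε ≤ 1 / 2) :
    IntegrableOn (fun z => k z / ((∏ i ∈ I, z.1 i : ℝ) : ℂ)) (A ε) := by
  have ha : 0 < ε / (2 * L) := by positivity
  refine Integrable.mono' ((hk.integrable_of_hasCompactSupport hc).norm.const_mul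
    (((ε / (2 * L)) ^ I.card)⁻¹)).integrableOn ?_ ?_
  · refine (Measurable.div hk.measurable ?_).aestronglyMeasurable
    exact Complex.measurable_ofReal.comp (Finset.measurable_prod _ fun i _ =>
      (Continuous.measurable (by fun_prop)))
  · refine (ae_restrict_iff' (hAm ε)).2 (ae_of_all _ fun z hz => ?_)
    by_cases hzT : z ∈ box n R ×ˢ T
    · obtain ⟨c, hcut⟩ := hA z.2 hzT.2
      rw [norm_div, Complex.norm_real, Real.norm_eq_abs, Finset.abs_prod, div_eq_inv_mul]
      refine mul_le_mul_of_nonneg_right ?_ (norm_nonneg _)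
      refine inv_anti₀ (pow_pos ha _) ?_
      rw [← Finset.prod_const]
      exact Finset.prod_le_prod (fun _ _ => ha.le) fun i hi =>
        hcut.le_abs hL hε hKε (x := z.1.ofLp) hzT.1 hz hi
    · rw [hsupp z hzT, zero_div, norm_zero, mul_zero]

/-- Integrating over the slices first. -/
theorem setIntegral_slices
    {A : Set (EuclideanSpace ℝ (Fin n) × EuclideanSpace ℝ (Fin n))} (hAm : MeasurableSet A)
    {F : EuclideanSpace ℝ (Fin n) × EuclideanSpace ℝ (Fin n) → ℂ} (hF : IntegrableOn F A) :
    Integrable (fun t => ∫ x in {x : Fin n → ℝ | (WithLp.toLp 2 x, t) ∈ A},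
      F (WithLp.toLp 2 x, t)) ∧
    ∫ z in A, F z = ∫ t, ∫ x in {x : Fin n → ℝ | (WithLp.toLp 2 x, t) ∈ A},
      F (WithLp.toLp 2 x, t) := by
  have h1 := (integrable_indicator_iff hAm).2 hF
  have h2 : ∀ t, ∫ x in {x : Fin n → ℝ | (WithLp.toLp 2 x, t) ∈ A}, F (WithLp.toLp 2 x, t) =
      ∫ x, A.indicator F (x, t) := by
    intro t
    have hm : MeasurableSet {x : EuclideanSpace ℝ (Fin n) | (x, t) ∈ A} :=
      (Continuous.prodMk_left t).measurable hAm
    refine (measurePreserving_toLp.setIntegral_preimage_emb measurableEmbedding_toLp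
      (fun x => F (x, t)) {x | (x, t) ∈ A}).trans ?_
    rw [← integral_indicator hm]
    rfl
  simp only [h2]
  rw [Measure.volume_eq_prod] at h1
  refine ⟨h1.integral_prod_right, ?_⟩
  rw [← integral_indicator hAm, Measure.volume_eq_prod, integral_prod_symm _ h1]

theorem HasCutoffSlices.tendsto_sub
    (hA : HasCutoffSlices I R L K (Metric.closedBall t₀ δ) A)
    (hB : HasCutoffSlices I R L K (Metric.closedBall t₀ δ) B) (hR : 0 < R) (hL : 1 ≤ L)
    (hK : 0 ≤ K) (hAm : ∀ ε, MeasurableSet (A ε)) (hBm : ∀ ε, MeasurableSet (B ε))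
    (hk : ContDiff ℝ 1 k) (hc : HasCompactSupport k)
    (hsupp : ∀ z ∉ box n R ×ˢ Metric.closedBall t₀ δ, k z = 0) :
    Tendsto (fun ε => (∫ z in A ε, k z / ((∏ i ∈ I, z.1 i : ℝ) : ℂ)) -
      ∫ z in B ε, k z / ((∏ i ∈ I, z.1 i : ℝ) : ℂ)) (𝓝[>] 0) (𝓝 0) := by
  obtain ⟨D, hD0, -, hD⟩ := exists_isBoxLipschitz_slice (R := R) hk hc
    (fun z hz => hsupp z fun h => hz h.1)
  set v := (volume : Measure (EuclideanSpace ℝ (Fin n))).real (Metric.closedBall t₀ δ)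
  have hlim : Tendsto (fun ε => 2 * D * v * cutoffError n R L K ε) (𝓝[>] 0) (𝓝 0) := by
    have := (tendsto_cutoffError n (R := R) (C := K) hL).const_mul (2 * D * v)
    rwa [mul_zero] at this
  refine squeeze_zero_norm' ?_ hlim
  filter_upwards [IsCutoff.eventually (L := L) (C := K)] with ε ⟨hε, hε1, hKε, _⟩
  obtain ⟨i1, e1⟩ := setIntegral_slices (hAm ε)
    (hA.integrableOn hL hAm hk.continuous hc hsupp hε hKε)
  obtain ⟨i2, e2⟩ := setIntegral_slices (hBm ε)
    (hB.integrableOn hL hBm hk.continuous hc hsupp hε hKε)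
  rw [e1, e2, ← integral_sub i1 i2, ← setIntegral_eq_integral_of_forall_compl_eq_zero
    (s := Metric.closedBall t₀ δ)]
  · refine (norm_setIntegral_le_of_norm_le_const (C := 2 * D * cutoffError n R L K ε)
      (isCompact_closedBall t₀ δ).measure_lt_top fun t ht => ?_).trans (le_of_eq (by ring))
    obtain ⟨c, hcut⟩ := hA t ht
    obtain ⟨c', hcut'⟩ := hB t ht
    have h1 := hcut.norm_sub_le hR hL hK hε hε1 hKε (hD t)
    have h2 := hcut'.norm_sub_le hR hL hK hε hε1 hKε (hD t)
    rw [norm_sub_rev] at h2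
    refine (norm_sub_le_norm_sub_add_norm_sub _ _ _).trans ((add_le_add h1 h2).trans ?_)
    linarith
  · intro t ht
    have h3 : ∀ x : Fin n → ℝ, k (WithLp.toLp 2 x, t) = 0 := fun x => hsupp _ fun h => ht h.2
    simp only [h3, zero_div, integral_zero, sub_zero]

end Slices

namespace LieGroupoid

variable {n d : ℕ} {M G : Type*}
  [TopologicalSpace M] [ChartedSpace (EuclideanSpace ℝ (Fin n)) M] [IsManifold (𝓡 n) ∞ M]
  [TopologicalSpace G] [ChartedSpace (EuclideanSpace ℝ (Fin d)) G] [IsManifold (𝓡 d) ∞ G]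
  {𝒢 : LieGroupoid n d M G} {𝒵 : Finset (Set M)}
  {oA : ∀ m, Orientation ℝ (𝒢.A m) (Fin n)}
  {oM : ∀ m : M, Orientation ℝ (TangentSpace (𝓡 n) m) (Fin n)}
  {f₁ f₀ : ∀ g, (Fin n → 𝒢.A (𝒢.r g)) → (Fin n → 𝒢.A (𝒢.s g)) → ℂ}

/-- The product `f₁(γ⁻¹) f₀(γ)` in given frames. -/
def pairing (f₁ f₀ : ∀ g, (Fin n → 𝒢.A (𝒢.r g)) → (Fin n → 𝒢.A (𝒢.s g)) → ℂ)
    (X Y : ∀ m, Fin n → 𝒢.A m) (γ : G) : ℂ :=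
  f₁ (𝒢.inv γ) (X (𝒢.r (𝒢.inv γ))) (Y (𝒢.s (𝒢.inv γ))) * f₀ γ (Y (𝒢.r γ)) (X (𝒢.s γ))

theorem pairing_inv (X Y : ∀ m, Fin n → 𝒢.A m) (γ : G) :
    pairing f₀ f₁ Y X (𝒢.inv γ) = pairing f₁ f₀ X Y γ := by
  have h : ∀ γ', γ' = γ → f₀ γ' (Y (𝒢.r γ')) (X (𝒢.s γ')) = f₀ γ (Y (𝒢.r γ)) (X (𝒢.s γ)) := by
    rintro _ rfl; rfl
  rw [pairing, pairing, h _ (𝒢.inv_inv γ), mul_comm]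

theorem one_mul_inv {γ : G} {m : M} (h : 𝒢.s γ = m) : 𝒢.mul (𝒢.one m) (𝒢.inv γ) = 𝒢.inv γ := by
  rw [← h, ← 𝒢.r_inv, 𝒢.one_mul]

theorem kernel_one (X Y : ∀ m, Fin n → 𝒢.A m) {γ : G} {m : M} (h : 𝒢.s γ = m) :
    kernel f₁ f₀ X Y X (𝒢.one m) γ = pairing f₁ f₀ X Y γ := by
  have h' : ∀ γ', γ' = 𝒢.inv γ → f₁ γ' (X (𝒢.r γ')) (Y (𝒢.s γ')) =
      f₁ (𝒢.inv γ) (X (𝒢.r (𝒢.inv γ))) (Y (𝒢.s (𝒢.inv γ))) := by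
    rintro _ rfl; rfl
  rw [kernel, pairing, h' _ (one_mul_inv h)]

namespace FibreChart

variable (C : 𝒢.FibreChart 𝒵 oA oM) {χ : G → ℝ}
  {z : EuclideanSpace ℝ (Fin n) × EuclideanSpace ℝ (Fin n)}

/-- The restriction of `f₁ ⋆ f₀` to the unit space is the integral of this function over the
vertical variable. -/
def weight (f₁ f₀ : ∀ g, (Fin n → 𝒢.A (𝒢.r g)) → (Fin n → 𝒢.A (𝒢.s g)) → ℂ) :
    EuclideanSpace ℝ (Fin n) × EuclideanSpace ℝ (Fin n) → ℂ :=
  C.Ψ.target.indicator fun z => C.jac z • pairing f₁ f₀ C.S.X C.T.X (C.Ψ.symm z)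

/-- `χ` is a cutoff function that is `1` at all arrows that contribute to the restriction of
`f₁ ⋆ f₀` to the unit space. -/
structure IsLocalPair (f₁ f₀ : ∀ g, (Fin n → 𝒢.A (𝒢.r g)) → (Fin n → 𝒢.A (𝒢.s g)) → ℂ)
    (χ : G → ℝ) : Prop where
  mem_left : f₁ ∈ 𝒢.Psi
  mem_right : f₀ ∈ 𝒢.Psi
  smooth : ContMDiff (𝓡 d) 𝓘(ℝ, ℝ) ∞ χ
  hasCompactSupport : HasCompactSupport χ
  tsupport_subset : tsupport χ ⊆ C.Ψ.source
  eq_one : ∀ γ, f₀ γ ≠ 0 → f₁ (𝒢.inv γ) ≠ 0 → χ γ = 1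

variable {C}

theorem pairing_ne_zero {X Y : ∀ m, Fin n → 𝒢.A m} {γ : G} (h : pairing f₁ f₀ X Y γ ≠ 0) :
    f₀ γ ≠ 0 ∧ f₁ (𝒢.inv γ) ≠ 0 := by
  constructor <;> intro h0 <;> exact h (by simp [pairing, h0])

theorem weight_ne_zero (h : C.weight f₁ f₀ z ≠ 0) :
    z ∈ C.Ψ.target ∧ f₀ (C.Ψ.symm z) ≠ 0 ∧ f₁ (𝒢.inv (C.Ψ.symm z)) ≠ 0 := by
  have hz : z ∈ C.Ψ.target := mem_of_indicator_ne_zero h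
  rw [weight, indicator_of_mem hz] at h
  exact ⟨hz, pairing_ne_zero (right_ne_zero_of_smul h)⟩

namespace IsLocalPair

theorem weight_eq_zero (hp : C.IsLocalPair f₁ f₀ χ) (hz : z ∉ C.Ψ '' tsupport χ) :
    C.weight f₁ f₀ z = 0 := by
  by_contra h
  obtain ⟨h1, h2, h3⟩ := weight_ne_zero h
  refine hz ⟨C.Ψ.symm z, subset_tsupport _ ?_, C.Ψ.right_inv h1⟩
  rw [Function.mem_support, hp.eq_one _ h2 h3]
  exact one_ne_zero

theorem localIntegrand_one (hp : C.IsLocalPair f₁ f₀ χ) {x t : EuclideanSpace ℝ (Fin n)}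
    (hx : x ∈ C.S.e.target) :
    C.localIntegrand χ f₁ f₀ C.S.X C.S.X (𝒢.one (C.S.e.symm x)) t = C.weight f₁ f₀ (x, t) := by
  simp only [localIntegrand]
  split_ifs with h <;> simp only [𝒢.s_one, C.S.e.right_inv hx, C.S.e.map_target hx, true_and] at h
  · simp only [𝒢.s_one, C.S.e.right_inv hx]
    rw [weight, indicator_of_mem h, kernel_one _ _ (C.source_eq h)]
    by_cases h0 : pairing f₁ f₀ C.S.X C.T.X (C.Ψ.symm (x, t)) = 0
    · rw [h0, smul_zero, smul_zero]
    · have h1 := pairing_ne_zero h0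
      rw [hp.eq_one _ h1.1 h1.2, one_smul]
  · rw [weight, indicator_of_notMem h]

theorem hasCompactSupport_weight (hp : C.IsLocalPair f₁ f₀ χ) :
    HasCompactSupport (C.weight f₁ f₀) :=
  HasCompactSupport.intro (C.isCompact_image hp.hasCompactSupport hp.tsupport_subset)
    fun _ hz => hp.weight_eq_zero hz

theorem contDiff_weight (hp : C.IsLocalPair f₁ f₀ χ) : ContDiff ℝ ∞ (C.weight f₁ f₀) := by
  have hK := C.isCompact_image hp.hasCompactSupport hp.tsupport_subset
  rw [contDiff_iff_contDiffAt]
  intro z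
  by_cases hz : z ∈ C.Ψ '' tsupport χ
  · have hzt : z ∈ C.Ψ.target := by
      obtain ⟨g, hg, rfl⟩ := hz
      exact C.Ψ.map_source (hp.tsupport_subset hg)
    have hx := C.target_mem hzt
    have hg : ContMDiffAt 𝓘(ℝ, EuclideanSpace ℝ (Fin n) × EuclideanSpace ℝ (Fin n)) (𝓡 d) ∞
        (fun z : EuclideanSpace ℝ (Fin n) × EuclideanSpace ℝ (Fin n) =>
          𝒢.one (C.S.e.symm z.1)) z :=
      (𝒢.contMDiff_one _).comp z (ContMDiffAt.comp (I' := 𝓘(ℝ, EuclideanSpace ℝ (Fin n))) z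
        (C.S.isSmoothChart.contMDiffAt_symm hx) contDiff_fst.contMDiff.contMDiffAt)
    have hS := C.S.e.map_target hx
    have h1 := C.contMDiffAt_localIntegrand hp.smooth hp.hasCompactSupport hp.tsupport_subset
      hp.mem_left hp.mem_right C.S.isFrameOn C.S.isFrameOn hg
      (contDiff_snd.contMDiff.contMDiffAt (x := z)) (by rw [𝒢.s_one]; exact hS)
      (by rw [𝒢.r_one]; exact hS) (by rw [𝒢.s_one]; exact hS)
    refine (contMDiffAt_iff_contDiffAt.1 h1).congr_of_eventuallyEq ?_
    filter_upwards [C.Ψ.open_target.mem_nhds hzt] with w hw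
    exact (hp.localIntegrand_one (C.target_mem hw)).symm
  · refine (contDiffAt_const (c := (0 : ℂ))).congr_of_eventuallyEq ?_
    filter_upwards [hK.isClosed.isOpen_compl.mem_nhds hz] with w hw
    exact hp.weight_eq_zero hw

variable [T2Space M] [SigmaCompactSpace G]

theorem coef_restrictFun_conv (hp : C.IsLocalPair f₁ f₀ χ) (h𝒢 : 𝒢.Integrates 𝒵)
    (h𝒵 : IsSimpleNormalCrossing n 𝒵) (x : EuclideanSpace ℝ (Fin n)) :
    C.S.coef (fun _ => 1) (𝒢.restrictFun (𝒢.conv f₁ f₀)) x = ∫ t, C.weight f₁ f₀ (x, t) := by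
  by_cases hx : x ∈ C.S.e.target
  · rw [C.S.coef_apply hx, one_smul, restrictFun, castTuple_section, castTuple_section]
    have hS := C.S.e.map_target hx
    rw [conv_eq_sum h𝒢 h𝒵 (fun _ : Unit => C) (fun _ => hp.smooth) (fun _ => hp.hasCompactSupport)
      (fun _ => hp.tsupport_subset) hp.mem_left hp.mem_right _ (fun γ h1 h2 h3 => ?_)
      C.S.isFrameOn C.S.isFrameOn (by rw [𝒢.r_one]; exact hS) (by rw [𝒢.s_one]; exact hS)]
    · simp only [Finset.univ_unique, Finset.sum_singleton, localConv]
      exact integral_congr_ae (ae_of_all _ fun t => hp.localIntegrand_one hx)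
    · rw [𝒢.s_one] at h1
      rw [one_mul_inv h1] at h3
      simpa using hp.eq_one γ h2 h3
  · have h0 : ∀ t, C.weight f₁ f₀ (x, t) = 0 := fun t =>
      indicator_of_notMem (fun h => hx (C.target_mem h)) _
    simp only [h0, integral_zero]
    exact indicator_of_notMem hx _

theorem mem_source_of_restrictFun_ne_zero (hp : C.IsLocalPair f₁ f₀ χ) {m : M}
    (h : 𝒢.restrictFun (𝒢.conv f₁ f₀) m ≠ 0) : m ∈ C.S.e.source := by
  by_contra hm
  refine h ?_
  have h0 : 𝒢.conv f₁ f₀ (𝒢.one m) = 0 := by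
    refine conv_eq_zero fun γ h1 h2 => ?_
    rw [𝒢.s_one] at h1
    rw [one_mul_inv h1]
    by_contra h3
    refine hm (h1 ▸ C.isProductChart.mem_source γ (hp.tsupport_subset (subset_tsupport _ ?_)))
    rw [Function.mem_support, hp.eq_one γ h2 h3]
    exact one_ne_zero
  funext a
  rw [restrictFun, h0]
  rfl

variable [CompactSpace M] [Nonempty M]

/-- The truncated integrals of the restriction of `f₁ ⋆ f₀`, in terms of the source. -/
theorem truncatedIntegral_eq (hp : C.IsLocalPair f₁ f₀ χ) (h𝒢 : 𝒢.Integrates 𝒵)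
    (h𝒵 : IsSimpleNormalCrossing n 𝒵) (h : RiemMetric n M)
    (hφ : 𝒢.restrictFun (𝒢.conv f₁ f₀) ∈ 𝒢.densities) {ε : ℝ}
    (hint : IntegrableOn (fun z => C.weight f₁ f₀ z / ((∏ i ∈ C.S.I, z.1 i : ℝ) : ℂ))
      {z | z.1 ∈ chartTruncation 𝒵 h C.S.e ε}) :
    truncatedIntegral 𝒵 h (𝒢.signedDensity oA oM (𝒢.restrictFun (𝒢.conv f₁ f₀))) ε =
      C.S.sgn * ∫ z in {z | z.1 ∈ chartTruncation 𝒵 h C.S.e ε},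
        C.weight f₁ f₀ z / ((∏ i ∈ C.S.I, z.1 i : ℝ) : ℂ) := by
  have hset : {z : EuclideanSpace ℝ (Fin n) × EuclideanSpace ℝ (Fin n) |
      z.1 ∈ chartTruncation 𝒵 h C.S.e ε} = chartTruncation 𝒵 h C.S.e ε ×ˢ univ := by
    ext z; simp
  rw [hset] at hint ⊢
  rw [IntegrableOn, Measure.volume_eq_prod, ← Measure.prod_restrict, Measure.restrict_univ] at hint
  have h1 : ∀ x, (∫ t, C.weight f₁ f₀ (x, t) / ((∏ i ∈ C.S.I, x i : ℝ) : ℂ)) =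
      C.S.coef (fun _ => 1) (𝒢.restrictFun (𝒢.conv f₁ f₀)) x / ((∏ i ∈ C.S.I, x i : ℝ) : ℂ) :=
    fun x => by rw [integral_div, hp.coef_restrictFun_conv h𝒢 h𝒵]
  have h2 := hint.integral_prod_left
  simp only [h1] at h2
  rw [AdaptedChart.truncatedIntegral_eq_sum h hφ.1 (fun _ : Unit => C.S) (fun _ _ => 1)
    (fun _ _ => by simp) (fun _ m hm _ => hp.mem_source_of_restrictFun_ne_zero hm) ε
    (fun _ => h2)]
  simp only [Finset.univ_unique, Finset.sum_singleton]
  rw [Measure.volume_eq_prod, ← Measure.prod_restrict, Measure.restrict_univ,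
    integral_prod _ hint]
  simp only [h1]

end IsLocalPair

end FibreChart

end LieGroupoid

/-- The sign rule for the transformation of densities with simple poles. -/
theorem mul_div_eq_of_abs_eq {a b p q s t : ℝ} (h : b * |p| = a * |q|) (h0 : p = 0 ↔ q = 0)
    (hs : s = 1 ∨ s = -1) (ht : t = 1 ∨ t = -1) (hpq : p ≠ 0 → q ≠ 0 → (0 < s * p ↔ 0 < t * q)) :
    s * a / p = t * b / q := by
  by_cases hp : p = 0
  · rw [hp, h0.1 hp, div_zero, div_zero]
  have hq : q ≠ 0 := fun hq => hp (h0.2 hq)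
  rw [div_eq_div_iff hp hq]
  have h1 := hpq hp hq
  rcases hs with rfl | rfl <;> rcases ht with rfl | rfl <;>
    rcases lt_or_gt_of_ne hp with h2 | h2 <;> rcases lt_or_gt_of_ne hq with h3 | h3 <;>
    simp only [abs_of_pos, abs_of_neg, h2, h3] at h <;>
    first
    | linarith
    | (exfalso
       simp only [_root_.one_mul, neg_mul, Left.neg_pos_iff] at h1
       first
       | exact lt_asymm h2 (h1.2 h3)
       | exact lt_asymm h3 (h1.1 h2))

namespace LieGroupoid

variable {n d : ℕ} {M G : Type*}
  [TopologicalSpace M] [ChartedSpace (EuclideanSpace ℝ (Fin n)) M] [IsManifold (𝓡 n) ∞ M]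
  [TopologicalSpace G] [ChartedSpace (EuclideanSpace ℝ (Fin d)) G] [IsManifold (𝓡 d) ∞ G]
  {𝒢 : LieGroupoid n d M G} {𝒵 : Finset (Set M)}
  {oA : ∀ m, Orientation ℝ (𝒢.A m) (Fin n)}
  {oM : ∀ m : M, Orientation ℝ (TangentSpace (𝓡 n) m) (Fin n)}
  {f₁ f₀ : ∀ g, (Fin n → 𝒢.A (𝒢.r g)) → (Fin n → 𝒢.A (𝒢.s g)) → ℂ}

theorem ReversesAt.not_preservesAt {m : M} (h : 𝒢.ReversesAt oA oM m) :
    ¬ 𝒢.PreservesAt oA oM m := by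
  rintro ⟨h1, h2⟩
  obtain ⟨_, h3⟩ := h
  exact Module.Ray.ne_neg_self (oM m) (h2.symm.trans h3)

theorem IsEven.preservesAt_iff (heven : 𝒢.IsEven oA oM 𝒵) {g : G}
    (hr : 𝒢.r g ∉ divisorSupport 𝒵) (hs : 𝒢.s g ∉ divisorSupport 𝒵) :
    𝒢.PreservesAt oA oM (𝒢.r g) ↔ 𝒢.PreservesAt oA oM (𝒢.s g) := by
  rcases heven g hr hs with h | h
  · exact iff_of_true h.1 h.2
  · exact iff_of_false h.1.not_preservesAt h.2.not_preservesAt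

namespace ArrowChart

variable {C : 𝒢.ArrowChart 𝒵 oA oM} {χ : G → ℝ}
  {z : EuclideanSpace ℝ (Fin n) × EuclideanSpace ℝ (Fin n)}

theorem isLocalPair_opp (hp : C.IsLocalPair f₁ f₀ χ) :
    C.opp.IsLocalPair f₀ f₁ (χ ∘ 𝒢.inv) := by
  let φ : G ≃ₜ G := ⟨⟨𝒢.inv, 𝒢.inv, 𝒢.inv_inv, 𝒢.inv_inv⟩, 𝒢.contMDiff_inv.continuous,
    𝒢.contMDiff_inv.continuous⟩
  refine ⟨hp.mem_right, hp.mem_left, hp.smooth.comp 𝒢.contMDiff_inv,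
    hp.hasCompactSupport.comp_homeomorph φ, fun g hg => ?_, fun γ h1 h0 => hp.eq_one _ h0 ?_⟩
  · have h : 𝒢.inv g ∈ tsupport χ :=
      tsupport_comp_subset_preimage χ 𝒢.contMDiff_inv.continuous hg
    have h2 := (C.inv_mem _).2 (hp.tsupport_subset h)
    rwa [inv_inv] at h2
  · rwa [inv_inv]

theorem sgn_mul_weight_swap (heven : 𝒢.IsEven oA oM 𝒵) (hz : z ∈ C.Ψ.target) :
    (C.T.sgn : ℂ) * (|(fderiv ℝ C.swap z).det| •
      (C.opp.weight f₀ f₁ (C.swap z) / ((∏ i ∈ C.T.I, (C.swap z).1 i : ℝ) : ℂ))) =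
      C.S.sgn * (C.weight f₁ f₀ z / ((∏ i ∈ C.S.I, z.1 i : ℝ) : ℂ)) := by
  have hT := C.range_mem _ (C.Ψ.map_target hz)
  have hS := C.source_mem hz
  have key : C.T.sgn * (|(fderiv ℝ C.swap z).det| * C.opp.jac (C.swap z)) /
      (∏ i ∈ C.T.I, C.range z i) = C.S.sgn * C.jac z / ∏ i ∈ C.S.I, z.1 i := by
    refine mul_div_eq_of_abs_eq ?_ (prod_range_eq_zero_iff hz) C.T.sgn_eq C.S.sgn_eq
      fun hp hq => ?_
    · rw [jac_mul_prod_range hz, _root_.mul_assoc]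
    · have hr : 𝒢.r (C.Ψ.symm z) ∉ divisorSupport 𝒵 := fun h => hp ((C.T.prod_eq_zero_iff hT).2 h)
      rw [← C.chart_source hz] at hq ⊢
      have hs : 𝒢.s (C.Ψ.symm z) ∉ divisorSupport 𝒵 := fun h => hq ((C.S.prod_eq_zero_iff hS).2 h)
      exact (C.T.preservesAt_iff _ hT hr).symm.trans ((heven.preservesAt_iff hr hs).trans
        (C.S.preservesAt_iff _ hS hs))
  have hw : C.opp.weight f₀ f₁ (C.swap z) =
      C.opp.jac (C.swap z) • pairing f₁ f₀ C.S.X C.T.X (C.Ψ.symm z) := by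
    rw [FibreChart.weight, indicator_of_mem (swap_mem hz), opp_symm_swap hz]
    exact congrArg _ (pairing_inv _ _ _)
  rw [hw, FibreChart.weight, indicator_of_mem hz, swap_fst hz]
  have key' := congrArg (fun x : ℝ => (x : ℂ) * pairing f₁ f₀ C.S.X C.T.X (C.Ψ.symm z)) key
  simp only [Complex.ofReal_div, Complex.ofReal_mul] at key'
  simp only [Complex.real_smul]
  calc _ = _ := by ring
    _ = _ := key'
    _ = _ := by ring

/-- The inversion exchanges integrals over truncations of the range and of the source. -/
theorem sgn_mul_setIntegral_opp (heven : 𝒢.IsEven oA oM 𝒵) (h : RiemMetric n M) (ε : ℝ) :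
    (C.T.sgn : ℂ) * ∫ w in {w | w.1 ∈ chartTruncation 𝒵 h C.T.e ε},
      C.opp.weight f₀ f₁ w / ((∏ i ∈ C.T.I, w.1 i : ℝ) : ℂ) =
      C.S.sgn * ∫ z in C.rangeTruncation h ε,
        C.weight f₁ f₀ z / ((∏ i ∈ C.S.I, z.1 i : ℝ) : ℂ) := by
  have hm := C.measurableSet_rangeTruncation h ε
  have himg : C.swap '' C.rangeTruncation h ε =
      C.opp.Ψ.target ∩ {w | w.1 ∈ chartTruncation 𝒵 h C.T.e ε} := by
    ext w
    constructor
    · rintro ⟨z, hz, rfl⟩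
      refine ⟨swap_mem hz.1, ?_⟩
      rw [mem_ofPred_eq, swap_fst hz.1]
      exact hz.2
    · rintro ⟨hw, hw2⟩
      have h1 : C.opp.swap w ∈ C.Ψ.target := swap_mem (C := C.opp) hw
      have h2 : C.swap (C.opp.swap w) = w := swap_swap (C := C.opp) hw
      refine ⟨C.opp.swap w, ⟨h1, ?_⟩, h2⟩
      rw [← swap_fst h1, h2]
      exact hw2
  have hmeas : MeasurableSet {w : EuclideanSpace ℝ (Fin n) × EuclideanSpace ℝ (Fin n) |
      w.1 ∈ chartTruncation 𝒵 h C.T.e ε} :=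
    measurable_fst (measurableSet_chartTruncation 𝒵 h C.T.e ε)
  have : (volume : Measure (EuclideanSpace ℝ (Fin n) ×
      EuclideanSpace ℝ (Fin n))).IsAddHaarMeasure :=
    Measure.prod.instIsAddHaarMeasure volume volume
  rw [setIntegral_eq_of_subset_of_forall_sdiff_eq_zero hmeas
    (inter_subset_right (s := C.opp.Ψ.target)) (fun w hw => ?_), ← himg,
    integral_image_eq_integral_abs_det_fderiv_smul volume hm
      (fun z hz =>
        ((contDiffAt_swap hz.1).differentiableAt (by simp)).hasFDerivAt.hasFDerivWithinAt)
      (injOn_swap.mono fun z hz => hz.1), ← integral_const_mul, ← integral_const_mul]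
  · exact setIntegral_congr_fun hm fun z hz => sgn_mul_weight_swap heven hz.1
  · have : C.opp.weight f₀ f₁ w = 0 := indicator_of_notMem (fun h => hw.2 ⟨h, hw.1⟩) _
    rw [this, zero_div]

end ArrowChart

variable [T2Space M] [T2Space G] [SigmaCompactSpace G] [CompactSpace M]

/-- Near a given arrow, the principal value functional is a trace. -/
theorem exists_nhds_trace (h𝒢 : 𝒢.Integrates 𝒵) (h𝒵 : IsSimpleNormalCrossing n 𝒵)
    (hoM : IsTangentOrientation oM) (hoA : 𝒢.IsOrientation oA) (heven : 𝒢.IsEven oA oM 𝒵)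
    (h : RiemMetric n M) {τ : 𝒢.densities →ₗ[ℂ] ℂ}
    (hτ : ∀ φ : 𝒢.densities,
      Tendsto (truncatedIntegral 𝒵 h (𝒢.signedDensity oA oM φ)) (𝓝[>] 0) (𝓝 (τ φ))) (g₀ : G) :
    ∃ N ∈ 𝓝 g₀, ∀ χ : G → ℝ, ContMDiff (𝓡 d) 𝓘(ℝ, ℝ) ∞ χ → HasCompactSupport χ →
      tsupport χ ⊆ N → ∀ f₁ f₀ : 𝒢.Psi, ∀ (h₁₀ : 𝒢.conv f₁ (fun g => χ g • f₀.1 g) ∈ 𝒢.Psi)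
        (h₀₁ : 𝒢.conv (fun g => χ g • f₀.1 g) f₁ ∈ 𝒢.Psi),
        (τ ∘ₗ 𝒢.restrict) ⟨_, h₁₀⟩ = (τ ∘ₗ 𝒢.restrict) ⟨_, h₀₁⟩ := by
  have : Nonempty M := ⟨𝒢.r g₀⟩
  obtain ⟨C, hg, hS0, hT0⟩ := exists_arrowChart h𝒢 h𝒵 hoM hoA g₀
  set z₀ := C.Ψ g₀ with hz₀
  have hz : z₀ ∈ C.Ψ.target := C.Ψ.map_source hg
  have hgz : C.Ψ.symm z₀ = g₀ := C.Ψ.left_inv hg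
  have h0 : z₀.1 = 0 := by rw [← C.chart_source hz, hgz, hS0]
  have h0' : C.range z₀ = 0 := by rw [FibreChart.range, hgz, hT0]
  obtain ⟨R, hR, δ, hδ, L, K, hL, hK, -, hbox, -, ⟨c, hc⟩, hcut⟩ :=
    ArrowChart.exists_isCutoff h hz h0 h0'
  obtain ⟨R', hR', δ', hδ', L', K', hL', hK', -, hbox', -, ⟨c', hc'⟩, -⟩ :=
    ArrowChart.exists_isCutoff (C := C.opp) h (ArrowChart.swap_mem hz)
      (by rw [ArrowChart.swap_fst hz, h0']) (by rw [ArrowChart.opp_range_swap hz, h0])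
  obtain ⟨κ, hκ, hκc, hκs, hκ1⟩ := exists_cutoff (d := d) (C.Ψ.open_source.mem_nhds hg)
  set B := box n R ×ˢ Metric.closedBall z₀.2 δ with hB
  set B' := box n R' ×ˢ Metric.closedBall (C.swap z₀).2 δ' with hB'
  have hBn : B ∈ 𝓝 z₀ := by
    rw [← Prod.mk.eta (p := z₀), h0]
    exact prod_mem_nhds hbox (Metric.closedBall_mem_nhds _ hδ)
  have hBn' : B' ∈ 𝓝 (C.swap z₀) := by
    rw [← Prod.mk.eta (p := C.swap z₀), ArrowChart.swap_fst hz, h0']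
    exact prod_mem_nhds hbox' (Metric.closedBall_mem_nhds _ hδ')
  have hinv : ContinuousAt (fun g => C.Φ (𝒢.inv g)) g₀ := by
    refine ContinuousAt.comp ?_ 𝒢.contMDiff_inv.continuous.continuousAt
    exact C.Φ.continuousAt ((C.inv_mem g₀).2 hg)
  have hswap : C.Φ (𝒢.inv g₀) = C.swap z₀ := by rw [ArrowChart.swap, hgz]
  refine ⟨{g | g ∈ C.Ψ.source ∧ C.Ψ g ∈ B ∧ C.Φ (𝒢.inv g) ∈ B' ∧ κ g = 1}, ?_,
    fun χ hχ hχc hχN f₁ f₀ h₁₀ h₀₁ => ?_⟩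
  · filter_upwards [C.Ψ.open_source.mem_nhds hg, (C.Ψ.continuousAt hg).preimage_mem_nhds hBn,
      hinv.preimage_mem_nhds (by rw [hswap]; exact hBn'), hκ1] with g e1 e2 e3 e4
    exact ⟨e1, e2, e3, e4⟩
  have hf₀ : (fun g => χ g • f₀.1 g) ∈ 𝒢.Psi := smul_mem_Psi f₀.2 hχ
  set f₀' : ∀ g, (Fin n → 𝒢.A (𝒢.r g)) → (Fin n → 𝒢.A (𝒢.s g)) → ℂ := fun g => χ g • f₀.1 g
  have hN : ∀ γ, f₀' γ ≠ 0 → γ ∈ C.Ψ.source ∧ C.Ψ γ ∈ B ∧ C.Φ (𝒢.inv γ) ∈ B' ∧ κ γ = 1 :=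
    fun γ hγ => hχN (subset_tsupport _ fun h1 => hγ (by simp only [f₀', h1, zero_smul]))
  have hp : C.IsLocalPair f₁ f₀' κ :=
    ⟨f₁.2, hf₀, hκ, hκc, hκs, fun γ hγ _ => (hN γ hγ).2.2.2⟩
  have hp' := ArrowChart.isLocalPair_opp hp
  have hsupp : ∀ z ∉ B, C.weight f₁ f₀' z = 0 := by
    intro z hzB
    by_contra hw
    obtain ⟨h1, h2, -⟩ := FibreChart.weight_ne_zero hw
    have h3 := (hN _ h2).2.1
    rw [C.Ψ.right_inv h1] at h3
    exact hzB h3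
  have hsupp' : ∀ z ∉ B', C.opp.weight f₀' f₁ z = 0 := by
    intro z hzB
    by_contra hw
    obtain ⟨h1, -, h2⟩ := FibreChart.weight_ne_zero hw
    have h3 := (hN _ h2).2.2.1
    rw [inv_inv, show C.Φ (C.opp.Ψ.symm z) = z from C.opp.Ψ.right_inv h1] at h3
    exact hzB h3
  have hsl : HasCutoffSlices C.S.I R L K (Metric.closedBall z₀.2 δ)
      fun ε => {z | z.1 ∈ chartTruncation 𝒵 h C.S.e ε} := fun t _ => ⟨c, hc⟩
  have hsl' : HasCutoffSlices C.T.I R' L' K' (Metric.closedBall (C.swap z₀).2 δ')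
      fun ε => {z | z.1 ∈ chartTruncation 𝒵 h C.T.e ε} := fun t _ => ⟨c', hc'⟩
  have hmeas : ∀ e : OpenPartialHomeomorph M (EuclideanSpace ℝ (Fin n)), ∀ ε,
      MeasurableSet {w : EuclideanSpace ℝ (Fin n) × EuclideanSpace ℝ (Fin n) |
        w.1 ∈ chartTruncation 𝒵 h e ε} := fun e ε =>
    measurable_fst (measurableSet_chartTruncation 𝒵 h e ε)
  have hlim := hsl.tendsto_sub (B := C.rangeTruncation h) hcut hR hL hK (hmeas _)
    (C.measurableSet_rangeTruncation h) (hp.contDiff_weight.of_le (by simp))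
    hp.hasCompactSupport_weight hsupp
  have hlim2 := hlim.const_mul (C.S.sgn : ℂ)
  have h10 := hτ (𝒢.restrict ⟨_, h₁₀⟩)
  have h01 := hτ (𝒢.restrict ⟨_, h₀₁⟩)
  have hdiff := h10.sub h01
  rw [mul_zero] at hlim2
  refine sub_eq_zero.1 (tendsto_nhds_unique hdiff (hlim2.congr' ?_))
  filter_upwards [IsCutoff.eventually (L := L) (C := K), IsCutoff.eventually (L := L') (C := K')]
    with ε hε hε'
  rw [mul_sub]
  refine congrArg₂ _ (hp.truncatedIntegral_eq h𝒢 h𝒵 h (𝒢.restrictFun_mem h₁₀)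
    (hsl.integrableOn hL (hmeas _) hp.contDiff_weight.continuous hp.hasCompactSupport_weight hsupp
      hε.1 hε.2.2.1)).symm ?_
  rw [← ArrowChart.sgn_mul_setIntegral_opp heven]
  exact (hp'.truncatedIntegral_eq h𝒢 h𝒵 h (𝒢.restrictFun_mem h₀₁)
    (hsl'.integrableOn hL' (hmeas _) hp'.contDiff_weight.continuous hp'.hasCompactSupport_weight
      hsupp' hε'.1 hε'.2.2.1)).symm

end LieGroupoid

end PvTrace

end

open PvTrace in
theorem propositionp {n d : ℕ} {M G : Type*}
    [TopologicalSpace M] [ChartedSpace (EuclideanSpace ℝ (Fin n)) M] [IsManifold (𝓡 n) ∞ M]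
    [T2Space M] [CompactSpace M] [ConnectedSpace M]
    [TopologicalSpace G] [ChartedSpace (EuclideanSpace ℝ (Fin d)) G] [IsManifold (𝓡 d) ∞ G]
    [T2Space G] [SigmaCompactSpace G]
    (𝒵 : Finset (Set M)) (h𝒵 : IsSimpleNormalCrossing n 𝒵)
    (𝒢 : LieGroupoid n d M G) (h𝒢 : 𝒢.Integrates 𝒵)
    (oM : ∀ m : M, Orientation ℝ (TangentSpace (𝓡 n) m) (Fin n)) (hoM : IsTangentOrientation oM)
    (oA : ∀ m : M, Orientation ℝ (𝒢.A m) (Fin n)) (hoA : 𝒢.IsOrientation oA)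
    (heven : 𝒢.IsEven oA oM 𝒵) (h : RiemMetric n M) :
    ∃ τ : 𝒢.densities →ₗ[ℂ] ℂ,
      (∀ φ : 𝒢.densities, τ φ = pvIntegral 𝒵 h (𝒢.signedDensity oA oM φ)) ∧
      (∀ (h' : RiemMetric n M) (φ : 𝒢.densities),
        Tendsto (truncatedIntegral 𝒵 h' (𝒢.signedDensity oA oM φ)) (𝓝[>] 0) (𝓝 (τ φ))) ∧
      (@Continuous _ _ 𝒢.densitiesTopology _ τ) ∧
      𝒢.IsTrace (τ ∘ₗ 𝒢.restrict) := by
  obtain ⟨Q⟩ := LieGroupoid.exists_adaptedPartition h𝒢 h𝒵 hoM hoA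
  refine ⟨Q.pv, fun φ => Q.pv_eq h φ, fun h' φ => Q.tendsto_truncatedIntegral h' φ,
    Q.continuous_pv, LieGroupoid.isTrace_of_local h𝒢 h𝒵 hoM hoA _ ?_⟩
  exact LieGroupoid.exists_nhds_trace h𝒢 h𝒵 hoM hoA heven h fun φ =>
    Q.tendsto_truncatedIntegral h φ
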